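/- Let $k$ be a field of characteristic $0$ and let $H=\bigoplus_n H^n$ be a graded commutative $k$-algebra which is simply connected ($H^n=0$ for $n<0$, $H^0=k$, $H^1=0$) and of finite type ($\dim H^n<\infty$ for all $n$). **Augmented homotopy types.** Consider pairs $(A,i)$ of a ($\mathbb Z$-graded, graded commutative) dgca $A$ over $k$ and an isomorphism of graded algebras $i:H\cong H(A)$. Two pairs $(A,i)$, $(B,j)$ have the same augmented homotopy type if there are a dgca $C$ and quasi-isomorphisms $\varphi:C\to A$, $\psi:C\to B$ with $i^{-1}H(\varphi)=j^{-1}H(\psi)$; augmented homotopy types are the classes of the equivalence relation this generates. **Filtered models.** A filtered model $\rho:(SZ,d)\to H$ is a free graded commutative algebra $SZ$ on a space $Z$ with a homogeneous basis, each basis element $z$ having a degree $\ge 1$ and a resolution degree $-r\le 0$, and so a weight $\deg z+r$, with a differential $d$ (a derivation of degree $+1$, $d^2=0$) that does not increase weights, and a map $\rho$ of graded algebras with $\rho d=0$ that induces an isomorphism $H(SZ,d)\cong H$, such that the cohomology of the associated weight-graded complex of $(SZ,d)$ is concentrated in resolution degree $0$ (where weight equals degree). The model is minimal if $dZ$ consists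 of decomposable elements, and of finite type if $Z$ is finite-dimensional in each degree. **The dg Lie algebra $L$.** Fix a filtered model. For $n\in\mathbb Z$ let $L^n$ be the space of derivations $\theta$ of $SZ$ of degree $n$ that decrease weights by at least $1$, $L=\bigoplus_n L^n$, with the graded commutator bracket and the differential $[d,\,\cdot\,]$. Let $F_pL^n$ be the subspace of those $\theta \in L^n$ that decrease weights by at least $p$. A perturbation is an element $p\in L^1$ with $(d+p)^2=0$, i.e. $[d,p]+\tfrac12[p,p]=0$. **The coalgebra $\hat C(L)$.** Let $sL$ be the suspension ($s\theta$ has degree $n-1$ for $\theta\in L^n$) and $T^c(sL)$ the tensor coalgebra, with the coderivation $D$ of degree $1$ whose corestriction $T^c(sL)\to sL$ is $s\theta\mapsto -s[d,\theta]$, $s\theta\otimes s\phi\mapsto \tfrac12(-1)^{|\theta|}s[\theta,\phi]$, and zero in other tensor degrees. $C(L)\subset T^c(sL)$ is the maximal graded cocommutative sub-coalgebra, i.e. the symmetric coalgebra $S^c(sL)$, with differential $D$; $\hat C(L)\subset\hat T^c(sL)$ is the completion with respect to the filtration induced by the $F_p$. A point of $\hat C(L)$ is a filtration-preserving map of dg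 coalgebras $k\to\hat C(L)$ (with completed coproducts). Let $J$ be the completion, with respect to the index $n$, of the coalgebra with basis $t_n$ (degree $0$), $t_nu$ (degree $-1$), $n\ge0$, dual to $k[t,dt]$: $\Delta t_n=\sum_{i+j=n}t_i\otimes t_j$, $\Delta(t_nu)=\sum_{i+j=n}(t_iu\otimes t_j+t_i\otimes t_ju)$, $d(t_nu)=(n+1)t_{n+1}$. Two points $\chi_0,\chi_1$ are filtered homotopic if there is a filtration-preserving map of dg coalgebras $\lambda:J\to\hat C(L)$ with $\lambda(t_0)=\chi_0(1)$ and $\lambda(\sum_n t_n)=\chi_1(1)$; the path components of $\hat C(L)$ are the classes of points modulo the equivalence relation generated by filtered homotopy. **Theorem.** 1. For each perturbation $p$ there is a unique isomorphism of graded algebras $i_p:H\cong H(SZ,d+p)$ with $i_p(\rho x)=[x]$ for all $x\in SZ$ of resolution degree $0$; and there is a unique point $\chi(p):k\to\hat C(L)$, the classifying map of $p$, with $\chi(p)(1)=1+sp+sp\otimes sp+\cdots$. 2. Two perturbations $p$ and $q$ represent the same augmented homotopy type, that is, $((SZ,d+p),i_p)$ and $((SZ,d+q),i_q)$ have the same augmented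 homotopy type, if and only if $\chi(p)$ and $\chi(q)$ are filtered homotopic. 3. There is a bijection from the set of augmented homotopy types of pairs $(A,i:H\cong H(A))$ to the set of path components of $\hat C(L)$ that takes the type of $((SZ,d+p),i_p)$ to the component of $\chi(p)$, for each perturbation $p$. 4. Assume that the filtered model is minimal or of finite type. Let $A(L)$ be the algebra of continuous linear forms on $C(L)$, i.e. of the restrictions to $C(L)$ of the linear forms on $T^c(sL)$ that, for some $w$ and $N$, vanish on all tensors $v_1\otimes\cdots\otimes v_r$ with $r\ge N$ and on all those having a letter $v_i = s\theta$ with $\theta$ zero on the elements of $SZ$ of weight $\le w$; its product, unit, differential and grading are dual to the coproduct, counit, differential and grading of $C(L)$ (it is the Chevalley–Eilenberg algebra, free graded commutative on the continuous dual of $sL$). Two dga maps $f_0,f_1:A(L)\to k$ are homotopic if there is a dga map $A(L)\to k[t,dt]$ from which $f_\varepsilon$ is obtained by setting $t=\varepsilon$, $dt=0$. Then each perturbation $p$ has a unique dga map $f_p:A(L)\to k$ with $f_p(\alpha)=\sum_n\alpha((sp)^{\otimes n})$ for all $\alpha$; $p$ and $q$ represent the same augmented homotopy type if and only if $f_p$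 and $f_q$ are homotopic; and there is a bijection from the set of augmented homotopy types of pairs $(A,i:H\cong H(A))$ to the set of homotopy classes (modulo the equivalence relation generated by homotopy) of dga maps $A(L)\to k$ that takes the type of $((SZ,d+p),i_p)$ to the class of $f_p$. -/

import Mathlib

open scoped TensorProduct DirectSum

universe u

noncomputable section

/-! ### Graded commutative algebras, dgca's and their homotopy types -/

/-- The sign `(-1)^n` as an element of the ground field. -/
def sgn (k : Type u) [Field k] (n : ℤ) : k := ((Int.negOnePow n : ℤ) : k)

theorem sgn_add {k : Type u} [Field k] (m n : ℤ) : sgn k (m + n) = sgn k m * sgn k n := by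
  simp [sgn, Int.negOnePow_add]

theorem sgn_mul_self {k : Type u} [Field k] (n : ℤ) : sgn k n * sgn k n = 1 := by
  rw [← sgn_add]; simp [sgn]

theorem sgn_zero {k : Type u} [Field k] : sgn k 0 = 1 := by simp [sgn]

/-- A `ℤ`-graded commutative unital algebra over `k`. -/
structure GCA (k : Type u) [Field k] where
  carrier : Type u
  [ring : Ring carrier]
  [algebra : Algebra k carrier]
  gr : ℤ → Submodule k carrier
  internal : DirectSum.IsInternal gr
  one_mem : (1 : carrier) ∈ gr 0
  mul_mem : ∀ {m n : ℤ} {a b : carrier}, a ∈ gr m → b ∈ gr n → a * b ∈ gr (m + n)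
  comm : ∀ {m n : ℤ} {a b : carrier}, a ∈ gr m → b ∈ gr n → a * b = sgn k (m * n) • (b * a)

attribute [instance] GCA.ring GCA.algebra

/-- Differential graded commutative algebras, with differential of degree `+1`. -/
structure DGCA (k : Type u) [Field k] extends GCA k where
  d : carrier →ₗ[k] carrier
  d_mem : ∀ {n : ℤ} {a : carrier}, a ∈ gr n → d a ∈ gr (n + 1)
  leibniz : ∀ {n : ℤ} {a : carrier}, a ∈ gr n → ∀ b, d (a * b) = d a * b + sgn k n • (a * d b)
  d_d : ∀ a, d (d a) = 0

section DGCA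

variable {k : Type u} [Field k]

/-- `H⁰ = k`, `H¹ = 0` and `Hⁿ = 0` for `n < 0`. -/
structure GCA.SimplyConnected (H : GCA k) : Prop where
  nontrivial : Nontrivial H.carrier
  neg : ∀ n : ℤ, n < 0 → H.gr n = ⊥
  zero : H.gr 0 = Submodule.span k {1}
  one : H.gr 1 = ⊥

/-- Each homogeneous component is finite-dimensional. -/
def GCA.FiniteType (H : GCA k) : Prop := ∀ n : ℤ, FiniteDimensional k (H.gr n)

/-- The cohomology `ker d / im d` (as a vector space). -/
abbrev DGCA.Coh (A : DGCA k) : Type u :=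
  LinearMap.ker A.d ⧸ (LinearMap.range A.d).comap (LinearMap.ker A.d).subtype

/-- The cohomology class of a cocycle. -/
def DGCA.cls (A : DGCA k) (a : A.carrier) (ha : A.d a = 0) : A.Coh :=
  Submodule.Quotient.mk ⟨a, ha⟩

/-- Maps of dgca's. -/
structure DGCA.Hom (A B : DGCA k) where
  toAlgHom : A.carrier →ₐ[k] B.carrier
  map_gr : ∀ {n : ℤ} {a : A.carrier}, a ∈ A.gr n → toAlgHom a ∈ B.gr n
  map_d : ∀ a, toAlgHom (A.d a) = B.d (toAlgHom a)

/-- The map induced in cohomology. -/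
def DGCA.Hom.coh {A B : DGCA k} (φ : DGCA.Hom A B) : A.Coh →ₗ[k] B.Coh :=
  Submodule.mapQ _ _
    (φ.toAlgHom.toLinearMap.restrict (p := LinearMap.ker A.d) (q := LinearMap.ker B.d)
      (fun a ha => by
        have h : A.d a = 0 := ha
        have h' := φ.map_d a
        rw [h, map_zero] at h'
        exact h'.symm))
    (by
      rintro ⟨a, ha⟩ ⟨b, hb⟩
      refine ⟨φ.toAlgHom b, ?_⟩
      have hb' : A.d b = a := hb
      rw [← φ.map_d, hb']
      rfl)

/-- Quasi-isomorphisms. -/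
def DGCA.Hom.IsQuasiIso {A B : DGCA k} (φ : DGCA.Hom A B) : Prop := Function.Bijective φ.coh

/-- An isomorphism `H ≅ H(A)` of graded algebras.  The algebra structure of `H(A)` is the one
induced from that of `A` on cocycles. -/
structure CohIso (H : GCA k) (A : DGCA k) where
  toEquiv : H.carrier ≃ₗ[k] A.Coh
  map_one : ∀ h : A.d 1 = 0, toEquiv 1 = A.cls 1 h
  map_mul : ∀ (x y : H.carrier) (a b : A.carrier) (ha : A.d a = 0) (hb : A.d b = 0)
    (hab : A.d (a * b) = 0), toEquiv x = A.cls a ha → toEquiv y = A.cls b hb →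
      toEquiv (x * y) = A.cls (a * b) hab
  map_gr : ∀ (n : ℤ) (x : H.carrier), x ∈ H.gr n →
    ∃ (a : A.carrier) (ha : A.d a = 0), a ∈ A.gr n ∧ toEquiv x = A.cls a ha

/-- Pairs `(A, i : H ≅ H(A))`. -/
structure AugDGCA (H : GCA k) where
  A : DGCA k
  i : CohIso H A

/-- `(A, i)` and `(B, j)` have the same augmented homotopy type: there are a dgca `C` and
quasi-isomorphisms `φ : C → A`, `ψ : C → B` with `H(ψ) H(φ)⁻¹ = j i⁻¹`. -/
def SameAugType {H : GCA k} (X Y : AugDGCA H) : Prop :=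
  ∃ (C : DGCA k) (φ : DGCA.Hom C X.A) (ψ : DGCA.Hom C Y.A), φ.IsQuasiIso ∧ ψ.IsQuasiIso ∧
    ∀ c : C.Coh, X.i.toEquiv.symm (φ.coh c) = Y.i.toEquiv.symm (ψ.coh c)

/-- The set of augmented homotopy types of dgca's with cohomology `H`. -/
def AugHomotopyType (H : GCA k) : Type (u + 1) := Quot (@SameAugType k _ H)

end DGCA

/-! ### The free graded commutative algebra on a graded vector space with homogeneous basis -/

inductive FreeGCA.Rel (k : Type u) [Field k] {I : Type u} (deg : I → ℕ) :
    FreeAlgebra k I → FreeAlgebra k I → Prop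
  | swap (i j : I) : FreeGCA.Rel k deg (FreeAlgebra.ι k i * FreeAlgebra.ι k j)
      (sgn k ((deg i : ℤ) * deg j) • (FreeAlgebra.ι k j * FreeAlgebra.ι k i))

/-- `S Z`, where `Z` has a homogeneous basis indexed by `I`, the `i`-th basis element having degree
`deg i`.  (In characteristic `0` the relation `x x = - x x` gives `x² = 0` for `x` odd.) -/
def FreeGCA (k : Type u) [Field k] {I : Type u} (deg : I → ℕ) : Type u :=
  RingQuot (FreeGCA.Rel k deg)

namespace FreeGCA

variable {k : Type u} [Field k] {I : Type u} {deg : I → ℕ}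

instance : Ring (FreeGCA k deg) := inferInstanceAs (Ring (RingQuot (FreeGCA.Rel k deg)))
instance : Algebra k (FreeGCA k deg) :=
  inferInstanceAs (Algebra k (RingQuot (FreeGCA.Rel k deg)))

variable (k deg) in
/-- The generators. -/
def gen (i : I) : FreeGCA k deg := RingQuot.mkAlgHom k (FreeGCA.Rel k deg) (FreeAlgebra.ι k i)

variable (k deg) in
/-- The monomial given by a word in the generators. -/
def mono (l : List I) : FreeGCA k deg := (l.map (gen k deg)).prod

variable (k deg) in
/-- The homogeneous component of (total) degree `n`. -/
def gr (n : ℤ) : Submodule k (FreeGCA k deg) :=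
  Submodule.span k {a | ∃ l : List I, ((l.map deg).sum : ℤ) = n ∧ a = mono k deg l}

variable (k deg) in
/-- If `wt i` is the weight of the `i`-th generator: the span of the monomials of weight at most
`w`. -/
def wtLE (wt : I → ℕ) (w : ℤ) : Submodule k (FreeGCA k deg) :=
  Submodule.span k {a | ∃ l : List I, ((l.map wt).sum : ℤ) ≤ w ∧ a = mono k deg l}

theorem gen_mul_gen (i j : I) :
    gen k deg i * gen k deg j = sgn k ((deg i : ℤ) * deg j) • (gen k deg j * gen k deg i) := by
  have h := RingQuot.mkAlgHom_rel k (FreeGCA.Rel.swap (k := k) (deg := deg) i j)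
  rw [map_mul, map_smul, map_mul] at h
  exact h

theorem mono_mul (l m : List I) : mono k deg l * mono k deg m = mono k deg (l ++ m) := by
  simp [mono]

theorem span_mono : Submodule.span k (Set.range (mono k deg)) = ⊤ := by
  rw [eq_top_iff]
  rintro x -
  obtain ⟨y, rfl⟩ := RingQuot.mkAlgHom_surjective k (FreeGCA.Rel k deg) x
  have hmul : ∀ a b : FreeGCA k deg, a ∈ Submodule.span k (Set.range (mono k deg)) →
      b ∈ Submodule.span k (Set.range (mono k deg)) →
      a * b ∈ Submodule.span k (Set.range (mono k deg)) := by
    intro a b ha hb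
    have := Submodule.mul_mem_mul ha hb
    rw [Submodule.span_mul_span] at this
    refine Submodule.span_mono ?_ this
    rintro _ ⟨_, ⟨l, rfl⟩, _, ⟨m, rfl⟩, rfl⟩
    exact ⟨l ++ m, (mono_mul l m).symm⟩
  have h1 : (1 : FreeGCA k deg) ∈ Submodule.span k (Set.range (mono k deg)) :=
    Submodule.subset_span ⟨[], by simp [mono]⟩
  induction y using FreeAlgebra.induction with
  | grade0 r =>
    rw [AlgHom.commutes, Algebra.algebraMap_eq_smul_one]
    exact Submodule.smul_mem _ _ h1
  | grade1 i => exact Submodule.subset_span ⟨[i], by rw [mono, List.map_singleton, List.prod_singleton]; rfl⟩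
  | mul a b ha hb => rw [map_mul]; exact hmul _ _ ha hb
  | add a b ha hb => rw [map_add]; exact Submodule.add_mem _ ha hb

variable (k deg) in
/-- The coaction `a ↦ a Tⁿ` (`a` of degree `n`), which exhibits the grading. -/
def coact : FreeGCA k deg →ₐ[k] AddMonoidAlgebra (FreeGCA k deg) ℤ :=
  RingQuot.liftAlgHom k ⟨FreeAlgebra.lift k
    (fun i => AddMonoidAlgebra.single (deg i : ℤ) (gen k deg i)), by
      rintro _ _ ⟨i, j⟩
      simp only [map_mul, map_smul, FreeAlgebra.lift_ι_apply, AddMonoidAlgebra.single_mul_single]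
      rw [gen_mul_gen, add_comm]
      exact (AddMonoidAlgebra.smul_single _ _ _).symm⟩

theorem coact_mono (l : List I) :
    coact k deg (mono k deg l) = AddMonoidAlgebra.single ((l.map deg).sum : ℤ) (mono k deg l) := by
  induction l with
  | nil =>
    have h : mono k deg [] = 1 := by simp [mono]
    rw [h, map_one]; rfl
  | cons i l ih =>
    have h : coact k deg (gen k deg i) = AddMonoidAlgebra.single (deg i : ℤ) (gen k deg i) := by
      simp only [coact, gen]
      erw [RingQuot.liftAlgHom_mkAlgHom_apply]
      simp
    have h2 : mono k deg (i :: l) = gen k deg i * mono k deg l := by simp [mono]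
    rw [h2, map_mul, h, ih, AddMonoidAlgebra.single_mul_single]
    simp

theorem coact_of_mem {n : ℤ} {a : FreeGCA k deg} (ha : a ∈ gr k deg n) :
    coact k deg a = AddMonoidAlgebra.single n a := by
  induction ha using Submodule.span_induction with
  | mem a h => obtain ⟨l, rfl, rfl⟩ := h; exact coact_mono l
  | zero => simp
  | add a b _ _ ha hb => rw [map_add, ha, hb, ← AddMonoidAlgebra.single_add]
  | smul r a _ ha => rw [map_smul, ha, AddMonoidAlgebra.smul_single]

theorem isInternal_gr : DirectSum.IsInternal (gr k deg) := by
  constructor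
  · intro x y hxy
    have key : ∀ z : ⨁ n, gr k deg n, ∀ n : ℤ,
        (coact k deg (DirectSum.coeAddMonoidHom (gr k deg) z)).coeff n = (z n : FreeGCA k deg) := by
      intro z n
      induction z using DirectSum.induction_on with
      | zero => simp
      | of i a =>
        rw [DirectSum.coeAddMonoidHom_of, coact_of_mem a.2]
        by_cases h : i = n
        · subst h; rw [DirectSum.of_eq_same]; exact Finsupp.single_eq_same
        · rw [DirectSum.of_eq_of_ne _ _ _ (Ne.symm h)]
          exact Finsupp.single_eq_of_ne (Ne.symm h)
      | add a b ha hb => simp [map_add, ha, hb]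
    refine DFinsupp.ext fun n => Subtype.ext ?_
    erw [← key x n, ← key y n, hxy]
  · intro x
    have hx : x ∈ Submodule.span k (Set.range (mono k deg)) :=
      (span_mono (k := k) (deg := deg)).symm ▸ Submodule.mem_top
    induction hx using Submodule.span_induction with
    | mem a h =>
      obtain ⟨l, rfl⟩ := h
      exact ⟨DirectSum.of (fun n => gr k deg n) ((l.map deg).sum : ℤ)
        ⟨mono k deg l, Submodule.subset_span ⟨l, rfl, rfl⟩⟩, DirectSum.coeAddMonoidHom_of _ _ _⟩
    | zero => exact ⟨0, map_zero _⟩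
    | add a b _ _ ha hb =>
      obtain ⟨a, rfl⟩ := ha
      obtain ⟨b, rfl⟩ := hb
      exact ⟨a + b, map_add _ _ _⟩
    | smul r a _ ha =>
      obtain ⟨a, rfl⟩ := ha
      exact ⟨r • a, (DirectSum.coeLinearMap (gr k deg)).map_smul r a⟩

theorem mul_mem_gr {m n : ℤ} {a b : FreeGCA k deg} (ha : a ∈ gr k deg m) (hb : b ∈ gr k deg n) :
    a * b ∈ gr k deg (m + n) := by
  have := Submodule.mul_mem_mul ha hb
  rw [gr, gr, Submodule.span_mul_span] at this
  refine Submodule.span_mono ?_ this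
  rintro _ ⟨_, ⟨l, rfl, rfl⟩, _, ⟨l', rfl, rfl⟩, rfl⟩
  exact ⟨l ++ l', by simp, mono_mul l l'⟩

theorem gen_mul_mono (i : I) (l : List I) : gen k deg i * mono k deg l =
    sgn k ((deg i : ℤ) * ((l.map deg).sum : ℕ)) • (mono k deg l * gen k deg i) := by
  induction l with
  | nil => simp [mono, sgn_zero]
  | cons j l ih =>
    have h2 : mono k deg (j :: l) = gen k deg j * mono k deg l := by simp [mono]
    rw [h2, ← mul_assoc, gen_mul_gen, smul_mul_assoc, mul_assoc, ih, mul_smul_comm, smul_smul,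
      mul_assoc, ← sgn_add]
    simp [mul_add]

theorem mono_comm (l m : List I) : mono k deg l * mono k deg m =
    sgn k (((l.map deg).sum : ℕ) * ((m.map deg).sum : ℕ)) • (mono k deg m * mono k deg l) := by
  induction l with
  | nil => simp [mono, sgn_zero]
  | cons i l ih =>
    have h2 : mono k deg (i :: l) = gen k deg i * mono k deg l := by simp [mono]
    rw [h2, mul_assoc, ih, mul_smul_comm, ← mul_assoc, gen_mul_mono, smul_mul_assoc, smul_smul,
      mul_assoc, ← sgn_add]
    congr 2
    push_cast [List.map_cons, List.sum_cons]
    ring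

theorem gr_comm {m n : ℤ} {a b : FreeGCA k deg} (ha : a ∈ gr k deg m) (hb : b ∈ gr k deg n) :
    a * b = sgn k (m * n) • (b * a) := by
  induction ha using Submodule.span_induction with
  | mem a h =>
    obtain ⟨l, rfl, rfl⟩ := h
    induction hb using Submodule.span_induction with
    | mem b h => obtain ⟨l', rfl, rfl⟩ := h; exact mono_comm l l'
    | zero => simp
    | add a b _ _ ha hb => rw [mul_add, ha, hb, add_mul, smul_add]
    | smul r a _ ha => rw [mul_smul_comm, ha, smul_mul_assoc, smul_comm]
  | zero => simp
  | add a b _ _ ha hb => rw [add_mul, ha, hb, mul_add, smul_add]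
  | smul r a _ ha => rw [smul_mul_assoc, ha, mul_smul_comm, smul_comm]

variable (k deg) in
/-- `S Z` as a graded commutative algebra. -/
def gca : GCA k where
  carrier := FreeGCA k deg
  gr := gr k deg
  internal := isInternal_gr
  one_mem := Submodule.subset_span ⟨[], by simp, by simp [mono]⟩
  mul_mem := mul_mem_gr
  comm := gr_comm

end FreeGCA

/-! ### Filtered modules, completions and cocomplete dg coalgebras -/

/-- A decreasing filtration of a vector space by subspaces. -/
structure Filtration (k X : Type u) [Field k] [AddCommGroup X] [Module k X] where
  F : ℕ → Submodule k X
  anti : Antitone F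

namespace Filtration

variable {k X Y X' Y' : Type u} [Field k] [AddCommGroup X] [Module k X] [AddCommGroup Y]
  [Module k Y] [AddCommGroup X'] [Module k X'] [AddCommGroup Y'] [Module k Y']

/-- The completion `lim X / F n`. -/
def Compl (F : Filtration k X) : Submodule k (∀ n, X ⧸ F.F n) where
  carrier := {x | ∀ (m n : ℕ) (h : m ≤ n), Submodule.factor (F.anti h) (x n) = x m}
  add_mem' := fun hx hy m n h => by simp [hx m n h, hy m n h]
  zero_mem' := fun m n h => by simp
  smul_mem' := fun c x hx m n h => by simp [hx m n h]

/-- The canonical map from `X` to its completion. -/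
def of (F : Filtration k X) : X →ₗ[k] F.Compl where
  toFun x := ⟨fun _ => Submodule.Quotient.mk x, fun _ _ _ => rfl⟩
  map_add' _ _ := rfl
  map_smul' _ _ := rfl

/-- The filtration of the completion by the kernels of the projections to `X / F n`. -/
def compl (F : Filtration k X) : Filtration k F.Compl where
  F n := LinearMap.ker ((LinearMap.proj n).comp F.Compl.subtype)
  anti := fun m n h x hx => by
    have h1 : x.1 n = 0 := hx
    have h2 := x.2 m n h
    rw [h1, map_zero] at h2
    exact h2.symm

theorem of_mem (F : Filtration k X) {n : ℕ} {x : X} (hx : x ∈ F.F n) : F.of x ∈ F.compl.F n :=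
  (Submodule.Quotient.mk_eq_zero _).2 hx

/-- The map between completions induced by a filtration-preserving map. -/
def map (F : Filtration k X) (G : Filtration k Y) (f : X →ₗ[k] Y)
    (hf : ∀ n, F.F n ≤ (G.F n).comap f) : F.Compl →ₗ[k] G.Compl where
  toFun x := ⟨fun n => Submodule.mapQ _ _ f (hf n) (x.1 n), fun m n h => by
    change Submodule.factor (G.anti h) (Submodule.mapQ _ _ f (hf n) (x.1 n)) =
      Submodule.mapQ _ _ f (hf m) (x.1 m)
    rw [← x.2 m n h]
    obtain ⟨y, hy⟩ := Submodule.Quotient.mk_surjective _ (x.1 n)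
    rw [← hy]; rfl⟩
  map_add' x y := Subtype.ext (funext fun n => by simp)
  map_smul' c x := Subtype.ext (funext fun n => by simp)

/-- The filtration of `X ⊗ Y` with `n`-th term `∑_{p+q ≥ n} F p ⊗ G q`.  The completed tensor product
is the completion of `X ⊗ Y` with respect to it. -/
def tensor (F : Filtration k X) (G : Filtration k Y) : Filtration k (X ⊗[k] Y) where
  F n := Submodule.span k
    {z | ∃ (p q : ℕ) (x : X) (y : Y), n ≤ p + q ∧ x ∈ F.F p ∧ y ∈ G.F q ∧ z = x ⊗ₜ[k] y}
  anti := fun m n h => Submodule.span_mono (by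
    rintro _ ⟨p, q, x, y, hpq, hx, hy, rfl⟩
    exact ⟨p, q, x, y, h.trans hpq, hx, hy, rfl⟩)

theorem tmul_mem {F : Filtration k X} {G : Filtration k Y} {n p q : ℕ} (h : n ≤ p + q) {x : X}
    {y : Y} (hx : x ∈ F.F p) (hy : y ∈ G.F q) : x ⊗ₜ[k] y ∈ (F.tensor G).F n :=
  Submodule.subset_span ⟨p, q, x, y, h, hx, hy, rfl⟩

/-- If `f` lowers filtrations by at most `c` and `g` preserves them, `f ⊗ g` lowers filtrations by at
most `c`. -/
theorem tensor_map_le {F : Filtration k X} {G : Filtration k Y} {F' : Filtration k X'}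
    {G' : Filtration k Y'} {f : X →ₗ[k] X'} {g : Y →ₗ[k] Y'} (c : ℕ)
    (hf : ∀ n, F.F n ≤ (F'.F (n - c)).comap f) (hg : ∀ n, G.F n ≤ (G'.F n).comap g) (n : ℕ) :
    (F.tensor G).F n ≤ ((F'.tensor G').F (n - c)).comap (TensorProduct.map f g) := by
  refine Submodule.span_le.2 ?_
  rintro _ ⟨p, q, x, y, hpq, hx, hy, rfl⟩
  exact tmul_mem (p := p - c) (q := q) (by omega) (hf p hx) (hg q hy)

theorem tensor_map_le' {F : Filtration k X} {G : Filtration k Y} {F' : Filtration k X'}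
    {G' : Filtration k Y'} {f : X →ₗ[k] X'} {g : Y →ₗ[k] Y'} (c : ℕ)
    (hf : ∀ n, F.F n ≤ (F'.F n).comap f) (hg : ∀ n, G.F n ≤ (G'.F (n - c)).comap g) (n : ℕ) :
    (F.tensor G).F n ≤ ((F'.tensor G').F (n - c)).comap (TensorProduct.map f g) := by
  refine Submodule.span_le.2 ?_
  rintro _ ⟨p, q, x, y, hpq, hx, hy, rfl⟩
  exact tmul_mem (p := p) (q := q - c) (by omega) (hf p hx) (hg q hy)

theorem tensor_map_le₀ {F : Filtration k X} {G : Filtration k Y} {F' : Filtration k X'}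
    {G' : Filtration k Y'} {f : X →ₗ[k] X'} {g : Y →ₗ[k] Y'}
    (hf : ∀ n, F.F n ≤ (F'.F n).comap f) (hg : ∀ n, G.F n ≤ (G'.F n).comap g) (n : ℕ) :
    (F.tensor G).F n ≤ ((F'.tensor G').F n).comap (TensorProduct.map f g) :=
  tensor_map_le 0 hf hg n

end Filtration

/-- The data of a filtered graded coalgebra with counit and with a degree `1` operator: a
(decreasing) filtration, a grading, an operator `d`, a counit and a comultiplication, the last three
compatible with the filtration. -/
structure FiltCoalg (k : Type u) [Field k] where
  X : Type u
  [grp : AddCommGroup X]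
  [mod : Module k X]
  fil : Filtration k X
  gr : ℤ → Submodule k X
  d : X →ₗ[k] X
  d_fil : ∀ n, fil.F n ≤ (fil.F n).comap d
  counit : X →ₗ[k] k
  counit_fil : fil.F 1 ≤ LinearMap.ker counit
  comul : X →ₗ[k] X ⊗[k] X
  comul_fil : ∀ n, fil.F n ≤ ((fil.tensor fil).F n).comap comul

attribute [instance] FiltCoalg.grp FiltCoalg.mod

namespace FiltCoalg

variable {k : Type u} [Field k]

/-- The completion `Ĉ` of `C`. -/
abbrev Hat (C : FiltCoalg k) : Type u := C.fil.Compl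

/-- The elements of degree `n` of the completion. -/
def hatGr (C : FiltCoalg k) (n : ℤ) : Submodule k C.Hat where
  carrier := {x | ∀ p, x.1 p ∈ (C.gr n).map (C.fil.F p).mkQ}
  add_mem' := fun hx hy p => Submodule.add_mem _ (hx p) (hy p)
  zero_mem' := fun _ => Submodule.zero_mem _
  smul_mem' := fun c _ hx p => Submodule.smul_mem _ c (hx p)

/-- The operator `d` on the completion. -/
def hatD (C : FiltCoalg k) : C.Hat →ₗ[k] C.Hat := C.fil.map C.fil C.d C.d_fil

/-- The counit of the completion. -/
def hatCounit (C : FiltCoalg k) : C.Hat →ₗ[k] k :=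
  ((C.fil.F 1).liftQ C.counit C.counit_fil).comp ((LinearMap.proj 1).comp C.fil.Compl.subtype)

/-- The completed tensor square `Ĉ ⊗̂ Ĉ`. -/
abbrev HatTensor (C : FiltCoalg k) : Type u := (C.fil.compl.tensor C.fil.compl).Compl

/-- The comultiplication `Ĉ → Ĉ ⊗̂ Ĉ`. -/
def hatComul (C : FiltCoalg k) : C.Hat →ₗ[k] C.HatTensor :=
  C.fil.map (C.fil.compl.tensor C.fil.compl) (TensorProduct.map C.fil.of C.fil.of ∘ₗ C.comul)
    (fun n _ hx => Filtration.tensor_map_le₀ (F' := C.fil.compl) (G' := C.fil.compl)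
      (f := C.fil.of) (g := C.fil.of) (fun _ _ h => C.fil.of_mem h)
      (fun _ _ h => C.fil.of_mem h) n (C.comul_fil n hx))

/-- The completed tensor square of a filtration-preserving map `f : Ĉ → D̂`. -/
def hatTensorMap (C D : FiltCoalg k) (f : C.Hat →ₗ[k] D.Hat)
    (hf : ∀ n, C.fil.compl.F n ≤ (D.fil.compl.F n).comap f) : C.HatTensor →ₗ[k] D.HatTensor :=
  Filtration.map (C.fil.compl.tensor C.fil.compl) (D.fil.compl.tensor D.fil.compl)
    (TensorProduct.map f f) (Filtration.tensor_map_le₀ hf hf)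

/-- Filtration-preserving maps of cocomplete dg coalgebras `Ĉ → D̂`. -/
structure Hom (C D : FiltCoalg k) where
  f : C.Hat →ₗ[k] D.Hat
  map_fil : ∀ n, C.fil.compl.F n ≤ (D.fil.compl.F n).comap f
  map_gr : ∀ (n : ℤ) (x : C.Hat), x ∈ C.hatGr n → f x ∈ D.hatGr n
  map_d : ∀ x, f (C.hatD x) = D.hatD (f x)
  map_counit : ∀ x, D.hatCounit (f x) = C.hatCounit x
  map_comul : ∀ x, D.hatComul (f x) = hatTensorMap C D f map_fil (C.hatComul x)

variable (k) in
/-- The ground field as a coalgebra (a point). -/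
def pt : FiltCoalg k where
  X := k
  fil := ⟨fun n => if n = 0 then ⊤ else ⊥, fun m n h => by
    by_cases hm : m = 0
    · simp [hm]
    · have : n ≠ 0 := by omega
      simp [this]⟩
  gr n := if n = 0 then ⊤ else ⊥
  d := 0
  d_fil := fun n x _ => by simp
  counit := LinearMap.id
  counit_fil := by simp
  comul := (TensorProduct.mk k k k) 1
  comul_fil := fun n x hx => by
    by_cases hn : n = 0
    · exact Filtration.tmul_mem (p := 0) (q := 0) (by omega) (by simp) (by simp)
    · have : x = 0 := by simpa [hn] using hx
      simp [this]

/-- The element `1` of the point. -/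
def ptOne : (pt k).Hat := (pt k).fil.of (1 : k)

/-- The space with basis `t_n`, `t_n u`, `n ≥ 0`. -/
abbrev IntervalSpace (k : Type u) [Field k] : Type u := (ℕ ⊕ ℕ) →₀ k

variable (k) in
/-- The basis element `t_n`. -/
def tt (n : ℕ) : IntervalSpace k := Finsupp.single (Sum.inl n) 1

variable (k) in
/-- The basis element `t_n u`. -/
def tu (n : ℕ) : IntervalSpace k := Finsupp.single (Sum.inr n) 1

variable (k) in
/-- The filtration by the index `n`. -/
def intervalFil : Filtration k (IntervalSpace k) where
  F p := Submodule.span k {x | ∃ n, p ≤ n ∧ (x = tt k n ∨ x = tu k n)}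
  anti := fun m n h => Submodule.span_mono (by
    rintro x ⟨i, hi, hx⟩
    exact ⟨i, h.trans hi, hx⟩)

variable (k) in
/-- The linear map with given values on the `t_n` and the `t_n u`. -/
def intervalLift {Y : Type u} [AddCommGroup Y] [Module k Y] (a b : ℕ → Y) :
    IntervalSpace k →ₗ[k] Y := Finsupp.linearCombination k (Sum.elim a b)

theorem intervalLift_tt {Y : Type u} [AddCommGroup Y] [Module k Y] (a b : ℕ → Y) (n : ℕ) :
    intervalLift k a b (tt k n) = a n := by simp [intervalLift, tt]

theorem intervalLift_tu {Y : Type u} [AddCommGroup Y] [Module k Y] (a b : ℕ → Y) (n : ℕ) :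
    intervalLift k a b (tu k n) = b n := by simp [intervalLift, tu]

theorem tt_mem (n : ℕ) : tt k n ∈ (intervalFil k).F n :=
  Submodule.subset_span ⟨n, le_rfl, Or.inl rfl⟩

theorem tu_mem (n : ℕ) : tu k n ∈ (intervalFil k).F n :=
  Submodule.subset_span ⟨n, le_rfl, Or.inr rfl⟩

theorem intervalLift_le {Y : Type u} [AddCommGroup Y] [Module k Y] {a b : ℕ → Y} {p : ℕ}
    {Q : Submodule k Y} (h : ∀ n, p ≤ n → a n ∈ Q ∧ b n ∈ Q) :
    (intervalFil k).F p ≤ Q.comap (intervalLift k a b) := by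
  refine Submodule.span_le.2 ?_
  rintro _ ⟨n, hn, rfl | rfl⟩
  · rw [SetLike.mem_coe, Submodule.mem_comap, intervalLift_tt]; exact (h n hn).1
  · rw [SetLike.mem_coe, Submodule.mem_comap, intervalLift_tu]; exact (h n hn).2

variable (k) in
/-- The coalgebra `I_*` dual to `k[t, dt]`, with basis `t_n` (of degree `0`) and `t_n u` (of degree
`-1`), diagonal `Δ t_n = ∑ t_i ⊗ t_j`, `Δ (t_n u) = ∑ (t_i u ⊗ t_j + t_i ⊗ t_j u)` (sums over
`i + j = n`), and differential `d (t_n u) = (n + 1) t_{n+1}`, filtered by the index `n`.  Its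
completion is the unit interval coalgebra `J`. -/
def interval : FiltCoalg k where
  X := IntervalSpace k
  fil := intervalFil k
  gr n := if n = 0 then Submodule.span k (Set.range (tt k))
    else if n = -1 then Submodule.span k (Set.range (tu k)) else ⊥
  d := intervalLift k (fun _ => 0) (fun n => ((n : k) + 1) • tt k (n + 1))
  d_fil := fun p => intervalLift_le fun n hn => ⟨Submodule.zero_mem _,
    Submodule.smul_mem _ _ ((intervalFil k).anti (hn.trans (Nat.le_succ n)) (tt_mem (n + 1)))⟩
  counit := intervalLift k (fun n => if n = 0 then 1 else 0) (fun _ => 0)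
  counit_fil := intervalLift_le (Q := ⊥) fun n hn => by simp [Nat.ne_of_gt hn]
  comul := intervalLift k
    (fun n => ∑ ij ∈ Finset.HasAntidiagonal.antidiagonal n, tt k ij.1 ⊗ₜ[k] tt k ij.2)
    (fun n => ∑ ij ∈ Finset.HasAntidiagonal.antidiagonal n,
      (tu k ij.1 ⊗ₜ[k] tt k ij.2 + tt k ij.1 ⊗ₜ[k] tu k ij.2))
  comul_fil := fun p => intervalLift_le fun n hn =>
    ⟨Submodule.sum_mem _ fun ij hij => by
        have := Finset.HasAntidiagonal.mem_antidiagonal.1 hij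
        exact Filtration.tmul_mem (by omega) (tt_mem _) (tt_mem _),
      Submodule.sum_mem _ fun ij hij => by
        have := Finset.HasAntidiagonal.mem_antidiagonal.1 hij
        exact Submodule.add_mem _ (Filtration.tmul_mem (by omega) (tu_mem _) (tt_mem _))
          (Filtration.tmul_mem (by omega) (tt_mem _) (tu_mem _))⟩

variable (k) in
/-- The element `t_0 = 1` of `J`. -/
def tZero : (interval k).Hat := (intervalFil k).of (tt k 0)

variable (k) in
/-- The element `∑ t_i` of `J`. -/
def tSum : (interval k).Hat :=
  ⟨fun n => (Submodule.Quotient.mk (∑ i ∈ Finset.range n, tt k i) :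
      IntervalSpace k ⧸ (intervalFil k).F n), by
    intro m n h
    refine (Submodule.Quotient.eq _).2 ?_
    change (∑ i ∈ Finset.range n, tt k i) - (∑ i ∈ Finset.range m, tt k i) ∈ (intervalFil k).F m
    rw [← Finset.sum_range_add_sum_Ico _ h, add_sub_cancel_left]
    refine Submodule.sum_mem _ fun i hi => ?_
    exact (intervalFil k).anti (Finset.mem_Ico.1 hi).1 (tt_mem i)⟩

end FiltCoalg

/-! ### The tensor coalgebra and its maximal cocommutative sub-coalgebra -/

namespace TensorCoalg

open TensorAlgebra

variable {k : Type u} [Field k] {V : Type u} [AddCommGroup V] [Module k V]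

variable (k V) in
/-- The algebra map `a ↦ !![a ⊗ 1, E a; 0, 1 ⊗ a]`, with `E v = 1 ⊗ v` for `v ∈ V`. -/
def deltaMat : TensorAlgebra k V →ₐ[k]
    Matrix (Fin 2) (Fin 2) (TensorAlgebra k V ⊗[k] TensorAlgebra k V) :=
  lift k
    { toFun := fun v => !![ι k v ⊗ₜ[k] 1, 1 ⊗ₜ[k] ι k v; 0, 1 ⊗ₜ[k] ι k v]
      map_add' := fun v w => by
        ext i j; fin_cases i <;> fin_cases j <;> simp [TensorProduct.add_tmul, TensorProduct.tmul_add]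
      map_smul' := fun c v => by
        ext i j
        fin_cases i <;> fin_cases j <;> simp [TensorProduct.smul_tmul', TensorProduct.tmul_smul] }

variable (k V) in
/-- The deconcatenation coproduct: `Δ (v₁ ⋯ vₙ) = ∑ (v₁ ⋯ vᵢ) ⊗ (vᵢ₊₁ ⋯ vₙ)`. -/
def delta : TensorAlgebra k V →ₗ[k] TensorAlgebra k V ⊗[k] TensorAlgebra k V where
  toFun x := deltaMat k V x 0 0 + deltaMat k V x 0 1
  map_add' x y := by simp only [map_add, Matrix.add_apply]; abel
  map_smul' c x := by simp [smul_add]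

variable (k) in
/-- The word `v₁ ⋯ vₙ` in the tensor algebra. -/
def word (l : List V) : TensorAlgebra k V := (l.map (ι k)).prod

@[simp] theorem word_nil : word k ([] : List V) = 1 := by simp [word]

@[simp] theorem word_cons (v : V) (l : List V) : word k (v :: l) = ι k v * word k l := by
  simp [word]

theorem word_append (l m : List V) : word k (l ++ m) = word k l * word k m := by simp [word]

theorem span_word : Submodule.span k (Set.range (word k (V := V))) = ⊤ := by
  rw [eq_top_iff]
  rintro x -
  have hmul : ∀ a b : TensorAlgebra k V, a ∈ Submodule.span k (Set.range (word k (V := V))) →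
      b ∈ Submodule.span k (Set.range (word k (V := V))) →
      a * b ∈ Submodule.span k (Set.range (word k (V := V))) := by
    intro a b ha hb
    have := Submodule.mul_mem_mul ha hb
    rw [Submodule.span_mul_span] at this
    refine Submodule.span_mono ?_ this
    rintro _ ⟨_, ⟨l, rfl⟩, _, ⟨m, rfl⟩, rfl⟩
    exact ⟨l ++ m, word_append l m⟩
  induction x using TensorAlgebra.induction with
  | algebraMap r =>
    rw [Algebra.algebraMap_eq_smul_one]
    exact Submodule.smul_mem _ _ (Submodule.subset_span ⟨[], word_nil⟩)
  | ι v => exact Submodule.subset_span ⟨[v], by simp⟩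
  | mul a b ha hb => exact hmul _ _ ha hb
  | add a b ha hb => exact Submodule.add_mem _ ha hb

/-- Two linear maps which agree on words are equal. -/
theorem ext_word {Y : Type u} [AddCommGroup Y] [Module k Y] {f g : TensorAlgebra k V →ₗ[k] Y}
    (h : ∀ l : List V, f (word k l) = g (word k l)) : f = g :=
  LinearMap.ext_on_range span_word h

theorem deltaMat_apply (x : TensorAlgebra k V) :
    deltaMat k V x 0 0 = x ⊗ₜ[k] 1 ∧ deltaMat k V x 1 0 = 0 ∧ deltaMat k V x 1 1 = 1 ⊗ₜ[k] x := by
  induction x using TensorAlgebra.induction with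
  | algebraMap r =>
    rw [AlgHom.commutes]
    refine ⟨?_, ?_, ?_⟩
    · simp [Matrix.algebraMap_matrix_apply, Algebra.TensorProduct.algebraMap_apply]
    · simp [Matrix.algebraMap_matrix_apply]
    · simp only [Matrix.algebraMap_matrix_apply, if_true]
      rw [Algebra.TensorProduct.algebraMap_apply, Algebra.algebraMap_eq_smul_one,
        TensorProduct.smul_tmul]
  | ι v => simp [deltaMat]
  | mul a b ha hb =>
    obtain ⟨a1, a2, a3⟩ := ha
    obtain ⟨b1, b2, b3⟩ := hb
    simp [map_mul, Matrix.mul_apply, Fin.sum_univ_two, a1, a2, a3, b1, b2, b3]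
  | add a b ha hb =>
    obtain ⟨a1, a2, a3⟩ := ha
    obtain ⟨b1, b2, b3⟩ := hb
    simp [a1, a2, a3, b1, b2, b3, TensorProduct.add_tmul, TensorProduct.tmul_add]

@[simp] theorem delta_one : delta k V 1 = 1 ⊗ₜ[k] 1 := by
  simp [delta, Algebra.TensorProduct.one_def]

theorem delta_ι_mul (v : V) (x : TensorAlgebra k V) :
    delta k V (ι k v * x) = 1 ⊗ₜ[k] (ι k v * x) + (ι k v ⊗ₜ[k] 1) * delta k V x := by
  have h01 : deltaMat k V (ι k v) 0 1 = 1 ⊗ₜ[k] ι k v := by simp [deltaMat]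
  simp only [delta, LinearMap.coe_mk, AddHom.coe_mk, map_mul, Matrix.mul_apply, Fin.sum_univ_two,
    (deltaMat_apply _).1, (deltaMat_apply _).2.2, h01, mul_add,
    Algebra.TensorProduct.tmul_mul_tmul, mul_one]
  abel

theorem ιInv_one : ιInv (1 : TensorAlgebra k V) = 0 := by
  let : Module kᵐᵒᵖ V := Module.compHom _ ((RingHom.id k).fromOpposite mul_comm)
  have : IsCentralScalar k V := ⟨fun r m => rfl⟩
  change (toTrivSqZeroExt (1 : TensorAlgebra k V)).snd = 0
  rw [map_one]
  rfl

theorem ιInv_ι_mul (v : V) (x : TensorAlgebra k V) :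
    ιInv (ι k v * x) = algebraMapInv x • v := by
  let : Module kᵐᵒᵖ V := Module.compHom _ ((RingHom.id k).fromOpposite mul_comm)
  have : IsCentralScalar k V := ⟨fun r m => rfl⟩
  have hfst : ∀ y : TensorAlgebra k V, (toTrivSqZeroExt y).fst = algebraMapInv y := by
    intro y
    have : (TrivSqZeroExt.fstHom k k V).comp toTrivSqZeroExt =
        (algebraMapInv : TensorAlgebra k V →ₐ[k] k) := by
      ext w; simp [algebraMapInv]
    exact DFunLike.congr_fun this y
  change (toTrivSqZeroExt (ι k v * x)).snd = _
  rw [map_mul, TrivSqZeroExt.snd_mul, hfst, hfst, toTrivSqZeroExt_ι]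
  simp [algebraMapInv]

/-- The counit applied to the left factor of the coproduct. -/
theorem counit_delta (x : TensorAlgebra k V) :
    TensorProduct.lid k _ (TensorProduct.map algebraMapInv.toLinearMap LinearMap.id (delta k V x))
      = x := by
  suffices h : (TensorProduct.lid k _).toLinearMap ∘ₗ
      TensorProduct.map algebraMapInv.toLinearMap LinearMap.id ∘ₗ delta k V = LinearMap.id from
    DFunLike.congr_fun h x
  refine ext_word fun l => ?_
  rcases l with _ | ⟨v, l⟩
  · simp
  · have h0 : ∀ z : TensorAlgebra k V ⊗[k] TensorAlgebra k V,
        TensorProduct.map (algebraMapInv (R := k) (M := V)).toLinearMap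
          (LinearMap.id (R := k) (M := TensorAlgebra k V)) ((ι k v ⊗ₜ[k] 1) * z) = 0 := by
      intro z
      induction z using TensorProduct.induction_on with
      | zero => simp
      | tmul a b => simp [algebraMapInv]
      | add a b ha hb => rw [mul_add, map_add, ha, hb, add_zero]
    simp [delta_ι_mul, h0]

/-- The algebra automorphism of the tensor algebra induced by a parity operator on `V`. -/
def par (s : V →ₗ[k] V) : TensorAlgebra k V →ₐ[k] TensorAlgebra k V := lift k (ι k ∘ₗ s)

/-- The graded interchange `x ⊗ y ↦ (-1)^{|x||y|} y ⊗ x`, written through the parity operator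
`x ↦ (-1)^{|x|} x`. -/
def swap (s : V →ₗ[k] V) : TensorAlgebra k V ⊗[k] TensorAlgebra k V →ₗ[k]
    TensorAlgebra k V ⊗[k] TensorAlgebra k V :=
  ((2 : k)⁻¹ • (LinearMap.id + TensorProduct.map (par s).toLinearMap LinearMap.id +
    TensorProduct.map LinearMap.id (par s).toLinearMap -
    TensorProduct.map (par s).toLinearMap (par s).toLinearMap)) ∘ₗ
      (TensorProduct.comm k _ _).toLinearMap

/-- The linear map `T V → V` with components `b₁ : V → V`, `b₂ : V ⊗ V → V` and zero on the other
tensor powers. -/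
def corest (b₁ : V →ₗ[k] V) (b₂ : V ⊗[k] V →ₗ[k] V) : TensorAlgebra k V →ₗ[k] V :=
  b₁ ∘ₗ ιInv + b₂ ∘ₗ TensorProduct.map ιInv ιInv ∘ₗ delta k V

/-- `x ↦ ∑ f(x') x''`, where `f = corest b₁ b₂`. -/
def contractHead (b₁ : V →ₗ[k] V) (b₂ : V ⊗[k] V →ₗ[k] V) :
    TensorAlgebra k V →ₗ[k] TensorAlgebra k V :=
  LinearMap.mul' k _ ∘ₗ TensorProduct.map (ι k ∘ₗ corest b₁ b₂) LinearMap.id ∘ₗ delta k V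

/-- The odd coderivation of the tensor coalgebra cogenerated by `f = corest b₁ b₂`:
`x ↦ ∑ (-1)^{|x'|} x' f(x'') x'''`. -/
def coder (s : V →ₗ[k] V) (b₁ : V →ₗ[k] V) (b₂ : V ⊗[k] V →ₗ[k] V) :
    TensorAlgebra k V →ₗ[k] TensorAlgebra k V :=
  LinearMap.mul' k _ ∘ₗ TensorProduct.map (par s).toLinearMap (contractHead b₁ b₂) ∘ₗ delta k V

section

variable {s b₁ : V →ₗ[k] V} {b₂ : V ⊗[k] V →ₗ[k] V}

@[simp] theorem par_ι (v : V) : par s (ι k v) = ι k (s v) := by simp [par]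

theorem corest_one : corest b₁ b₂ (1 : TensorAlgebra k V) = 0 := by
  simp [corest, ιInv_one]

/-- Multiplication by `v ⊗ 1` commutes past maps acting on the left factor. -/
theorem map_tmul_mul {Y Z : Type u} [AddCommGroup Y] [Module k Y] [AddCommGroup Z] [Module k Z]
    (f f' : TensorAlgebra k V →ₗ[k] Y) (g : TensorAlgebra k V →ₗ[k] Z) (v : V)
    (h : ∀ x, f (ι k v * x) = f' x) (z : TensorAlgebra k V ⊗[k] TensorAlgebra k V) :
    TensorProduct.map f g ((ι k v ⊗ₜ[k] 1) * z) = TensorProduct.map f' g z := by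
  induction z using TensorProduct.induction_on with
  | zero => simp
  | tmul a b => simp [h]
  | add a b ha hb => rw [mul_add, map_add, ha, hb, map_add]

theorem corest_ι_mul (v : V) (x : TensorAlgebra k V) :
    corest b₁ b₂ (ι k v * x) = algebraMapInv x • b₁ v + b₂ (v ⊗ₜ[k] ιInv x) := by
  simp only [corest, LinearMap.add_apply, LinearMap.comp_apply, ιInv_ι_mul, map_smul, delta_ι_mul,
    map_add, TensorProduct.map_tmul, ιInv_one, TensorProduct.zero_tmul, zero_add]
  congr 2
  rw [map_tmul_mul ιInv (LinearMap.toSpanSingleton k V v ∘ₗ algebraMapInv.toLinearMap) ιInv v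
    (fun x => by simp [ιInv_ι_mul])]
  have h : v ⊗ₜ[k] ιInv x = v ⊗ₜ[k] ιInv (TensorProduct.lid k _
      (TensorProduct.map algebraMapInv.toLinearMap LinearMap.id (delta k V x))) := by
    rw [counit_delta]
  rw [h]
  generalize delta k V x = z
  induction z using TensorProduct.induction_on with
  | zero => simp
  | tmul a b => simp [TensorProduct.smul_tmul]
  | add a b ha hb => simp only [map_add, TensorProduct.tmul_add, ha, hb]

theorem contractHead_one : contractHead b₁ b₂ (1 : TensorAlgebra k V) = 0 := by
  simp [contractHead, corest_one]

theorem contractHead_ι (v : V) : contractHead b₁ b₂ (ι k v) = ι k (b₁ v) := by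
  have h := corest_ι_mul (b₁ := b₁) (b₂ := b₂) v 1
  have h2 := delta_ι_mul (k := k) v 1
  simp only [mul_one, delta_one, Algebra.TensorProduct.tmul_mul_tmul, map_one, one_smul,
    ιInv_one, TensorProduct.tmul_zero, map_zero, add_zero] at h h2
  simp [contractHead, h2, h, corest_one]

theorem contractHead_ι_mul_ι_mul (v w : V) (x : TensorAlgebra k V) :
    contractHead b₁ b₂ (ι k v * (ι k w * x)) =
      ι k (b₁ v) * (ι k w * x) + ι k (b₂ (v ⊗ₜ[k] w)) * x := by
  have h1 := corest_ι_mul (b₁ := b₁) (b₂ := b₂) v 1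
  simp only [mul_one, map_one, one_smul, ιInv_one, TensorProduct.tmul_zero, map_zero,
    add_zero] at h1
  simp only [contractHead, LinearMap.comp_apply, delta_ι_mul, map_add, mul_add,
    TensorProduct.map_tmul, corest_one, Algebra.TensorProduct.tmul_mul_tmul, mul_one, one_mul,
    map_zero, TensorProduct.zero_tmul, zero_add, h1, LinearMap.mul'_apply, LinearMap.id_apply]
  congr 1
  rw [← mul_assoc, Algebra.TensorProduct.tmul_mul_tmul, mul_one]
  have h2 : ∀ z : TensorAlgebra k V ⊗[k] TensorAlgebra k V,
      TensorProduct.map (ι k ∘ₗ corest b₁ b₂) (LinearMap.id (R := k) (M := TensorAlgebra k V))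
        (((ι k v * ι k w) ⊗ₜ[k] 1) * z) =
      ι k (b₂ (v ⊗ₜ[k] w)) ⊗ₜ[k]
        (TensorProduct.lid k _ (TensorProduct.map algebraMapInv.toLinearMap LinearMap.id z)) := by
    intro z
    induction z using TensorProduct.induction_on with
    | zero => simp
    | tmul a b =>
      have : algebraMapInv (ι k w * a) = (0 : k) := by simp [algebraMapInv]
      simp [mul_assoc, corest_ι_mul, ιInv_ι_mul, this, TensorProduct.smul_tmul]
    | add a b ha hb => simp only [mul_add, map_add, ha, hb, TensorProduct.tmul_add]
  rw [h2, counit_delta]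
  simp

theorem coder_one : coder s b₁ b₂ (1 : TensorAlgebra k V) = 0 := by
  simp [coder, contractHead_one]

theorem coder_ι_mul (v : V) (x : TensorAlgebra k V) :
    coder s b₁ b₂ (ι k v * x) =
      contractHead b₁ b₂ (ι k v * x) + ι k (s v) * coder s b₁ b₂ x := by
  simp only [coder, LinearMap.comp_apply, delta_ι_mul, map_add, TensorProduct.map_tmul,
    AlgHom.toLinearMap_apply, map_one, LinearMap.mul'_apply, one_mul]
  congr 1
  generalize delta k V x = z
  induction z using TensorProduct.induction_on with
  | zero => simp
  | tmul a b => simp [mul_assoc]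
  | add a b ha hb => simp only [mul_add, map_add, ha, hb]

theorem delta_contractHead (x : TensorAlgebra k V) :
    delta k V (contractHead b₁ b₂ x) = 1 ⊗ₜ[k] contractHead b₁ b₂ x +
      TensorProduct.map (contractHead b₁ b₂) LinearMap.id (delta k V x) := by
  suffices h : delta k V ∘ₗ contractHead b₁ b₂ = TensorProduct.mk k _ _ 1 ∘ₗ contractHead b₁ b₂ +
      TensorProduct.map (contractHead b₁ b₂) LinearMap.id ∘ₗ delta k V from
    DFunLike.congr_fun h x
  refine ext_word fun l => ?_
  rcases l with _ | ⟨v, _ | ⟨w, l⟩⟩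
  · simp [contractHead_one]
  · have h2 := delta_ι_mul (k := k) v 1
    have h3 := delta_ι_mul (k := k) (b₁ v) 1
    simp only [mul_one, delta_one, Algebra.TensorProduct.tmul_mul_tmul] at h2 h3
    simp [contractHead_ι, h2, h3, contractHead_one]
  · simp only [word_cons, LinearMap.comp_apply, LinearMap.add_apply, contractHead_ι_mul_ι_mul,
      TensorProduct.mk_apply, delta_ι_mul, map_add, mul_add, TensorProduct.map_tmul,
      contractHead_one, TensorProduct.zero_tmul, Algebra.TensorProduct.tmul_mul_tmul, mul_one,
      one_mul, contractHead_ι, LinearMap.id_apply]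
    have h2 : ∀ z : TensorAlgebra k V ⊗[k] TensorAlgebra k V,
        TensorProduct.map (contractHead b₁ b₂) (LinearMap.id (R := k) (M := TensorAlgebra k V))
          ((ι k v ⊗ₜ[k] 1) * ((ι k w ⊗ₜ[k] 1) * z)) =
        (ι k (b₁ v) ⊗ₜ[k] 1) * ((ι k w ⊗ₜ[k] 1) * z) +
          (ι k (b₂ (v ⊗ₜ[k] w)) ⊗ₜ[k] 1) * z := by
      intro z
      induction z using TensorProduct.induction_on with
      | zero => simp
      | tmul a b => simp [contractHead_ι_mul_ι_mul, TensorProduct.add_tmul]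
      | add a b ha hb => simp only [mul_add, map_add, ha, hb]; abel
    rw [h2]
    abel

variable (s b₁ b₂) in
/-- The map `b ⊗ 1 + σ ⊗ b` for `b = coder s b₁ b₂` and the parity operator `σ`. -/
def coderTensor : TensorAlgebra k V ⊗[k] TensorAlgebra k V →ₗ[k]
    TensorAlgebra k V ⊗[k] TensorAlgebra k V :=
  TensorProduct.map (coder s b₁ b₂) LinearMap.id +
    TensorProduct.map (par s).toLinearMap (coder s b₁ b₂)

theorem coderTensor_tmul (x y : TensorAlgebra k V) : coderTensor s b₁ b₂ (x ⊗ₜ[k] y) =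
    coder s b₁ b₂ x ⊗ₜ[k] y + par s x ⊗ₜ[k] coder s b₁ b₂ y := rfl

/-- `coder s b₁ b₂` is a coderivation. -/
theorem delta_coder (x : TensorAlgebra k V) :
    delta k V (coder s b₁ b₂ x) = coderTensor s b₁ b₂ (delta k V x) := by
  suffices h : delta k V ∘ₗ coder s b₁ b₂ = coderTensor s b₁ b₂ ∘ₗ delta k V from
    DFunLike.congr_fun h x
  refine ext_word fun l => ?_
  induction l with
  | nil => simp [coder_one, coderTensor_tmul]
  | cons v l ih =>
    simp only [LinearMap.comp_apply] at ih
    simp only [word_cons, LinearMap.comp_apply]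
    rw [coder_ι_mul, map_add, delta_contractHead, delta_ι_mul (s v), ih, delta_ι_mul v]
    have h1 : ∀ z : TensorAlgebra k V ⊗[k] TensorAlgebra k V,
        coderTensor s b₁ b₂ ((ι k v ⊗ₜ[k] 1) * z) =
        TensorProduct.map (contractHead b₁ b₂) LinearMap.id ((ι k v ⊗ₜ[k] 1) * z) +
        (ι k (s v) ⊗ₜ[k] 1) * coderTensor s b₁ b₂ z := by
      intro z
      induction z using TensorProduct.induction_on with
      | zero => simp
      | tmul a b => simp [coder_ι_mul, coderTensor_tmul, TensorProduct.add_tmul, mul_add, add_assoc]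
      | add a b ha hb => rw [mul_add, map_add, ha, hb, map_add, map_add, mul_add]; abel
    rw [map_add, map_add, h1]
    simp only [coderTensor_tmul, TensorProduct.map_tmul, coder_one, TensorProduct.zero_tmul,
      contractHead_one, map_one, coder_ι_mul, TensorProduct.tmul_add, zero_add]
    abel

theorem par_par (hs : ∀ v, s (s v) = v) (x : TensorAlgebra k V) : par s (par s x) = x := by
  have : (par s).comp (par s) = AlgHom.id k _ := by
    ext v; simp [hs]
  exact DFunLike.congr_fun this x

theorem contractHead_par (h₁ : ∀ v, s (b₁ v) = -b₁ (s v))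
    (h₂ : ∀ v w, s (b₂ (v ⊗ₜ[k] w)) = -b₂ (s v ⊗ₜ[k] s w)) (x : TensorAlgebra k V) :
    contractHead b₁ b₂ (par s x) = -par s (contractHead b₁ b₂ x) := by
  suffices h : contractHead b₁ b₂ ∘ₗ (par s).toLinearMap =
      -((par s).toLinearMap ∘ₗ contractHead b₁ b₂) from DFunLike.congr_fun h x
  refine ext_word fun l => ?_
  rcases l with _ | ⟨v, _ | ⟨w, l⟩⟩
  · simp [contractHead_one]
  · simp [contractHead_ι, h₁]
  · simp [contractHead_ι_mul_ι_mul, h₁, h₂]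
    abel

theorem coder_par (h₁ : ∀ v, s (b₁ v) = -b₁ (s v))
    (h₂ : ∀ v w, s (b₂ (v ⊗ₜ[k] w)) = -b₂ (s v ⊗ₜ[k] s w)) (x : TensorAlgebra k V) :
    coder s b₁ b₂ (par s x) = -par s (coder s b₁ b₂ x) := by
  suffices h : coder s b₁ b₂ ∘ₗ (par s).toLinearMap =
      -((par s).toLinearMap ∘ₗ coder s b₁ b₂) from DFunLike.congr_fun h x
  refine ext_word fun l => ?_
  induction l with
  | nil => simp [coder_one]
  | cons v l ih =>
    simp only [LinearMap.comp_apply, LinearMap.neg_apply, AlgHom.toLinearMap_apply] at ih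
    simp only [word_cons, LinearMap.comp_apply, LinearMap.neg_apply, AlgHom.toLinearMap_apply,
      coder_ι_mul, map_add, map_mul, par_ι]
    rw [ih, ← par_ι, ← map_mul, contractHead_par h₁ h₂]
    simp
    abel

theorem delta_par (x : TensorAlgebra k V) : delta k V (par s x) =
    TensorProduct.map (par s).toLinearMap (par s).toLinearMap (delta k V x) := by
  suffices h : delta k V ∘ₗ (par s).toLinearMap =
      TensorProduct.map (par s).toLinearMap (par s).toLinearMap ∘ₗ delta k V from
    DFunLike.congr_fun h x
  refine ext_word fun l => ?_
  induction l with
  | nil => simp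
  | cons v l ih =>
    simp only [LinearMap.comp_apply, AlgHom.toLinearMap_apply] at ih
    simp only [word_cons, LinearMap.comp_apply, AlgHom.toLinearMap_apply, map_mul, par_ι,
      delta_ι_mul, ih, map_add, TensorProduct.map_tmul, map_one]
    congr 1
    generalize delta k V (word k l) = z
    induction z using TensorProduct.induction_on with
    | zero => simp
    | tmul a b => simp
    | add a b ha hb => simp only [mul_add, map_add, ha, hb]

end

/-- The subspace `D ⊗ D` of `T V ⊗ T V`. -/
def sq (D : Submodule k (TensorAlgebra k V)) :
    Submodule k (TensorAlgebra k V ⊗[k] TensorAlgebra k V) :=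
  LinearMap.range (TensorProduct.map D.subtype D.subtype)

/-- `D` is a sub-coalgebra of `T V` whose coproduct is graded cocommutative. -/
def IsCocommSub (s : V →ₗ[k] V) (D : Submodule k (TensorAlgebra k V)) : Prop :=
  ∀ x ∈ D, delta k V x ∈ sq D ∧ swap s (delta k V x) = delta k V x

variable (s : V →ₗ[k] V) in
/-- The symmetric coalgebra `S^c V`: the maximal cocommutative sub-coalgebra of the tensor
coalgebra `T^c V`. -/
def symm : Submodule k (TensorAlgebra k V) := sSup {D | IsCocommSub s D}

section

variable {s b₁ : V →ₗ[k] V} {b₂ : V ⊗[k] V →ₗ[k] V}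

theorem tmul_mem_sq {D : Submodule k (TensorAlgebra k V)} {x y : TensorAlgebra k V} (hx : x ∈ D)
    (hy : y ∈ D) : x ⊗ₜ[k] y ∈ sq D := ⟨(⟨x, hx⟩ : D) ⊗ₜ[k] (⟨y, hy⟩ : D), rfl⟩

/-- A map on `T V ⊗ T V` which takes decomposable elements of `D ⊗ D` to `E` takes `D ⊗ D`
to `E`. -/
theorem sq_le_comap {D : Submodule k (TensorAlgebra k V)} {Y : Type u} [AddCommGroup Y] [Module k Y]
    {E : Submodule k Y} {f : TensorAlgebra k V ⊗[k] TensorAlgebra k V →ₗ[k] Y}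
    (h : ∀ x ∈ D, ∀ y ∈ D, f (x ⊗ₜ[k] y) ∈ E) : sq D ≤ E.comap f := by
  rintro _ ⟨z, rfl⟩
  induction z using TensorProduct.induction_on with
  | zero => simp
  | tmul a b => exact h a a.2 b b.2
  | add a b ha hb => rw [map_add]; exact Submodule.add_mem _ ha hb

theorem sq_mono {D E : Submodule k (TensorAlgebra k V)} (h : D ≤ E) : sq D ≤ sq E :=
  sq_le_comap (f := LinearMap.id) fun _ hx _ hy => tmul_mem_sq (h hx) (h hy)

theorem isCocommSub_symm : IsCocommSub s (symm s) := by
  have : symm s ≤ (sq (symm s)).comap (delta k V) ⊓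
      LinearMap.ker (swap s ∘ₗ delta k V - delta k V) := by
    refine sSup_le fun D hD x hx => ⟨sq_mono (le_sSup hD) (hD x hx).1, ?_⟩
    exact sub_eq_zero.2 (hD x hx).2
  intro x hx
  exact ⟨(this hx).1, sub_eq_zero.1 (this hx).2⟩

theorem swap_tmul (x y : TensorAlgebra k V) : swap s (x ⊗ₜ[k] y) = (2 : k)⁻¹ •
    (y ⊗ₜ[k] x + par s y ⊗ₜ[k] x + y ⊗ₜ[k] par s x - par s y ⊗ₜ[k] par s x) := by
  simp [swap]

theorem isCocommSub_sup {D : Submodule k (TensorAlgebra k V)}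
    {f : TensorAlgebra k V →ₗ[k] TensorAlgebra k V} (hD : IsCocommSub s D)
    (h : ∀ x ∈ D, delta k V (f x) ∈ sq (D ⊔ D.map f) ∧
      swap s (delta k V (f x)) = delta k V (f x)) : IsCocommSub s (D ⊔ D.map f) := by
  intro x hx
  obtain ⟨y, hy, z, ⟨z, hz, rfl⟩, rfl⟩ := Submodule.mem_sup.1 hx
  rw [map_add, map_add, (hD y hy).2, (h z hz).2]
  exact ⟨Submodule.add_mem _ (sq_mono le_sup_left (hD y hy).1) (h z hz).1, rfl⟩

theorem par_mem_symm {x : TensorAlgebra k V} (hx : x ∈ symm s) :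
    par s x ∈ symm s := by
  have h : IsCocommSub s (symm s ⊔ (symm s).map (par s).toLinearMap) := by
    refine isCocommSub_sup isCocommSub_symm fun x hx => ?_
    obtain ⟨h1, h2⟩ := isCocommSub_symm x hx
    rw [AlgHom.toLinearMap_apply, delta_par]
    refine ⟨?_, ?_⟩
    · refine Submodule.mem_comap.1 (sq_le_comap
        (f := TensorProduct.map (par s).toLinearMap (par s).toLinearMap) (fun x hx y hy => ?_) h1)
      exact tmul_mem_sq (Submodule.mem_sup_right ⟨x, hx, rfl⟩)
        (Submodule.mem_sup_right ⟨y, hy, rfl⟩)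
    · conv_rhs => rw [← h2]
      generalize delta k V x = z
      induction z using TensorProduct.induction_on with
      | zero => simp
      | tmul a b => simp [swap_tmul]
      | add a b ha hb => simp only [map_add, ha, hb]
  exact le_sSup (a := symm s ⊔ (symm s).map (par s).toLinearMap) h
    (Submodule.mem_sup_right ⟨x, hx, rfl⟩)

theorem coder_mem_symm (hs : ∀ v, s (s v) = v) (h₁ : ∀ v, s (b₁ v) = -b₁ (s v))
    (h₂ : ∀ v w, s (b₂ (v ⊗ₜ[k] w)) = -b₂ (s v ⊗ₜ[k] s w)) {x : TensorAlgebra k V}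
    (hx : x ∈ symm s) : coder s b₁ b₂ x ∈ symm s := by
  have h : IsCocommSub s (symm s ⊔ (symm s).map (coder s b₁ b₂)) := by
    refine isCocommSub_sup isCocommSub_symm fun x hx => ?_
    obtain ⟨h1, h2⟩ := isCocommSub_symm x hx
    rw [delta_coder]
    refine ⟨?_, ?_⟩
    · refine Submodule.mem_comap.1 (sq_le_comap (f := coderTensor s b₁ b₂)
        (fun x hx y hy => ?_) h1)
      exact Submodule.add_mem _
        (tmul_mem_sq (Submodule.mem_sup_right ⟨x, hx, rfl⟩) (Submodule.mem_sup_left hy))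
        (tmul_mem_sq (Submodule.mem_sup_left (par_mem_symm hx))
          (Submodule.mem_sup_right ⟨y, hy, rfl⟩))
    · conv_rhs => rw [← h2]
      generalize delta k V x = z
      induction z using TensorProduct.induction_on with
      | zero => simp
      | tmul a b =>
        simp only [swap_tmul, coderTensor_tmul, map_add, map_smul, map_sub, par_par hs, ← smul_add,
          coder_par h₁ h₂, TensorProduct.neg_tmul, TensorProduct.tmul_neg]
        congr 1
        abel
      | add a b ha hb => simp only [map_add, ha, hb]
  exact le_sSup (a := symm s ⊔ (symm s).map (coder s b₁ b₂)) h
    (Submodule.mem_sup_right ⟨x, hx, rfl⟩)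

end

variable (s : V →ₗ[k] V) in
/-- The coproduct of `S^c V`. -/
def comulSymm : symm s →ₗ[k] symm s ⊗[k] symm s :=
  (LinearEquiv.ofInjective (TensorProduct.map (symm s).subtype (symm s).subtype)
    (TensorProduct.map_injective_of_flat_flat _ _ (Submodule.subtype_injective _)
      (Submodule.subtype_injective _))).symm.toLinearMap ∘ₗ
    LinearMap.codRestrict (sq (symm s)) (delta k V ∘ₗ (symm s).subtype)
      (fun x => (isCocommSub_symm x.1 x.2).1)

/-- The filtration of the tensor algebra induced by a filtration `G` of `V`: its `n`-th term is
spanned by the words `v₁ ⋯ vᵣ` with `vᵢ ∈ G pᵢ` and `p₁ + ⋯ + pᵣ ≥ n`. -/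
def wordFil (G : Filtration k V) : Filtration k (TensorAlgebra k V) where
  F n := Submodule.span k {x | ∃ l : List (ℕ × V), (∀ a ∈ l, a.2 ∈ G.F a.1) ∧
    n ≤ (l.map Prod.fst).sum ∧ x = word k (l.map Prod.snd)}
  anti := fun m n h => Submodule.span_mono (by
    rintro x ⟨l, hl, hn, hx⟩
    exact ⟨l, hl, h.trans hn, hx⟩)

section

variable {G : Filtration k V}

theorem word_mem {l : List (ℕ × V)} (hl : ∀ a ∈ l, a.2 ∈ G.F a.1) {n : ℕ}
    (hn : n ≤ (l.map Prod.fst).sum) : word k (l.map Prod.snd) ∈ (wordFil G).F n :=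
  Submodule.subset_span ⟨l, hl, hn, rfl⟩

theorem ι_mem {n : ℕ} {v : V} (hv : v ∈ G.F n) : ι k v ∈ (wordFil G).F n := by
  have := word_mem (G := G) (l := [(n, v)]) (by simpa using hv) (n := n) (by simp)
  simpa using this

theorem wordFil_mul {m n : ℕ} {x y : TensorAlgebra k V} (hx : x ∈ (wordFil G).F m)
    (hy : y ∈ (wordFil G).F n) : x * y ∈ (wordFil G).F (m + n) := by
  have := Submodule.mul_mem_mul hx hy
  rw [wordFil, Submodule.span_mul_span] at this
  refine Submodule.span_mono ?_ this
  rintro _ ⟨_, ⟨l, hl, hm, rfl⟩, _, ⟨l', hl', hn, rfl⟩, rfl⟩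
  refine ⟨l ++ l', ?_, ?_, ?_⟩
  · intro a ha
    rcases List.mem_append.1 ha with h | h
    · exact hl a h
    · exact hl' a h
  · simp only [List.map_append, List.sum_append]; omega
  · simp [word_append]

theorem wordFil_mul' (n : ℕ) : ((wordFil G).tensor (wordFil G)).F n ≤
    ((wordFil G).F n).comap (LinearMap.mul' k _) := by
  refine Submodule.span_le.2 ?_
  rintro _ ⟨p, q, x, y, h, hx, hy, rfl⟩
  exact (wordFil G).anti h (wordFil_mul hx hy)

theorem wordFil_le {Y : Type u} [AddCommGroup Y] [Module k Y] {f : TensorAlgebra k V →ₗ[k] Y}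
    {Q : Submodule k Y} {n : ℕ} (h : ∀ l : List (ℕ × V), (∀ a ∈ l, a.2 ∈ G.F a.1) →
      n ≤ (l.map Prod.fst).sum → f (word k (l.map Prod.snd)) ∈ Q) :
    (wordFil G).F n ≤ Q.comap f := by
  refine Submodule.span_le.2 ?_
  rintro _ ⟨l, hl, hn, rfl⟩
  exact h l hl hn

theorem wordFil_par {s : V →ₗ[k] V} (hs : ∀ n, G.F n ≤ (G.F n).comap s) (n : ℕ) :
    (wordFil G).F n ≤ ((wordFil G).F n).comap (par s).toLinearMap := by
  refine wordFil_le fun l hl hn => ?_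
  have h := word_mem (G := G) (l := l.map (fun a => (a.1, s a.2))) (n := n) (by
    intro a ha
    obtain ⟨b, hb, rfl⟩ := List.mem_map.1 ha
    exact hs _ (hl b hb)) (by simpa [Function.comp_def] using hn)
  convert h using 1
  simp [word, map_list_prod, Function.comp_def]

theorem tensor_ι_mul {p n : ℕ} {v : V} (hv : v ∈ G.F p)
    {z : TensorAlgebra k V ⊗[k] TensorAlgebra k V}
    (hz : z ∈ ((wordFil G).tensor (wordFil G)).F n) :
    (ι k v ⊗ₜ[k] 1) * z ∈ ((wordFil G).tensor (wordFil G)).F (p + n) := by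
  induction hz using Submodule.span_induction with
  | mem z h =>
    obtain ⟨p', q', x, y, h, hx, hy, rfl⟩ := h
    rw [Algebra.TensorProduct.tmul_mul_tmul, one_mul]
    exact Filtration.tmul_mem (by omega) (wordFil_mul (ι_mem hv) hx) hy
  | zero => simp
  | add a b _ _ ha hb => rw [mul_add]; exact Submodule.add_mem _ ha hb
  | smul c a _ ha => rw [mul_smul_comm]; exact Submodule.smul_mem _ c ha

theorem one_mem_wordFil : (1 : TensorAlgebra k V) ∈ (wordFil G).F 0 := by
  have := word_mem (G := G) (l := []) (by simp) (n := 0) (by simp)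
  simpa using this

theorem wordFil_delta (n : ℕ) : (wordFil G).F n ≤
    (((wordFil G).tensor (wordFil G)).F n).comap (delta k V) := by
  refine wordFil_le fun l hl hn => ?_
  refine ((wordFil G).tensor (wordFil G)).anti hn ?_
  clear hn
  induction l with
  | nil =>
    simp only [List.map_nil, word_nil, delta_one, List.sum_nil]
    exact Filtration.tmul_mem (p := 0) (q := 0) le_rfl one_mem_wordFil one_mem_wordFil
  | cons a l ih =>
    have hw := word_mem (G := G) hl le_rfl
    simp only [List.map_cons, word_cons, delta_ι_mul, List.sum_cons] at hw ⊢
    refine Submodule.add_mem _ (Filtration.tmul_mem (p := 0) (by omega) one_mem_wordFil hw) ?_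
    exact tensor_ι_mul (hl a (by simp)) (ih fun b hb => hl b (by simp [hb]))

theorem wordFil_counit : (wordFil G).F 1 ≤ LinearMap.ker
    (algebraMapInv (R := k) (M := V)).toLinearMap := by
  refine wordFil_le (Q := ⊥) fun l hl hn => ?_
  rcases l with _ | ⟨a, l⟩
  · simp at hn
  · simp [algebraMapInv]

theorem wordFil_ιInv (n : ℕ) : (wordFil G).F n ≤ (G.F n).comap (ιInv (R := k) (M := V)) := by
  refine wordFil_le fun l hl hn => ?_
  rcases l with _ | ⟨a, _ | ⟨b, l⟩⟩
  · simp [ιInv_one]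
  · have h : algebraMapInv (1 : TensorAlgebra k V) = (1 : k) := map_one _
    simp only [List.map_cons, List.map_nil, word_cons, word_nil, ιInv_ι_mul, h, one_smul]
    exact G.anti (by simpa using hn) (hl a (by simp))
  · have h : algebraMapInv (ι k b.2 * word k (l.map Prod.snd)) = (0 : k) := by
      simp [algebraMapInv]
    simp [ιInv_ι_mul, h]

variable {s b₁ : V →ₗ[k] V} {b₂ : V ⊗[k] V →ₗ[k] V} (c : ℕ)

theorem wordFil_corest (h₁ : ∀ n, G.F n ≤ (G.F (n - c)).comap b₁)
    (h₂ : ∀ n, (G.tensor G).F n ≤ (G.F (n - c)).comap b₂) (n : ℕ) :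
    (wordFil G).F n ≤ (G.F (n - c)).comap (corest b₁ b₂) := by
  intro x hx
  refine Submodule.add_mem _ (h₁ n (wordFil_ιInv n hx)) (h₂ n ?_)
  exact Filtration.tensor_map_le₀ wordFil_ιInv wordFil_ιInv n (wordFil_delta n hx)

theorem wordFil_contractHead (h₁ : ∀ n, G.F n ≤ (G.F (n - c)).comap b₁)
    (h₂ : ∀ n, (G.tensor G).F n ≤ (G.F (n - c)).comap b₂) (n : ℕ) :
    (wordFil G).F n ≤ ((wordFil G).F (n - c)).comap (contractHead b₁ b₂) := by
  intro x hx
  refine wordFil_mul' (n - c) ?_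
  exact Filtration.tensor_map_le (F' := wordFil G) (G' := wordFil G)
    (f := ι k ∘ₗ corest b₁ b₂) (g := LinearMap.id) c
    (fun n y hy => ι_mem (wordFil_corest c h₁ h₂ n hy)) (fun _ _ h => h) n (wordFil_delta n hx)

theorem wordFil_coder (hs : ∀ n, G.F n ≤ (G.F n).comap s)
    (h₁ : ∀ n, G.F n ≤ (G.F (n - c)).comap b₁)
    (h₂ : ∀ n, (G.tensor G).F n ≤ (G.F (n - c)).comap b₂) (n : ℕ) :
    (wordFil G).F n ≤ ((wordFil G).F (n - c)).comap (coder s b₁ b₂) := by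
  intro x hx
  refine wordFil_mul' (n - c) ?_
  exact Filtration.tensor_map_le' (F' := wordFil G) (G' := wordFil G)
    (f := (par s).toLinearMap) (g := contractHead b₁ b₂) c (wordFil_par hs)
    (wordFil_contractHead c h₁ h₂) n (wordFil_delta n hx)

end

end TensorCoalg

/-! ### The dgca's `k` and `k[t, dt]` -/

section Interval

variable (k : Type u) [Field k]

/-- Internal decompositions of a module into two summands, placed in degrees `0` and `1`. -/
theorem isInternal_two {X : Type u} [AddCommGroup X] [Module k X] (gr : ℤ → Submodule k X)
    (a b : X →ₗ[k] X) (hab : ∀ x, a x + b x = x) (ha : ∀ x, a x ∈ gr 0) (hb : ∀ x, b x ∈ gr 1)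
    (h0 : ∀ x ∈ gr 0, b x = 0) (h1 : ∀ x ∈ gr 1, a x = 0)
    (hn : ∀ n, n ≠ 0 → n ≠ 1 → gr n = ⊥) : DirectSum.IsInternal gr := by
  have key : ∀ z : ⨁ n, gr n, a (DirectSum.coeAddMonoidHom gr z) = z 0 ∧
      b (DirectSum.coeAddMonoidHom gr z) = z 1 := by
    intro z
    induction z using DirectSum.induction_on with
    | zero => simp
    | of i x =>
      rw [DirectSum.coeAddMonoidHom_of]
      by_cases hi0 : i = 0
      · subst hi0
        have := hab x
        rw [h0 x x.2, add_zero] at this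
        rw [DirectSum.of_eq_same, DirectSum.of_eq_of_ne _ _ _ (by decide), this, h0 x x.2]
        simp
      · by_cases hi1 : i = 1
        · subst hi1
          have := hab x
          rw [h1 x x.2, zero_add] at this
          rw [DirectSum.of_eq_same, DirectSum.of_eq_of_ne _ _ _ (by decide), this, h1 x x.2]
          simp
        · have hx : (x : X) = 0 := by
            simpa using (hn i hi0 hi1).le x.2
          rw [DirectSum.of_eq_of_ne _ _ _ (Ne.symm hi0), DirectSum.of_eq_of_ne _ _ _ (Ne.symm hi1),
            hx]
          simp
    | add x y hx hy => simp [map_add, hx.1, hx.2, hy.1, hy.2]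
  constructor
  · intro x y hxy
    refine DFinsupp.ext fun n => Subtype.ext ?_
    by_cases h0 : n = 0
    · subst h0
      erw [← (key x).1, ← (key y).1, hxy]
    · by_cases h1 : n = 1
      · subst h1
        erw [← (key x).2, ← (key y).2, hxy]
      · have hb : ∀ z : gr n, (z : X) = 0 := fun z => by
          simpa using (hn n h0 h1).le z.2
        rw [hb, hb]
  · intro x
    refine ⟨DirectSum.of (fun n => gr n) 0 ⟨a x, ha x⟩ +
      DirectSum.of (fun n => gr n) 1 ⟨b x, hb x⟩, ?_⟩
    rw [map_add, DirectSum.coeAddMonoidHom_of, DirectSum.coeAddMonoidHom_of]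
    exact hab x

/-- The ground field as a dgca. -/
def DGCA.unit : DGCA k where
  carrier := k
  gr n := if n = 0 then ⊤ else ⊥
  internal := isInternal_two k _ LinearMap.id 0 (by simp) (by simp) (by simp) (by simp)
    (by simp) (fun n h _ => by simp [h])
  one_mem := by simp
  mul_mem := fun {m n a b} ha hb => by
    by_cases hm : m = 0
    · by_cases hn : n = 0
      · simp [hm, hn]
      · have : b = 0 := by simpa [hn] using hb
        simp [this]
    · have : a = 0 := by simpa [hm] using ha
      simp [this]
  comm := fun {m n a b} ha hb => by
    by_cases hm : m = 0
    · simp [hm, sgn_zero, mul_comm]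
    · have : a = 0 := by simpa [hm] using ha
      simp [this]
  d := 0
  d_mem := by simp
  leibniz := by simp
  d_d := by simp

open Polynomial in
/-- The dgca `k[t, dt]`: the element `a(t) + b(t) dt` is the pair `(a, b)` (with `dt² = 0`), and
`d (a(t) + b(t) dt) = a'(t) dt`. -/
def DGCA.polyForms : DGCA k where
  carrier := TrivSqZeroExt k[X] k[X]
  gr n := if n = 0 then LinearMap.ker (TrivSqZeroExt.sndHom k[X] k[X] |>.restrictScalars k)
    else if n = 1 then LinearMap.ker (TrivSqZeroExt.fstHom k k[X] k[X]).toLinearMap else ⊥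
  internal := isInternal_two k _
    ((TrivSqZeroExt.inlAlgHom k k[X] k[X]).toLinearMap ∘ₗ
      (TrivSqZeroExt.fstHom k k[X] k[X]).toLinearMap)
    ((TrivSqZeroExt.inrHom k[X] k[X]).restrictScalars k ∘ₗ
      (TrivSqZeroExt.sndHom k[X] k[X]).restrictScalars k)
    (fun x => TrivSqZeroExt.inl_fst_add_inr_snd_eq x)
    (fun x => by simp) (fun x => by simp)
    (fun x hx => by
      have h : x.snd = 0 := hx
      simp [h])
    (fun x hx => by
      have h : x.fst = 0 := hx
      simp [h])
    (fun n h0 h1 => by simp [h0, h1])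
  one_mem := by simp
  mul_mem := fun {m n a b} ha hb => by
    by_cases hm : m = 0
    · subst hm
      have ha' : a.snd = 0 := ha
      by_cases hn : n = 0
      · subst hn
        have hb' : b.snd = 0 := hb
        simp [ha', hb']
      · by_cases hn1 : n = 1
        · subst hn1
          have hb' : b.fst = 0 := hb
          simp [hb']
        · have hb' : b = 0 := by simpa [hn, hn1] using hb
          simp [hb']
    · by_cases hm1 : m = 1
      · subst hm1
        have ha' : a.fst = 0 := ha
        by_cases hn : n = 0
        · subst hn
          simp [ha']
        · by_cases hn1 : n = 1
          · subst hn1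
            have hb' : b.fst = 0 := hb
            have : a * b = 0 := by ext <;> simp [ha', hb']
            rw [this]
            exact Submodule.zero_mem _
          · have hb' : b = 0 := by simpa [hn, hn1] using hb
            simp [hb']
      · have ha' : a = 0 := by simpa [hm, hm1] using ha
        simp [ha']
  comm := fun {m n a b} ha hb => by
    by_cases hm : m = 0
    · simp [hm, sgn_zero, mul_comm]
    · by_cases hn : n = 0
      · simp [hn, sgn_zero, mul_comm]
      · have h0 : ∀ (j : ℤ) (c : TrivSqZeroExt k[X] k[X]), j ≠ 0 →
            c ∈ (if j = 0 then LinearMap.ker (TrivSqZeroExt.sndHom k[X] k[X] |>.restrictScalars k)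
              else if j = 1 then LinearMap.ker (TrivSqZeroExt.fstHom k k[X] k[X]).toLinearMap
              else ⊥) → c.fst = 0 := by
          intro j c hj hc
          by_cases hj1 : j = 1
          · subst hj1
            exact hc
          · have : c = 0 := by simpa [hj, hj1] using hc
            simp [this]
        have ha' := h0 m a hm ha
        have hb' := h0 n b hn hb
        ext <;> simp [ha', hb']
  d := (TrivSqZeroExt.inrHom k[X] k[X]).restrictScalars k ∘ₗ Polynomial.derivative ∘ₗ
    (TrivSqZeroExt.fstHom k k[X] k[X]).toLinearMap
  d_mem := fun {n a} ha => by
    by_cases hn : n = 0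
    · subst hn
      simp
    · have : a.fst = 0 := by
        by_cases hn1 : n = 1
        · subst hn1
          exact ha
        · have : a = 0 := by simpa [hn, hn1] using ha
          simp [this]
      simp [this]
  leibniz := fun {n a} ha b => by
    by_cases hn : n = 0
    · subst hn
      have ha' : a.snd = 0 := ha
      ext <;> simp [sgn_zero, mul_comm]
    · have : a.fst = 0 := by
        by_cases hn1 : n = 1
        · subst hn1
          exact ha
        · have : a = 0 := by simpa [hn, hn1] using ha
          simp [this]
      ext <;> simp [this]
  d_d := by simp

end Interval

/-! ### Filtered models and perturbations -/

/-- A filtered model `ρ : (S Z, d) → H`.  Here `Z` has a homogeneous basis indexed by `I`, the `i`-th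
basis element having (total) degree `deg i ≥ 1`, resolution degree `- res i ≤ 0` and weight
`deg i + res i`. -/
structure FilteredModel {k : Type u} [Field k] (H : GCA k) where
  I : Type u
  deg : I → ℕ
  res : I → ℕ
  deg_pos : ∀ i, 0 < deg i
  d : FreeGCA k deg →ₗ[k] FreeGCA k deg
  d_mem : ∀ {n : ℤ} {a : FreeGCA k deg}, a ∈ FreeGCA.gr k deg n → d a ∈ FreeGCA.gr k deg (n + 1)
  leibniz : ∀ {n : ℤ} {a : FreeGCA k deg}, a ∈ FreeGCA.gr k deg n → ∀ b,
    d (a * b) = d a * b + sgn k n • (a * d b)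
  d_d : ∀ a, d (d a) = 0
  /-- the differential does not increase weights -/
  d_wt : ∀ {w : ℤ} {a : FreeGCA k deg}, a ∈ FreeGCA.wtLE k deg (fun i => deg i + res i) w →
    d a ∈ FreeGCA.wtLE k deg (fun i => deg i + res i) w
  ρ : FreeGCA k deg →ₐ[k] H.carrier
  ρ_mem : ∀ {n : ℤ} {a : FreeGCA k deg}, a ∈ FreeGCA.gr k deg n → ρ a ∈ H.gr n
  ρ_d : ∀ a, ρ (d a) = 0
  /-- `ρ` is injective in cohomology -/
  ρ_inj : ∀ a, d a = 0 → ρ a = 0 → ∃ b, d b = a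
  /-- `ρ` is surjective in cohomology -/
  ρ_surj : ∀ h, ∃ a, d a = 0 ∧ ρ a = h
  /-- The cohomology of the associated graded complex is concentrated in resolution degree `0`,
  i.e. in bidegrees (degree, weight) with degree equal to weight. -/
  exact : ∀ (n w : ℤ) (a : FreeGCA k deg), n ≠ w → a ∈ FreeGCA.gr k deg n →
    a ∈ FreeGCA.wtLE k deg (fun i => deg i + res i) w →
    d a ∈ FreeGCA.wtLE k deg (fun i => deg i + res i) (w - 1) →
    ∃ b ∈ FreeGCA.gr k deg (n - 1), b ∈ FreeGCA.wtLE k deg (fun i => deg i + res i) w ∧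
      a - d b ∈ FreeGCA.wtLE k deg (fun i => deg i + res i) (w - 1)

namespace FilteredModel

variable {k : Type u} [Field k] {H : GCA k} (M : FilteredModel H)

/-- The algebra `S Z`. -/
abbrev S : Type u := FreeGCA k M.deg

/-- The elements of `S Z` of degree `n`. -/
abbrev gr (n : ℤ) : Submodule k M.S := FreeGCA.gr k M.deg n

/-- The elements of `S Z` of weight at most `w`. -/
abbrev wtLE (w : ℤ) : Submodule k M.S := FreeGCA.wtLE k M.deg (fun i => M.deg i + M.res i) w

/-- The model is minimal: `d Z` consists of decomposable elements. -/
def Minimal : Prop := ∀ i, M.d (FreeGCA.gen k M.deg i) ∈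
  Submodule.span k {c | ∃ (m n : ℤ) (a b : M.S), 0 < m ∧ 0 < n ∧ a ∈ M.gr m ∧ b ∈ M.gr n ∧
    c = a * b}

/-- There are finitely many generators in each degree. -/
def FiniteType : Prop := ∀ n, {i | M.deg i = n}.Finite

/-- The derivations of `S Z` of degree `n` which decrease weights by at least `p`. -/
def der (n : ℤ) (p : ℕ) : Submodule k (M.S →ₗ[k] M.S) where
  carrier := {θ | (∀ m, ∀ a ∈ M.gr m, θ a ∈ M.gr (m + n)) ∧
    (∀ m, ∀ a ∈ M.gr m, ∀ b, θ (a * b) = θ a * b + sgn k (n * m) • (a * θ b)) ∧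
    (∀ w, ∀ a ∈ M.wtLE w, θ a ∈ M.wtLE (w - p))}
  add_mem' := fun {θ φ} hθ hφ =>
    ⟨fun m a ha => Submodule.add_mem _ (hθ.1 m a ha) (hφ.1 m a ha),
      fun m a ha b => by
        simp only [LinearMap.add_apply, hθ.2.1 m a ha b, hφ.2.1 m a ha b, add_mul, mul_add, smul_add]
        abel,
      fun w a ha => Submodule.add_mem _ (hθ.2.2 w a ha) (hφ.2.2 w a ha)⟩
  zero_mem' := ⟨fun m a ha => Submodule.zero_mem _, by simp, fun w a ha => Submodule.zero_mem _⟩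
  smul_mem' := fun c θ hθ =>
    ⟨fun m a ha => Submodule.smul_mem _ c (hθ.1 m a ha),
      fun m a ha b => by
        simp only [LinearMap.smul_apply, hθ.2.1 m a ha b, smul_add, smul_mul_assoc, mul_smul_comm]
        rw [smul_comm],
      fun w a ha => Submodule.smul_mem _ c (hθ.2.2 w a ha)⟩

theorem wtLE_mono {v w : ℤ} (h : v ≤ w) : M.wtLE v ≤ M.wtLE w :=
  Submodule.span_mono (by rintro _ ⟨l, hl, rfl⟩; exact ⟨l, hl.trans h, rfl⟩)

theorem der_anti (n : ℤ) {p q : ℕ} (h : p ≤ q) : M.der n q ≤ M.der n p :=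
  fun _ hθ => ⟨hθ.1, hθ.2.1, fun w a ha => M.wtLE_mono (by omega) (hθ.2.2 w a ha)⟩

/-- The graded commutator of operators of degrees `n` and `m`. -/
def gcomm (n m : ℤ) (θ φ : M.S →ₗ[k] M.S) : M.S →ₗ[k] M.S :=
  θ ∘ₗ φ - sgn k (n * m) • (φ ∘ₗ θ)

theorem gcomm_mem {n m : ℤ} {p q : ℕ} {θ φ : M.S →ₗ[k] M.S} (hθ : θ ∈ M.der n p)
    (hφ : φ ∈ M.der m q) : M.gcomm n m θ φ ∈ M.der (n + m) (p + q) := by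
  refine ⟨fun j a ha => ?_, fun j a ha b => ?_, fun w a ha => ?_⟩
  · refine Submodule.sub_mem _ ?_ (Submodule.smul_mem _ _ ?_)
    · have := hθ.1 _ _ (hφ.1 j a ha)
      rwa [show j + (n + m) = j + m + n by ring]
    · have := hφ.1 _ _ (hθ.1 j a ha)
      rwa [← add_assoc]
  · have e1 := hφ.1 j a ha
    have e2 := hθ.1 j a ha
    simp only [gcomm, LinearMap.sub_apply, LinearMap.smul_apply, LinearMap.comp_apply,
      hφ.2.1 j a ha b, hθ.2.1 j a ha b, map_add, map_smul, hθ.2.1 _ _ e1, hθ.2.1 j a ha,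
      hφ.2.1 _ _ e2, hφ.2.1 j a ha, mul_add, add_mul, sgn_add, sub_mul, mul_sub, smul_sub,
      smul_add, smul_smul, smul_mul_assoc, mul_smul_comm]
    have h1 : sgn k (n * m) * sgn k (m * n) = 1 := by rw [mul_comm m n, sgn_mul_self]
    have h2 : sgn k (n * m) * (sgn k (m * j) * sgn k (m * n)) = sgn k (m * j) := by
      rw [mul_left_comm, h1, mul_one]
    simp only [mul_comm m n] at h2 ⊢
    rw [h2]
    module
  · refine Submodule.sub_mem _ ?_ (Submodule.smul_mem _ _ ?_)
    · have := hθ.2.2 _ _ (hφ.2.2 w a ha)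
      rwa [show w - ((p + q : ℕ) : ℤ) = w - q - p by push_cast; ring]
    · have := hφ.2.2 _ _ (hθ.2.2 w a ha)
      rwa [show w - ((p + q : ℕ) : ℤ) = w - p - q by push_cast; ring]

theorem d_mem_der : M.d ∈ M.der 1 0 :=
  ⟨fun _ _ ha => M.d_mem ha, fun m a ha b => by rw [M.leibniz ha, one_mul],
    fun w a ha => by simpa using M.d_wt ha⟩

/-- A perturbation: a weight decreasing derivation `p` of degree `1` with `(d + p)² = 0`. -/
structure Perturbation where
  p : M.S →ₗ[k] M.S
  mem : p ∈ M.der 1 1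
  sq : ∀ a, (M.d + p) ((M.d + p) a) = 0

theorem perturb_leibniz {A : Type u} [Ring A] [Algebra k A] {a b da db pa pb dab pab : A} {c : k}
    (h1 : dab = da * b + c • (a * db)) (h2 : pab = pa * b + c • (a * pb)) :
    dab + pab = (da + pa) * b + c • (a * (db + pb)) := by
  rw [h1, h2, add_mul, mul_add, smul_add]
  abel

variable {M} in
/-- The dgca `(S Z, d + p)`. -/
def Perturbation.dgca (p : M.Perturbation) : DGCA k where
  toGCA := FreeGCA.gca k M.deg
  d := M.d + p.p
  d_mem := fun ha => Submodule.add_mem _ (M.d_mem ha) (p.mem.1 _ _ ha)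
  leibniz := fun {n a} ha b => by
    have h1 := M.leibniz ha b
    have h2 := p.mem.2.1 n a ha b
    rw [one_mul] at h2
    exact perturb_leibniz h1 h2
  d_d := p.sq

variable {M} in
/-- `i : H ≅ H(S Z, d + p)` is the canonical isomorphism: it takes `ρ x` to the class of `x` for `x`
of resolution degree `0`. -/
def Perturbation.IsAugmentation (p : M.Perturbation) (i : CohIso H p.dgca) : Prop :=
  ∀ (n : ℤ) (x : M.S), x ∈ M.gr n → x ∈ M.wtLE n →
    ∃ hx : p.dgca.d x = 0, i.toEquiv (M.ρ x) = p.dgca.cls x hx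

/-! ### The dg Lie algebra `L` and the coalgebra `Ĉ(L)` -/

instance derGroup (n : ℤ) (p : ℕ) : AddCommGroup (M.der n p) := Submodule.addCommGroup _

/-- The space `s L`, where `L = ⨁ Lⁿ` consists of the weight decreasing derivations; the summand
indexed by `n` is `s Lⁿ`, of degree `n - 1`. -/
def sL : Type u := ⨁ n : ℤ, M.der n 1

instance : AddCommGroup M.sL := inferInstanceAs (AddCommGroup (⨁ n : ℤ, M.der n 1))

instance : Module k M.sL := inferInstanceAs (Module k (⨁ n : ℤ, M.der n 1))

/-- The map `θ ↦ s θ` on `Lⁿ`. -/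
def susp (n : ℤ) : M.der n 1 →ₗ[k] M.sL := DirectSum.lof k ℤ (fun n => M.der n 1) n

/-- The component in `Lⁿ` of an element of `s L`. -/
def comp (n : ℤ) : M.sL →ₗ[k] M.der n 1 := DirectSum.component k ℤ (fun n => M.der n 1) n

/-- The linear map on `s L` with given restrictions to the `s Lⁿ`. -/
def lift {Y : Type u} [AddCommGroup Y] [Module k Y] (f : ∀ n, M.der n 1 →ₗ[k] Y) :
    M.sL →ₗ[k] Y := DirectSum.toModule k ℤ Y f

variable {M} in
theorem lift_susp {Y : Type u} [AddCommGroup Y] [Module k Y] (f : ∀ n, M.der n 1 →ₗ[k] Y) (n : ℤ)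
    (θ : M.der n 1) : M.lift f (M.susp n θ) = f n θ := by
  change DirectSum.toModule k ℤ Y f (DirectSum.lof k ℤ (fun n => M.der n 1) n θ) = f n θ
  rw [DirectSum.toModule_lof]

/-- The parity operator `x ↦ (-1)^{|x|} x` on `s L`. -/
def par : M.sL →ₗ[k] M.sL :=
  M.lift fun n => sgn k (n - 1) • M.susp n

/-- The bracket `Lⁿ ⊗ Lᵐ → Lⁿ⁺ᵐ`, as a bilinear map. -/
def bracket (n m : ℤ) : M.der n 1 →ₗ[k] M.der m 1 →ₗ[k] M.der (n + m) 1 :=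
  LinearMap.mk₂ k
    (fun θ φ => ⟨M.gcomm n m θ.1 φ.1, M.der_anti _ (by omega) (M.gcomm_mem θ.2 φ.2)⟩)
    (fun a b c => Subtype.ext (by
      simp only [gcomm, Submodule.coe_add, LinearMap.add_comp, LinearMap.comp_add, smul_add]; abel))
    (fun r a b => Subtype.ext (by
      simp only [gcomm, Submodule.coe_smul, LinearMap.smul_comp, LinearMap.comp_smul, smul_sub]
      rw [smul_comm]))
    (fun a b c => Subtype.ext (by
      simp only [gcomm, Submodule.coe_add, LinearMap.add_comp, LinearMap.comp_add, smul_add]; abel))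
    (fun r a b => Subtype.ext (by
      simp only [gcomm, Submodule.coe_smul, LinearMap.smul_comp, LinearMap.comp_smul, smul_sub]
      rw [smul_comm]))

/-- The differential `θ ↦ [d, θ]` of `L`. -/
def dL (n : ℤ) : M.der n 1 →ₗ[k] M.der (1 + n) 1 where
  toFun θ := ⟨M.gcomm 1 n M.d θ.1, by simpa using M.gcomm_mem M.d_mem_der θ.2⟩
  map_add' a b := Subtype.ext (by
    simp only [gcomm, Submodule.coe_add, LinearMap.add_comp, LinearMap.comp_add, smul_add]; abel)
  map_smul' r a := Subtype.ext (by
    simp only [gcomm, Submodule.coe_smul, LinearMap.smul_comp, LinearMap.comp_smul, smul_sub,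
      RingHom.id_apply]
    rw [smul_comm])

/-- The map `s θ ↦ - s [d, θ]`. -/
def b₁ : M.sL →ₗ[k] M.sL :=
  M.lift fun n => -(M.susp (1 + n) ∘ₗ M.dL n)

/-- The map `s θ ⊗ s φ ↦ ½ (-1)^{|θ|} s [θ, φ]`, as a bilinear map. -/
def b₂Aux : M.sL →ₗ[k] M.sL →ₗ[k] M.sL :=
  M.lift fun n => LinearMap.flip
    (M.lift fun m => LinearMap.flip
      (((2 : k)⁻¹ * sgn k n) • (M.bracket n m).compr₂ (M.susp (n + m))))

/-- The map `s θ ⊗ s φ ↦ ½ (-1)^{|θ|} s [θ, φ]`. -/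
def b₂ : M.sL ⊗[k] M.sL →ₗ[k] M.sL := TensorProduct.lift M.b₂Aux

variable {M}

theorem par_susp (n : ℤ) (θ : M.der n 1) : M.par (M.susp n θ) = sgn k (n - 1) • M.susp n θ := by
  simp [par, lift_susp]

theorem b₁_susp (n : ℤ) (θ : M.der n 1) : M.b₁ (M.susp n θ) = -M.susp (1 + n) (M.dL n θ) := by
  simp [b₁, lift_susp]

theorem b₂_susp (n m : ℤ) (θ : M.der n 1) (φ : M.der m 1) :
    M.b₂ (M.susp n θ ⊗ₜ[k] M.susp m φ) =
      ((2 : k)⁻¹ * sgn k n) • M.susp (n + m) (M.bracket n m θ φ) := by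
  simp [b₂, b₂Aux, lift_susp]

theorem susp_ext {Y : Type u} [AddCommGroup Y] [Module k Y] {f g : M.sL →ₗ[k] Y}
    (h : ∀ (n : ℤ) (θ : M.der n 1), f (M.susp n θ) = g (M.susp n θ)) : f = g :=
  DirectSum.linearMap_ext k fun n => LinearMap.ext (h n)

theorem sgn_smul_smul {X : Type u} [AddCommGroup X] [Module k X] (n : ℤ) (x : X) :
    sgn k n • sgn k n • x = x := by rw [smul_smul, sgn_mul_self, one_smul]

theorem sgn_succ (n : ℤ) : sgn k (1 + n) = -sgn k n := by
  rw [sgn_add]; simp [sgn]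

theorem par_invol (v : M.sL) : M.par (M.par v) = v := by
  suffices h : M.par ∘ₗ M.par = LinearMap.id from DFunLike.congr_fun h v
  refine susp_ext fun n θ => ?_
  simp [par_susp, sgn_smul_smul]

theorem par_b₁ (v : M.sL) : M.par (M.b₁ v) = -M.b₁ (M.par v) := by
  suffices h : M.par ∘ₗ M.b₁ = -(M.b₁ ∘ₗ M.par) from DFunLike.congr_fun h v
  refine susp_ext fun n θ => ?_
  have h : sgn k n = -sgn k (n - 1) := by rw [← sgn_succ, add_sub_cancel]
  simp [par_susp, b₁_susp, h]

theorem par_b₂ (v w : M.sL) : M.par (M.b₂ (v ⊗ₜ[k] w)) = -M.b₂ (M.par v ⊗ₜ[k] M.par w) := by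
  suffices h : (TensorProduct.mk k M.sL M.sL).compr₂ (M.par ∘ₗ M.b₂) =
      -(TensorProduct.mk k M.sL M.sL).compr₂ (M.b₂ ∘ₗ TensorProduct.map M.par M.par) from
    DFunLike.congr_fun (DFunLike.congr_fun h v) w
  refine susp_ext fun n θ => susp_ext fun m φ => ?_
  have h : sgn k (n + m - 1) = -(sgn k (m - 1) * sgn k (n - 1)) := by
    rw [show n + m - 1 = 1 + ((m - 1) + (n - 1)) by ring, sgn_succ, sgn_add]
  simp only [LinearMap.compr₂_apply, LinearMap.neg_apply, LinearMap.comp_apply,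
    TensorProduct.mk_apply, TensorProduct.map_tmul, par_susp, b₂_susp, map_smul, h,
    ← TensorProduct.smul_tmul', TensorProduct.tmul_smul, smul_smul, neg_smul]
  module

/-- A filtration of `s L` given by filtrations of the `Lⁿ`. -/
def filOf (F : ℕ → ∀ n, Submodule k (M.der n 1)) (hF : ∀ p q n, p ≤ q → F q n ≤ F p n) :
    Filtration k M.sL where
  F p :=
    { carrier := {x | ∀ n, M.comp n x ∈ F p n}
      add_mem' := fun hx hy n => by rw [map_add]; exact Submodule.add_mem _ (hx n) (hy n)
      zero_mem' := fun n => by rw [map_zero]; exact Submodule.zero_mem _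
      smul_mem' := fun c _ hx n => by rw [map_smul]; exact Submodule.smul_mem _ c (hx n) }
  anti := fun p q h x hx n => hF p q n h (hx n)

section

variable {F : ℕ → ∀ n, Submodule k (M.der n 1)} {hF : ∀ p q n, p ≤ q → F q n ≤ F p n}

theorem susp_mem {p : ℕ} {n : ℤ} {θ : M.der n 1} (h : θ ∈ F p n) :
    M.susp n θ ∈ (filOf F hF).F p := by
  intro m
  by_cases hm : m = n
  · subst hm
    have : M.comp m (M.susp m θ) = θ := by
      change DirectSum.component k ℤ (fun n => M.der n 1) m
        (DirectSum.lof k ℤ (fun n => M.der n 1) m θ) = θ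
      rw [DirectSum.component.lof_self]
    rwa [this]
  · have : M.comp m (M.susp n θ) = 0 := DirectSum.of_eq_of_ne _ _ _ hm
    rw [this]
    exact Submodule.zero_mem _

theorem filOf_le {p : ℕ} {Y : Type u} [AddCommGroup Y] [Module k Y] {f : M.sL →ₗ[k] Y}
    {Q : Submodule k Y} (h : ∀ n, ∀ θ ∈ F p n, f (M.susp n θ) ∈ Q) :
    (filOf F hF).F p ≤ Q.comap f := by
  classical
  intro x hx
  have hx' : x = ∑ n ∈ DFinsupp.support (β := fun n => M.der n 1) x, M.susp n (M.comp n x) :=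
    (DirectSum.sum_support_of (β := fun n => M.der n 1) x).symm
  rw [Submodule.mem_comap, hx', map_sum]
  exact Submodule.sum_mem _ fun n _ => h n _ (hx n)

theorem par_le (n : ℕ) : (filOf F hF).F n ≤ ((filOf F hF).F n).comap M.par :=
  filOf_le fun m θ hθ => by rw [par_susp]; exact Submodule.smul_mem _ _ (susp_mem hθ)

theorem b₁_le (c : ℕ) (h : ∀ p n, ∀ θ ∈ F p n, M.dL n θ ∈ F (p - c) (1 + n)) (p : ℕ) :
    (filOf F hF).F p ≤ ((filOf F hF).F (p - c)).comap M.b₁ :=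
  filOf_le fun m θ hθ => by
    rw [b₁_susp]; exact Submodule.neg_mem _ (susp_mem (h p m θ hθ))

theorem b₂_le (c : ℕ) (h : ∀ p q n m, ∀ θ ∈ F p n, ∀ φ ∈ F q m,
    M.bracket n m θ φ ∈ F (p + q - c) (n + m)) (p : ℕ) :
    ((filOf F hF).tensor (filOf F hF)).F p ≤ ((filOf F hF).F (p - c)).comap M.b₂ := by
  refine Submodule.span_le.2 ?_
  rintro _ ⟨q, r, x, y, hp, hx, hy, rfl⟩
  refine (filOf F hF).anti (show p - c ≤ q + r - c by omega) ?_
  have h1 : (filOf F hF).F q ≤ ((filOf F hF).F (q + r - c)).comap (M.b₂Aux.flip y) :=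
    filOf_le fun n θ hθ => by
      have h2 : (filOf F hF).F r ≤ ((filOf F hF).F (q + r - c)).comap (M.b₂Aux (M.susp n θ)) :=
        filOf_le fun m φ hφ => by
          have := b₂_susp n m θ φ
          rw [b₂, TensorProduct.lift.tmul] at this
          rw [this]
          exact Submodule.smul_mem _ _ (susp_mem (h q r n m θ hθ φ hφ))
      exact h2 hy
  exact h1 hx

end

variable (M)

/-- The filtration of `s L` by weight: the `p`-th term consists of the derivations which decrease
weights by at least `p`. -/
def wtFil : Filtration k M.sL :=
  filOf (fun p n => (M.der n p).comap (M.der n 1).subtype) fun _ _ n h _ hθ => M.der_anti n h hθ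

theorem wtFil_par (p : ℕ) : M.wtFil.F p ≤ (M.wtFil.F p).comap M.par := par_le p

theorem wtFil_b₁ (p : ℕ) : M.wtFil.F p ≤ (M.wtFil.F (p - 0)).comap M.b₁ :=
  b₁_le 0 (fun p n θ hθ => by
    have h := M.gcomm_mem M.d_mem_der hθ
    rw [zero_add] at h
    exact h) p

theorem wtFil_b₂ (p : ℕ) : (M.wtFil.tensor M.wtFil).F p ≤ (M.wtFil.F (p - 0)).comap M.b₂ :=
  b₂_le 0 (fun _ _ _ _ _ hθ _ hφ => M.gcomm_mem hθ hφ) p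

/-- The tensor coalgebra `T^c (s L)`, filtered by weight, with the coderivation whose components are
`b₁` and `b₂`. -/
def tens : FiltCoalg k where
  X := TensorAlgebra k M.sL
  fil := TensorCoalg.wordFil M.wtFil
  gr j := Submodule.span k {x | ∃ l : List (Σ n : ℤ, M.der n 1),
    (l.map fun a => a.1 - 1).sum = j ∧ x = TensorCoalg.word k (l.map fun a => M.susp a.1 a.2)}
  d := TensorCoalg.coder M.par M.b₁ M.b₂
  d_fil := TensorCoalg.wordFil_coder 0 M.wtFil_par M.wtFil_b₁ M.wtFil_b₂
  counit := TensorAlgebra.algebraMapInv.toLinearMap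
  counit_fil := TensorCoalg.wordFil_counit
  comul := TensorCoalg.delta k M.sL
  comul_fil := TensorCoalg.wordFil_delta

/-- The coalgebra `C(L)`, as a sub-coalgebra of `T^c (s L)`. -/
abbrev symm : Submodule k (TensorAlgebra k M.sL) := TensorCoalg.symm M.par

/-- The cocompletion `Ĉ(L)`, as a subspace of the completion of `T^c (s L)`. -/
def symmHat : Submodule k M.tens.Hat where
  carrier := {x | ∀ p, x.1 p ∈ M.symm.map (M.tens.fil.F p).mkQ}
  add_mem' := fun hx hy p => Submodule.add_mem _ (hx p) (hy p)
  zero_mem' := fun _ => Submodule.zero_mem _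
  smul_mem' := fun c _ hx p => Submodule.smul_mem _ c (hx p)

/-- Points of `Ĉ(L)`: filtered maps of dg coalgebras `k → Ĉ(L)`. -/
def Point : Type u :=
  {χ : FiltCoalg.Hom (FiltCoalg.pt k) M.tens // ∀ x, χ.f x ∈ M.symmHat}

/-- Paths in `Ĉ(L)`: filtered maps of dg coalgebras `J → Ĉ(L)`. -/
def Path : Type u :=
  {c : FiltCoalg.Hom (FiltCoalg.interval k) M.tens // ∀ x, c.f x ∈ M.symmHat}

variable {M} in
/-- Filtered homotopy of points: `1 ↦ χ₀ 1` and `∑ t_i ↦ χ₁ 1`. -/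
def FiltHomotopic (χ₀ χ₁ : M.Point) : Prop :=
  ∃ c : M.Path, c.1.f (FiltCoalg.tZero k) = χ₀.1.f FiltCoalg.ptOne ∧
    c.1.f (FiltCoalg.tSum k) = χ₁.1.f FiltCoalg.ptOne

/-- Path components of `Ĉ(L)`. -/
def PathComponent : Type u := Quot (@FiltHomotopic k _ H M)

variable {M}

/-- The element `s p` of `s L`. -/
def Perturbation.sp (p : M.Perturbation) : M.sL := M.susp 1 ⟨p.p, p.mem⟩

theorem Perturbation.sp_pow_mem (p : M.Perturbation) (j : ℕ) :
    (TensorAlgebra.ι k p.sp) ^ j ∈ (TensorCoalg.wordFil M.wtFil).F j := by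
  have h : p.sp ∈ M.wtFil.F 1 := susp_mem (F := fun p n => (M.der n p).comap (M.der n 1).subtype)
    p.mem
  induction j with
  | zero => rw [pow_zero]; exact TensorCoalg.one_mem_wordFil
  | succ j ih => rw [pow_succ]; exact TensorCoalg.wordFil_mul ih (TensorCoalg.ι_mem h)

/-- The element `1 + s p + s p ⊗ s p + ⋯` of the completion of `T^c (s L)`. -/
def Perturbation.chiElt (p : M.Perturbation) : M.tens.Hat :=
  ⟨fun n => (Submodule.Quotient.mk (∑ j ∈ Finset.range n, (TensorAlgebra.ι k p.sp) ^ j) :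
      TensorAlgebra k M.sL ⧸ (TensorCoalg.wordFil M.wtFil).F n), by
    intro m n h
    refine (Submodule.Quotient.eq _).2 ?_
    change (∑ j ∈ Finset.range n, (TensorAlgebra.ι k p.sp) ^ j) -
      (∑ j ∈ Finset.range m, (TensorAlgebra.ι k p.sp) ^ j) ∈ (TensorCoalg.wordFil M.wtFil).F m
    rw [← Finset.sum_range_add_sum_Ico _ h, add_sub_cancel_left]
    exact Submodule.sum_mem _ fun j hj =>
      (TensorCoalg.wordFil M.wtFil).anti (Finset.mem_Ico.1 hj).1 (p.sp_pow_mem j)⟩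

/-- `χ` is the classifying map of `p`: `χ 1 = 1 + s p + s p ⊗ s p + ⋯`. -/
def Perturbation.IsClassifying (p : M.Perturbation) (χ : M.Point) : Prop :=
  χ.1.f FiltCoalg.ptOne = p.chiElt

/-! ### The algebra `A(L)` -/

/-- The derivations in `Lⁿ` which vanish on the elements of weight at most `w`. -/
def vanish (w n : ℤ) : Submodule k (M.der n 1) where
  carrier := {θ | ∀ a ∈ M.wtLE w, θ.1 a = 0}
  add_mem' := fun hx hy a ha => by simp [hx a ha, hy a ha]
  zero_mem' := fun a _ => by simp
  smul_mem' := fun c x hx a ha => by simp [hx a ha]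

variable (M) in
/-- The filtration with first term `s L` and with all further terms equal to the space of
derivations which vanish on the elements of weight at most `w`. -/
def contFil (w : ℤ) : Filtration k M.sL :=
  filOf (fun p n => if p ≤ 1 then ⊤ else vanish w n) fun p q n h => by
    by_cases hp : p ≤ 1
    · simp [hp]
    · have : ¬ q ≤ 1 := by omega
      simp [hp, this]

theorem gcomm_vanish {w n m : ℤ} {p : ℕ} {θ φ : M.S →ₗ[k] M.S} (hθ : θ ∈ M.der n p)
    (hφ : ∀ a ∈ M.wtLE w, φ a = 0) : ∀ a ∈ M.wtLE w, M.gcomm n m θ φ a = 0 := by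
  intro a ha
  have h := hθ.2.2 w a ha
  simp [gcomm, hφ a ha, hφ _ (M.wtLE_mono (by omega) h)]

theorem gcomm_vanish' {w n m : ℤ} {p : ℕ} {θ φ : M.S →ₗ[k] M.S} (hφ : φ ∈ M.der m p)
    (hθ : ∀ a ∈ M.wtLE w, θ a = 0) : ∀ a ∈ M.wtLE w, M.gcomm n m θ φ a = 0 := by
  intro a ha
  have h := hφ.2.2 w a ha
  simp [gcomm, hθ a ha, hθ _ (M.wtLE_mono (by omega) h)]

theorem contFil_coder (w : ℤ) (N : ℕ) : (TensorCoalg.wordFil (M.contFil w)).F N ≤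
    ((TensorCoalg.wordFil (M.contFil w)).F (N - 1)).comap
      (TensorCoalg.coder M.par M.b₁ M.b₂) := by
  refine TensorCoalg.wordFil_coder 1 par_le (b₁_le 1 ?_) (b₂_le 1 ?_) N
  · intro p n θ hθ
    by_cases hp : p - 1 ≤ 1
    · simp [hp]
    · have hp' : ¬ p ≤ 1 := by omega
      simp only [hp, hp', if_false] at hθ ⊢
      exact gcomm_vanish  M.d_mem_der hθ
  · intro p q n m θ hθ φ hφ
    by_cases hp : p + q - 1 ≤ 1
    · simp [hp]
    · by_cases hp' : p ≤ 1
      · have hq' : ¬ q ≤ 1 := by omega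
        simp only [hp, hq', if_false] at hφ ⊢
        exact gcomm_vanish  θ.2 hφ
      · simp only [hp, hp', if_false] at hθ ⊢
        exact gcomm_vanish'  φ.2 hθ

theorem contFil_mono {v w : ℤ} (h : v ≤ w) (N : ℕ) :
    (TensorCoalg.wordFil (M.contFil w)).F N ≤ (TensorCoalg.wordFil (M.contFil v)).F N := by
  refine Submodule.span_mono ?_
  rintro _ ⟨l, hl, hN, rfl⟩
  refine ⟨l, fun a ha n => ?_, hN, rfl⟩
  have := hl a ha n
  by_cases hp : a.1 ≤ 1
  · simp [hp]
  · simp only [hp, if_false] at this ⊢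
    exact fun b hb => this b (M.wtLE_mono h hb)

variable (M) in
/-- The linear forms on `T^c (s L)` which, for some `w` and `N`, vanish on words of length at least
`N` and on words one of whose letters is a derivation vanishing on the elements of weight at most
`w`. -/
def contDual : Submodule k (Module.Dual k (TensorAlgebra k M.sL)) where
  carrier := {α | ∃ (w : ℤ) (N : ℕ), (TensorCoalg.wordFil (M.contFil w)).F N ≤ LinearMap.ker α}
  add_mem' := fun {α β} hα hβ => by
    obtain ⟨w, N, h⟩ := hα
    obtain ⟨w', N', h'⟩ := hβ
    refine ⟨max w w', max N N', fun x hx => ?_⟩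
    have h1 : α x = 0 := h (contFil_mono (le_max_left w w') N
      ((TensorCoalg.wordFil _).anti (le_max_left N N') hx))
    have h2 : β x = 0 := h' (contFil_mono (le_max_right w w') N'
      ((TensorCoalg.wordFil _).anti (le_max_right N N') hx))
    simp [h1, h2]
  zero_mem' := ⟨0, 0, by simp⟩
  smul_mem' := fun c α hα => by
    obtain ⟨w, N, h⟩ := hα
    refine ⟨w, N, fun x hx => ?_⟩
    have h1 : α x = 0 := h hx
    simp [h1]

variable (M) in
/-- The restriction of linear forms from `T^c (s L)` to `C(L)`. -/
def restrict : Module.Dual k (TensorAlgebra k M.sL) →ₗ[k] Module.Dual k M.symm :=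
  M.symm.subtype.dualMap

variable (M) in
/-- The algebra `A(L)` (as a vector space): the continuous linear forms on `C(L)`. -/
def A : Submodule k (Module.Dual k M.symm) := M.contDual.map M.restrict

theorem comulSymm_eq (x : M.symm) : TensorProduct.map M.symm.subtype M.symm.subtype
    (TensorCoalg.comulSymm M.par x) = TensorCoalg.delta k M.sL x := by
  have := LinearEquiv.apply_symm_apply (LinearEquiv.ofInjective
    (TensorProduct.map M.symm.subtype M.symm.subtype)
    (TensorProduct.map_injective_of_flat_flat _ _ (Submodule.subtype_injective _)
      (Submodule.subtype_injective _)))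
      ⟨TensorCoalg.delta k M.sL x, (TensorCoalg.isCocommSub_symm x.1 x.2).1⟩
  exact congrArg Subtype.val this

variable (M) in
/-- The product of linear forms on `C(L)`, dual to the coproduct. -/
def dualMul (α β : Module.Dual k M.symm) : Module.Dual k M.symm :=
  LinearMap.mul' k k ∘ₗ TensorProduct.map α β ∘ₗ TensorCoalg.comulSymm M.par

variable (M) in
/-- The differential of `C(L)`. -/
def dC : M.symm →ₗ[k] M.symm :=
  (TensorCoalg.coder M.par M.b₁ M.b₂).restrict
    fun _ hx => TensorCoalg.coder_mem_symm par_invol par_b₁ par_b₂ hx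

variable (M) in
/-- The product of `A(L)`. -/
def A.mul (α β : M.A) : M.A :=
  ⟨M.dualMul α.1 β.1, by
    obtain ⟨_, ⟨α, ⟨w, N, h⟩, rfl⟩⟩ := α
    obtain ⟨_, ⟨β, ⟨w', N', h'⟩, rfl⟩⟩ := β
    refine ⟨LinearMap.mul' k k ∘ₗ TensorProduct.map α β ∘ₗ TensorCoalg.delta k M.sL,
      ⟨max w w', N + N', fun x hx => ?_⟩, ?_⟩
    · have hx' := TensorCoalg.wordFil_delta (N + N') hx
      have : ((TensorCoalg.wordFil (M.contFil (max w w'))).tensor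
          (TensorCoalg.wordFil (M.contFil (max w w')))).F (N + N') ≤
          LinearMap.ker (LinearMap.mul' k k ∘ₗ TensorProduct.map α β) := by
        refine Submodule.span_le.2 ?_
        rintro _ ⟨p, q, x, y, hpq, hx, hy, rfl⟩
        rcases le_or_gt N p with hp | hp
        · have h1 : α x = 0 := h (contFil_mono (le_max_left w w') N
            ((TensorCoalg.wordFil _).anti hp hx))
          simp [h1]
        · have h1 : β y = 0 := h' (contFil_mono (le_max_right w w') N'
            ((TensorCoalg.wordFil _).anti (by omega) hy))
          simp [h1]
      exact this hx'
    · refine LinearMap.ext fun x => ?_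
      change LinearMap.mul' k k (TensorProduct.map α β (TensorCoalg.delta k M.sL x)) =
        LinearMap.mul' k k (TensorProduct.map (α ∘ₗ M.symm.subtype) (β ∘ₗ M.symm.subtype)
          (TensorCoalg.comulSymm M.par x))
      rw [← comulSymm_eq, TensorProduct.map_comp]
      rfl⟩

variable (M) in
/-- The unit of `A(L)`: the counit of `C(L)`. -/
def A.one : M.A :=
  ⟨M.restrict TensorAlgebra.algebraMapInv.toLinearMap, Submodule.mem_map_of_mem
    ⟨0, 1, TensorCoalg.wordFil_counit⟩⟩

variable (M) in
/-- The differential of `A(L)`: the transpose of the differential of `C(L)`. -/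
def A.d (α : M.A) : M.A :=
  ⟨α.1 ∘ₗ M.dC, by
    obtain ⟨_, ⟨α, ⟨w, N, h⟩, rfl⟩⟩ := α
    exact ⟨α ∘ₗ TensorCoalg.coder M.par M.b₁ M.b₂, ⟨w, N + 1, fun x hx =>
      h (contFil_coder w (N + 1) hx)⟩, rfl⟩⟩

/-- `α ∈ A(L)` has degree `m`: it vanishes on the elements of `C(L)` of degree `≠ - m`. -/
def A.HasDegree (α : M.A) (m : ℤ) : Prop :=
  ∀ (n : ℤ) (x : M.symm), n ≠ -m → (x : TensorAlgebra k M.sL) ∈ M.tens.gr n → α.1 x = 0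

variable (M) in
/-- Maps of dg algebras `A(L) → B`. -/
structure AMap (B : DGCA k) where
  f : M.A →ₗ[k] B.carrier
  map_one : f (A.one M) = 1
  map_mul : ∀ α β, f (A.mul M α β) = f α * f β
  map_gr : ∀ (m : ℤ) (α : M.A), A.HasDegree α m → f α ∈ B.gr m
  map_d : ∀ α, f (A.d M α) = B.d (f α)

/-- Homotopy of dga maps `A(L) → k`, through a dga map `A(L) → k[t, dt]`. -/
def AHomotopic (f₀ f₁ : M.AMap (DGCA.unit k)) : Prop :=
  ∃ h : M.AMap (DGCA.polyForms k), ∀ α,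
    f₀.f α = Polynomial.eval 0 (TrivSqZeroExt.fst (h.f α)) ∧
    f₁.f α = Polynomial.eval 1 (TrivSqZeroExt.fst (h.f α))

variable (M) in
/-- Homotopy classes of dga maps `A(L) → k`. -/
def AHomotopyClass : Type u := Quot (@AHomotopic k _ H M)

/-- `f : A(L) → k` is evaluation at `1 + s p + s p ⊗ s p + ⋯` (only finitely many terms contribute,
for each form `α`). -/
def Perturbation.IsEval (p : M.Perturbation) (f : M.AMap (DGCA.unit k)) : Prop :=
  ∀ (α : Module.Dual k (TensorAlgebra k M.sL)) (hα : α ∈ M.contDual),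
    f.f ⟨M.restrict α, Submodule.mem_map_of_mem hα⟩ =
      ∑ᶠ n : ℕ, α ((TensorAlgebra.ι k p.sp) ^ n)

end FilteredModel

end

noncomputable section

/-! ### Signs and projections to homogeneous components -/

theorem sgn_congr {k : Type u} [Field k] {m n : ℤ} (h : Even (m - n)) : sgn k m = sgn k n := by
  rw [show m = (m - n) + n by ring, sgn_add]
  simp [sgn, Int.negOnePow_even _ h]

theorem sgn_one {k : Type u} [Field k] : sgn k 1 = -1 := by simp [sgn]

section GradedProj

variable {k V W : Type u} [Field k] [AddCommGroup V] [Module k V] [AddCommGroup W] [Module k W]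
  {G : ℤ → Submodule k V} {G' : ℤ → Submodule k W}

/-- The projection to the `n`-th homogeneous component. -/
def gproj (h : DirectSum.IsInternal G) (n : ℤ) : V →ₗ[k] V :=
  (G n).subtype ∘ₗ DirectSum.component k ℤ (fun n => G n) n ∘ₗ
    (LinearEquiv.ofBijective (DirectSum.coeLinearMap G) h).symm.toLinearMap

theorem gproj_mem (h : DirectSum.IsInternal G) (n : ℤ) (a : V) : gproj h n a ∈ G n :=
  Subtype.property _

theorem gproj_of_mem (h : DirectSum.IsInternal G) {m n : ℤ} {a : V} (ha : a ∈ G m) :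
    gproj h n a = if m = n then a else 0 := by
  have : (LinearEquiv.ofBijective (DirectSum.coeLinearMap G) h).symm a =
      DirectSum.lof k ℤ (fun n => G n) m ⟨a, ha⟩ := by
    rw [LinearEquiv.symm_apply_eq]
    exact (DirectSum.coeLinearMap_lof G m ⟨a, ha⟩).symm
  simp only [gproj, LinearMap.comp_apply, LinearEquiv.coe_coe, this]
  split_ifs with hm
  · subst hm
    rw [DirectSum.component.lof_self]
    rfl
  · have : DirectSum.component k ℤ (fun n => G n) n (DirectSum.lof k ℤ (fun n => G n) m ⟨a, ha⟩) = 0 :=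
      DirectSum.of_eq_of_ne _ _ _ (Ne.symm hm)
    rw [this]
    simp

theorem graded_induction (h : DirectSum.IsInternal G) {p : V → Prop}
    (hom : ∀ n, ∀ a ∈ G n, p a) (zero : p 0) (add : ∀ a b, p a → p b → p (a + b)) (a : V) : p a := by
  have ha : a ∈ ⨆ n, G n := by rw [h.submodule_iSup_eq_top]; exact Submodule.mem_top
  exact Submodule.iSup_induction G (motive := p) ha hom zero add

theorem graded_ext (h : DirectSum.IsInternal G) {f g : V →ₗ[k] W}
    (hfg : ∀ n, ∀ a ∈ G n, f a = g a) : f = g :=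
  LinearMap.ext fun a => graded_induction h (p := fun a => f a = g a) hfg (by simp)
    (fun a b ha hb => by rw [map_add, map_add, ha, hb]) a

/-- Projections to homogeneous components commute with homogeneous maps. -/
theorem gproj_map (h : DirectSum.IsInternal G) (h' : DirectSum.IsInternal G') (f : V →ₗ[k] W)
    (e : ℤ) (hf : ∀ n, ∀ a ∈ G n, f a ∈ G' (n + e)) (n : ℤ) (a : V) :
    gproj h' (n + e) (f a) = f (gproj h n a) := by
  suffices hs : gproj h' (n + e) ∘ₗ f = f ∘ₗ gproj h n from DFunLike.congr_fun hs a
  refine graded_ext h fun m a ha => ?_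
  simp only [LinearMap.comp_apply]
  rw [gproj_of_mem h' (hf m a ha), gproj_of_mem h ha]
  by_cases hm : m = n
  · simp [hm]
  · simp [hm]

theorem sum_gproj (h : DirectSum.IsInternal G) (a : V) :
    ∃ s : Finset ℤ, a = ∑ n ∈ s, gproj h n a := by
  classical
  refine ⟨DFinsupp.support ((LinearEquiv.ofBijective (DirectSum.coeLinearMap G) h).symm a), ?_⟩
  conv_lhs => rw [← LinearEquiv.apply_symm_apply (LinearEquiv.ofBijective (DirectSum.coeLinearMap G) h) a,
    ← DirectSum.sum_support_of ((LinearEquiv.ofBijective (DirectSum.coeLinearMap G) h).symm a)]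
  rw [map_sum]
  refine Finset.sum_congr rfl fun n _ => ?_
  exact DirectSum.coeLinearMap_lof G n _

theorem eq_zero_of_gproj (h : DirectSum.IsInternal G) {a : V} (ha : ∀ n, gproj h n a = 0) :
    a = 0 := by
  obtain ⟨s, hs⟩ := sum_gproj h a
  rw [hs]
  exact Finset.sum_eq_zero fun n _ => ha n

end GradedProj

/-! ### Maps out of the free graded commutative algebra -/

namespace FreeGCA

variable {k : Type u} [Field k] {I : Type u} {deg : I → ℕ}

theorem mono_nil : mono k deg [] = 1 := by simp [mono]

theorem mono_cons (i : I) (l : List I) : mono k deg (i :: l) = gen k deg i * mono k deg l := by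
  simp [mono]

theorem mono_mem_gr (l : List I) : mono k deg l ∈ gr k deg ((l.map deg).sum : ℕ) :=
  Submodule.subset_span ⟨l, rfl, rfl⟩

theorem gen_mem_gr (i : I) : gen k deg i ∈ gr k deg (deg i) :=
  Submodule.subset_span ⟨[i], by simp, by simp [mono]⟩

theorem one_mem_gr : (1 : FreeGCA k deg) ∈ gr k deg 0 :=
  Submodule.subset_span ⟨[], by simp, by simp [mono]⟩

theorem mono_mem_wtLE (wt : I → ℕ) (l : List I) :
    mono k deg l ∈ wtLE k deg wt ((l.map wt).sum : ℕ) :=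
  Submodule.subset_span ⟨l, le_rfl, rfl⟩

theorem gen_mem_wtLE (wt : I → ℕ) (i : I) : gen k deg i ∈ wtLE k deg wt (wt i) :=
  Submodule.subset_span ⟨[i], by simp, by simp [mono]⟩

theorem one_mem_wtLE (wt : I → ℕ) : (1 : FreeGCA k deg) ∈ wtLE k deg wt 0 :=
  Submodule.subset_span ⟨[], by simp, by simp [mono]⟩

theorem mul_mem_wtLE {wt : I → ℕ} {v w : ℤ} {a b : FreeGCA k deg} (ha : a ∈ wtLE k deg wt v)
    (hb : b ∈ wtLE k deg wt w) : a * b ∈ wtLE k deg wt (v + w) := by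
  have := Submodule.mul_mem_mul ha hb
  rw [wtLE, wtLE, Submodule.span_mul_span] at this
  refine Submodule.span_mono ?_ this
  rintro _ ⟨_, ⟨l, hl, rfl⟩, _, ⟨l', hl', rfl⟩, rfl⟩
  exact ⟨l ++ l', by simp only [List.map_append, List.sum_append, Nat.cast_add]; omega, mono_mul l l'⟩

theorem ext_mono {Y : Type u} [AddCommGroup Y] [Module k Y] {f g : FreeGCA k deg →ₗ[k] Y}
    (h : ∀ l : List I, f (mono k deg l) = g (mono k deg l)) : f = g :=
  LinearMap.ext_on_range span_mono h

section lift

variable {R : Type u} [Ring R] [Algebra k R]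

/-- The algebra map with given values on the generators. -/
def lift (f : I → R) (hf : ∀ i j, f i * f j = sgn k ((deg i : ℤ) * deg j) • (f j * f i)) :
    FreeGCA k deg →ₐ[k] R :=
  RingQuot.liftAlgHom k ⟨FreeAlgebra.lift k f, by
    rintro _ _ ⟨i, j⟩
    simp only [map_mul, map_smul, FreeAlgebra.lift_ι_apply, hf i j]⟩

theorem lift_gen (f : I → R) (hf : ∀ i j, f i * f j = sgn k ((deg i : ℤ) * deg j) • (f j * f i))
    (i : I) : lift f hf (gen k deg i) = f i := by
  simp only [lift, gen]
  erw [RingQuot.liftAlgHom_mkAlgHom_apply]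
  simp

theorem algHom_ext {f g : FreeGCA k deg →ₐ[k] R} (h : ∀ i, f (gen k deg i) = g (gen k deg i)) :
    f = g := by
  have : f.toLinearMap = g.toLinearMap := ext_mono fun l => by
    induction l with
    | nil => simp [mono_nil]
    | cons i l ih =>
      simp only [AlgHom.toLinearMap_apply] at ih ⊢
      rw [mono_cons, map_mul, map_mul, h, ih]
  exact AlgHom.ext fun a => DFunLike.congr_fun this a

/-- Given an algebra map `α` and a twist `γ` of it, a `(γ, α)`-derivation with given values on the
generators. -/
theorem exists_twistedDerivation (α γ : FreeGCA k deg →ₐ[k] R) (v : I → R)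
    (hv : ∀ i j, γ (gen k deg i) * v j + v i * α (gen k deg j) = sgn k ((deg i : ℤ) * deg j) •
      (γ (gen k deg j) * v i + v j * α (gen k deg i))) :
    ∃ β : FreeGCA k deg →ₗ[k] R, (∀ i, β (gen k deg i) = v i) ∧
      ∀ a b, β (a * b) = γ a * β b + β a * α b := by
  have hα : ∀ i j, α (gen k deg i) * α (gen k deg j) = sgn k ((deg i : ℤ) * deg j) •
      (α (gen k deg j) * α (gen k deg i)) := fun i j => by
    rw [← map_mul, ← map_mul, gen_mul_gen, map_smul]
  have hγ : ∀ i j, γ (gen k deg i) * γ (gen k deg j) = sgn k ((deg i : ℤ) * deg j) •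
      (γ (gen k deg j) * γ (gen k deg i)) := fun i j => by
    rw [← map_mul, ← map_mul, gen_mul_gen, map_smul]
  let F : FreeGCA k deg →ₐ[k] Matrix (Fin 2) (Fin 2) R :=
    lift (fun i => !![γ (gen k deg i), v i; 0, α (gen k deg i)]) (fun i j => by
      ext x y
      fin_cases x <;> fin_cases y
      · simpa using hγ i j
      · simpa using hv i j
      · simp
      · simpa using hα i j)
  have hF : ∀ i, F (gen k deg i) = !![γ (gen k deg i), v i; 0, α (gen k deg i)] := lift_gen _ _
  have key : ∀ l : List I, F (mono k deg l) 0 0 = γ (mono k deg l) ∧ F (mono k deg l) 1 0 = 0 ∧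
      F (mono k deg l) 1 1 = α (mono k deg l) := by
    intro l
    induction l with
    | nil => simp [mono_nil]
    | cons i l ih =>
      obtain ⟨h1, h2, h3⟩ := ih
      simp [mono_cons, map_mul, Matrix.mul_apply, Fin.sum_univ_two, hF, h1, h2, h3]
  have e (x y : Fin 2) : ∃ f : FreeGCA k deg →ₗ[k] R, ∀ a, f a = F a x y :=
    ⟨⟨⟨fun a => F a x y, by simp⟩, by simp⟩, fun _ => rfl⟩
  have key2 : ∀ a, F a 0 0 = γ a ∧ F a 1 0 = 0 ∧ F a 1 1 = α a := by
    intro a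
    obtain ⟨f, hf⟩ := e 0 0
    obtain ⟨f', hf'⟩ := e 1 0
    obtain ⟨f'', hf''⟩ := e 1 1
    refine ⟨?_, ?_, ?_⟩
    · rw [← hf, ← AlgHom.toLinearMap_apply]
      exact DFunLike.congr_fun (ext_mono fun l => by rw [hf, (key l).1]; rfl) a
    · rw [← hf', ext_mono (f := f') (g := 0) fun l => by rw [hf', (key l).2.1]; rfl]
      rfl
    · rw [← hf'', ← AlgHom.toLinearMap_apply]
      exact DFunLike.congr_fun (ext_mono fun l => by rw [hf'', (key l).2.2]; rfl) a
  obtain ⟨β, hβ⟩ := e 0 1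
  refine ⟨β, fun i => by rw [hβ, hF]; simp, fun a b => ?_⟩
  rw [hβ, hβ, hβ, map_mul, Matrix.mul_apply, Fin.sum_univ_two, (key2 a).1, (key2 b).2.2]

theorem twistedDerivation_one {α γ : FreeGCA k deg →ₐ[k] R} {β : FreeGCA k deg →ₗ[k] R}
    (h : ∀ a b, β (a * b) = γ a * β b + β a * α b) : β 1 = 0 := by
  have := h 1 1
  simpa using this

/-- An algebra map which takes the generators to pieces of a multiplicative filtration. -/
theorem map_mem_of_gen {α : FreeGCA k deg →ₐ[k] R} {Q : ℤ → Submodule k R} {wt : I → ℕ}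
    (h1 : (1 : R) ∈ Q 0) (hmul : ∀ m n a b, a ∈ Q m → b ∈ Q n → a * b ∈ Q (m + n))
    (hα : ∀ i, α (gen k deg i) ∈ Q (wt i)) (l : List I) :
    α (mono k deg l) ∈ Q ((l.map wt).sum : ℕ) := by
  induction l with
  | nil => simpa [mono_nil] using h1
  | cons i l ih =>
    rw [mono_cons, map_mul]
    have := hmul _ _ _ _ (hα i) ih
    simpa using this

theorem map_mem_of_gen' {α γ : FreeGCA k deg →ₐ[k] R} {β : FreeGCA k deg →ₗ[k] R}
    (h : ∀ a b, β (a * b) = γ a * β b + β a * α b) {Q : ℤ → Submodule k R} {wt : I → ℕ}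
    (h1 : (1 : R) ∈ Q 0) (hmul : ∀ m n a b, a ∈ Q m → b ∈ Q n → a * b ∈ Q (m + n))
    (hα : ∀ i, α (gen k deg i) ∈ Q (wt i)) (hγ : ∀ i, γ (gen k deg i) ∈ Q (wt i)) {c : ℤ}
    (hβ : ∀ i, β (gen k deg i) ∈ Q (wt i + c)) (l : List I) :
    β (mono k deg l) ∈ Q ((l.map wt).sum + c) := by
  induction l with
  | nil => rw [mono_nil, twistedDerivation_one h]; exact Submodule.zero_mem _
  | cons i l ih =>
    rw [mono_cons, h]
    have e1 := hmul _ _ _ _ (hγ i) ih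
    have e2 := hmul _ _ _ _ (hβ i) (map_mem_of_gen h1 hmul hα l)
    simp only [List.map_cons, List.sum_cons, Nat.cast_add] at e1 e2 ⊢
    refine Submodule.add_mem _ ?_ ?_
    · convert e1 using 2; ring
    · convert e2 using 2; ring

theorem mem_of_mem_gr {β : FreeGCA k deg →ₗ[k] R} {Q : ℤ → Submodule k R} {c : ℤ}
    (h : ∀ l : List I, β (mono k deg l) ∈ Q ((l.map deg).sum + c)) {n : ℤ} {a : FreeGCA k deg}
    (ha : a ∈ gr k deg n) : β a ∈ Q (n + c) := by
  suffices hs : gr k deg n ≤ (Q (n + c)).comap β from hs ha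
  refine Submodule.span_le.2 ?_
  rintro _ ⟨l, rfl, rfl⟩
  exact h l

theorem mem_of_mem_wtLE {β : FreeGCA k deg →ₗ[k] R} {Q : ℤ → Submodule k R} (hQ : Monotone Q)
    {wt : I → ℕ} {c : ℤ}
    (h : ∀ l : List I, β (mono k deg l) ∈ Q ((l.map wt).sum + c)) {n : ℤ} {a : FreeGCA k deg}
    (ha : a ∈ wtLE k deg wt n) : β a ∈ Q (n + c) := by
  suffices hs : wtLE k deg wt n ≤ (Q (n + c)).comap β from hs ha
  refine Submodule.span_le.2 ?_
  rintro _ ⟨l, hl, rfl⟩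
  exact hQ (by omega) (h l)

end lift

/-- The automorphism `a ↦ (-1)^{n |a|} a`. -/
def parity (n : ℤ) : FreeGCA k deg →ₐ[k] FreeGCA k deg :=
  lift (fun i => sgn k (n * deg i) • gen k deg i) fun i j => by
    rw [smul_mul_smul_comm, smul_mul_smul_comm, gen_mul_gen i j, smul_comm,
      mul_comm (sgn k (n * deg i))]

theorem parity_of_mem {n m : ℤ} {a : FreeGCA k deg} (ha : a ∈ gr k deg m) :
    parity n a = sgn k (n * m) • a := by
  suffices hs : gr k deg m ≤ LinearMap.ker ((parity n).toLinearMap -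
      sgn k (n * m) • LinearMap.id : FreeGCA k deg →ₗ[k] FreeGCA k deg) from
    sub_eq_zero.1 (hs ha)
  refine Submodule.span_le.2 ?_
  rintro _ ⟨l, rfl, rfl⟩
  clear ha
  rw [SetLike.mem_coe, LinearMap.mem_ker, LinearMap.sub_apply, AlgHom.toLinearMap_apply,
    LinearMap.smul_apply, LinearMap.id_apply, sub_eq_zero]
  induction l with
  | nil => simp [mono_nil, sgn_zero]
  | cons i l ih =>
    have hi : parity n (gen k deg i) = sgn k (n * deg i) • gen k deg i := lift_gen _ _ i
    rw [mono_cons, map_mul, ih, hi, smul_mul_smul_comm, ← sgn_add]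
    simp [mul_add]

/-- A derivation of degree `n` with given values on the generators. -/
theorem exists_derivation (n : ℤ) (v : I → FreeGCA k deg)
    (hv : ∀ i, v i ∈ gr k deg (deg i + n)) :
    ∃ θ : FreeGCA k deg →ₗ[k] FreeGCA k deg, (∀ i, θ (gen k deg i) = v i) ∧
      (∀ m, ∀ a ∈ gr k deg m, θ a ∈ gr k deg (m + n)) ∧
      (∀ m, ∀ a ∈ gr k deg m, ∀ b, θ (a * b) = θ a * b + sgn k (n * m) • (a * θ b)) ∧
      ∀ (wt : I → ℕ) (c : ℤ), (∀ i, v i ∈ wtLE k deg wt (wt i + c)) →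
        ∀ w, ∀ a ∈ wtLE k deg wt w, θ a ∈ wtLE k deg wt (w + c) := by
  have hp : ∀ i, parity n (gen k deg i) = sgn k (n * deg i) • gen k deg i :=
    fun i => parity_of_mem (gen_mem_gr i)
  obtain ⟨θ, h1, h2⟩ := exists_twistedDerivation (AlgHom.id k _) (parity n) v (fun i j => by
    have e1 := gr_comm (gen_mem_gr i) (hv j)
    have e2 := gr_comm (hv i) (gen_mem_gr j)
    simp only [hp, AlgHom.id_apply, smul_add, smul_mul_assoc, e1, e2, smul_smul]
    rw [add_comm]
    congr 2
    · rw [← sgn_add]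
      exact sgn_congr ⟨0, by ring⟩
    · rw [← sgn_add]
      exact sgn_congr ⟨n * deg i, by ring⟩)
  refine ⟨θ, h1, fun m a ha => ?_, fun m a ha b => ?_, fun wt c hc w a ha => ?_⟩
  · refine mem_of_mem_gr (Q := gr k deg) (fun l => ?_) ha
    refine map_mem_of_gen' h2 one_mem_gr (fun _ _ _ _ => mul_mem_gr) (fun i => gen_mem_gr i)
      (fun i => ?_) (fun i => by rw [h1]; exact hv i) l
    rw [hp]
    exact Submodule.smul_mem _ _ (gen_mem_gr i)
  · rw [h2, parity_of_mem ha, smul_mul_assoc, add_comm]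
    rfl
  · refine mem_of_mem_wtLE (Q := wtLE k deg wt) (fun m n h => Submodule.span_mono (by
      rintro _ ⟨l, hl, rfl⟩; exact ⟨l, hl.trans h, rfl⟩)) (fun l => ?_) ha
    refine map_mem_of_gen' h2 (one_mem_wtLE wt) (fun _ _ _ _ => mul_mem_wtLE)
      (fun i => gen_mem_wtLE wt i) (fun i => ?_) (fun i => by rw [h1]; exact hc i) l
    rw [hp]
    exact Submodule.smul_mem _ _ (gen_mem_wtLE wt i)

theorem gproj_mono (n : ℤ) (l : List I) : gproj (isInternal_gr (k := k) (deg := deg)) n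
    (mono k deg l) = if (((l.map deg).sum : ℕ) : ℤ) = n then mono k deg l else 0 :=
  gproj_of_mem _ (mono_mem_gr l)

/-- Elements of given degree and weight are combinations of monomials of this degree and weight. -/
theorem mem_span_of_mem_gr_of_mem_wtLE {wt : I → ℕ} {n w : ℤ} {a : FreeGCA k deg}
    (ha : a ∈ gr k deg n) (ha' : a ∈ wtLE k deg wt w) :
    a ∈ Submodule.span k {a | ∃ l : List I, ((l.map deg).sum : ℤ) = n ∧
      ((l.map wt).sum : ℤ) ≤ w ∧ a = mono k deg l} := by
  have h : gproj isInternal_gr n a = a := by rw [gproj_of_mem _ ha]; simp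
  rw [← h]
  suffices hs : wtLE k deg wt w ≤ (Submodule.span k {a | ∃ l : List I, ((l.map deg).sum : ℤ) = n ∧
      ((l.map wt).sum : ℤ) ≤ w ∧ a = mono k deg l}).comap (gproj isInternal_gr n) from hs ha'
  refine Submodule.span_le.2 ?_
  rintro _ ⟨l, hl, rfl⟩
  rw [SetLike.mem_coe, Submodule.mem_comap, gproj_mono]
  split_ifs with hn
  · exact Submodule.subset_span ⟨l, by exact_mod_cast hn, hl, rfl⟩
  · exact Submodule.zero_mem _

theorem exists_mem_wtLE (wt : I → ℕ) (a : FreeGCA k deg) : ∃ w : ℕ, a ∈ wtLE k deg wt w := by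
  have hm : ∀ v w : ℕ, v ≤ w → wtLE k deg wt v ≤ wtLE k deg wt w := fun v w h =>
    Submodule.span_mono (by rintro _ ⟨l, hl, rfl⟩; exact ⟨l, hl.trans (by exact_mod_cast h), rfl⟩)
  have : a ∈ Submodule.span k (Set.range (mono k deg)) := by rw [span_mono]; exact Submodule.mem_top
  induction this using Submodule.span_induction with
  | mem a h => obtain ⟨l, rfl⟩ := h; exact ⟨_, mono_mem_wtLE wt l⟩
  | zero => exact ⟨0, Submodule.zero_mem _⟩
  | add a b _ _ ha hb =>
    obtain ⟨v, hv⟩ := ha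
    obtain ⟨w, hw⟩ := hb
    exact ⟨max v w, Submodule.add_mem _ (hm _ _ (le_max_left v w) hv) (hm _ _ (le_max_right v w) hw)⟩
  | smul c a _ ha =>
    obtain ⟨v, hv⟩ := ha
    exact ⟨v, Submodule.smul_mem _ c hv⟩

theorem wtLE_neg {wt : I → ℕ} {w : ℤ} (hw : w < 0) : wtLE k deg wt w = ⊥ := by
  rw [eq_bot_iff]
  refine Submodule.span_le.2 ?_
  rintro _ ⟨l, hl, rfl⟩
  have : (0 : ℤ) ≤ (l.map wt).sum := by positivity
  omega

end FreeGCA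

/-! ### Cohomology classes -/

namespace DGCA

variable {k : Type u} [Field k]

theorem cls_eq_iff {A : DGCA k} {a b : A.carrier} (ha : A.d a = 0) (hb : A.d b = 0) :
    A.cls a ha = A.cls b hb ↔ ∃ y, A.d y = a - b := by
  rw [cls, cls, Submodule.Quotient.eq]
  rfl

theorem cls_surjective {A : DGCA k} (c : A.Coh) : ∃ (a : A.carrier) (ha : A.d a = 0),
    c = A.cls a ha := by
  obtain ⟨⟨a, ha⟩, rfl⟩ := Submodule.Quotient.mk_surjective _ c
  exact ⟨a, ha, rfl⟩

theorem d_one (A : DGCA k) : A.d 1 = 0 := by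
  have := A.leibniz A.one_mem 1
  simpa [sgn_zero] using this

theorem d_mul_of_closed {A : DGCA k} {a b : A.carrier} (hb : A.d b = 0) :
    A.d (a * b) = A.d a * b := by
  have h : A.d ∘ₗ LinearMap.mulRight k b = LinearMap.mulRight k b ∘ₗ A.d :=
    graded_ext A.internal fun n x hx => by
      have := A.leibniz hx b
      simpa [hb] using this
  exact DFunLike.congr_fun h a

theorem gproj_d (A : DGCA k) (n : ℤ) (a : A.carrier) :
    gproj A.internal (n + 1) (A.d a) = A.d (gproj A.internal n a) :=
  gproj_map A.internal A.internal A.d 1 (fun _ _ h => A.d_mem h) n a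

/-- The product of cohomology classes is well defined. -/
theorem cls_mul {A : DGCA k} {x y a b : A.carrier} (hx : A.d x = 0) (ha : A.d a = 0)
    (hy : A.d y = 0) (hb : A.d b = 0) (hxy : A.d (x * y) = 0) (hab : A.d (a * b) = 0)
    (h : A.cls x hx = A.cls a ha) (h' : A.cls y hy = A.cls b hb) :
    A.cls (x * y) hxy = A.cls (a * b) hab := by
  rw [cls_eq_iff] at h h' ⊢
  obtain ⟨u, hu⟩ := h
  obtain ⟨v, hv⟩ := h'
  obtain ⟨s, hs⟩ := sum_gproj A.internal a
  refine ⟨u * y + ∑ n ∈ s, sgn k n • (gproj A.internal n a * v), ?_⟩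
  have h1 : A.d (u * y) = (x - a) * y := by rw [d_mul_of_closed hy, hu]
  have h2 : ∑ n ∈ s, A.d (sgn k n • (gproj A.internal n a * v)) = a * (y - b) := by
    conv_rhs => rw [hs, Finset.sum_mul]
    refine Finset.sum_congr rfl fun n _ => ?_
    have h4 : A.d (gproj A.internal n a) = 0 := by
      rw [← gproj_d, ha, map_zero]
    rw [map_smul, A.leibniz (gproj_mem _ n a), h4, zero_mul, zero_add, hv, smul_smul,
      sgn_mul_self, one_smul]
  rw [map_add, map_sum, h1, h2, sub_mul, mul_sub]
  abel

theorem Hom.coh_cls {A B : DGCA k} (φ : DGCA.Hom A B) (a : A.carrier) (ha : A.d a = 0) :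
    φ.coh (A.cls a ha) = B.cls (φ.toAlgHom a) (by rw [← φ.map_d, ha, map_zero]) := rfl

end DGCA

namespace FilteredModel

variable {k : Type u} [Field k] {H : GCA k} {M : FilteredModel H}

/-! ### Degrees, weights and resolution degrees -/

variable (M) in
/-- The generators, and their weights. -/
abbrev z (i : M.I) : M.S := FreeGCA.gen k M.deg i

variable (M) in
abbrev wt (i : M.I) : ℕ := M.deg i + M.res i

theorem sum_wt (l : List M.I) :
    (l.map M.wt).sum = (l.map M.deg).sum + (l.map M.res).sum := by
  induction l with
  | nil => simp
  | cons i l ih => simp only [List.map_cons, List.sum_cons, ih, wt]; omega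

theorem eq_zero_of_mem {n w : ℤ} {a : M.S} (ha : a ∈ M.gr n) (hw : a ∈ M.wtLE w) (h : w < n) :
    a = 0 := by
  have := FreeGCA.mem_span_of_mem_gr_of_mem_wtLE ha hw
  suffices hs : Submodule.span k {a | ∃ l : List M.I, ((l.map M.deg).sum : ℤ) = n ∧
      ((l.map M.wt).sum : ℤ) ≤ w ∧ a = FreeGCA.mono k M.deg l} ≤ ⊥ from hs this
  refine Submodule.span_le.2 ?_
  rintro _ ⟨l, h1, h2, rfl⟩
  have := sum_wt l
  omega

variable (M) in
/-- The subalgebra generated by the generators of resolution degree `> - r`. -/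
def resSub (r : ℕ) : Submodule k M.S :=
  Submodule.span k {a | ∃ l : List M.I, (∀ j ∈ l, M.res j < r) ∧ a = FreeGCA.mono k M.deg l}

theorem resSub_le {r : ℕ} {Q : Submodule k M.S}
    (h : ∀ l : List M.I, (∀ j ∈ l, M.res j < r) → FreeGCA.mono k M.deg l ∈ Q) : M.resSub r ≤ Q := by
  refine Submodule.span_le.2 ?_
  rintro _ ⟨l, hl, rfl⟩
  exact h l hl

theorem mem_resSub {m w : ℤ} {r : ℕ} {a : M.S} (ha : a ∈ M.gr m) (hw : a ∈ M.wtLE w)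
    (h : w < m + r) : a ∈ M.resSub r := by
  refine Submodule.span_mono ?_ (FreeGCA.mem_span_of_mem_gr_of_mem_wtLE ha hw)
  rintro _ ⟨l, h1, h2, rfl⟩
  refine ⟨l, fun j hj => ?_, rfl⟩
  have h3 := sum_wt l
  have h4 : M.res j ≤ (l.map M.res).sum := List.single_le_sum (by simp) _ (List.mem_map_of_mem hj)
  have h2' : ((l.map M.wt).sum : ℤ) ≤ w := h2
  omega

theorem gen_mem_gr (i : M.I) : M.z i ∈ M.gr (M.deg i) := FreeGCA.gen_mem_gr i

theorem gen_mem_wtLE (i : M.I) : M.z i ∈ M.wtLE (M.wt i) := FreeGCA.gen_mem_wtLE M.wt i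

theorem d_gen_mem_resSub (i : M.I) : M.d (M.z i) ∈ M.resSub (M.res i) :=
  mem_resSub (M.d_mem (gen_mem_gr i)) (M.d_wt (gen_mem_wtLE i)) (by push_cast; omega)

theorem exists_mem_wtLE (v : ℤ) (a : M.S) : ∃ j : ℕ, a ∈ M.wtLE (v + j) := by
  obtain ⟨w, hw⟩ := FreeGCA.exists_mem_wtLE M.wt a
  exact ⟨w + v.natAbs, M.wtLE_mono (by omega) hw⟩

theorem der_one {n : ℤ} {p : ℕ} {θ : M.S →ₗ[k] M.S} (h : θ ∈ M.der n p) : θ 1 = 0 := by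
  have := h.2.1 0 1 FreeGCA.one_mem_gr 1
  simpa [sgn_zero] using this

theorem add_mem_der {p : M.S →ₗ[k] M.S} (hp : p ∈ M.der 1 1) : M.d + p ∈ M.der 1 0 :=
  Submodule.add_mem _ M.d_mem_der (M.der_anti 1 (by omega) hp)

theorem gproj_der {n : ℤ} {p : ℕ} {θ : M.S →ₗ[k] M.S} (h : θ ∈ M.der n p) (m : ℤ) (a : M.S) :
    gproj FreeGCA.isInternal_gr (m + n) (θ a) = θ (gproj FreeGCA.isInternal_gr m a) :=
  gproj_map _ _ θ n h.1 m a

/-- Lowering the weight of a chain by adding a boundary. -/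
theorem reduce {p : M.S →ₗ[k] M.S} (hp : p ∈ M.der 1 1) {m V : ℤ} (hV : m ≤ V) (j : ℕ) :
    ∀ e : M.S, e ∈ M.gr m → e ∈ M.wtLE (V + j) → (M.d + p) e ∈ M.wtLE V →
      (∀ a ∈ M.gr (m - 1), a ∈ M.wtLE (V + j) → (M.d + p) ((M.d + p) a) = 0) →
      ∃ b ∈ M.gr (m - 1), b ∈ M.wtLE (V + j) ∧ e - (M.d + p) b ∈ M.wtLE V := by
  induction j with
  | zero =>
    intro e _ hw _ _
    refine ⟨0, Submodule.zero_mem _, Submodule.zero_mem _, ?_⟩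
    simpa using hw
  | succ j ih =>
    intro e he hw hD hsq
    have e1 : (V + (j + 1 : ℕ) : ℤ) - 1 = V + j := by push_cast; ring
    have hde : M.d e ∈ M.wtLE (V + (j + 1 : ℕ) - 1) := by
      have h1 : M.d e = (M.d + p) e - p e := by simp
      rw [h1]
      exact Submodule.sub_mem _ (M.wtLE_mono (by omega) hD) (hp.2.2 _ _ hw)
    obtain ⟨b, hb, hbw, hb'⟩ := M.exact m _ e (by omega) he hw hde
    have h2 : e - (M.d + p) b ∈ M.wtLE (V + j) := by
      have h1 : e - (M.d + p) b = (e - M.d b) - p b := by simp; abel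
      rw [h1, ← e1]
      exact Submodule.sub_mem _ hb' (hp.2.2 _ _ hbw)
    have h3 : (M.d + p) b ∈ M.gr m := by
      have := (add_mem_der hp).1 _ _ hb
      rwa [sub_add_cancel] at this
    obtain ⟨c, hc, hcw, hc'⟩ := ih _ (Submodule.sub_mem _ he h3) h2 (by
      rw [map_sub, hsq b hb hbw, sub_zero]; exact hD)
      (fun a ha haw => hsq a ha (M.wtLE_mono (by push_cast; omega) haw))
    refine ⟨b + c, Submodule.add_mem _ hb hc,
      Submodule.add_mem _ hbw (M.wtLE_mono (by push_cast; omega) hcw), ?_⟩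
    rwa [map_add, ← sub_sub]

theorem Perturbation.reduce (p : M.Perturbation) {m V : ℤ} (hV : m ≤ V) {e : M.S}
    (he : e ∈ M.gr m) (hD : (M.d + p.p) e ∈ M.wtLE V) :
    ∃ b ∈ M.gr (m - 1), e - (M.d + p.p) b ∈ M.wtLE V := by
  obtain ⟨j, hj⟩ := M.exists_mem_wtLE V e
  obtain ⟨b, hb, -, h⟩ := FilteredModel.reduce p.mem hV j e he hj hD (fun a _ _ => p.sq a)
  exact ⟨b, hb, h⟩

variable (M) in
/-- The zero perturbation. -/
def Perturbation.zero : M.Perturbation where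
  p := 0
  mem := Submodule.zero_mem _
  sq := by simpa using M.d_d

/-- On elements of degree at least the weight less one, a perturbation vanishes. -/
theorem der_eq_zero {p : M.S →ₗ[k] M.S} (hp : p ∈ M.der 1 1) {m : ℤ} {b : M.S}
    (hb : b ∈ M.gr (m - 1)) (hw : b ∈ M.wtLE m) : p b = 0 :=
  eq_zero_of_mem (n := m) (w := m - 1) (by have := hp.1 _ _ hb; rwa [sub_add_cancel] at this)
    (by simpa using hp.2.2 _ _ hw) (by omega)

theorem D_eq_zero {p : M.S →ₗ[k] M.S} (hp : p ∈ M.der 1 1) {m : ℤ} {b : M.S}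
    (hb : b ∈ M.gr m) (hw : b ∈ M.wtLE m) : (M.d + p) b = 0 :=
  eq_zero_of_mem ((add_mem_der hp).1 _ _ hb) (by simpa using (add_mem_der hp).2.2 _ _ hw)
    (by omega)

theorem exists_boundary {p : M.S →ₗ[k] M.S} (hp : p ∈ M.der 1 1) {m : ℤ} {x : M.S}
    (hx : x ∈ M.gr m) (hw : x ∈ M.wtLE m) (h : M.ρ x = 0) :
    ∃ b ∈ M.gr (m - 1), b ∈ M.wtLE m ∧ (M.d + p) b = x := by
  have hdx : M.d x = 0 := by
    simpa using D_eq_zero (p := 0) (Submodule.zero_mem _) hx hw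
  obtain ⟨b, hb⟩ := M.ρ_inj x hdx h
  have h1 : M.d (gproj FreeGCA.isInternal_gr (m - 1) b) = x := by
    rw [← gproj_der M.d_mem_der, hb, sub_add_cancel, gproj_of_mem _ hx, if_pos rfl]
  obtain ⟨c, hc, hc'⟩ := (Perturbation.zero M).reduce (m := m - 1) (V := m) (by omega)
    (gproj_mem FreeGCA.isInternal_gr (m - 1) b) (by simpa [Perturbation.zero, h1] using hw)
  have h2 : gproj FreeGCA.isInternal_gr (m - 1) b - M.d c ∈ M.gr (m - 1) := by
    refine Submodule.sub_mem _ (gproj_mem _ _ _) ?_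
    have := M.d_mem hc
    rwa [sub_add_cancel] at this
  have h3 : gproj FreeGCA.isInternal_gr (m - 1) b - M.d c ∈ M.wtLE m := by
    simpa [Perturbation.zero] using hc'
  refine ⟨_, h2, h3, ?_⟩
  rw [LinearMap.add_apply, der_eq_zero hp h2 h3, map_sub, M.d_d, h1, sub_zero, add_zero]

theorem gproj_ρ (n : ℤ) (a : M.S) :
    gproj H.internal n (M.ρ a) = M.ρ (gproj FreeGCA.isInternal_gr n a) := by
  have := gproj_map FreeGCA.isInternal_gr H.internal M.ρ.toLinearMap 0
    (fun n a ha => by simpa using M.ρ_mem ha) n a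
  simpa using this

theorem exists_ρ_eq {m : ℤ} {h : H.carrier} (hh : h ∈ H.gr m) :
    ∃ x ∈ M.gr m, x ∈ M.wtLE m ∧ M.ρ x = h := by
  obtain ⟨a, hda, ha⟩ := M.ρ_surj h
  have h1 : M.ρ (gproj FreeGCA.isInternal_gr m a) = h := by
    rw [← gproj_ρ, ha, gproj_of_mem _ hh, if_pos rfl]
  obtain ⟨c, hc, hc'⟩ := (Perturbation.zero M).reduce (m := m) (V := m) le_rfl
    (gproj_mem FreeGCA.isInternal_gr m a) (by
      have : M.d (gproj FreeGCA.isInternal_gr m a) = 0 := by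
        rw [← gproj_der M.d_mem_der, hda, map_zero]
      simp [Perturbation.zero, this])
  refine ⟨_, Submodule.sub_mem _ (gproj_mem _ _ _) ?_, by simpa [Perturbation.zero] using hc', ?_⟩
  · have := M.d_mem hc
    rwa [sub_add_cancel] at this
  · rw [map_sub, M.ρ_d, h1, sub_zero]

/-! ### The canonical augmentation of a perturbed model -/

theorem gproj_mem_wtLE_of_mem_resSub {x : M.S} (hx : x ∈ M.resSub 1) (m : ℤ) :
    gproj FreeGCA.isInternal_gr m x ∈ M.wtLE m := by
  suffices hs : M.resSub 1 ≤ (M.wtLE m).comap (gproj FreeGCA.isInternal_gr m) from hs hx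
  refine resSub_le fun l hl => ?_
  rw [Submodule.mem_comap, FreeGCA.gproj_mono]
  split_ifs with h
  · rw [← h]
    have h1 : (l.map M.res).sum = 0 := by
      refine List.sum_eq_zero fun x hx => ?_
      obtain ⟨j, hj, rfl⟩ := List.mem_map.1 hx
      have := hl j hj
      omega
    have h2 := FreeGCA.mono_mem_wtLE (k := k) (deg := M.deg) M.wt l
    have h3 := sum_wt l
    rw [h1, add_zero] at h3
    rw [h3] at h2
    exact h2
  · exact Submodule.zero_mem _

theorem mem_resSub_one {m : ℤ} {x : M.S} (hx : x ∈ M.gr m) (hw : x ∈ M.wtLE m) :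
    x ∈ M.resSub 1 := mem_resSub hx hw (by omega)

theorem D_eq_zero_of_mem_resSub {p : M.S →ₗ[k] M.S} (hp : p ∈ M.der 1 1) {x : M.S}
    (hx : x ∈ M.resSub 1) : (M.d + p) x = 0 := by
  obtain ⟨s, hs⟩ := sum_gproj FreeGCA.isInternal_gr x
  rw [hs, map_sum]
  exact Finset.sum_eq_zero fun m _ => D_eq_zero hp (gproj_mem _ m x)
    (gproj_mem_wtLE_of_mem_resSub hx m)

theorem ρ_eq_zero_iff (p : M.Perturbation) {x : M.S} (hx : x ∈ M.resSub 1) :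
    M.ρ x = 0 ↔ ∃ b, (M.d + p.p) b = x := by
  constructor
  · intro h
    have h1 : ∀ m, ∃ b, (M.d + p.p) b = gproj FreeGCA.isInternal_gr m x := fun m => by
      obtain ⟨b, -, -, hb⟩ := exists_boundary p.mem (gproj_mem FreeGCA.isInternal_gr m x)
        (gproj_mem_wtLE_of_mem_resSub hx m) (by rw [← gproj_ρ, h, map_zero])
      exact ⟨b, hb⟩
    choose b hb using h1
    obtain ⟨s, hs⟩ := sum_gproj FreeGCA.isInternal_gr x
    exact ⟨∑ m ∈ s, b m, by rw [map_sum, Finset.sum_congr rfl fun m _ => hb m, ← hs]⟩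
  · rintro ⟨b, hb⟩
    refine eq_zero_of_gproj H.internal fun m => ?_
    have hD := add_mem_der p.mem
    have h1 : (M.d + p.p) (gproj FreeGCA.isInternal_gr (m - 1) b) =
        gproj FreeGCA.isInternal_gr m x := by
      rw [← gproj_der hD, hb, sub_add_cancel]
    have h0 := gproj_mem_wtLE_of_mem_resSub hx m
    obtain ⟨c, hc, hc'⟩ := p.reduce (m := m - 1) (V := m) (by omega)
      (gproj_mem FreeGCA.isInternal_gr (m - 1) b) (by rw [h1]; exact h0)
    have h2 : gproj FreeGCA.isInternal_gr (m - 1) b - (M.d + p.p) c ∈ M.gr (m - 1) := by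
      refine Submodule.sub_mem _ (gproj_mem _ _ _) ?_
      have := hD.1 _ _ hc
      rwa [sub_add_cancel] at this
    have h3 : M.d (gproj FreeGCA.isInternal_gr (m - 1) b - (M.d + p.p) c) =
        gproj FreeGCA.isInternal_gr m x := by
      have h4 : M.d (gproj FreeGCA.isInternal_gr (m - 1) b - (M.d + p.p) c) =
        (M.d + p.p) (gproj FreeGCA.isInternal_gr (m - 1) b - (M.d + p.p) c) := by
        have h5 := der_eq_zero p.mem h2 hc'
        generalize gproj FreeGCA.isInternal_gr (m - 1) b - (M.d + p.p) c = y at h5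
        rw [LinearMap.add_apply, h5, add_zero]
      rw [h4, map_sub, p.sq, h1, sub_zero]
    rw [gproj_ρ, ← h3, M.ρ_d]

/-- Every cocycle of a perturbed model is cohomologous to an element of resolution degree `0`. -/
theorem exists_resSub_cohomologous (p : M.Perturbation) {a : M.S} (ha : (M.d + p.p) a = 0) :
    ∃ x ∈ M.resSub 1, ∃ b, (M.d + p.p) b = a - x := by
  have hD := add_mem_der p.mem
  have h1 : ∀ m, ∃ b ∈ M.gr (m - 1), gproj FreeGCA.isInternal_gr m a - (M.d + p.p) b ∈ M.wtLE m :=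
    fun m => p.reduce le_rfl (gproj_mem _ _ _) (by
      rw [← gproj_der hD, ha, map_zero]; exact Submodule.zero_mem _)
  choose b hb hb' using h1
  obtain ⟨s, hs⟩ := sum_gproj FreeGCA.isInternal_gr a
  refine ⟨∑ m ∈ s, (gproj FreeGCA.isInternal_gr m a - (M.d + p.p) (b m)),
    Submodule.sum_mem _ fun m _ => mem_resSub_one (Submodule.sub_mem _ (gproj_mem _ m a) ?_) (hb' m),
    ∑ m ∈ s, b m, ?_⟩
  · have := hD.1 _ _ (hb m)
    rwa [sub_add_cancel] at this
  · rw [Finset.sum_sub_distrib, ← hs, map_sum]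
    abel

theorem exists_ρ_eq_resSub (h : H.carrier) : ∃ x ∈ M.resSub 1, M.ρ x = h := by
  have h1 : ∀ m, ∃ x ∈ M.resSub 1, M.ρ x = gproj H.internal m h := fun m => by
    obtain ⟨x, hx, hw, e⟩ := exists_ρ_eq (M := M) (gproj_mem H.internal m h)
    exact ⟨x, mem_resSub_one hx hw, e⟩
  choose x hx e using h1
  obtain ⟨s, hs⟩ := sum_gproj H.internal h
  exact ⟨∑ m ∈ s, x m, Submodule.sum_mem _ fun m _ => hx m, by
    rw [map_sum, Finset.sum_congr rfl fun m _ => e m, ← hs]⟩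

theorem one_mem_resSub (r : ℕ) : (1 : M.S) ∈ M.resSub r :=
  Submodule.subset_span ⟨[], by simp, by simp [FreeGCA.mono]⟩

theorem mul_mem_resSub {r : ℕ} {a b : M.S} (ha : a ∈ M.resSub r) (hb : b ∈ M.resSub r) :
    a * b ∈ M.resSub r := by
  have := Submodule.mul_mem_mul ha hb
  rw [resSub, Submodule.span_mul_span] at this
  refine Submodule.span_mono ?_ this
  rintro _ ⟨_, ⟨l, hl, rfl⟩, _, ⟨l', hl', rfl⟩, rfl⟩
  refine ⟨l ++ l', fun j hj => ?_, FreeGCA.mono_mul l l'⟩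
  rcases List.mem_append.1 hj with h | h
  · exact hl j h
  · exact hl' j h

theorem exists_cohEquiv (p : M.Perturbation) : ∃ e : H.carrier ≃ₗ[k] p.dgca.Coh,
    ∀ x ∈ M.resSub 1, ∃ hx : p.dgca.d x = 0, e (M.ρ x) = p.dgca.cls x hx := by
  let f : M.resSub 1 →ₗ[k] H.carrier := M.ρ.toLinearMap ∘ₗ (M.resSub 1).subtype
  let g : M.resSub 1 →ₗ[k] p.dgca.Coh := Submodule.mkQ _ ∘ₗ
    LinearMap.codRestrict (LinearMap.ker p.dgca.d) (M.resSub 1).subtype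
      (fun x => D_eq_zero_of_mem_resSub p.mem x.2)
  have hf : Function.Surjective f := fun h => by
    obtain ⟨x, hx, e⟩ := exists_ρ_eq_resSub (M := M) h
    exact ⟨⟨x, hx⟩, e⟩
  have hg : Function.Surjective g := fun c => by
    obtain ⟨a, ha, rfl⟩ := DGCA.cls_surjective c
    obtain ⟨x, hx, b, hb⟩ := exists_resSub_cohomologous p ha
    exact ⟨⟨x, hx⟩, ((DGCA.cls_eq_iff ha (D_eq_zero_of_mem_resSub p.mem hx)).2 ⟨b, hb⟩).symm⟩
  have hfg : LinearMap.ker f = LinearMap.ker g := by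
    ext ⟨x, hx⟩
    rw [LinearMap.mem_ker, LinearMap.mem_ker]
    change M.ρ x = 0 ↔ p.dgca.cls x (D_eq_zero_of_mem_resSub p.mem hx) = 0
    rw [ρ_eq_zero_iff p hx]
    refine Iff.trans ?_ (DGCA.cls_eq_iff (D_eq_zero_of_mem_resSub p.mem hx) (map_zero _)).symm
    have e : x - 0 = x := sub_zero x
    exact exists_congr fun y => ⟨fun h => Eq.trans h e.symm, fun h => Eq.trans h e⟩
  refine ⟨(f.quotKerEquivOfSurjective hf).symm ≪≫ₗ Submodule.quotEquivOfEq _ _ hfg ≪≫ₗ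
    g.quotKerEquivOfSurjective hg, fun x hx => ⟨D_eq_zero_of_mem_resSub p.mem hx, ?_⟩⟩
  have h1 : (f.quotKerEquivOfSurjective hf).symm (M.ρ x) = Submodule.Quotient.mk ⟨x, hx⟩ := by
    rw [LinearEquiv.symm_apply_eq]
    rfl
  refine (congrArg (fun y => g.quotKerEquivOfSurjective hg (Submodule.quotEquivOfEq _ _ hfg y))
    h1).trans rfl

theorem Perturbation.existsUnique_augmentation (p : M.Perturbation) :
    ∃! i : CohIso H p.dgca, p.IsAugmentation i := by
  obtain ⟨e, he⟩ := exists_cohEquiv p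
  refine ⟨⟨e, fun h => ?_, fun x y a b ha hb hab hx hy => ?_, fun n x hx => ?_⟩, ?_, ?_⟩
  · obtain ⟨_, h1⟩ := he 1 (one_mem_resSub 1)
    rw [map_one] at h1
    exact h1
  · obtain ⟨x, hx0, rfl⟩ := exists_ρ_eq_resSub (M := M) x
    obtain ⟨y, hy0, rfl⟩ := exists_ρ_eq_resSub (M := M) y
    obtain ⟨h1, e1⟩ := he x hx0
    obtain ⟨h2, e2⟩ := he y hy0
    obtain ⟨h3, e3⟩ := he (x * y) (mul_mem_resSub hx0 hy0)
    rw [← map_mul]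
    exact e3.trans (DGCA.cls_mul h1 ha h2 hb h3 hab (e1.symm.trans hx) (e2.symm.trans hy))
  · obtain ⟨a, ha, hw, rfl⟩ := exists_ρ_eq (M := M) hx
    obtain ⟨h1, h2⟩ := he a (mem_resSub_one ha hw)
    exact ⟨a, h1, ha, h2⟩
  · intro n x hx hw
    exact he x (mem_resSub_one hx hw)
  · intro j hj
    have h1 : j.toEquiv = e := by
      refine LinearEquiv.toLinearMap_injective (graded_ext H.internal fun n h hh => ?_)
      obtain ⟨x, hx, hw, rfl⟩ := exists_ρ_eq (M := M) hh
      obtain ⟨_, e1⟩ := hj n x hx hw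
      obtain ⟨_, e2⟩ := he x (mem_resSub_one hx hw)
      exact e1.trans e2.symm
    cases j
    congr

end FilteredModel

/-! ### Recursive constructions on the generators -/

/-- Recursion on a rank function: a local condition which can be satisfied one index at a time can be
satisfied at all indices. -/
theorem exists_of_local {I : Type*} {T : I → Type*} [∀ i, Inhabited (T i)] (r : I → ℕ)
    (P : (∀ i, T i) → I → Prop)
    (hloc : ∀ v v' i, (∀ j, r j < r i → v j = v' j) → v i = v' i → P v i → P v' i)
    (hext : ∀ v i, (∀ j, r j < r i → P v j) → ∃ v', (∀ j, r j < r i → v j = v' j) ∧ P v' i) :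
    ∃ v, ∀ i, P v i := by
  classical
  have step : ∀ (n : ℕ) (v : ∀ i, T i), (∀ i, r i < n → P v i) →
      ∃ v', (∀ i, r i < n + 1 → P v' i) ∧ ∀ i, r i < n → v' i = v i := by
    intro n v hv
    have h : ∀ i, r i = n → ∃ v', (∀ j, r j < r i → v j = v' j) ∧ P v' i :=
      fun i hi => hext v i fun j hj => hv j (hi ▸ hj)
    choose f hf hfP using h
    refine ⟨fun i => if hi : r i = n then f i hi i else v i, fun i hi => ?_, fun i hi => ?_⟩
    · rcases Nat.lt_succ_iff_lt_or_eq.1 hi with h | h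
      · refine hloc v _ i (fun j hj => ?_) ?_ (hv i h)
        · rw [dif_neg (by omega)]
        · rw [dif_neg (by omega)]
      · refine hloc (f i h) _ i (fun j hj => ?_) ?_ (hfP i h)
        · rw [dif_neg (by omega), hf i h j hj]
        · rw [dif_pos h]
    · exact dif_neg (by omega)
  choose g hg hg' using step
  let s : ∀ n : ℕ, {v : ∀ i, T i // ∀ i, r i < n → P v i} := fun n =>
    Nat.rec ⟨fun _ => default, fun i hi => absurd hi (Nat.not_lt_zero _)⟩
      (fun n v => ⟨g n v.1 v.2, hg n v.1 v.2⟩) n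
  have hs : ∀ m n i, r i < m → m ≤ n → (s n).1 i = (s m).1 i := by
    intro m n i hi hmn
    induction n, hmn using Nat.le_induction with
    | base => rfl
    | succ n hn ih =>
      rw [← ih]
      exact hg' n (s n).1 (s n).2 i (by omega)
  refine ⟨fun i => (s (r i + 1)).1 i, fun i => ?_⟩
  refine hloc (s (r i + 1)).1 _ i (fun j hj => ?_) rfl ((s (r i + 1)).2 i (Nat.lt_succ_self _))
  exact hs _ _ j (Nat.lt_succ_self _) (by omega)

namespace CohIso

variable {k : Type u} [Field k] {H : GCA k} {A : DGCA k}

theorem exists_rep (i : CohIso H A) (h : H.carrier) : ∃ (b : A.carrier) (hb : A.d b = 0),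
    i.toEquiv h = A.cls b hb ∧ ∀ m, ∃ hm : A.d (gproj A.internal m b) = 0,
      i.toEquiv (gproj H.internal m h) = A.cls (gproj A.internal m b) hm := by
  refine graded_induction H.internal (p := fun h => ∃ (b : A.carrier) (hb : A.d b = 0),
    i.toEquiv h = A.cls b hb ∧ ∀ m, ∃ hm : A.d (gproj A.internal m b) = 0,
      i.toEquiv (gproj H.internal m h) = A.cls (gproj A.internal m b) hm) ?_ ?_ ?_ h
  · intro n h hh
    obtain ⟨b, hb, hbn, e⟩ := i.map_gr n h hh
    refine ⟨b, hb, e, fun m => ⟨by rw [← DGCA.gproj_d, hb, map_zero], ?_⟩⟩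
    rw [gproj_of_mem _ hh]
    simp only [gproj_of_mem _ hbn]
    split_ifs
    · exact e
    · rw [map_zero]
      rfl
  · exact ⟨0, map_zero _, by rw [map_zero]; rfl, fun m => ⟨by simp, by simp; rfl⟩⟩
  · rintro a b ⟨x, hx, e, h1⟩ ⟨y, hy, e', h2⟩
    refine ⟨x + y, by rw [map_add, hx, hy, add_zero], by rw [map_add, e, e']; rfl, fun m => ?_⟩
    obtain ⟨h3, h3'⟩ := h1 m
    obtain ⟨h4, h4'⟩ := h2 m
    refine ⟨by rw [map_add, map_add, h3, h4, add_zero], ?_⟩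
    simp only [map_add, h3', h4']
    rfl

/-- Classes of homogeneous cocycles come from homogeneous elements. -/
theorem exists_of_mem (i : CohIso H A) {m : ℤ} {a : A.carrier} (ha : a ∈ A.gr m)
    (hd : A.d a = 0) : ∃ h ∈ H.gr m, i.toEquiv h = A.cls a hd := by
  obtain ⟨b, hb, e, hm⟩ := i.exists_rep (i.toEquiv.symm (A.cls a hd))
  rw [LinearEquiv.apply_symm_apply, DGCA.cls_eq_iff] at e
  obtain ⟨y, hy⟩ := e
  obtain ⟨h1, h2⟩ := hm m
  refine ⟨_, gproj_mem _ m _, h2.trans ((DGCA.cls_eq_iff _ _).2 ⟨-gproj A.internal (m - 1) y, ?_⟩)⟩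
  rw [map_neg, ← DGCA.gproj_d, hy, sub_add_cancel, map_sub, gproj_of_mem _ ha, if_pos rfl, neg_sub]

end CohIso

theorem DGCA.exists_boundary_of_mem {k : Type u} [Field k] {A : DGCA k} {m : ℤ} {a : A.carrier}
    (ha : a ∈ A.gr (m + 1)) (h : ∃ y, A.d y = a) : ∃ y ∈ A.gr m, A.d y = a := by
  obtain ⟨y, hy⟩ := h
  exact ⟨_, gproj_mem A.internal m y, by rw [← DGCA.gproj_d, hy, gproj_of_mem _ ha, if_pos rfl]⟩

namespace FilteredModel

variable {k : Type u} [Field k] {H : GCA k} {M : FilteredModel H}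

theorem exists_der (n : ℤ) (c : ℕ) (v : M.I → M.S) (hv : ∀ i, v i ∈ M.gr (M.deg i + n))
    (hw : ∀ i, v i ∈ M.wtLE (M.wt i - c)) : ∃ θ ∈ M.der n c, ∀ i, θ (M.z i) = v i := by
  obtain ⟨θ, h1, h2, h3, h4⟩ := FreeGCA.exists_derivation n v hv
  exact ⟨θ, ⟨h2, h3, fun w a ha => h4 M.wt (-c) hw w a ha⟩, h1⟩

theorem eqOn_resSub {n : ℤ} {p q : ℕ} {θ φ : M.S →ₗ[k] M.S} (hθ : θ ∈ M.der n p)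
    (hφ : φ ∈ M.der n q) {r : ℕ} (h : ∀ i, M.res i < r → θ (M.z i) = φ (M.z i)) {a : M.S}
    (ha : a ∈ M.resSub r) : θ a = φ a := by
  suffices hs : M.resSub r ≤ LinearMap.ker (θ - φ) from sub_eq_zero.1 (hs ha)
  refine resSub_le fun l hl => ?_
  rw [LinearMap.mem_ker, LinearMap.sub_apply, sub_eq_zero]
  induction l with
  | nil => rw [FreeGCA.mono_nil, der_one hθ, der_one hφ]
  | cons i l ih =>
    rw [FreeGCA.mono_cons, hθ.2.1 _ _ (gen_mem_gr i), hφ.2.1 _ _ (gen_mem_gr i),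
      h i (hl i (by simp)), ih fun j hj => hl j (by simp [hj])]

theorem algHom_eqOn_resSub {R : Type u} [Ring R] [Algebra k R] {f g : M.S →ₐ[k] R} {r : ℕ}
    (h : ∀ i, M.res i < r → f (M.z i) = g (M.z i)) {a : M.S} (ha : a ∈ M.resSub r) :
    f a = g a := by
  suffices hs : M.resSub r ≤ LinearMap.ker (f.toLinearMap - g.toLinearMap) from
    sub_eq_zero.1 (hs ha)
  refine resSub_le fun l hl => ?_
  rw [LinearMap.mem_ker, LinearMap.sub_apply, sub_eq_zero]
  simp only [AlgHom.toLinearMap_apply]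
  induction l with
  | nil => rw [FreeGCA.mono_nil, map_one, map_one]
  | cons i l ih =>
    rw [FreeGCA.mono_cons, map_mul, map_mul, h i (hl i (by simp)),
      ih fun j hj => hl j (by simp [hj])]

theorem exists_mem_resSub (a : M.S) : ∃ r, a ∈ M.resSub r := by
  obtain ⟨w, hw⟩ := FreeGCA.exists_mem_wtLE M.wt a
  refine ⟨w + 1, Submodule.span_mono ?_ hw⟩
  rintro _ ⟨l, hl, rfl⟩
  refine ⟨l, fun j hj => ?_, rfl⟩
  have h3 : M.wt j ≤ (l.map M.wt).sum := List.single_le_sum (by simp) _ (List.mem_map_of_mem hj)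
  have hl' : ((l.map M.wt).sum : ℤ) ≤ w := hl
  have : M.wt j = M.deg j + M.res j := rfl
  omega

theorem sq_eq_zero {D : M.S →ₗ[k] M.S} (hD : D ∈ M.der 1 0) {r : ℕ}
    (h : ∀ i, M.res i < r → D (D (M.z i)) = 0) {a : M.S} (ha : a ∈ M.resSub r) :
    D (D a) = 0 := by
  suffices hs : M.resSub r ≤ LinearMap.ker (D ∘ₗ D) from hs ha
  refine resSub_le fun l hl => ?_
  rw [LinearMap.mem_ker, LinearMap.comp_apply]
  induction l with
  | nil => rw [FreeGCA.mono_nil, der_one hD, map_zero]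
  | cons i l ih =>
    have e1 := h i (hl i (by simp))
    have e2 := ih fun j hj => hl j (by simp [hj])
    have e3 := sgn_add (k := k) 1 (M.deg i)
    rw [sgn_one] at e3
    rw [FreeGCA.mono_cons, hD.2.1 _ _ (gen_mem_gr i), map_add, map_smul,
      hD.2.1 _ _ (hD.1 _ _ (gen_mem_gr i)), hD.2.1 _ _ (gen_mem_gr i), e1, e2]
    simp only [one_mul, zero_mul, zero_add, mul_zero, smul_zero, add_zero,
      add_comm (M.deg i : ℤ) 1, e3]
    simp

theorem algHom_D_eq_on_resSub {R : Type u} [Ring R] [Algebra k R] {D : M.S →ₗ[k] M.S}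
    (hD : D ∈ M.der 1 0) {π : M.S →ₐ[k] R} {dR : R →ₗ[k] R} (h1 : dR 1 = 0)
    (hL : ∀ i b, dR (π (M.z i) * b) = dR (π (M.z i)) * b + sgn k (M.deg i) • (π (M.z i) * dR b))
    {r : ℕ} (h : ∀ i, M.res i < r → π (D (M.z i)) = dR (π (M.z i))) {a : M.S}
    (ha : a ∈ M.resSub r) : π (D a) = dR (π a) := by
  suffices hs : M.resSub r ≤ LinearMap.ker (π.toLinearMap ∘ₗ D - dR ∘ₗ π.toLinearMap) from
    sub_eq_zero.1 (hs ha)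
  refine resSub_le fun l hl => ?_
  rw [LinearMap.mem_ker, LinearMap.sub_apply, sub_eq_zero]
  simp only [AlgHom.toLinearMap_apply, LinearMap.comp_apply]
  induction l with
  | nil => rw [FreeGCA.mono_nil, der_one hD, map_zero, map_one, h1]
  | cons i l ih =>
    rw [FreeGCA.mono_cons, hD.2.1 _ _ (gen_mem_gr i), map_add, map_smul, map_mul, map_mul, map_mul,
      hL, h i (hl i (by simp)), ih fun j hj => hl j (by simp [hj]), one_mul]

theorem chainMap_on_resSub {A : DGCA k} {D : M.S →ₗ[k] M.S} (hD : D ∈ M.der 1 0)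
    {π : M.S →ₐ[k] A.carrier} (hπ : ∀ i, π (M.z i) ∈ A.gr (M.deg i)) {r : ℕ}
    (h : ∀ i, M.res i < r → π (D (M.z i)) = A.d (π (M.z i))) {a : M.S} (ha : a ∈ M.resSub r) :
    π (D a) = A.d (π a) :=
  algHom_D_eq_on_resSub hD A.d_one (fun i b => A.leibniz (hπ i) b) h ha

theorem map_gr_of_gen {A : GCA k} {π : M.S →ₐ[k] A.carrier}
    (hπ : ∀ i, π (M.z i) ∈ A.gr (M.deg i)) {n : ℤ} {a : M.S} (ha : a ∈ M.gr n) : π a ∈ A.gr n := by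
  have := FreeGCA.mem_of_mem_gr (β := π.toLinearMap) (Q := A.gr) (c := 0) (fun l => by
    rw [add_zero]
    exact FreeGCA.map_mem_of_gen A.one_mem (fun _ _ _ _ => A.mul_mem) hπ l) ha
  rwa [add_zero] at this

/-- Maps from perturbed models to dgca's with cohomology `H`, compatible with augmentations. -/
structure ModelMap (p : M.Perturbation) (X : AugDGCA H) where
  π : M.S →ₐ[k] X.A.carrier
  π_gen : ∀ i, π (M.z i) ∈ X.A.gr (M.deg i)
  π_D : ∀ a, π ((M.d + p.p) a) = X.A.d (π a)
  compat : ∀ x ∈ M.resSub 1, ∃ h : X.A.d (π x) = 0, X.i.toEquiv (M.ρ x) = X.A.cls (π x) h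

theorem compat_of_gen {X : AugDGCA H} {π : M.S →ₐ[k] X.A.carrier}
    (h : ∀ i, M.res i < 1 → ∃ h : X.A.d (π (M.z i)) = 0,
      X.i.toEquiv (M.ρ (M.z i)) = X.A.cls (π (M.z i)) h) {x : M.S} (hx : x ∈ M.resSub 1) :
    ∃ h : X.A.d (π x) = 0, X.i.toEquiv (M.ρ x) = X.A.cls (π x) h := by
  induction hx using Submodule.span_induction with
  | mem x hx =>
    obtain ⟨l, hl, rfl⟩ := hx
    induction l with
    | nil =>
      simp only [FreeGCA.mono_nil, map_one]
      exact ⟨X.A.d_one, X.i.map_one _⟩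
    | cons i l ih =>
      obtain ⟨h1, e1⟩ := h i (hl i (by simp))
      obtain ⟨h2, e2⟩ := ih fun j hj => hl j (by simp [hj])
      simp only [FreeGCA.mono_cons, map_mul]
      have h3 : X.A.d (π (M.z i) * π (FreeGCA.mono k M.deg l)) = 0 := by
        rw [DGCA.d_mul_of_closed h2, h1, zero_mul]
      exact ⟨h3, X.i.map_mul _ _ _ _ h1 h2 h3 e1 e2⟩
  | zero => exact ⟨by simp, by simp; rfl⟩
  | add a b _ _ ha hb =>
    obtain ⟨h1, e1⟩ := ha
    obtain ⟨h2, e2⟩ := hb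
    exact ⟨by rw [map_add, map_add, h1, h2, add_zero], by simp only [map_add, e1, e2]; rfl⟩
  | smul c a _ ha =>
    obtain ⟨h1, e1⟩ := ha
    exact ⟨by rw [map_smul, map_smul, h1, smul_zero], by simp only [map_smul, e1]; rfl⟩

/-- Values of a perturbation on generators can be corrected by elements of low weight so as to
square to zero. -/
theorem exists_correction {X : AugDGCA H} {p : M.S →ₗ[k] M.S} (hp : p ∈ M.der 1 1)
    {π : M.S →ₐ[k] X.A.carrier} (i : M.I)
    (hsq : ∀ a ∈ M.resSub (M.res i), (M.d + p) ((M.d + p) a) = 0)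
    (hπD : ∀ a ∈ M.resSub (M.res i), π ((M.d + p) a) = X.A.d (π a))
    (hc : 0 < M.res i → ∀ x ∈ M.resSub 1, ∃ h : X.A.d (π x) = 0,
      X.i.toEquiv (M.ρ x) = X.A.cls (π x) h) :
    ∃ u ∈ M.gr (M.deg i + 1), u ∈ M.wtLE (M.wt i - 1) ∧ (M.d + p) (M.d (M.z i) + u) = 0 := by
  have hz := d_gen_mem_resSub (M := M) i
  set z := M.d (M.z i) with hzdef
  have hD := add_mem_der hp
  have hzg : z ∈ M.gr (M.deg i + 1) := M.d_mem (gen_mem_gr i)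
  have hzw : z ∈ M.wtLE (M.wt i) := M.d_wt (gen_mem_wtLE i)
  have heg : (M.d + p) z ∈ M.gr (M.deg i + 2) := by
    have := hD.1 _ _ hzg
    rwa [add_assoc] at this
  have hew : (M.d + p) z ∈ M.wtLE (M.wt i - 1) := by
    have h1 : (M.d + p) z = p z := by rw [LinearMap.add_apply, hzdef, M.d_d, zero_add]
    rw [h1]
    exact hp.2.2 _ _ hzw
  have hwt : (M.wt i : ℤ) = M.deg i + M.res i := by push_cast; rfl
  by_cases hR : M.res i < 3
  · refine ⟨0, Submodule.zero_mem _, Submodule.zero_mem _, ?_⟩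
    rw [add_zero]
    exact eq_zero_of_mem heg hew (by omega)
  · obtain ⟨b, hb, hbw, hb'⟩ := reduce hp (le_refl ((M.deg i : ℤ) + 2)) (M.res i - 3) _ heg
      (M.wtLE_mono (by omega) hew) (by rw [hsq z hz]; exact Submodule.zero_mem _)
      (fun a ha haw => hsq a (mem_resSub ha haw (by omega)))
    rw [show (M.deg i : ℤ) + 2 - 1 = M.deg i + 1 by ring] at hb
    have hbr : b ∈ M.resSub (M.res i) := mem_resSub hb hbw (by omega)
    have heg' : (M.d + p) z - (M.d + p) b ∈ M.gr (M.deg i + 2) := by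
      refine Submodule.sub_mem _ heg ?_
      have := hD.1 _ _ hb
      rwa [add_assoc] at this
    obtain ⟨h1, h2⟩ := hc (by omega) _ (mem_resSub_one heg' hb')
    have h3 : M.ρ ((M.d + p) z - (M.d + p) b) = 0 := by
      rw [← X.i.toEquiv.map_eq_zero_iff, h2]
      have h0 : X.A.cls 0 (map_zero _) = 0 := rfl
      rw [← h0, DGCA.cls_eq_iff]
      refine ⟨π (z - b), ?_⟩
      rw [← hπD _ (Submodule.sub_mem _ hz hbr), map_sub (M.d + p), sub_zero]
    obtain ⟨c, hcg, hcw, hcc⟩ := exists_boundary hp heg' hb' h3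
    rw [show (M.deg i : ℤ) + 2 - 1 = M.deg i + 1 by ring] at hcg
    refine ⟨-(b + c), Submodule.neg_mem _ (Submodule.add_mem _ hb hcg),
      Submodule.neg_mem _ (Submodule.add_mem _ (M.wtLE_mono (by omega) hbw)
        (M.wtLE_mono (by omega) hcw)), ?_⟩
    rw [map_add, map_neg, map_add, hcc]
    abel

theorem exists_values {X : AugDGCA H} {p : M.S →ₗ[k] M.S} (hp : p ∈ M.der 1 1)
    {π : M.S →ₐ[k] X.A.carrier} (hπ : ∀ i, π (M.z i) ∈ X.A.gr (M.deg i)) (i : M.I)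
    (hsq : ∀ a ∈ M.resSub (M.res i), (M.d + p) ((M.d + p) a) = 0)
    (hπD : ∀ a ∈ M.resSub (M.res i), π ((M.d + p) a) = X.A.d (π a))
    (hc : 0 < M.res i → ∀ x ∈ M.resSub 1, ∃ h : X.A.d (π x) = 0,
      X.i.toEquiv (M.ρ x) = X.A.cls (π x) h) :
    ∃ u ∈ M.gr (M.deg i + 1), u ∈ M.wtLE (M.wt i - 1) ∧ (M.d + p) (M.d (M.z i) + u) = 0 ∧
      ∃ y ∈ X.A.gr (M.deg i), X.A.d y = π (M.d (M.z i) + u) ∧ (M.res i < 1 →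
        ∃ h : X.A.d y = 0, X.i.toEquiv (M.ρ (M.z i)) = X.A.cls y h) := by
  have hD := add_mem_der hp
  have hz := d_gen_mem_resSub (M := M) i
  have hzg : M.d (M.z i) ∈ M.gr (M.deg i + 1) := M.d_mem (gen_mem_gr i)
  have hzw : M.d (M.z i) ∈ M.wtLE (M.wt i) := M.d_wt (gen_mem_wtLE i)
  have hwt : (M.wt i : ℤ) = M.deg i + M.res i := by push_cast; rfl
  rcases Nat.lt_or_ge (M.res i) 1 with h0 | h0
  · obtain ⟨y, hy, hyg, e⟩ := X.i.map_gr _ _ (M.ρ_mem (gen_mem_gr i))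
    have h1 : M.d (M.z i) = 0 := eq_zero_of_mem hzg hzw (by omega)
    refine ⟨0, Submodule.zero_mem _, Submodule.zero_mem _, ?_, y, hyg, ?_, fun _ => ⟨hy, e⟩⟩
    · rw [h1, add_zero, map_zero]
    · rw [h1, add_zero, map_zero, hy]
  rcases Nat.lt_or_ge (M.res i) 2 with h2 | h2
  · have hzw' : M.d (M.z i) ∈ M.wtLE (M.deg i + 1) := M.wtLE_mono (by omega) hzw
    obtain ⟨e1, e2⟩ := hc h0 _ (mem_resSub_one hzg hzw')
    rw [M.ρ_d, map_zero] at e2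
    have h00 : X.A.cls 0 (map_zero _) = 0 := rfl
    rw [← h00, eq_comm, DGCA.cls_eq_iff, sub_zero] at e2
    obtain ⟨y, hy, e⟩ := DGCA.exists_boundary_of_mem (map_gr_of_gen hπ hzg) e2
    refine ⟨0, Submodule.zero_mem _, Submodule.zero_mem _, ?_, y, hy, ?_, fun h => by omega⟩
    · rw [add_zero]
      exact D_eq_zero hp hzg hzw'
    · rw [e, add_zero]
  · obtain ⟨u, hu, huw, hDu⟩ := exists_correction hp i hsq hπD hc
    have hcr : M.d (M.z i) + u ∈ M.resSub (M.res i) :=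
      Submodule.add_mem _ hz (mem_resSub hu huw (by omega))
    have hcg : π (M.d (M.z i) + u) ∈ X.A.gr (M.deg i + 1) :=
      map_gr_of_gen hπ (Submodule.add_mem _ hzg hu)
    have hcd : X.A.d (π (M.d (M.z i) + u)) = 0 := by rw [← hπD _ hcr, hDu, map_zero]
    obtain ⟨h, hh, e⟩ := X.i.exists_of_mem hcg hcd
    obtain ⟨x, hx, hxw, rfl⟩ := exists_ρ_eq (M := M) hh
    obtain ⟨e1, e2⟩ := hc h0 x (mem_resSub_one hx hxw)
    rw [e, DGCA.cls_eq_iff, ← map_sub] at e2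
    obtain ⟨y, hy, e3⟩ := DGCA.exists_boundary_of_mem
      (map_gr_of_gen hπ (Submodule.sub_mem _ (Submodule.add_mem _ hzg hu) hx)) e2
    refine ⟨u - x, Submodule.sub_mem _ hu hx, Submodule.sub_mem _ huw
      (M.wtLE_mono (by omega) hxw), ?_, y, hy, ?_, fun h => by omega⟩
    · rw [← add_sub_assoc, map_sub, hDu, D_eq_zero hp hx hxw, sub_zero]
    · rw [e3, add_sub_assoc]

/-- Every dgca with cohomology `H` has a model which is a perturbation of the given one. -/
theorem exists_modelMap (X : AugDGCA H) : ∃ p : M.Perturbation, Nonempty (ModelMap p X) := by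
  let T : M.I → Type u := fun i => {u : M.S // u ∈ M.gr (M.deg i + 1) ∧ u ∈ M.wtLE (M.wt i - 1)} ×
    {y : X.A.carrier // y ∈ X.A.gr (M.deg i)}
  have : ∀ i, Inhabited (T i) := fun i =>
    ⟨⟨⟨0, Submodule.zero_mem _, Submodule.zero_mem _⟩, ⟨0, Submodule.zero_mem _⟩⟩⟩
  have hp : ∀ v : ∀ i, T i, ∃ θ ∈ M.der 1 1, ∀ i, θ (M.z i) = (v i).1.1 := fun v =>
    exists_der 1 1 _ (fun i => (v i).1.2.1) (fun i => (v i).1.2.2)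
  choose P hP hPz using hp
  let Pi : (∀ i, T i) → (M.S →ₐ[k] X.A.carrier) := fun v =>
    FreeGCA.lift (fun i => (v i).2.1) fun i j => X.A.comm (v i).2.2 (v j).2.2
  have hPiz : ∀ v i, Pi v (M.z i) = (v i).2.1 := fun v i => FreeGCA.lift_gen _ _ i
  have hPi : ∀ v i, Pi v (M.z i) ∈ X.A.gr (M.deg i) := fun v i => by rw [hPiz]; exact (v i).2.2
  have hPr : ∀ (v v' : ∀ i, T i) r, (∀ j, M.res j < r → v j = v' j) → ∀ a ∈ M.resSub r,
      (M.d + P v) a = (M.d + P v') a := fun v v' r h a ha => by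
    rw [LinearMap.add_apply, LinearMap.add_apply,
      eqOn_resSub (hP v) (hP v') (fun i hi => by rw [hPz, hPz, h i hi]) ha]
  have hPir : ∀ (v v' : ∀ i, T i) r, (∀ j, M.res j < r → v j = v' j) → ∀ a ∈ M.resSub r,
      Pi v a = Pi v' a := fun v v' r h a ha =>
    algHom_eqOn_resSub (fun i hi => by rw [hPiz, hPiz, h i hi]) ha
  have hDz : ∀ (v : ∀ i, T i) i, (M.d + P v) (M.z i) ∈ M.resSub (M.res i) := fun v i => by
    rw [LinearMap.add_apply, hPz]
    have hwt : (M.wt i : ℤ) = M.deg i + M.res i := by push_cast; rfl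
    exact Submodule.add_mem _ (d_gen_mem_resSub i)
      (mem_resSub (v i).1.2.1 (v i).1.2.2 (by omega))
  suffices hs : ∃ v, ∀ i, (fun v i => (M.d + P v) ((M.d + P v) (M.z i)) = 0 ∧
      Pi v ((M.d + P v) (M.z i)) = X.A.d (Pi v (M.z i)) ∧
      (M.res i < 1 → ∃ h : X.A.d (Pi v (M.z i)) = 0,
        X.i.toEquiv (M.ρ (M.z i)) = X.A.cls (Pi v (M.z i)) h)) v i by
    obtain ⟨v, hv⟩ := hs
    refine ⟨⟨P v, hP v, fun a => ?_⟩, ⟨Pi v, hPi v, fun a => ?_, fun x hx => ?_⟩⟩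
    · obtain ⟨r, hr⟩ := exists_mem_resSub a
      exact sq_eq_zero (add_mem_der (hP v)) (fun i _ => (hv i).1) hr
    · obtain ⟨r, hr⟩ := exists_mem_resSub a
      exact chainMap_on_resSub (add_mem_der (hP v)) (hPi v) (fun i _ => (hv i).2.1) hr
    · exact compat_of_gen (fun i hi => (hv i).2.2 hi) hx
  refine exists_of_local (T := T) M.res _ ?_ ?_
  · rintro v v' i hlt hi ⟨h1, h2, h3⟩
    have e1 : (M.d + P v') (M.z i) = (M.d + P v) (M.z i) := by
      rw [LinearMap.add_apply, LinearMap.add_apply, hPz, hPz, hi]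
    have e2 : Pi v' (M.z i) = Pi v (M.z i) := by rw [hPiz, hPiz, hi]
    rw [e1, ← hPr v v' _ hlt _ (hDz v i), ← hPir v v' _ hlt _ (hDz v i), e2]
    exact ⟨h1, h2, h3⟩
  · intro v i hlt
    obtain ⟨u, hu, huw, h1, y, hy, h2, h3⟩ := exists_values (X := X) (hP v) (hPi v) i
      (fun a ha => sq_eq_zero (add_mem_der (hP v)) (fun j hj => (hlt j hj).1) ha)
      (fun a ha => chainMap_on_resSub (add_mem_der (hP v)) (hPi v) (fun j hj => (hlt j hj).2.1) ha)
      (fun hi x hx => compat_of_gen (fun j hj => (hlt j (by omega)).2.2 hj) hx)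
    classical
    refine ⟨Function.update v i ⟨⟨u, hu, huw⟩, ⟨y, hy⟩⟩, fun j hj => ?_, ?_⟩
    · rw [Function.update_of_ne]
      rintro rfl
      exact lt_irrefl _ hj
    set v' := Function.update v i ⟨⟨u, hu, huw⟩, ⟨y, hy⟩⟩ with hv'
    have hvv : ∀ j, M.res j < M.res i → v j = v' j := fun j hj => by
      rw [hv', Function.update_of_ne]
      rintro rfl
      exact lt_irrefl _ hj
    have e0 : v' i = ⟨⟨u, hu, huw⟩, ⟨y, hy⟩⟩ := Function.update_self ..
    have e1 : (M.d + P v') (M.z i) = M.d (M.z i) + u := by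
      rw [LinearMap.add_apply, hPz, e0]
    have e2 : Pi v' (M.z i) = y := by rw [hPiz, e0]
    have hr := hDz v' i
    rw [e1] at hr
    rw [e1, e2, ← hPr v v' _ hvv _ hr, ← hPir v v' _ hvv _ hr]
    exact ⟨h1, h2.symm, h3⟩

end FilteredModel

/-! ### Polynomials with coefficients in a (noncommutative) algebra -/

section Poly

open Polynomial

variable {k : Type u} [Field k] {A B : Type u} [Ring A] [Algebra k A] [Ring B] [Algebra k B]

variable (k A) in
/-- The map `a ↦ a Xⁿ`, as a linear map over the ground field. -/
def lmono (n : ℕ) : A →ₗ[k] A[X] where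
  toFun := monomial n
  map_add' := map_add _
  map_smul' c a := by rw [smul_monomial, RingHom.id_apply]

theorem lmono_apply (n : ℕ) (a : A) : lmono k A n a = monomial n a := rfl

/-- The `X`-linear extension of a linear map `A → B[X]` to a map `A[X] → B[X]`. -/
def polyExt (y : A →ₗ[k] B[X]) : A[X] →ₗ[k] B[X] :=
  Polynomial.lsum fun n => LinearMap.mulRight k (X ^ n) ∘ₗ y

theorem polyExt_monomial (y : A →ₗ[k] B[X]) (n : ℕ) (a : A) :
    polyExt y (monomial n a) = y a * X ^ n := by
  simp [polyExt, Polynomial.lsum_apply]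

theorem polyExt_C (y : A →ₗ[k] B[X]) (a : A) : polyExt y (C a) = y a := by
  rw [← monomial_zero_left, polyExt_monomial, pow_zero, mul_one]

theorem poly_ext {Y : Type u} [AddCommGroup Y] [Module k Y] {f g : A[X] →ₗ[k] Y}
    (h : ∀ n a, f (monomial n a) = g (monomial n a)) : f = g := by
  refine LinearMap.ext fun p => ?_
  induction p using Polynomial.induction_on' with
  | add p q hp hq => rw [map_add, map_add, hp, hq]
  | monomial n a => exact h n a

theorem monomial_eq (n : ℕ) (a : A) : monomial n a = C a * X ^ n := (C_mul_X_pow_eq_monomial).symm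

theorem polyExt_mul_X_pow (y : A →ₗ[k] B[X]) (f : A[X]) (n : ℕ) :
    polyExt y (f * X ^ n) = polyExt y f * X ^ n := by
  suffices h : polyExt y ∘ₗ LinearMap.mulRight k (X ^ n) = LinearMap.mulRight k (X ^ n) ∘ₗ polyExt y from
    DFunLike.congr_fun h f
  refine poly_ext fun m a => ?_
  simp only [LinearMap.comp_apply, LinearMap.mulRight_apply, monomial_mul_X_pow, polyExt_monomial,
    mul_assoc, ← pow_add]

/-- `X`-linear maps are determined by their values on constants. -/
theorem polyLinear_ext {f g : A[X] →ₗ[k] B[X]} (hf : ∀ p n, f (p * X ^ n) = f p * X ^ n)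
    (hg : ∀ p n, g (p * X ^ n) = g p * X ^ n) (h : ∀ a, f (C a) = g (C a)) : f = g :=
  poly_ext fun n a => by rw [monomial_eq, hf, hg, h]

theorem coeff_polyExt (y : A →ₗ[k] B[X]) (f : A[X]) (n : ℕ) : (polyExt y f).coeff n =
    ∑ ij ∈ Finset.HasAntidiagonal.antidiagonal n, (y (f.coeff ij.2)).coeff ij.1 := by
  induction f using Polynomial.induction_on' with
  | add p q hp hq =>
    rw [map_add, coeff_add, hp, hq, ← Finset.sum_add_distrib]
    refine Finset.sum_congr rfl fun ij _ => ?_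
    rw [coeff_add, map_add, coeff_add]
  | monomial m a =>
    rw [polyExt_monomial, coeff_mul_X_pow']
    split_ifs with h
    · rw [Finset.sum_eq_single (n - m, m)]
      · simp
      · rintro ⟨i, j⟩ hij hne
        have hij' : i + j = n := Finset.HasAntidiagonal.mem_antidiagonal.1 hij
        have : m ≠ j := by
          rintro rfl
          exact hne (by rw [← hij']; simp)
        simp [coeff_monomial, this]
      · intro hn
        exact absurd (Finset.HasAntidiagonal.mem_antidiagonal.2 (by omega)) hn
    · refine (Finset.sum_eq_zero ?_).symm
      rintro ⟨i, j⟩ hij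
      have hij' : i + j = n := Finset.HasAntidiagonal.mem_antidiagonal.1 hij
      have : m ≠ j := by omega
      simp [coeff_monomial, this]

/-- The coefficientwise extension of a linear map. -/
def polyMap (f : A →ₗ[k] B) : A[X] →ₗ[k] B[X] :=
  polyExt (lmono k B 0 ∘ₗ f)

theorem coeff_polyMap (f : A →ₗ[k] B) (p : A[X]) (n : ℕ) :
    (polyMap f p).coeff n = f (p.coeff n) := by
  rw [polyMap, coeff_polyExt, Finset.sum_eq_single (0, n)]
  · simp [lmono_apply]
  · rintro ⟨i, j⟩ hij hne
    have hij' : i + j = n := Finset.HasAntidiagonal.mem_antidiagonal.1 hij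
    have : (0 : ℕ) ≠ i := by
      rintro rfl
      exact hne (by rw [← hij']; simp)
    rw [LinearMap.comp_apply, lmono_apply, coeff_monomial, if_neg this]
  · intro hn
    exact absurd (Finset.HasAntidiagonal.mem_antidiagonal.2 (by simp)) hn

variable (k A) in
/-- The primitive without constant term. -/
def polyInt : A[X] →ₗ[k] A[X] :=
  Polynomial.lsum fun n => ((n : k) + 1)⁻¹ • lmono k A (n + 1)

theorem coeff_polyInt_zero (p : A[X]) : (polyInt k A p).coeff 0 = 0 := by
  induction p using Polynomial.induction_on' with
  | add p q hp hq => rw [map_add, coeff_add, hp, hq, add_zero]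
  | monomial m a => simp [polyInt, Polynomial.lsum_apply, lmono_apply]

theorem coeff_polyInt_succ (p : A[X]) (n : ℕ) :
    (polyInt k A p).coeff (n + 1) = ((n : k) + 1)⁻¹ • p.coeff n := by
  induction p using Polynomial.induction_on' with
  | add p q hp hq => rw [map_add, coeff_add, hp, hq, coeff_add, smul_add]
  | monomial m a =>
    by_cases h : m = n
    · subst h
      simp [polyInt, Polynomial.lsum_apply, lmono_apply, coeff_monomial]
    · simp [polyInt, Polynomial.lsum_apply, lmono_apply, coeff_monomial, h]

theorem coeff_derivative' (p : A[X]) (n : ℕ) :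
    (derivative p).coeff n = ((n : k) + 1) • p.coeff (n + 1) := by
  rw [coeff_derivative, Algebra.smul_def, map_add, map_natCast, map_one]
  exact ((Nat.cast_commute n _).add_left (Commute.one_left _)).symm.eq

theorem natCast_add_one_ne_zero' [CharZero k] (n : ℕ) : (n : k) + 1 ≠ 0 := Nat.cast_add_one_ne_zero n

theorem derivative_polyInt [CharZero k] (p : A[X]) : derivative (polyInt k A p) = p := by
  ext n
  rw [coeff_derivative' (k := k), coeff_polyInt_succ, smul_smul,
    mul_inv_cancel₀ (natCast_add_one_ne_zero' n), one_smul]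

theorem polyInt_derivative [CharZero k] (p : A[X]) : polyInt k A (derivative p) = p - C (p.coeff 0) := by
  ext n
  rcases n with _ | n
  · simp [coeff_polyInt_zero]
  · rw [coeff_polyInt_succ, coeff_derivative' (k := k), smul_smul,
      inv_mul_cancel₀ (natCast_add_one_ne_zero' n), one_smul, coeff_sub, coeff_C_succ, sub_zero]

theorem polyInt_polyMap (f : A →ₗ[k] B) (p : A[X]) :
    polyInt k B (polyMap f p) = polyMap f (polyInt k A p) := by
  ext n
  rcases n with _ | n
  · rw [coeff_polyInt_zero, coeff_polyMap, coeff_polyInt_zero, map_zero]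
  · rw [coeff_polyInt_succ, coeff_polyMap, coeff_polyMap, coeff_polyInt_succ, map_smul]

variable (k A) in
/-- Evaluation at `c ∈ k`. -/
def polyEv (c : k) : A[X] →ₐ[k] A :=
  Polynomial.eval₂AlgHom (AlgHom.id k A) (algebraMap k A c) fun a => (Algebra.commutes c a).symm

theorem polyEv_apply (c : k) (p : A[X]) :
    polyEv k A c p = eval₂ (RingHom.id A) (algebraMap k A c) p := rfl

theorem polyEv_C (c : k) (a : A) : polyEv k A c (C a) = a := by
  rw [polyEv_apply]
  exact eval₂_C _ _

theorem polyEv_X (c : k) : polyEv k A c X = algebraMap k A c := by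
  rw [polyEv_apply]
  exact eval₂_X _ _

theorem polyEv_zero (p : A[X]) : polyEv k A 0 p = p.coeff 0 := by
  rw [polyEv_apply, map_zero]
  exact Polynomial.eval₂_at_zero _

theorem polyEv_polyMap (c : k) (f : A →ₗ[k] B) (p : A[X]) :
    polyEv k B c (polyMap f p) = f (polyEv k A c p) := by
  suffices h : (polyEv k B c).toLinearMap ∘ₗ polyMap f = f ∘ₗ (polyEv k A c).toLinearMap from
    DFunLike.congr_fun h p
  refine poly_ext fun n a => ?_
  have h1 : polyMap f (monomial n a) = monomial n (f a) := by
    ext m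
    rw [coeff_polyMap, coeff_monomial, coeff_monomial]
    split_ifs <;> simp
  have h2 : ∀ {D : Type u} [Ring D] [Algebra k D] (a : D),
      polyEv k D c (monomial n a) = c ^ n • a := fun a => by
    rw [monomial_eq, map_mul, polyEv_C, map_pow, polyEv_X, ← map_pow, ← Algebra.commutes,
      ← Algebra.smul_def]
  rw [LinearMap.comp_apply, LinearMap.comp_apply, AlgHom.toLinearMap_apply,
    AlgHom.toLinearMap_apply, h1, h2, h2, map_smul]

/-- The polynomials with coefficients in a subspace. -/
def polyIn (Q : Submodule k A) : Submodule k A[X] where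
  carrier := {p | ∀ n, p.coeff n ∈ Q}
  add_mem' := fun hp hq n => by rw [coeff_add]; exact Q.add_mem (hp n) (hq n)
  zero_mem' := fun n => by simp
  smul_mem' := fun c p hp n => by rw [coeff_smul]; exact Q.smul_mem c (hp n)

theorem C_mem_polyIn {Q : Submodule k A} {a : A} (ha : a ∈ Q) : C a ∈ polyIn Q := fun n => by
  rw [coeff_C]
  split_ifs
  · exact ha
  · exact Q.zero_mem

theorem mul_X_pow_mem_polyIn {Q : Submodule k A} {p : A[X]} (hp : p ∈ polyIn Q) (m : ℕ) :
    p * X ^ m ∈ polyIn Q := fun n => by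
  rw [coeff_mul_X_pow']
  split_ifs
  · exact hp _
  · exact Q.zero_mem

theorem mul_mem_polyIn {Q Q' Q'' : Submodule k A} (h : ∀ a ∈ Q, ∀ b ∈ Q', a * b ∈ Q'') {p q : A[X]}
    (hp : p ∈ polyIn Q) (hq : q ∈ polyIn Q') : p * q ∈ polyIn Q'' := fun n => by
  rw [coeff_mul]
  exact Submodule.sum_mem _ fun ij _ => h _ (hp _) _ (hq _)

theorem polyInt_mem_polyIn {Q : Submodule k A} {p : A[X]} (hp : p ∈ polyIn Q) :
    polyInt k A p ∈ polyIn Q := fun n => by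
  rcases n with _ | n
  · rw [coeff_polyInt_zero]; exact Q.zero_mem
  · rw [coeff_polyInt_succ]; exact Q.smul_mem _ (hp n)

theorem derivative_mem_polyIn {Q : Submodule k A} {p : A[X]} (hp : p ∈ polyIn Q) :
    derivative p ∈ polyIn Q := fun n => by
  rw [coeff_derivative' (k := k)]
  exact Q.smul_mem _ (hp _)

theorem polyEv_mem {Q : Submodule k A} {p : A[X]} (hp : p ∈ polyIn Q) (c : k) :
    polyEv k A c p ∈ Q := by
  rw [polyEv_apply, eval₂_eq_sum_range]
  refine Submodule.sum_mem _ fun n _ => ?_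
  rw [RingHom.id_apply, ← map_pow, ← Algebra.commutes, ← Algebra.smul_def]
  exact Q.smul_mem _ (hp n)

theorem polyExt_mem_polyIn {Q : Submodule k A} {Q' : Submodule k B} {y : A →ₗ[k] B[X]}
    (h : ∀ a ∈ Q, y a ∈ polyIn Q') {p : A[X]} (hp : p ∈ polyIn Q) : polyExt y p ∈ polyIn Q' :=
  fun n => by
  rw [coeff_polyExt]
  exact Submodule.sum_mem _ fun ij _ => h _ (hp _) _

theorem polyMap_mem_polyIn {Q : Submodule k A} {Q' : Submodule k B} {f : A →ₗ[k] B}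
    (h : ∀ a ∈ Q, f a ∈ Q') {p : A[X]} (hp : p ∈ polyIn Q) : polyMap f p ∈ polyIn Q' :=
  fun n => by
  rw [coeff_polyMap]
  exact h _ (hp _)

/-- If `θ (a b) = θ a b + a' θ b` for `a, b` in a subspace then the extensions have the same
property. -/
theorem polyExt_mul {y : A →ₗ[k] A[X]} {Q : Submodule k A} {c : k}
    (h : ∀ a ∈ Q, ∀ b, y (a * b) = y a * C b + c • (C a * y b)) {p : A[X]} (hp : p ∈ polyIn Q)
    (q : A[X]) : polyExt y (p * q) = polyExt y p * q + c • (p * polyExt y q) := by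
  have h1 : ∀ (a : A), a ∈ Q → ∀ (q : A[X]), polyExt y (C a * q) = y a * q + c • (C a * polyExt y q) := by
    intro a ha q
    suffices hs : polyExt y ∘ₗ LinearMap.mulLeft k (C a) = LinearMap.mulLeft k (y a) +
        c • (LinearMap.mulLeft k (C a) ∘ₗ polyExt y) from DFunLike.congr_fun hs q
    refine poly_ext fun n b => ?_
    simp only [LinearMap.comp_apply, LinearMap.add_apply, LinearMap.smul_apply,
      LinearMap.mulLeft_apply, C_mul_monomial, polyExt_monomial, h a ha b, add_mul,
      smul_mul_assoc, mul_assoc]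
    rw [monomial_eq]
  rw [p.as_sum_range_C_mul_X_pow]
  simp only [Finset.sum_mul, map_sum, Finset.smul_sum, ← Finset.sum_add_distrib]
  refine Finset.sum_congr rfl fun n _ => ?_
  have e : C (p.coeff n) * X ^ n * q = C (p.coeff n) * q * X ^ n := by
    rw [mul_assoc, X_pow_mul, mul_assoc]
  rw [e, polyExt_mul_X_pow, h1 _ (hp n), polyExt_mul_X_pow, polyExt_C, add_mul, smul_mul_assoc,
    mul_assoc _ q, ← X_pow_mul, mul_assoc _ (X ^ n) q, mul_assoc _ (polyExt y q), ← X_pow_mul,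
    mul_assoc _ (X ^ n)]

end Poly

namespace GCA

open Polynomial

variable {k : Type u} [Field k] (A : GCA k)

theorem poly_comm {m n : ℤ} {p q : A.carrier[X]} (hp : p ∈ polyIn (A.gr m))
    (hq : q ∈ polyIn (A.gr n)) : p * q = sgn k (m * n) • (q * p) := by
  ext j
  rw [coeff_smul, coeff_mul, coeff_mul, ← Finset.Nat.sum_antidiagonal_swap, Finset.smul_sum]
  exact Finset.sum_congr rfl fun ij _ => A.comm (hp _) (hq _)

end GCA

theorem DGCA.poly_leibniz {k : Type u} [Field k] (A : DGCA k) {m : ℤ}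
    {p : Polynomial A.carrier} (hp : p ∈ polyIn (A.gr m)) (q : Polynomial A.carrier) :
    polyMap A.d (p * q) = polyMap A.d p * q + sgn k m • (p * polyMap A.d q) := by
  refine polyExt_mul (Q := A.gr m) (fun a ha b => ?_) hp q
  rw [LinearMap.comp_apply, A.leibniz ha, map_add, map_smul]
  simp [lmono_apply]

/-! ### Uniqueness of perturbed models -/

namespace FilteredModel

open Polynomial

variable {k : Type u} [Field k] {H : GCA k} {M : FilteredModel H}

/-- An isomorphism `(S Z, d + p) → (S Z, d + q)` which is the identity up to lower weights. -/
def Gauge (p q : M.Perturbation) : Prop :=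
  ∃ g : M.S →ₐ[k] M.S, (∀ i, g (M.z i) ∈ M.gr (M.deg i)) ∧
    (∀ i, g (M.z i) - M.z i ∈ M.wtLE (M.wt i - 1)) ∧
    ∀ a, g ((M.d + p.p) a) = (M.d + q.p) (g a)

theorem wtLE_monotone : Monotone M.wtLE := fun _ _ h => M.wtLE_mono h

theorem map_gr {g : M.S →ₐ[k] M.S} (h : ∀ i, g (M.z i) ∈ M.gr (M.deg i)) {n : ℤ} {a : M.S}
    (ha : a ∈ M.gr n) : g a ∈ M.gr n :=
  map_gr_of_gen (A := FreeGCA.gca k M.deg) (π := g) h ha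

theorem sub_mem_wtLE_of_gen {g : M.S →ₐ[k] M.S}
    (h : ∀ i, g (M.z i) - M.z i ∈ M.wtLE (M.wt i - 1)) {w : ℤ} {a : M.S} (ha : a ∈ M.wtLE w) :
    g a - a ∈ M.wtLE (w - 1) := by
  have hg : ∀ l : List M.I, g (FreeGCA.mono k M.deg l) ∈ M.wtLE ((l.map M.wt).sum : ℕ) :=
    FreeGCA.map_mem_of_gen (Q := M.wtLE) (FreeGCA.one_mem_wtLE _)
      (fun _ _ _ _ => FreeGCA.mul_mem_wtLE) fun i => by
        have := Submodule.add_mem _ (M.wtLE_mono (by omega) (h i)) (gen_mem_wtLE i)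
        rwa [sub_add_cancel] at this
  refine FreeGCA.mem_of_mem_wtLE (β := g.toLinearMap - LinearMap.id) (Q := M.wtLE) (c := -1)
    wtLE_monotone (fun l => ?_) ha
  rw [LinearMap.sub_apply, AlgHom.toLinearMap_apply, LinearMap.id_apply]
  induction l with
  | nil => rw [FreeGCA.mono_nil, map_one, sub_self]; exact Submodule.zero_mem _
  | cons i l ih =>
    have e : g (M.z i * FreeGCA.mono k M.deg l) - M.z i * FreeGCA.mono k M.deg l =
        (g (M.z i) - M.z i) * g (FreeGCA.mono k M.deg l) +
          M.z i * (g (FreeGCA.mono k M.deg l) - FreeGCA.mono k M.deg l) := by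
      rw [map_mul, sub_mul, mul_sub]; abel
    rw [FreeGCA.mono_cons, e]
    simp only [List.map_cons, List.sum_cons, Nat.cast_add]
    refine Submodule.add_mem _ ?_ ?_
    · have e' : ∀ a b : ℤ, a - 1 + b ≤ a + b + -1 := fun a b => by linarith
      exact M.wtLE_mono (e' _ _) (FreeGCA.mul_mem_wtLE (h i) (hg l))
    · exact M.wtLE_mono (add_assoc _ _ _).symm.le (FreeGCA.mul_mem_wtLE (gen_mem_wtLE i) ih)

theorem map_wtLE_of_gen {g : M.S →ₐ[k] M.S}
    (h : ∀ i, g (M.z i) - M.z i ∈ M.wtLE (M.wt i - 1)) {w : ℤ} {a : M.S} (ha : a ∈ M.wtLE w) :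
    g a ∈ M.wtLE w := by
  have := Submodule.add_mem _ (M.wtLE_mono (by omega) (sub_mem_wtLE_of_gen h ha)) ha
  rwa [sub_add_cancel] at this

/-- A cocycle which becomes exact under a compatible map is exact. -/
theorem ModelMap.exists_boundary {q : M.Perturbation} {X : AugDGCA H} (f : ModelMap q X) {m : ℤ}
    {c : M.S} (hc : c ∈ M.gr m) (hd : (M.d + q.p) c = 0) (h : ∃ x, X.A.d x = f.π c) :
    ∃ a ∈ M.gr (m - 1), (M.d + q.p) a = c := by
  have hD := add_mem_der q.mem
  obtain ⟨b, hb, hbw⟩ := q.reduce (m := m) (V := m) le_rfl hc (by rw [hd]; exact Submodule.zero_mem _)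
  have hy : c - (M.d + q.p) b ∈ M.gr m := by
    refine Submodule.sub_mem _ hc ?_
    have := hD.1 _ _ hb
    rwa [sub_add_cancel] at this
  obtain ⟨h1, h2⟩ := f.compat _ (mem_resSub_one hy hbw)
  have h3 : M.ρ (c - (M.d + q.p) b) = 0 := by
    obtain ⟨x, hx⟩ := h
    rw [← X.i.toEquiv.map_eq_zero_iff, h2]
    have h0 : X.A.cls 0 (map_zero _) = 0 := rfl
    rw [← h0, DGCA.cls_eq_iff]
    refine ⟨x - f.π b, ?_⟩
    rw [map_sub, map_sub, f.π_D, hx, sub_zero]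
  obtain ⟨e, he, -, hee⟩ := FilteredModel.exists_boundary q.mem hy hbw h3
  exact ⟨e + b, Submodule.add_mem _ he hb, by rw [map_add, hee, sub_add_cancel]⟩

theorem ModelMap.exists_cocycle {q : M.Perturbation} {X : AugDGCA H} (f : ModelMap q X) {m : ℤ}
    {x : X.A.carrier} (hx : x ∈ X.A.gr (m + 1)) (hd : X.A.d x = 0) :
    ∃ y ∈ M.gr (m + 1), (M.d + q.p) y = 0 ∧ ∃ w ∈ X.A.gr m, X.A.d w = x - f.π y := by
  obtain ⟨h, hh, e⟩ := X.i.exists_of_mem hx hd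
  obtain ⟨y, hy, hyw, rfl⟩ := exists_ρ_eq (M := M) hh
  obtain ⟨h1, h2⟩ := f.compat y (mem_resSub_one hy hyw)
  have h3 := (DGCA.cls_eq_iff hd h1).1 (e.symm.trans h2)
  exact ⟨y, hy, D_eq_zero q.mem hy hyw,
    DGCA.exists_boundary_of_mem (Submodule.sub_mem _ hx (map_gr_of_gen f.π_gen hy)) h3⟩

/-- Homotopies `S Z → A[t, dt]`, `a ↦ α a + dt β a`: the `dt`-component of the compatibility with
differentials. -/
theorem homotopy_on_resSub {A : DGCA k} {D : M.S →ₗ[k] M.S} (hD : D ∈ M.der 1 0)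
    {α : M.S →ₐ[k] A.carrier[X]} (hα : ∀ i, α (M.z i) ∈ polyIn (A.gr (M.deg i)))
    {β : M.S →ₗ[k] A.carrier[X]} (hβz : ∀ i, β (M.z i) ∈ polyIn (A.gr (M.deg i - 1)))
    (hβ : ∀ a b, β (a * b) = α (FreeGCA.parity 1 a) * β b + β a * α b) {r : ℕ}
    (hc : ∀ a ∈ M.resSub r, α (D a) = polyMap A.d (α a))
    (h : ∀ i, M.res i < r → derivative (α (M.z i)) = β (D (M.z i)) + polyMap A.d (β (M.z i)))
    {a : M.S} (ha : a ∈ M.resSub r) : derivative (α a) = β (D a) + polyMap A.d (β a) := by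
  induction ha using Submodule.span_induction with
  | mem x hx =>
    obtain ⟨l, hl, rfl⟩ := hx
    induction l with
    | nil =>
      rw [FreeGCA.mono_nil, der_one hD, map_one, map_zero,
        FreeGCA.twistedDerivation_one (γ := α.comp (FreeGCA.parity 1)) hβ, map_zero]
      simp
    | cons i l ih =>
      have hlz := hl i (by simp)
      have hl' : ∀ j ∈ l, M.res j < r := fun j hj => hl j (by simp [hj])
      have hmz : M.z i ∈ M.resSub r :=
        Submodule.subset_span ⟨[i], by simpa using hlz, by simp [FreeGCA.mono]⟩
      have e1 := hc _ hmz
      have e2 := hc _ (Submodule.subset_span ⟨l, hl', rfl⟩)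
      have p1 : FreeGCA.parity 1 (M.z i) = sgn k (M.deg i) • M.z i := by
        rw [FreeGCA.parity_of_mem (gen_mem_gr i), one_mul]
      have p2 : FreeGCA.parity 1 (D (M.z i)) = -sgn k (M.deg i) • D (M.z i) := by
        rw [FreeGCA.parity_of_mem (hD.1 _ _ (gen_mem_gr i)), one_mul, sgn_add, sgn_one]
        simp
      have p3 : sgn k (M.deg i - 1) = -sgn k (M.deg i) := by
        rw [← neg_eq_iff_eq_neg, ← sgn_succ, add_sub_cancel]
      rw [FreeGCA.mono_cons, map_mul, derivative_mul, ih hl', h i hlz,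
        hD.2.1 _ _ (gen_mem_gr i), map_add, map_smul, hβ, hβ, hβ (M.z i), map_add,
        p1, p2]
      simp only [map_smul, smul_mul_assoc]
      rw [A.poly_leibniz (hα i), A.poly_leibniz (hβz i), p3, ← e1, ← e2, one_mul]
      simp only [smul_add, smul_smul, sgn_mul_self, one_smul, add_mul, mul_add, neg_smul]
      abel
  | zero => simp
  | add a b _ _ ha hb => simp only [map_add, ha, hb]; abel
  | smul c a _ ha =>
    simp only [map_smul, ← smul_add, ← ha]
    exact derivative_smul c _

/-- The choice of values on a generator in the comparison of two models of the same dgca. -/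
theorem exists_comparison_values [CharZero k] {p q : M.Perturbation} {X : AugDGCA H}
    (f : ModelMap p X) (f' : ModelMap q X) {g : M.S →ₐ[k] M.S}
    (hg : ∀ i, g (M.z i) ∈ M.gr (M.deg i))
    (hgw : ∀ i, g (M.z i) - M.z i ∈ M.wtLE (M.wt i - 1)) (i : M.I) {A B : X.A.carrier[X]}
    (hB : B ∈ polyIn (X.A.gr (M.deg i)))
    (hc : (M.d + q.p) (g ((M.d + p.p) (M.z i))) = 0)
    (hAB : derivative A = polyMap X.A.d B)
    (hA0 : polyEv k _ 0 A = f'.π (g ((M.d + p.p) (M.z i))))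
    (hA1 : polyEv k _ 1 A = f.π ((M.d + p.p) (M.z i)))
    (h0 : M.res i < 1 → B = 0) :
    ∃ u ∈ M.gr (M.deg i), u ∈ M.wtLE (M.wt i - 1) ∧
      (M.d + q.p) (M.z i + u) = g ((M.d + p.p) (M.z i)) ∧ ∃ y ∈ X.A.gr (M.deg i - 1),
        X.A.d y = f.π (M.z i) - polyEv k _ 1 (polyInt k _ B) - f'.π (M.z i + u) := by
  have hDp := add_mem_der p.mem
  have hDq := add_mem_der q.mem
  have hzw : (M.d + p.p) (M.z i) ∈ M.wtLE (M.wt i) := by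
    simpa using hDp.2.2 _ _ (gen_mem_wtLE i)
  have hzg := hDp.1 _ _ (gen_mem_gr i)
  have hwt : (M.wt i : ℤ) = M.deg i + M.res i := by push_cast; rfl
  rcases Nat.lt_or_ge (M.res i) 1 with hr | hr
  · have hw : M.z i ∈ M.wtLE (M.deg i) := M.wtLE_mono (by omega) (gen_mem_wtLE i)
    have e1 := D_eq_zero p.mem (gen_mem_gr i) hw
    have e2 := D_eq_zero q.mem (gen_mem_gr i) hw
    obtain ⟨h1, h2⟩ := f.compat _ (mem_resSub_one (gen_mem_gr i) hw)
    obtain ⟨h3, h4⟩ := f'.compat _ (mem_resSub_one (gen_mem_gr i) hw)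
    have h5 := (DGCA.cls_eq_iff h1 h3).1 (h2.symm.trans h4)
    obtain ⟨y, hy, hyy⟩ := DGCA.exists_boundary_of_mem (m := M.deg i - 1)
      (by rw [sub_add_cancel]; exact Submodule.sub_mem _ (f.π_gen i) (f'.π_gen i)) h5
    refine ⟨0, Submodule.zero_mem _, Submodule.zero_mem _, ?_, y, hy, ?_⟩
    · rw [add_zero, e1, e2, map_zero]
    · rw [h0 hr, hyy]
      simp
  · set x := f.π (M.z i) - polyEv k _ 1 (polyInt k _ B) with hx
    have hxg : x ∈ X.A.gr (M.deg i) :=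
      Submodule.sub_mem _ (f.π_gen i) (polyEv_mem (polyInt_mem_polyIn hB) 1)
    have hdx : X.A.d x = f'.π (g ((M.d + p.p) (M.z i))) := by
      rw [hx, map_sub, ← f.π_D, ← hA1, ← polyEv_polyMap, ← polyInt_polyMap, ← hAB,
        polyInt_derivative, map_sub, polyEv_C, ← polyEv_zero (k := k), hA0]
      abel
    obtain ⟨a, ha, haa⟩ := f'.exists_boundary (map_gr hg hzg) hc ⟨x, hdx⟩
    rw [add_sub_cancel_right] at ha
    obtain ⟨e, he, hed, w, hw, hww⟩ := f'.exists_cocycle (m := M.deg i - 1) (x := x - f'.π a)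
      (by rw [sub_add_cancel]; exact Submodule.sub_mem _ hxg (map_gr_of_gen f'.π_gen ha))
      (by rw [map_sub, ← f'.π_D, haa, hdx, sub_self])
    rw [sub_add_cancel] at he
    have h1 : (M.d + q.p) (a + e - M.z i) ∈ M.wtLE (M.wt i - 1) := by
      have e1 : (M.d + q.p) (a + e - M.z i) = (g ((M.d + p.p) (M.z i)) - (M.d + p.p) (M.z i)) +
          (p.p (M.z i) - q.p (M.z i)) := by
        rw [map_sub, map_add, haa, hed]
        simp only [LinearMap.add_apply]
        abel
      rw [e1]
      exact Submodule.add_mem _ (sub_mem_wtLE_of_gen hgw hzw)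
        (Submodule.sub_mem _ (p.mem.2.2 _ _ (gen_mem_wtLE i)) (q.mem.2.2 _ _ (gen_mem_wtLE i)))
    obtain ⟨b, hb, hbw⟩ := q.reduce (m := M.deg i) (by omega)
      (Submodule.sub_mem _ (Submodule.add_mem _ ha he) (gen_mem_gr i)) h1
    have e2 : M.z i + (a + e - M.z i - (M.d + q.p) b) = a + e - (M.d + q.p) b := by abel
    refine ⟨_, Submodule.sub_mem _
      (Submodule.sub_mem _ (Submodule.add_mem _ ha he) (gen_mem_gr i)) ?_, hbw, ?_,
      w + f'.π b, Submodule.add_mem _ hw (map_gr_of_gen f'.π_gen hb), ?_⟩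
    · have := hDq.1 _ _ hb
      rwa [sub_add_cancel] at this
    · rw [e2, map_sub, map_add, haa, hed, q.sq, add_zero, sub_zero]
    · rw [e2, map_add, hww, map_sub, map_add, f'.π_D]
      abel

/-- Two perturbed models of the same dgca differ by a gauge transformation. -/
theorem gauge_of_modelMap [CharZero k] {p q : M.Perturbation} {X : AugDGCA H} (f : ModelMap p X)
    (f' : ModelMap q X) : Gauge p q := by
  let T : M.I → Type u := fun i => {u : M.S // u ∈ M.gr (M.deg i) ∧ u ∈ M.wtLE (M.wt i - 1)} ×
    {a : X.A.carrier[X] // a ∈ polyIn (X.A.gr (M.deg i))} ×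
    {b : X.A.carrier[X] // b ∈ polyIn (X.A.gr (M.deg i - 1))}
  have : ∀ i, Inhabited (T i) := fun i => ⟨⟨⟨0, Submodule.zero_mem _, Submodule.zero_mem _⟩,
    ⟨0, Submodule.zero_mem _⟩, ⟨0, Submodule.zero_mem _⟩⟩⟩
  have hDp := add_mem_der p.mem
  have hDq := add_mem_der q.mem
  have hzu : ∀ (v : ∀ i, T i) i, M.z i + (v i).1.1 ∈ M.gr (M.deg i) := fun v i =>
    Submodule.add_mem _ (gen_mem_gr i) (v i).1.2.1
  let g : (∀ i, T i) → (M.S →ₐ[k] M.S) := fun v =>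
    FreeGCA.lift (fun i => M.z i + (v i).1.1) fun i j => FreeGCA.gr_comm (hzu v i) (hzu v j)
  have hgz : ∀ v i, g v (M.z i) = M.z i + (v i).1.1 := fun v i => FreeGCA.lift_gen _ _ i
  have hg : ∀ v i, g v (M.z i) ∈ M.gr (M.deg i) := fun v i => by rw [hgz]; exact hzu v i
  have hgw : ∀ v i, g v (M.z i) - M.z i ∈ M.wtLE (M.wt i - 1) := fun v i => by
    rw [hgz, add_sub_cancel_left]; exact (v i).1.2.2
  let α : (∀ i, T i) → (M.S →ₐ[k] X.A.carrier[X]) := fun v =>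
    FreeGCA.lift (fun i => (v i).2.1.1) fun i j => X.A.poly_comm (v i).2.1.2 (v j).2.1.2
  have hαz : ∀ v i, α v (M.z i) = (v i).2.1.1 := fun v i => FreeGCA.lift_gen _ _ i
  have hα : ∀ v i, α v (M.z i) ∈ polyIn (X.A.gr (M.deg i)) := fun v i => by
    rw [hαz]; exact (v i).2.1.2
  have hpar : ∀ i, FreeGCA.parity 1 (M.z i) = sgn k (M.deg i) • M.z i := fun i => by
    rw [FreeGCA.parity_of_mem (gen_mem_gr i), one_mul]
  have hβ' : ∀ v : ∀ i, T i, ∃ β : M.S →ₗ[k] X.A.carrier[X], (∀ i, β (M.z i) = (v i).2.2.1) ∧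
      ∀ a b, β (a * b) = α v (FreeGCA.parity 1 a) * β b + β a * α v b := fun v => by
    refine FreeGCA.exists_twistedDerivation (α v) ((α v).comp (FreeGCA.parity 1))
      (fun i => (v i).2.2.1) fun i j => ?_
    have e1 := X.A.poly_comm (hα v i) (v j).2.2.2
    have e2 := X.A.poly_comm (v i).2.2.2 (hα v j)
    simp only [AlgHom.comp_apply, hpar, map_smul, smul_add, smul_mul_assoc, e1, e2, smul_smul]
    rw [add_comm]
    congr 2
    · rw [← sgn_add]
      exact sgn_congr ⟨-M.deg j, by ring⟩
    · rw [← sgn_add]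
      exact sgn_congr ⟨0, by ring⟩
  choose β hβz hβ using hβ'
  have hβg : ∀ v i, β v (M.z i) ∈ polyIn (X.A.gr (M.deg i - 1)) := fun v i => by
    rw [hβz]; exact (v i).2.2.2
  have hgr : ∀ (v v' : ∀ i, T i) r, (∀ j, M.res j < r → v j = v' j) → ∀ a ∈ M.resSub r,
      g v a = g v' a := fun v v' r h a ha =>
    algHom_eqOn_resSub (fun i hi => by rw [hgz, hgz, h i hi]) ha
  have hαr : ∀ (v v' : ∀ i, T i) r, (∀ j, M.res j < r → v j = v' j) → ∀ a ∈ M.resSub r,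
      α v a = α v' a := fun v v' r h a ha =>
    algHom_eqOn_resSub (fun i hi => by rw [hαz, hαz, h i hi]) ha
  have hβr : ∀ (v v' : ∀ i, T i) r, (∀ j, M.res j < r → v j = v' j) → ∀ a ∈ M.resSub r,
      β v a = β v' a := fun v v' r h a ha => by
    suffices hs : M.resSub r ≤ LinearMap.ker (β v - β v') from sub_eq_zero.1 (hs ha)
    refine resSub_le fun l hl => ?_
    rw [LinearMap.mem_ker, LinearMap.sub_apply, sub_eq_zero]
    induction l with
    | nil =>
      rw [FreeGCA.mono_nil, FreeGCA.twistedDerivation_one (γ := (α v).comp (FreeGCA.parity 1)) (hβ v),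
        FreeGCA.twistedDerivation_one (γ := (α v').comp (FreeGCA.parity 1)) (hβ v')]
    | cons i l ih =>
      have hl' : ∀ j ∈ l, M.res j < r := fun j hj => hl j (by simp [hj])
      have hi := h i (hl i (by simp))
      have e := hαr v v' r h _ (Submodule.subset_span ⟨l, hl', rfl⟩)
      rw [FreeGCA.mono_cons, hβ, hβ, hpar, map_smul, map_smul, hαz, hαz, hβz, hβz, hi, e, ih hl']
  have hDz : ∀ i, (M.d + p.p) (M.z i) ∈ M.resSub (M.res i) := fun i => by
    have hwt : (M.wt i : ℤ) = M.deg i + M.res i := by push_cast; rfl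
    refine mem_resSub (w := M.wt i) (hDp.1 _ _ (gen_mem_gr i)) ?_ (by omega)
    simpa using hDp.2.2 _ _ (gen_mem_wtLE i)
  let P : (∀ i, T i) → M.I → Prop := fun v i =>
    g v ((M.d + p.p) (M.z i)) = (M.d + q.p) (g v (M.z i)) ∧
    α v ((M.d + p.p) (M.z i)) = polyMap X.A.d (α v (M.z i)) ∧
    derivative (α v (M.z i)) = β v ((M.d + p.p) (M.z i)) + polyMap X.A.d (β v (M.z i)) ∧
    polyEv k _ 1 (α v (M.z i)) = f.π (M.z i) ∧ polyEv k _ 0 (α v (M.z i)) = f'.π (g v (M.z i))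
  have hP1 : ∀ v r, (∀ i, M.res i < r → P v i) → ∀ a ∈ M.resSub r,
      g v ((M.d + p.p) a) = (M.d + q.p) (g v a) := fun v r h a ha =>
    algHom_D_eq_on_resSub hDp (der_one hDq) (fun i b => by
      rw [hDq.2.1 _ _ (hg v i), one_mul]) (fun i hi => (h i hi).1) ha
  have hP2 : ∀ v r, (∀ i, M.res i < r → P v i) → ∀ a ∈ M.resSub r,
      α v ((M.d + p.p) a) = polyMap X.A.d (α v a) := fun v r h a ha =>
    algHom_D_eq_on_resSub hDp (by
      ext n
      rw [coeff_polyMap, coeff_one]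
      split_ifs <;> simp [X.A.d_one]) (fun i b => X.A.poly_leibniz (hα v i) b)
      (fun i hi => (h i hi).2.1) ha
  have hP3 : ∀ v r, (∀ i, M.res i < r → P v i) → ∀ a ∈ M.resSub r,
      derivative (α v a) = β v ((M.d + p.p) a) + polyMap X.A.d (β v a) := fun v r h a ha =>
    homotopy_on_resSub hDp (hα v) (hβg v) (hβ v) (hP2 v r h) (fun i hi => (h i hi).2.2.1) ha
  have hP4 : ∀ v r, (∀ i, M.res i < r → P v i) → ∀ a ∈ M.resSub r,
      polyEv k _ 1 (α v a) = f.π a := fun v r h a ha =>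
    algHom_eqOn_resSub (f := (polyEv k _ 1).comp (α v)) (fun i hi => (h i hi).2.2.2.1) ha
  have hP5 : ∀ v r, (∀ i, M.res i < r → P v i) → ∀ a ∈ M.resSub r,
      polyEv k _ 0 (α v a) = f'.π (g v a) := fun v r h a ha =>
    algHom_eqOn_resSub (f := (polyEv k _ 0).comp (α v)) (g := f'.π.comp (g v))
      (fun i hi => (h i hi).2.2.2.2) ha
  suffices hs : ∃ v, ∀ i, P v i by
    obtain ⟨v, hv⟩ := hs
    refine ⟨g v, hg v, hgw v, fun a => ?_⟩
    obtain ⟨r, hr⟩ := exists_mem_resSub a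
    exact hP1 v r (fun i _ => hv i) a hr
  refine exists_of_local M.res P ?_ ?_
  · rintro v v' i hlt hi ⟨h1, h2, h3, h4, h5⟩
    have e1 : g v' (M.z i) = g v (M.z i) := by rw [hgz, hgz, hi]
    have e2 : α v' (M.z i) = α v (M.z i) := by rw [hαz, hαz, hi]
    have e3 : β v' (M.z i) = β v (M.z i) := by rw [hβz, hβz, hi]
    have e4 := hgr v v' _ hlt _ (hDz i)
    have e5 := hαr v v' _ hlt _ (hDz i)
    have e6 := hβr v v' _ hlt _ (hDz i)
    refine ⟨?_, ?_, ?_, ?_, ?_⟩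
    · rw [← e4, e1, h1]
    · rw [← e5, e2, h2]
    · rw [← e6, e2, e3, h3]
    · rw [e2, h4]
    · rw [e2, e1, h5]
  · intro v i hlt
    have hB : β v ((M.d + p.p) (M.z i)) ∈ polyIn (X.A.gr (M.deg i)) := by
      have := FreeGCA.mem_of_mem_gr (β := β v) (Q := fun n => polyIn (X.A.gr n)) (c := -1)
        (fun l => FreeGCA.map_mem_of_gen' (γ := (α v).comp (FreeGCA.parity 1))
          (Q := fun n => polyIn (X.A.gr n)) (wt := M.deg) (hβ v)
          (C_mem_polyIn X.A.one_mem)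
          (fun m n a b ha hb => mul_mem_polyIn (fun _ hx _ hy => X.A.mul_mem hx hy) ha hb) (hα v)
          (fun i => by
            rw [AlgHom.comp_apply, hpar, map_smul]
            exact Submodule.smul_mem _ _ (hα v i)) (hβg v) l) (hDp.1 _ _ (gen_mem_gr i))
      rwa [add_neg_cancel_right] at this
    have hAB : derivative (α v ((M.d + p.p) (M.z i))) =
        polyMap X.A.d (β v ((M.d + p.p) (M.z i))) := by
      rw [hP3 v _ hlt _ (hDz i), p.sq, map_zero, zero_add]
    obtain ⟨u, hu, huw, h1, y, hy, hyy⟩ := exists_comparison_values f f' (hg v) (hgw v) i hB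
      (by rw [← hP1 v _ hlt _ (hDz i), p.sq, map_zero]) hAB (hP5 v _ hlt _ (hDz i))
      (hP4 v _ hlt _ (hDz i)) (fun hr => by
        rw [D_eq_zero p.mem (gen_mem_gr i) (M.wtLE_mono (by push_cast; omega) (gen_mem_wtLE i)),
          map_zero])
    set B := β v ((M.d + p.p) (M.z i)) with hBdef
    have hA : C (f'.π (M.z i + u)) + polyInt k _ B + C (X.A.d y) * Polynomial.X ∈
        polyIn (X.A.gr (M.deg i)) := by
      refine Submodule.add_mem _ (Submodule.add_mem _ (C_mem_polyIn (map_gr_of_gen f'.π_gen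
        (Submodule.add_mem _ (gen_mem_gr i) hu))) (polyInt_mem_polyIn hB)) ?_
      have := X.A.d_mem hy
      rw [sub_add_cancel] at this
      simpa using mul_X_pow_mem_polyIn (C_mem_polyIn this) 1
    classical
    set v' := Function.update v i ⟨⟨u, hu, huw⟩, ⟨_, hA⟩, ⟨C y, C_mem_polyIn hy⟩⟩ with hv'
    have hvv : ∀ j, M.res j < M.res i → v j = v' j := fun j hj => by
      rw [hv', Function.update_of_ne]
      rintro rfl
      exact lt_irrefl _ hj
    have e0 : v' i = ⟨⟨u, hu, huw⟩, ⟨_, hA⟩, ⟨C y, C_mem_polyIn hy⟩⟩ := Function.update_self ..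
    have e1 : g v' (M.z i) = M.z i + u := by rw [hgz, e0]
    have e2 : α v' (M.z i) = C (f'.π (M.z i + u)) + polyInt k _ B + C (X.A.d y) * Polynomial.X := by
      rw [hαz, e0]
    have e3 : β v' (M.z i) = C y := by rw [hβz, e0]
    have hdC : ∀ x, polyMap X.A.d (C x) = C (X.A.d x) := fun x => by
      ext n
      rw [coeff_polyMap, coeff_C, coeff_C]
      split_ifs <;> simp
    refine ⟨v', hvv, ?_, ?_, ?_, ?_, ?_⟩
    · rw [← hgr v v' _ hvv _ (hDz i), e1, h1]
    · have e4 : polyMap X.A.d (C (X.A.d y) * Polynomial.X) = 0 := by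
        ext n
        rw [coeff_polyMap]
        rcases n with _ | n
        · simp
        · rw [coeff_mul_X, coeff_C]
          split_ifs <;> simp [X.A.d_d]
      rw [← hαr v v' _ hvv _ (hDz i), e2, map_add, map_add, e4, hdC, ← polyInt_polyMap, ← hAB,
        polyInt_derivative, ← f'.π_D, h1, ← hP5 v _ hlt _ (hDz i), polyEv_zero]
      simp
    · rw [← hβr v v' _ hvv _ (hDz i), e2, e3, hdC, derivative_add, derivative_add,
        derivative_polyInt, hBdef]
      simp
    · rw [e2, map_add, map_add, map_mul, polyEv_C, polyEv_C, polyEv_X, hyy, map_one, mul_one]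
      abel
    · rw [e2, e1, polyEv_zero, coeff_add, coeff_add, coeff_polyInt_zero]
      simp

end FilteredModel

/-! ### Augmented homotopy types and perturbations -/

namespace DGCA

variable {k : Type u} [Field k] {H : GCA k}

/-- The augmentation of the source of a quasi-isomorphism to an augmented dgca. -/
theorem Hom.exists_cohIso {X : AugDGCA H} {C : DGCA k} (φ : DGCA.Hom C X.A) (hφ : φ.IsQuasiIso) :
    ∃ i : CohIso H C, ∀ h, φ.coh (i.toEquiv h) = X.i.toEquiv h := by
  let e : C.Coh ≃ₗ[k] X.A.Coh := LinearEquiv.ofBijective φ.coh hφ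
  have he : ∀ h, φ.coh ((X.i.toEquiv.trans e.symm) h) = X.i.toEquiv h := fun h =>
    e.apply_symm_apply _
  refine ⟨⟨X.i.toEquiv.trans e.symm, fun h => ?_, fun x y a b ha hb hab hx hy => ?_,
    fun n x hx => ?_⟩, he⟩
  · refine hφ.1 ((he 1).trans ?_)
    have h1 : X.A.d 1 = 0 := X.A.d_one
    refine (X.i.map_one h1).trans ?_
    rw [φ.coh_cls]
    congr 1
    exact (map_one _).symm
  · refine hφ.1 ((he _).trans ?_)
    have hx' : X.i.toEquiv x = _ := (he x).symm.trans ((congrArg φ.coh hx).trans (φ.coh_cls a ha))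
    have hy' : X.i.toEquiv y = _ := (he y).symm.trans ((congrArg φ.coh hy).trans (φ.coh_cls b hb))
    have h1 := X.i.map_mul x y _ _ _ _
      (by rw [← map_mul, ← φ.map_d, hab, map_zero]) hx' hy'
    refine h1.trans ?_
    rw [φ.coh_cls]
    congr 1
    exact (map_mul _ _ _).symm
  · obtain ⟨a, ha, hag, e1⟩ := X.i.map_gr n x hx
    obtain ⟨c, hc, e2⟩ := C.cls_surjective ((X.i.toEquiv.trans e.symm) x)
    have e3 := (he x).symm.trans ((congrArg φ.coh e2).trans (φ.coh_cls c hc))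
    obtain ⟨y, hy⟩ := (DGCA.cls_eq_iff _ _).1 (e3.symm.trans e1)
    have hd : ∀ m, C.d (gproj C.internal m c) = 0 := fun m => by rw [← gproj_d, hc, map_zero]
    refine ⟨gproj C.internal n c, hd n, gproj_mem _ _ _, hφ.1 ((he x).trans (e1.trans ?_))⟩
    rw [φ.coh_cls, DGCA.cls_eq_iff]
    refine ⟨-gproj X.A.internal (n - 1) y, ?_⟩
    have h4 := gproj_map C.internal X.A.internal φ.toAlgHom.toLinearMap 0
      (fun n a ha => by simpa using φ.map_gr ha) n c
    rw [add_zero] at h4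
    have h5 := X.A.gproj_d (n - 1) y
    rw [sub_add_cancel, hy, map_sub, gproj_of_mem _ hag, if_pos rfl] at h5
    rw [map_neg, ← h5, neg_sub]
    exact congrArg _ h4

end DGCA

namespace FilteredModel

variable {k : Type u} [Field k] {H : GCA k} {M : FilteredModel H}

theorem Perturbation.IsAugmentation.cls_eq {p : M.Perturbation} {i : CohIso H p.dgca}
    (hi : p.IsAugmentation i) {x : M.S} (hx : x ∈ M.resSub 1) :
    ∃ h : p.dgca.d x = 0, i.toEquiv (M.ρ x) = p.dgca.cls x h := by
  induction hx using Submodule.span_induction with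
  | mem x hx =>
    obtain ⟨l, hl, rfl⟩ := hx
    refine hi _ _ (FreeGCA.mono_mem_gr l) (M.wtLE_mono ?_ (FreeGCA.mono_mem_wtLE M.wt l))
    have h0 : (l.map M.res).sum = 0 := by
      refine List.sum_eq_zero fun x hx => ?_
      obtain ⟨j, hj, rfl⟩ := List.mem_map.1 hx
      have := hl j hj
      omega
    rw [sum_wt, h0, add_zero]
  | zero => exact ⟨map_zero _, by rw [map_zero, map_zero]; rfl⟩
  | add a b _ _ ha hb =>
    obtain ⟨h1, e1⟩ := ha
    obtain ⟨h2, e2⟩ := hb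
    refine ⟨(map_add _ _ _).trans (by rw [h1, h2, add_zero]), ?_⟩
    rw [map_add, map_add, e1, e2]
    rfl
  | smul c a _ ha =>
    obtain ⟨h1, e1⟩ := ha
    refine ⟨(map_smul _ _ _).trans (by rw [h1, smul_zero]), ?_⟩
    rw [map_smul, map_smul, e1]
    rfl

namespace ModelMap

variable {p q : M.Perturbation} {X Y : AugDGCA H}

/-- A model of an augmented dgca, as a map of dgca's. -/
def hom (f : ModelMap p X) : DGCA.Hom p.dgca X.A where
  toAlgHom := f.π
  map_gr := map_gr_of_gen f.π_gen
  map_d := f.π_D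

theorem coh_hom (f : ModelMap p X) {i : CohIso H p.dgca} (hi : p.IsAugmentation i)
    (h : H.carrier) : f.hom.coh (i.toEquiv h) = X.i.toEquiv h := by
  obtain ⟨x, hx, rfl⟩ := exists_ρ_eq_resSub (M := M) h
  obtain ⟨h1, e1⟩ := f.compat x hx
  obtain ⟨h2, e2⟩ := hi.cls_eq hx
  exact ((congrArg f.hom.coh e2).trans (f.hom.coh_cls x h2)).trans e1.symm

theorem isQuasiIso (f : ModelMap p X) : f.hom.IsQuasiIso := by
  obtain ⟨i, hi, -⟩ := p.existsUnique_augmentation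
  have h : f.hom.coh ∘ i.toEquiv = X.i.toEquiv := funext fun h => f.coh_hom hi h
  refine (Function.Bijective.of_comp_iff _ i.toEquiv.bijective).1 ?_
  rw [h]
  exact X.i.toEquiv.bijective

theorem sameAugType (f : ModelMap p X) (g : ModelMap p Y) : SameAugType X Y := by
  refine ⟨p.dgca, f.hom, g.hom, f.isQuasiIso, g.isQuasiIso, fun c => ?_⟩
  obtain ⟨i, hi, -⟩ := p.existsUnique_augmentation
  obtain ⟨h, rfl⟩ := i.toEquiv.surjective c
  rw [f.coh_hom hi, g.coh_hom hi, LinearEquiv.symm_apply_apply, LinearEquiv.symm_apply_apply]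

/-- Composition with a map of dgca's. -/
def comp {Z : AugDGCA H} (f : ModelMap p Z) (φ : DGCA.Hom Z.A X.A)
    (hφ : ∀ h, φ.coh (Z.i.toEquiv h) = X.i.toEquiv h) : ModelMap p X where
  π := φ.toAlgHom.comp f.π
  π_gen := fun i => φ.map_gr (f.π_gen i)
  π_D := fun a => (congrArg φ.toAlgHom (f.π_D a)).trans (φ.map_d _)
  compat := fun x hx => by
    obtain ⟨h, e⟩ := f.compat x hx
    refine ⟨(φ.map_d _).symm.trans ((congrArg φ.toAlgHom h).trans (map_zero _)), ?_⟩
    exact (hφ _).symm.trans ((congrArg φ.coh e).trans (φ.coh_cls _ h))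

/-- A perturbation is a model of its own dgca. -/
def self {i : CohIso H p.dgca} (hi : p.IsAugmentation i) : ModelMap p ⟨p.dgca, i⟩ where
  π := AlgHom.id k M.S
  π_gen := gen_mem_gr
  π_D := fun _ => rfl
  compat := fun _ hx => hi.cls_eq hx

end ModelMap

theorem Gauge.exists_modelMap {p q : M.Perturbation} (h : Gauge p q) {j : CohIso H q.dgca}
    (hj : q.IsAugmentation j) : Nonempty (ModelMap p ⟨q.dgca, j⟩) := by
  obtain ⟨g, hg, hgw, hgD⟩ := h
  refine ⟨⟨g, hg, hgD, fun x hx => compat_of_gen (fun i hi => ?_) hx⟩⟩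
  have e : g (M.z i) = M.z i := sub_eq_zero.1 (eq_zero_of_mem
    (Submodule.sub_mem _ (hg i) (gen_mem_gr i)) (hgw i) (by push_cast; omega))
  have hz : M.z i ∈ M.resSub 1 := mem_resSub_one (gen_mem_gr i)
    (M.wtLE_mono (by push_cast; omega) (gen_mem_wtLE i))
  obtain ⟨h1, h2⟩ := hj.cls_eq hz
  exact ⟨(congrArg q.dgca.d e).trans h1, h2.trans ((DGCA.cls_eq_iff _ _).2
    ⟨0, (map_zero _).trans (sub_eq_zero.2 e.symm).symm⟩)⟩

theorem Gauge.trans {p q r : M.Perturbation} (h : Gauge p q) (h' : Gauge q r) : Gauge p r := by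
  obtain ⟨g, hg, hgw, hgD⟩ := h
  obtain ⟨g', hg', hgw', hgD'⟩ := h'
  refine ⟨g'.comp g, fun i => map_gr hg' (hg i), fun i => ?_, fun a => ?_⟩
  · have h1 : g (M.z i) ∈ M.wtLE (M.wt i) := map_wtLE_of_gen hgw (gen_mem_wtLE i)
    have := Submodule.add_mem _ (sub_mem_wtLE_of_gen hgw' h1) (hgw i)
    rwa [sub_add_sub_cancel] at this
  · rw [AlgHom.comp_apply, AlgHom.comp_apply, hgD, hgD']

theorem exists_modelMap_of_sameAugType {X Y : AugDGCA H} (h : SameAugType X Y) :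
    ∃ p : M.Perturbation, Nonempty (ModelMap p X) ∧ Nonempty (ModelMap p Y) := by
  obtain ⟨C, φ, ψ, hφ, hψ, e⟩ := h
  obtain ⟨i, hi⟩ := φ.exists_cohIso hφ
  obtain ⟨p, ⟨f⟩⟩ := exists_modelMap (M := M) ⟨C, i⟩
  refine ⟨p, ⟨f.comp φ hi⟩, ⟨f.comp ψ fun h => ?_⟩⟩
  have h1 := e (i.toEquiv h)
  rw [hi, LinearEquiv.symm_apply_apply] at h1
  exact ((LinearEquiv.eq_symm_apply _).1 h1).symm

theorem sameAugType_iff_gauge [CharZero k] {p q : M.Perturbation} {i : CohIso H p.dgca}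
    {j : CohIso H q.dgca} (hi : p.IsAugmentation i) (hj : q.IsAugmentation j) :
    SameAugType ⟨p.dgca, i⟩ ⟨q.dgca, j⟩ ↔ Gauge p q := by
  constructor
  · intro h
    obtain ⟨r, ⟨f⟩, ⟨g⟩⟩ := exists_modelMap_of_sameAugType (M := M) h
    exact (gauge_of_modelMap (ModelMap.self hi) f).trans (gauge_of_modelMap g (ModelMap.self hj))
  · intro h
    obtain ⟨f⟩ := h.exists_modelMap hj
    exact (ModelMap.self hi).sameAugType f

theorem Gauge.sameAugType {p q : M.Perturbation} (h : Gauge p q) {i : CohIso H p.dgca}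
    {j : CohIso H q.dgca} (hi : p.IsAugmentation i) (hj : q.IsAugmentation j) :
    SameAugType ⟨p.dgca, i⟩ ⟨q.dgca, j⟩ := by
  obtain ⟨f⟩ := h.exists_modelMap hj
  exact (ModelMap.self hi).sameAugType f

variable (M) in
/-- Augmented homotopy types are the gauge equivalence classes of perturbations. -/
theorem exists_augHomotopyType_equiv [CharZero k] : ∃ Φ : AugHomotopyType H ≃ Quot (@Gauge k _ H M),
    ∀ (p : M.Perturbation) (i : CohIso H p.dgca), p.IsAugmentation i →
      Φ (Quot.mk SameAugType ⟨p.dgca, i⟩) = Quot.mk Gauge p := by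
  choose P hP using fun X : AugDGCA H => exists_modelMap (M := M) X
  choose i hi hi' using fun p : M.Perturbation => p.existsUnique_augmentation
  let Φ : AugHomotopyType H → Quot (@Gauge k _ H M) := Quot.map P fun X Y h => by
    obtain ⟨r, ⟨f⟩, ⟨g⟩⟩ := exists_modelMap_of_sameAugType (M := M) h
    exact (gauge_of_modelMap (hP X).some f).trans (gauge_of_modelMap g (hP Y).some)
  let Ψ : Quot (@Gauge k _ H M) → AugHomotopyType H :=
    Quot.map (fun p => (⟨p.dgca, i p⟩ : AugDGCA H)) fun p q h => h.sameAugType (hi p) (hi q)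
  have h1 : ∀ (p : M.Perturbation) (i : CohIso H p.dgca), p.IsAugmentation i →
      Φ (Quot.mk SameAugType ⟨p.dgca, i⟩) = Quot.mk Gauge p := fun p i hi =>
    Quot.sound (gauge_of_modelMap (hP _).some (ModelMap.self hi))
  refine ⟨⟨Φ, Ψ, ?_, ?_⟩, h1⟩
  · rintro ⟨X⟩
    exact Quot.sound ((ModelMap.self (hi _)).sameAugType (hP X).some)
  · rintro ⟨p⟩
    exact h1 p _ (hi p)

end FilteredModel

/-! ### Polynomial paths of perturbations -/

section PolyPath

open Polynomial

variable {k : Type u} [Field k] {A B : Type u} [Ring A] [Algebra k A] [Ring B] [Algebra k B]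

/-- A locally finite family of linear maps, as a map to polynomials. -/
theorem exists_polynomial_coeff {V : Type u} [AddCommGroup V] [Module k V] (F : ℕ → V →ₗ[k] B)
    (h : ∀ a, ∃ N, ∀ n, N ≤ n → F n a = 0) :
    ∃ y : V →ₗ[k] B[X], ∀ a n, (y a).coeff n = F n a := by
  choose N hN using h
  have hc : ∀ a n, (∑ m ∈ Finset.range (N a), monomial m (F m a)).coeff n = F n a := fun a n => by
    rw [finsetSum_coeff]
    simp only [coeff_monomial, Finset.sum_ite_eq', Finset.mem_range]
    split_ifs with hn
    · rfl
    · exact (hN a n (by omega)).symm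
  refine ⟨⟨⟨fun a => ∑ m ∈ Finset.range (N a), monomial m (F m a), fun a b => ?_⟩, fun c a => ?_⟩,
    hc⟩
  · ext n
    rw [coeff_add, hc, hc, hc, map_add]
  · ext n
    dsimp only
    rw [RingHom.id_apply, coeff_smul, hc, hc, map_smul]

variable (k A) in
/-- The derivative, as a linear map over the ground field. -/
def polyD : A[X] →ₗ[k] A[X] where
  toFun := derivative
  map_add' := map_add _
  map_smul' c p := by rw [RingHom.id_apply]; exact derivative_smul c p

theorem polyD_apply (p : A[X]) : polyD k A p = derivative p := rfl

theorem polyExt_comp {C' : Type u} [Ring C'] [Algebra k C'] (y : B →ₗ[k] C'[X]) (y' : A →ₗ[k] B[X]) :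
    polyExt y ∘ₗ polyExt y' = polyExt (polyExt y ∘ₗ y') :=
  polyLinear_ext (fun p n => by simp only [LinearMap.comp_apply, polyExt_mul_X_pow])
    (fun p n => polyExt_mul_X_pow _ _ _) fun a => by
      rw [LinearMap.comp_apply, polyExt_C, polyExt_C, LinearMap.comp_apply]

theorem derivative_polyExt (y : A →ₗ[k] B[X]) (p : A[X]) :
    derivative (polyExt y p) = polyExt y (derivative p) + polyExt (polyD k B ∘ₗ y) p := by
  suffices h : polyD k B ∘ₗ polyExt y = polyExt y ∘ₗ polyD k A + polyExt (polyD k B ∘ₗ y) from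
    DFunLike.congr_fun h p
  refine poly_ext fun n a => ?_
  simp only [LinearMap.comp_apply, LinearMap.add_apply, polyD_apply, polyExt_monomial,
    derivative_monomial, derivative_mul]
  have h1 : a * (n : A) = (n : k) • a := by
    rw [Algebra.smul_def, map_natCast, Nat.cast_comm]
  have h2 : (C (n : B) : B[X]) = (n : k) • 1 := by
    rw [map_natCast C, Algebra.smul_def, mul_one, map_natCast]
  rw [h1, map_smul, add_comm, derivative_X_pow, h2, smul_mul_assoc, smul_mul_assoc, one_mul,
    mul_smul_comm]

theorem polyExt_derivative_comm {f : A →ₗ[k] B} (p : A[X]) :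
    derivative (polyMap f p) = polyMap f (derivative p) := by
  ext n
  rw [coeff_derivative' (k := k), coeff_polyMap, coeff_polyMap, coeff_derivative' (k := k), map_smul]

theorem sum_antidiagonal_snd_zero {V : Type u} [AddCommGroup V] (n : ℕ) (F : ℕ → V) :
    ∑ ij ∈ Finset.HasAntidiagonal.antidiagonal n, (if ij.2 = 0 then F ij.1 else 0) = F n := by
  rw [Finset.sum_eq_single (n, 0)]
  · simp
  · rintro ⟨i, j⟩ hij hne
    rw [if_neg]
    rintro rfl
    rw [Finset.HasAntidiagonal.mem_antidiagonal] at hij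
    exact hne (by simpa using hij)
  · intro h
    exact absurd (Finset.HasAntidiagonal.mem_antidiagonal.2 (by simp)) h

theorem sum_antidiagonal_fst_zero {V : Type u} [AddCommGroup V] (n : ℕ) (F : ℕ → V) :
    ∑ ij ∈ Finset.HasAntidiagonal.antidiagonal n, (if ij.1 = 0 then F ij.2 else 0) = F n := by
  rw [← Finset.Nat.sum_antidiagonal_swap]
  exact sum_antidiagonal_snd_zero n F

theorem eq_zero_of_eventually {V : Type u} [AddCommGroup V] [Module k V] {T : V →ₗ[k] V} {a : V}
    (h : T a = a) {n : ℕ} (hn : (T ^ n) a = 0) : a = 0 := by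
  rw [← hn]
  clear hn
  induction n with
  | zero => rfl
  | succ n ih => rw [pow_succ, Module.End.mul_apply, h, ← ih]

theorem sum_pow_sub {V : Type u} [AddCommGroup V] [Module k V] {T : V →ₗ[k] V} {a : V}
    {n : ℕ} (hn : (T ^ n) a = 0) :
    (∑ m ∈ Finset.range n, (T ^ m) a) - T (∑ m ∈ Finset.range n, (T ^ m) a) = a := by
  have h : ∀ m, T ((T ^ m) a) = (T ^ (m + 1)) a := fun m => by
    rw [pow_succ', Module.End.mul_apply]
  rw [map_sum, ← Finset.sum_sub_distrib]
  simp only [h]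
  rw [Finset.sum_range_sub', hn, pow_zero, sub_zero]
  rfl

/-- A map which differs from the identity by a locally nilpotent map is bijective. -/
theorem bijective_of_locally_nilpotent {V : Type u} [AddCommGroup V] [Module k V] {G : V →ₗ[k] V}
    (h : ∀ a, ∃ n, ((LinearMap.id - G : V →ₗ[k] V) ^ n) a = 0) : Function.Bijective G := by
  constructor
  · refine (injective_iff_map_eq_zero G).2 fun a ha => ?_
    obtain ⟨n, hn⟩ := h a
    exact eq_zero_of_eventually (T := LinearMap.id - G)
      (by rw [LinearMap.sub_apply, ha, sub_zero, LinearMap.id_apply]) hn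
  · intro a
    obtain ⟨n, hn⟩ := h a
    have := sum_pow_sub hn
    rw [LinearMap.sub_apply, LinearMap.id_apply, sub_sub_cancel] at this
    exact ⟨_, this⟩

theorem mem_of_locally_nilpotent {V : Type u} [AddCommGroup V] [Module k V] {G : V →ₗ[k] V}
    (h : ∀ a, ∃ n, ((LinearMap.id - G : V →ₗ[k] V) ^ n) a = 0) {N : Submodule k V}
    (hN : ∀ a ∈ N, G a ∈ N) {a : V} (ha : G a ∈ N) : a ∈ N := by
  obtain ⟨n, hn⟩ := h (G a)
  have := sum_pow_sub hn
  rw [LinearMap.sub_apply, LinearMap.id_apply, sub_sub_cancel] at this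
  rw [← (bijective_of_locally_nilpotent h).1 this]
  refine Submodule.sum_mem _ fun m hm => ?_
  clear hn this hm
  induction m with
  | zero => exact ha
  | succ m ih =>
    rw [pow_succ', Module.End.mul_apply]
    exact Submodule.sub_mem _ ih (hN _ ih)

end PolyPath

namespace FilteredModel

open Polynomial

variable {k : Type u} [Field k] {H : GCA k} {M : FilteredModel H}

/-- A polynomial path `∑ tⁿ P n + ∑ tⁿ dt Y n` of perturbations: a Maurer-Cartan element of
`L[t, dt]`. -/
structure PolyPath (M : FilteredModel H) where
  P : ℕ → M.S →ₗ[k] M.S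
  Y : ℕ → M.S →ₗ[k] M.S
  P_mem : ∀ n, P n ∈ M.der 1 1
  Y_mem : ∀ n, Y n ∈ M.der 0 1
  fin : ∀ a, ∃ N, ∀ n, N ≤ n → P n a = 0 ∧ Y n a = 0
  mc : ∀ n a, M.d (P n a) + P n (M.d a) +
    ∑ ij ∈ Finset.HasAntidiagonal.antidiagonal n, P ij.1 (P ij.2 a) = 0
  ev : ∀ (n : ℕ) a, ((n : k) + 1) • P (n + 1) a = Y n (M.d a) - M.d (Y n a) +
    ∑ ij ∈ Finset.HasAntidiagonal.antidiagonal n, (Y ij.1 (P ij.2 a) - P ij.2 (Y ij.1 a))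

theorem der_zero_mul {θ : M.S →ₗ[k] M.S} {p : ℕ} (h : θ ∈ M.der 0 p) (a b : M.S) :
    θ (a * b) = θ a * b + a * θ b := by
  refine graded_induction FreeGCA.isInternal_gr
    (p := fun a => θ (a * b) = θ a * b + a * θ b) ?_ ?_ ?_ a
  · intro m a ha
    rw [h.2.1 m a ha, zero_mul, sgn_zero, one_smul]
  · rw [zero_mul, map_zero, zero_mul, zero_mul, add_zero]
  · intro a a' ha ha'
    rw [add_mul, map_add, ha, ha', map_add, add_mul, add_mul]
    abel

theorem pow_eq_zero_of_lower {T : M.S[X] →ₗ[k] M.S[X]}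
    (hT : ∀ w, ∀ f ∈ polyIn (M.wtLE w), T f ∈ polyIn (M.wtLE (w - 1))) (f : M.S[X]) :
    ∃ n, (T ^ n) f = 0 := by
  have hTn : ∀ (n : ℕ) w, ∀ f ∈ polyIn (M.wtLE w), (T ^ n) f ∈ polyIn (M.wtLE (w - n)) := by
    intro n
    induction n with
    | zero => intro w f hf; simpa using hf
    | succ n ih =>
      intro w f hf
      rw [pow_succ, Module.End.mul_apply]
      have := ih _ _ (hT w f hf)
      rwa [sub_sub, add_comm, ← Nat.cast_succ] at this
  choose w hw using fun a : M.S => FreeGCA.exists_mem_wtLE M.wt a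
  have hf : f ∈ polyIn (M.wtLE (f.support.sup (fun n => w (f.coeff n)) : ℕ)) := fun n => by
    by_cases hn : n ∈ f.support
    · exact M.wtLE_mono (by exact_mod_cast Finset.le_sup (f := fun n => w (f.coeff n)) hn)
        (hw (f.coeff n))
    · rw [notMem_support_iff.1 hn]
      exact Submodule.zero_mem _
  refine ⟨f.support.sup (fun n => w (f.coeff n)) + 1, ?_⟩
  ext n
  have := hTn (f.support.sup (fun n => w (f.coeff n)) + 1) _ f hf n
  rw [show M.wtLE (((f.support.sup (fun n => w (f.coeff n)) : ℕ) : ℤ) -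
    (f.support.sup (fun n => w (f.coeff n)) + 1 : ℕ)) = ⊥ from
    FreeGCA.wtLE_neg (wt := M.wt) (by push_cast; omega)] at this
  simpa using this

/-- The flow of a weight decreasing polynomial vector field. -/
theorem exists_flow [CharZero k] (η : M.S →ₗ[k] M.S[X])
    (hη : ∀ w, ∀ a ∈ M.wtLE w, η a ∈ polyIn (M.wtLE (w - 1)))
    (hgr : ∀ m, ∀ a ∈ M.gr m, η a ∈ polyIn (M.gr m)) (hmul : ∀ a b, η (a * b) = η a * C b + C a * η b) :
    ∃ r : M.S →ₐ[k] M.S[X], (∀ a, (r a).coeff 0 = a) ∧ (∀ a, derivative (r a) = polyExt η (r a)) ∧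
      (∀ f : M.S[X], derivative f = polyExt η f → f = r (f.coeff 0)) ∧
      (∀ m, ∀ a ∈ M.gr m, r a ∈ polyIn (M.gr m)) ∧
      ∀ w, ∀ a ∈ M.wtLE w, r a - C a ∈ polyIn (M.wtLE (w - 1)) := by
  set T : M.S[X] →ₗ[k] M.S[X] := polyInt k M.S ∘ₗ polyExt η with hT
  have hTw : ∀ w, ∀ f ∈ polyIn (M.wtLE w), T f ∈ polyIn (M.wtLE (w - 1)) := fun w f hf =>
    polyInt_mem_polyIn (polyExt_mem_polyIn (hη w) hf)
  have hTg : ∀ m, ∀ f ∈ polyIn (M.gr m), T f ∈ polyIn (M.gr m) := fun m f hf =>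
    polyInt_mem_polyIn (polyExt_mem_polyIn (hgr m) hf)
  have hTn : ∀ (n : ℕ) w, ∀ f ∈ polyIn (M.wtLE w), (T ^ n) f ∈ polyIn (M.wtLE (w - n)) := by
    intro n
    induction n with
    | zero => intro w f hf; simpa using hf
    | succ n ih =>
      intro w f hf
      rw [pow_succ, Module.End.mul_apply]
      have := ih _ _ (hTw w f hf)
      rwa [sub_sub, add_comm, ← Nat.cast_succ] at this
  have hTgn : ∀ (n : ℕ) m, ∀ f ∈ polyIn (M.gr m), (T ^ n) f ∈ polyIn (M.gr m) := by
    intro n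
    induction n with
    | zero => intro w f hf; simpa using hf
    | succ n ih =>
      intro w f hf
      rw [pow_succ, Module.End.mul_apply]
      exact ih _ _ (hTg w f hf)
  have hnil := pow_eq_zero_of_lower hTw
  have hK : ∀ f : M.S[X], derivative f = polyExt η f → f - T f = C (f.coeff 0) := fun f hf => by
    rw [hT, LinearMap.comp_apply, ← hf, polyInt_derivative, sub_sub_cancel]
  have hun : ∀ f f' : M.S[X], derivative f = polyExt η f → derivative f' = polyExt η f' →
      f.coeff 0 = f'.coeff 0 → f = f' := fun f f' hf hf' h => by
    obtain ⟨n, hn⟩ := hnil (f - f')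
    refine sub_eq_zero.1 (eq_zero_of_eventually (T := T) ?_ hn)
    have h1 := hK f hf
    have h2 := hK f' hf'
    rw [← h, ← h1] at h2
    rw [map_sub, ← sub_eq_zero]
    calc T f - T f' - (f - f') = (f' - T f') - (f - T f) := by abel
      _ = 0 := by rw [h2, sub_self]
  have hex : ∀ a, ∃ f : M.S[X], f.coeff 0 = a ∧ derivative f = polyExt η f ∧
      (∀ m, a ∈ M.gr m → f ∈ polyIn (M.gr m)) ∧
      ∀ w, a ∈ M.wtLE w → f - C a ∈ polyIn (M.wtLE (w - 1)) := fun a => by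
    obtain ⟨n, hn⟩ := hnil (C a)
    have h1 := sum_pow_sub hn
    set f := ∑ m ∈ Finset.range n, (T ^ m) (C a) with hf
    have h2 : f = C a + T f := by rw [← h1]; abel
    refine ⟨f, ?_, ?_, fun m ha => ?_, fun w ha => ?_⟩
    · rw [h2, coeff_add, hT, LinearMap.comp_apply, coeff_polyInt_zero, coeff_C_zero, add_zero]
    · have := congrArg derivative h2
      rwa [derivative_add, derivative_C, zero_add, hT, LinearMap.comp_apply,
        derivative_polyInt] at this
    · exact Submodule.sum_mem _ fun j _ => hTgn j m _ (C_mem_polyIn ha)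
    · have h3 : f - C a = T f := by rw [← h1]; abel
      rw [h3]
      refine hTw _ _ (Submodule.sum_mem _ fun j _ n => ?_)
      exact M.wtLE_mono (by omega) (hTn j w _ (C_mem_polyIn ha) n)
  choose r hr0 hrd hrg hrw using hex
  have hmul' : ∀ f f' : M.S[X], polyExt η (f * f') = polyExt η f * f' + f * polyExt η f' :=
    fun f f' => by
      have := polyExt_mul (y := η) (Q := ⊤) (c := 1)
        (fun a _ b => by rw [one_smul, hmul]) (p := f) (fun _ => Submodule.mem_top) f'
      rwa [one_smul] at this
  let R : M.S →ₗ[k] M.S[X] :=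
    { toFun := r
      map_add' := fun a b => hun _ _ (hrd _) (by rw [derivative_add, hrd, hrd, map_add])
        (by rw [coeff_add, hr0, hr0, hr0])
      map_smul' := fun c a => hun _ _ (hrd _)
        (by
          rw [RingHom.id_apply]
          exact (derivative_smul c _).trans (by rw [hrd, map_smul]))
        (by rw [RingHom.id_apply, coeff_smul, hr0, hr0]) }
  refine ⟨AlgHom.ofLinearMap R ?_ ?_, hr0, hrd, ?_, fun m a ha => hrg a m ha, fun w a ha => hrw a w ha⟩
  · refine hun _ _ (hrd _) ?_ ?_
    · have h1 : η 1 = 0 := by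
        have := hmul 1 1
        rw [mul_one, C_1, mul_one, one_mul] at this
        exact left_eq_add.1 this
      rw [derivative_one, ← C_1, polyExt_C, h1]
    · exact (hr0 1).trans coeff_one_zero.symm
  · intro a b
    refine hun _ _ (hrd _) ?_ ?_
    · change derivative (r a * r b) = polyExt η (r a * r b)
      rw [derivative_mul, hmul', hrd, hrd]
    · refine (hr0 _).trans ?_
      change a * b = (r a * r b).coeff 0
      rw [mul_coeff_zero, hr0, hr0]
  · exact fun f hf => hun _ _ hf (hrd _) (hr0 _).symm

theorem polyEv_polyExt {δ : M.S →ₗ[k] M.S[X]} (c : k) (f : M.S[X]) :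
    polyEv k M.S c (polyExt δ f) =
      polyEv k M.S c (δ (polyEv k M.S c f)) := by
  induction f using Polynomial.induction_on' with
  | add p q hp hq => rw [map_add, map_add, hp, hq, map_add, map_add, map_add]
  | monomial n a =>
    rw [polyExt_monomial, monomial_eq, map_mul, map_pow, polyEv_X, map_mul, map_pow, polyEv_X,
      polyEv_C, ← map_pow, ← Algebra.commutes, ← Algebra.commutes, ← Algebra.smul_def,
      ← Algebra.smul_def, map_smul, map_smul]

/-- The ends of a polynomial path differ by a gauge transformation. -/
theorem PolyPath.gauge [CharZero k] (c : PolyPath M) {p q : M.Perturbation} (h0 : c.P 0 = p.p)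
    (h1 : ∀ a, ∃ N, ∀ n, N ≤ n → ∑ j ∈ Finset.range n, c.P j a = q.p a) : Gauge p q := by
  let D : ℕ → M.S →ₗ[k] M.S := fun n => if n = 0 then M.d + c.P 0 else c.P n
  have hD0 : D 0 = M.d + c.P 0 := if_pos rfl
  have hDs : ∀ n, D (n + 1) = c.P (n + 1) := fun n => if_neg (Nat.succ_ne_zero n)
  obtain ⟨η, hη⟩ := exists_polynomial_coeff c.Y fun a => by
    obtain ⟨N, hN⟩ := c.fin a
    exact ⟨N, fun n hn => (hN n hn).2⟩
  obtain ⟨δ, hδ⟩ := exists_polynomial_coeff D fun a => by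
    obtain ⟨N, hN⟩ := c.fin a
    refine ⟨N + 1, fun n hn => ?_⟩
    obtain ⟨n, rfl⟩ : ∃ m, n = m + 1 := ⟨n - 1, by omega⟩
    rw [hDs]
    exact (hN _ (by omega)).1
  obtain ⟨r, hr0, hrd, hru, hrg, hrw⟩ := exists_flow η
    (fun w a ha n => by rw [hη]; exact_mod_cast (c.Y_mem n).2.2 w a ha)
    (fun m a ha n => by rw [hη]; simpa using (c.Y_mem n).1 m a ha)
    (fun a b => by
      ext n
      rw [coeff_add, coeff_mul_C, coeff_C_mul, hη, hη, hη, der_zero_mul (c.Y_mem n)])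
  have hev : ∀ a, derivative (δ a) = polyExt η (δ a) - polyExt δ (η a) := fun a => by
    ext n
    rw [coeff_derivative' (k := k), coeff_sub, coeff_polyExt, coeff_polyExt, hδ, hDs, c.ev]
    simp only [hη, hδ]
    have hDj : ∀ j x, D j x = c.P j x + if j = 0 then M.d x else 0 := fun j x => by
      rcases j with _ | j
      · rw [hD0, if_pos rfl, LinearMap.add_apply, add_comm]
      · rw [hDs, if_neg (Nat.succ_ne_zero j), add_zero]
    rw [← Finset.Nat.sum_antidiagonal_swap (f := fun ij => D ij.1 (c.Y ij.2 a)),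
      ← Finset.sum_sub_distrib]
    simp only [hDj, Prod.fst_swap, Prod.snd_swap, map_add, apply_ite (c.Y _), map_zero]
    rw [← sum_antidiagonal_snd_zero n fun i => c.Y i (M.d a),
      ← sum_antidiagonal_snd_zero n fun i => M.d (c.Y i a), ← Finset.sum_sub_distrib, ← Finset.sum_add_distrib]
    refine Finset.sum_congr rfl fun ij _ => ?_
    abel
  have hcomm : ∀ f, derivative (polyExt δ f) - polyExt η (polyExt δ f) =
      polyExt δ (derivative f - polyExt η f) := fun f => by
    have h : polyD k M.S ∘ₗ δ = polyExt η ∘ₗ δ - polyExt δ ∘ₗ η := LinearMap.ext hev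
    have h2 : polyExt (polyD k M.S ∘ₗ δ) f = polyExt η (polyExt δ f) - polyExt δ (polyExt η f) := by
      have e1 := DFunLike.congr_fun (polyExt_comp η δ) f
      have e2 := DFunLike.congr_fun (polyExt_comp δ η) f
      rw [LinearMap.comp_apply] at e1 e2
      rw [e1, e2, h, ← LinearMap.sub_apply]
      congr 1
      refine poly_ext fun n a => ?_
      simp only [LinearMap.sub_apply, polyExt_monomial, sub_mul]
    rw [derivative_polyExt, h2, map_sub]
    abel
  have hδ0 : ∀ a, polyEv k M.S 0 (δ a) = (M.d + p.p) a := fun a => by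
    rw [polyEv_zero, hδ, hD0, h0]
  have hδ1 : ∀ a, polyEv k M.S 1 (δ a) = (M.d + q.p) a := fun a => by
    obtain ⟨N, hN⟩ := h1 a
    rw [polyEv_apply, eval₂_eq_sum_range' (n := max ((δ a).natDegree + 1) (N + 1)) _
      (lt_of_lt_of_le (Nat.lt_succ_self _) (le_max_left _ _))]
    simp only [map_one, one_pow, mul_one, RingHom.id_apply, hδ]
    rw [LinearMap.add_apply, ← hN (max ((δ a).natDegree + 1) (N + 1)) (by omega)]
    obtain ⟨m, hm⟩ : ∃ m, max ((δ a).natDegree + 1) (N + 1) = m + 1 := ⟨_, (Nat.succ_pred (by omega)).symm⟩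
    rw [hm, Finset.sum_range_succ', Finset.sum_range_succ', hD0, LinearMap.add_apply]
    simp only [hDs]
    abel
  have hrD : ∀ a, polyExt δ (r a) = r ((M.d + p.p) a) := fun a => by
    have h2 : derivative (polyExt δ (r a)) = polyExt η (polyExt δ (r a)) := by
      rw [← sub_eq_zero, hcomm, hrd, sub_self, map_zero]
    rw [hru _ h2]
    congr 1
    rw [← polyEv_zero (k := k), polyEv_polyExt, polyEv_zero (r a), hr0, hδ0]
  refine ⟨(polyEv k M.S 1).comp r, fun i => polyEv_mem (hrg _ _ (gen_mem_gr i)) 1, fun i => ?_,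
    fun a => ?_⟩
  · have := polyEv_mem (hrw _ _ (gen_mem_wtLE i)) 1
    rwa [map_sub, polyEv_C] at this
  · rw [AlgHom.comp_apply, AlgHom.comp_apply, ← hrD, polyEv_polyExt, hδ1]

end FilteredModel

/-! ### The path associated with a gauge transformation -/

namespace FilteredModel

open Polynomial

variable {k : Type u} [Field k] {H : GCA k} {M : FilteredModel H}

variable (M) in
/-- The polynomials in `X` over `S Z` which have weight at most `w` if `X` has weight `1`. -/
def polyWt (w : ℤ) : Submodule k M.S[X] where
  carrier := {f | ∀ n : ℕ, f.coeff n ∈ M.wtLE (w - n)}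
  add_mem' := fun hp hq n => by rw [coeff_add]; exact Submodule.add_mem _ (hp n) (hq n)
  zero_mem' := fun n => by rw [coeff_zero]; exact Submodule.zero_mem _
  smul_mem' := fun c p hp n => by rw [coeff_smul]; exact Submodule.smul_mem _ c (hp n)

theorem polyWt_mul {v w : ℤ} {f g : M.S[X]} (hf : f ∈ M.polyWt v) (hg : g ∈ M.polyWt w) :
    f * g ∈ M.polyWt (v + w) := fun n => by
  rw [coeff_mul]
  refine Submodule.sum_mem _ fun ij hij => ?_
  have h : ij.1 + ij.2 = n := Finset.HasAntidiagonal.mem_antidiagonal.1 hij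
  exact M.wtLE_mono (by omega) (FreeGCA.mul_mem_wtLE (hf ij.1) (hg ij.2))

theorem polyWt_C {w : ℤ} {a : M.S} (ha : a ∈ M.wtLE w) : C a ∈ M.polyWt w := fun n => by
  rw [coeff_C]
  split_ifs with h
  · subst h; simpa using ha
  · exact Submodule.zero_mem _

theorem polyWt_mul_X_pow {w : ℤ} {f : M.S[X]} (hf : f ∈ M.polyWt w) (m : ℕ) :
    f * X ^ m ∈ M.polyWt (w + m) := fun n => by
  rw [coeff_mul_X_pow']
  split_ifs with h
  · exact M.wtLE_mono (by omega) (hf _)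
  · exact Submodule.zero_mem _

theorem polyWt_mono {v w : ℤ} (h : v ≤ w) : M.polyWt v ≤ M.polyWt w := fun _ hf n =>
  M.wtLE_mono (by omega) (hf n)

/-- The straight line from the identity to a weight-unipotent automorphism. -/
theorem exists_line {g : M.S →ₐ[k] M.S} (hg : ∀ i, g (M.z i) ∈ M.gr (M.deg i))
    (hgw : ∀ i, g (M.z i) - M.z i ∈ M.wtLE (M.wt i - 1)) :
    ∃ G : M.S[X] →ₐ[k] M.S[X], (∀ f n, G (f * X ^ n) = G f * X ^ n) ∧
      (∀ f, (G f).coeff 0 = f.coeff 0) ∧ (∀ f, polyEv k M.S 1 (G f) = g (polyEv k M.S 1 f)) ∧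
      (∀ m, ∀ f ∈ polyIn (M.gr m), G f ∈ polyIn (M.gr m)) ∧
      (∀ w, ∀ f ∈ M.polyWt w, G f ∈ M.polyWt w) ∧
      ∀ w, ∀ f ∈ polyIn (M.wtLE w), f - G f ∈ polyIn (M.wtLE (w - 1)) := by
  have hv : ∀ i, C (M.z i) + C (g (M.z i) - M.z i) * X ^ 1 ∈
      polyIn ((FreeGCA.gca k M.deg).gr (M.deg i)) := fun i => Submodule.add_mem _
    (C_mem_polyIn (gen_mem_gr i)) (mul_X_pow_mem_polyIn (C_mem_polyIn
      (Submodule.sub_mem _ (hg i) (gen_mem_gr i))) 1)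
  let G₀ : M.S →ₐ[k] M.S[X] := FreeGCA.lift
    (fun i => C (M.z i) + C (g (M.z i) - M.z i) * X ^ 1) fun i j =>
      (FreeGCA.gca k M.deg).poly_comm (hv i) (hv j)
  have hG₀ : ∀ i, G₀ (M.z i) = C (M.z i) + C (g (M.z i) - M.z i) * X ^ 1 := fun i =>
    FreeGCA.lift_gen _ _ i
  let G : M.S[X] →ₐ[k] M.S[X] := Polynomial.eval₂AlgHom G₀ X fun a => (X_mul (p := G₀ a)).symm
  have hGC : ∀ a, G (C a) = G₀ a := fun a => eval₂_C _ _
  have hGX : G X = X := eval₂_X _ _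
  have hGm : ∀ f n, G (f * X ^ n) = G f * X ^ n := fun f n => by rw [map_mul, map_pow, hGX]
  have hGmon : ∀ n a, G (monomial n a) = G₀ a * X ^ n := fun n a => by rw [monomial_eq, hGm, hGC]
  have hGsum : ∀ (Q : Submodule k M.S[X]) (f : M.S[X]),
      (∀ n, G₀ (f.coeff n) * X ^ n ∈ Q) → G f ∈ Q := fun Q f h => by
    rw [f.as_sum_range, map_sum]
    refine Submodule.sum_mem _ fun n _ => ?_
    rw [hGmon]
    exact h n
  have h0 : ∀ a, (G₀ a).coeff 0 = a := fun a => by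
    have : ((polyEv k M.S 0).comp G₀) = AlgHom.id k M.S := FreeGCA.algHom_ext fun i => by
      rw [AlgHom.comp_apply]
      refine (congrArg _ (hG₀ i)).trans ?_
      rw [polyEv_zero]
      simp [FilteredModel.z]
    rw [← polyEv_zero (k := k)]
    exact DFunLike.congr_fun this a
  have h1 : ∀ a, polyEv k M.S 1 (G₀ a) = g a := fun a => by
    have : ((polyEv k M.S 1).comp G₀) = g := FreeGCA.algHom_ext fun i => by
      rw [AlgHom.comp_apply]
      refine (congrArg _ (hG₀ i)).trans ?_
      rw [map_add, map_mul, map_pow, polyEv_X, polyEv_C, polyEv_C]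
      simp [FilteredModel.z]
    exact DFunLike.congr_fun this a
  have hgr : ∀ m, ∀ a ∈ M.gr m, G₀ a ∈ polyIn (M.gr m) := fun m a ha => by
    refine Submodule.span_le (p := (polyIn (M.gr m)).comap G₀.toLinearMap).2 ?_ ha
    rintro _ ⟨l, rfl, rfl⟩
    exact_mod_cast FreeGCA.map_mem_of_gen (α := G₀) (Q := fun n => polyIn (M.gr n)) (wt := M.deg)
      (C_mem_polyIn FreeGCA.one_mem_gr)
      (fun m n a b ha hb => mul_mem_polyIn (fun _ hx _ hy => FreeGCA.mul_mem_gr hx hy) ha hb)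
      (fun i => by rw [hG₀]; exact hv i) l
  have hW : ∀ w, ∀ a ∈ M.wtLE w, G₀ a ∈ M.polyWt w := fun w a ha => by
    refine Submodule.span_le (p := (M.polyWt w).comap G₀.toLinearMap).2 ?_ ha
    rintro _ ⟨l, hl, rfl⟩
    refine polyWt_mono hl ?_
    refine FreeGCA.map_mem_of_gen (α := G₀) (Q := M.polyWt) (wt := M.wt)
      (polyWt_C (FreeGCA.one_mem_wtLE M.wt)) (fun m n a b ha hb => polyWt_mul ha hb) (fun i => ?_) l
    rw [hG₀]
    refine Submodule.add_mem _ (polyWt_C (gen_mem_wtLE i)) ?_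
    have := polyWt_mul_X_pow (polyWt_C (hgw i)) 1
    rwa [Nat.cast_one, sub_add_cancel] at this
  have hL : ∀ w, ∀ a ∈ M.wtLE w, C a - G₀ a ∈ polyIn (M.wtLE (w - 1)) := fun w a ha n => by
    rcases n with _ | n
    · rw [coeff_sub, h0, coeff_C_zero, sub_self]; exact Submodule.zero_mem _
    · rw [coeff_sub, coeff_C_succ, zero_sub]
      exact Submodule.neg_mem _ (M.wtLE_mono (by push_cast; omega) (hW w a ha (n + 1)))
  refine ⟨G, hGm, fun f => ?_, fun f => ?_, fun m f hf => hGsum _ f fun n => ?_,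
    fun w f hf => hGsum _ f fun n => ?_, fun w f hf => ?_⟩
  · induction f using Polynomial.induction_on' with
    | add p q hp hq => rw [map_add, coeff_add, hp, hq, coeff_add]
    | monomial n a =>
      rw [hGmon, coeff_monomial, coeff_mul_X_pow']
      rcases n with _ | n
      · simp [h0]
      · simp
  · induction f using Polynomial.induction_on' with
    | add p q hp hq => rw [map_add, map_add, hp, hq, map_add, map_add]
    | monomial n a =>
      rw [hGmon, monomial_eq, map_mul, map_mul, h1, polyEv_C, map_mul, map_pow, polyEv_X]
      simp
  · exact mul_X_pow_mem_polyIn (hgr m _ (hf n)) n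
  · have := polyWt_mul_X_pow (hW _ _ (hf n)) n
    rwa [sub_add_cancel] at this
  · have e : f - G f = ∑ n ∈ Finset.range (f.natDegree + 1),
        (C (f.coeff n) - G₀ (f.coeff n)) * X ^ n := by
      conv_lhs => rw [f.as_sum_range, map_sum, ← Finset.sum_sub_distrib]
      refine Finset.sum_congr rfl fun n _ => ?_
      rw [hGmon, monomial_eq, sub_mul]
    rw [e]
    exact Submodule.sum_mem _ fun n _ => mul_X_pow_mem_polyIn (hL _ _ (hf n)) n

/-- The coefficients of the restriction of an endomorphism of `S Z[X]` to `S Z`. -/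
def coeffMap (δ : M.S[X] →ₗ[k] M.S[X]) (n : ℕ) : M.S →ₗ[k] M.S where
  toFun a := (δ (C a)).coeff n
  map_add' a b := by rw [C_add, map_add, coeff_add]
  map_smul' c a := by
    have : C (c • a) = c • (C a : M.S[X]) := (smul_C c a).symm
    rw [this, map_smul, coeff_smul, RingHom.id_apply]

theorem coeffMap_apply (δ : M.S[X] →ₗ[k] M.S[X]) (n : ℕ) (a : M.S) :
    coeffMap δ n a = (δ (C a)).coeff n := rfl

theorem coeff_of_linear {δ : M.S[X] →ₗ[k] M.S[X]} (hδ : ∀ f n, δ (f * X ^ n) = δ f * X ^ n)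
    (f : M.S[X]) (n : ℕ) : (δ f).coeff n = ∑ ij ∈ Finset.HasAntidiagonal.antidiagonal n,
      coeffMap δ ij.1 (f.coeff ij.2) := by
  have h : δ = polyExt (δ ∘ₗ lmono k M.S 0) := polyLinear_ext hδ (fun p n => polyExt_mul_X_pow _ _ _)
    fun a => by rw [polyExt_C]; rfl
  conv_lhs => rw [h, coeff_polyExt]
  rfl

theorem coeffMap_mem_der {δ : M.S[X] →ₗ[k] M.S[X]} {e : ℤ} {n c : ℕ}
    (hgr : ∀ m, ∀ f ∈ polyIn (M.gr m), δ f ∈ polyIn (M.gr (m + e)))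
    (hl : ∀ m, ∀ f ∈ polyIn (M.gr m), ∀ f', δ (f * f') = δ f * f' + sgn k (e * m) • (f * δ f'))
    (hW : ∀ w, ∀ f ∈ M.polyWt w, δ f ∈ M.polyWt (w - c)) : coeffMap δ n ∈ M.der e (n + c) := by
  refine ⟨fun m a ha => hgr m _ (C_mem_polyIn ha) n, fun m a ha b => ?_, fun w a ha => ?_⟩
  · rw [coeffMap_apply, C_mul, hl m _ (C_mem_polyIn ha), coeff_add, coeff_smul, coeff_mul_C,
      coeff_C_mul]
    rfl
  · exact M.wtLE_mono (by push_cast; omega) (hW w _ (polyWt_C ha) n)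

theorem polyMap_mul_X_pow (f : M.S →ₗ[k] M.S) (p : M.S[X]) (n : ℕ) :
    polyMap f (p * X ^ n) = polyMap f p * X ^ n := by
  ext m
  rw [coeff_polyMap, coeff_mul_X_pow', coeff_mul_X_pow', coeff_polyMap]
  split_ifs
  · rfl
  · exact map_zero f

/-- The operators on `S Z[X]` describing the path of perturbations given by a gauge
transformation. -/
theorem Gauge.exists_operators {p q : M.Perturbation} (h : Gauge p q) :
    ∃ δ η : M.S[X] →ₗ[k] M.S[X], (∀ f n, δ (f * X ^ n) = δ f * X ^ n) ∧
      (∀ f n, η (f * X ^ n) = η f * X ^ n) ∧ (∀ n, coeffMap δ n ∈ M.der 1 n) ∧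
      (∀ n, coeffMap η n ∈ M.der 0 (n + 1)) ∧ coeffMap δ 0 = M.d + p.p ∧
      (∀ a, δ (δ (C a)) = 0) ∧ (∀ a, derivative (δ (C a)) = η (δ (C a)) - δ (η (C a))) ∧
      ∀ a, polyEv k M.S 1 (δ (C a)) = (M.d + q.p) a := by
  obtain ⟨g, hg, hgw, hgD⟩ := h
  obtain ⟨G, hGm, hG0, hG1, hGg, hGW, hGL⟩ := exists_line hg hgw
  have hnil : ∀ f, ∃ n, ((LinearMap.id - G.toLinearMap : M.S[X] →ₗ[k] M.S[X]) ^ n) f = 0 :=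
    pow_eq_zero_of_lower hGL
  let e : M.S[X] ≃ₐ[k] M.S[X] := AlgEquiv.ofBijective G (bijective_of_locally_nilpotent hnil)
  have heG : ∀ f, G (e.symm f) = f := fun f => e.apply_symm_apply f
  have hRg : ∀ m, ∀ f ∈ polyIn (M.gr m), e.symm f ∈ polyIn (M.gr m) := fun m f hf =>
    mem_of_locally_nilpotent hnil (hGg m) (by
      rw [AlgHom.toLinearMap_apply, heG]; exact hf)
  have hRW : ∀ w, ∀ f ∈ M.polyWt w, e.symm f ∈ M.polyWt w := fun w f hf =>
    mem_of_locally_nilpotent hnil (hGW w) (by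
      rw [AlgHom.toLinearMap_apply, heG]; exact hf)
  have hRm : ∀ f n, e.symm (f * X ^ n) = e.symm f * X ^ n := fun f n => e.injective (by
    rw [e.apply_symm_apply]
    exact ((hGm _ _).trans (by rw [heG])).symm)
  let Dp : M.S[X] →ₗ[k] M.S[X] := polyMap (M.d + p.p)
  have hDc : ∀ f n, (Dp f).coeff n = (M.d + p.p) (f.coeff n) := fun f n => coeff_polyMap _ _ _
  let R : M.S[X] →ₗ[k] M.S[X] := e.symm.toLinearMap
  have hRa : ∀ f, R f = e.symm f := fun _ => rfl
  let δ : M.S[X] →ₗ[k] M.S[X] := G.toLinearMap ∘ₗ Dp ∘ₗ R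
  have hδa : ∀ f, δ f = G (Dp (R f)) := fun _ => rfl
  let η : M.S[X] →ₗ[k] M.S[X] := polyD k M.S - G.toLinearMap ∘ₗ polyD k M.S ∘ₗ R
  have hηa : ∀ f, η f = derivative f - G (derivative (R f)) := fun _ => rfl
  have hRG : ∀ f, R (G f) = f := fun f => e.symm_apply_apply f
  have hGR : ∀ f, G (R f) = f := heG
  have hδm : ∀ f n, δ (f * X ^ n) = δ f * X ^ n := fun f n => by
    rw [hδa, hδa, hRa, hRm, polyMap_mul_X_pow, hGm]
    rfl
  have hηm : ∀ f n, η (f * X ^ n) = η f * X ^ n := fun f n => by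
    have h1 : ∀ f' : M.S[X], G (f' * derivative (X ^ n)) = G f' * derivative (X ^ n) := fun f' => by
      have h2 : (derivative (X ^ n) : M.S[X]) = (n : k) • X ^ (n - 1) := by
        rw [derivative_X_pow, map_natCast C, Algebra.smul_def, map_natCast]
      rw [h2, mul_smul_comm, map_smul, hGm, mul_smul_comm]
    rw [hηa, hηa, hRa, hRm, derivative_mul, derivative_mul, map_add, hGm, h1, heG, hRa]
    rw [sub_mul]
    abel
  have hD := add_mem_der p.mem
  have hδg : ∀ m, ∀ f ∈ polyIn (M.gr m), δ f ∈ polyIn (M.gr (m + 1)) := fun m f hf =>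
    hGg _ _ (polyMap_mem_polyIn (hD.1 m) (hRg m f hf))
  have hδl : ∀ m, ∀ f ∈ polyIn (M.gr m), ∀ f',
      δ (f * f') = δ f * f' + sgn k (1 * m) • (f * δ f') := fun m f hf f' => by
    have h1 : R (f * f') = R f * R f' := map_mul e.symm _ _
    rw [hδa, h1]
    have h2 : Dp (R f * R f') = Dp (R f) * R f' + sgn k m • (R f * Dp (R f')) :=
      p.dgca.poly_leibniz (hRg m f hf) (R f')
    rw [h2, map_add, map_smul, map_mul, map_mul, hGR, hGR, one_mul]
    rfl
  have hδW : ∀ w, ∀ f ∈ M.polyWt w, δ f ∈ M.polyWt (w - (0 : ℕ)) := fun w f hf => by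
    rw [Nat.cast_zero, sub_zero]
    have h1 : Dp (R f) ∈ M.polyWt w := fun n => by
      rw [hDc]
      have h2 := hD.2.2 _ _ (hRW w f hf n)
      rwa [Nat.cast_zero, sub_zero] at h2
    exact hGW w _ h1
  have hηg : ∀ m, ∀ f ∈ polyIn (M.gr m), η f ∈ polyIn (M.gr (m + 0)) := fun m f hf => by
    rw [add_zero]
    exact Submodule.sub_mem _ (derivative_mem_polyIn hf)
      (hGg _ _ (derivative_mem_polyIn (hRg m f hf)))
  have hηl : ∀ m, ∀ f ∈ polyIn (M.gr m), ∀ f',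
      η (f * f') = η f * f' + sgn k (0 * m) • (f * η f') := fun m f hf f' => by
    have h1 : R (f * f') = R f * R f' := map_mul e.symm _ _
    rw [hηa, h1, derivative_mul, derivative_mul, map_add, map_mul, map_mul, hGR, hGR, zero_mul,
      sgn_zero, one_smul, hηa, hηa, sub_mul, mul_sub]
    abel
  have hdW : ∀ w, ∀ f ∈ M.polyWt w, derivative f ∈ M.polyWt (w - 1) := fun w f hf n => by
    rw [coeff_derivative' (k := k)]
    exact Submodule.smul_mem _ _ (M.wtLE_mono (by push_cast; omega) (hf (n + 1)))
  have hηW : ∀ w, ∀ f ∈ M.polyWt w, η f ∈ M.polyWt (w - (1 : ℕ)) := fun w f hf => by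
    rw [Nat.cast_one]
    exact Submodule.sub_mem _ (hdW w f hf) (hGW _ _ (hdW w _ (hRW w f hf)))
  have hDn : ∀ n, coeffMap δ n ∈ M.der 1 n := fun n => coeffMap_mem_der (c := 0) hδg hδl hδW
  have hYn : ∀ n, coeffMap η n ∈ M.der 0 (n + 1) := fun n => coeffMap_mem_der hηg hηl hηW
  have hD0 : coeffMap δ 0 = M.d + p.p := LinearMap.ext fun a => by
    rw [coeffMap_apply, hδa, hG0]
    rw [hDc, ← hG0, hGR, coeff_C_zero]
  refine ⟨δ, η, hδm, hηm, hDn, hYn, hD0, fun a => ?_, fun a => ?_, fun a => ?_⟩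
  · rw [hδa, hδa, hRG]
    have h2 : Dp (Dp (R (C a))) = 0 := by
      ext m
      rw [hDc, hDc, coeff_zero, p.sq]
    rw [h2, map_zero]
  · have h2 : derivative (Dp (R (C a))) = Dp (derivative (R (C a))) := polyExt_derivative_comm _
    rw [hηa, hηa, derivative_C, zero_sub, map_neg, hδa, hδa, hRG, hRG, h2]
    abel
  · have h2 : polyEv k M.S 1 (Dp (R (C a))) = (M.d + p.p) (polyEv k M.S 1 (R (C a))) :=
      polyEv_polyMap _ _ _
    rw [hδa, hG1, h2, hgD, ← hG1, hGR, polyEv_C]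

/-- A gauge transformation from `p` to `q` gives a path from `p` to `q`. -/
theorem Gauge.exists_path {p q : M.Perturbation} (h : Gauge p q) : ∃ c : PolyPath M,
    (∀ n, c.P n ∈ M.der 1 n) ∧ (∀ n, c.Y n ∈ M.der 0 n) ∧ c.P 0 = p.p ∧
      ∀ N, q.p - ∑ j ∈ Finset.range N, c.P j ∈ M.der 1 N := by
  obtain ⟨δ, η, hδm, hηm, hDn, hYn, hD0, hsq, hev, h1⟩ := h.exists_operators
  let P : ℕ → M.S →ₗ[k] M.S := fun n => if n = 0 then p.p else coeffMap δ n
  have hP0 : P 0 = p.p := if_pos rfl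
  have hPs : ∀ n, P (n + 1) = coeffMap δ (n + 1) := fun n => if_neg (Nat.succ_ne_zero n)
  have hDP : ∀ n a, coeffMap δ n a = P n a + if n = 0 then M.d a else 0 := fun n a => by
    rcases n with _ | n
    · rw [hP0, hD0, if_pos rfl, LinearMap.add_apply, add_comm]
    · rw [hPs, if_neg (Nat.succ_ne_zero n), add_zero]
  have hPn : ∀ n, P n ∈ M.der 1 n := fun n => by
    rcases n with _ | n
    · rw [hP0]; exact M.der_anti 1 (by omega) p.mem
    · rw [hPs]; exact hDn (n + 1)
  have hP1 : ∀ n, P n ∈ M.der 1 1 := fun n => by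
    rcases n with _ | n
    · rw [hP0]; exact p.mem
    · exact M.der_anti 1 (by omega) (hPn (n + 1))
  have hPz : ∀ a, ∃ N, ∀ n, N ≤ n → P n a = 0 ∧ coeffMap η n a = 0 := fun a => by
    obtain ⟨w, hw⟩ := FreeGCA.exists_mem_wtLE M.wt a
    have hz : ∀ n : ℕ, w + 1 ≤ n → ∀ x ∈ M.wtLE ((w : ℤ) - n), x = 0 := fun n hn x hx => by
      have h0 : M.wtLE ((w : ℤ) - n) = ⊥ := FreeGCA.wtLE_neg (wt := M.wt) (by omega)
      rw [h0] at hx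
      exact hx
    exact ⟨w + 1, fun n hn => ⟨hz n hn _ ((hPn n).2.2 _ _ hw), hz n hn _
      (M.wtLE_mono (by push_cast; omega) ((hYn n).2.2 _ _ hw))⟩⟩
  refine ⟨⟨P, coeffMap η, hP1, fun n => M.der_anti 0 (by omega) (hYn n), hPz, fun n a => ?_,
    fun n a => ?_⟩, hPn, fun n => M.der_anti 0 (by omega) (hYn n), hP0, fun N => ?_⟩
  · have h2 := coeff_of_linear hδm (δ (C a)) n
    rw [hsq, coeff_zero] at h2
    simp only [← coeffMap_apply] at h2
    simp only [hDP, map_add, Finset.sum_add_distrib, apply_ite (P _), apply_ite M.d, map_zero] at h2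
    simp only [M.d_d, ite_self, add_zero] at h2
    rw [sum_antidiagonal_fst_zero n fun j => M.d (P j a),
      sum_antidiagonal_snd_zero n fun i => P i (M.d a)] at h2
    refine Eq.trans ?_ h2.symm
    abel
  · have h2 := congrArg (fun f => coeff f n) (hev a)
    rw [coeff_derivative' (k := k), coeff_sub, coeff_of_linear hηm,
      coeff_of_linear hδm (η (C a))] at h2
    simp only [← coeffMap_apply] at h2
    rw [← Finset.Nat.sum_antidiagonal_swap (f := fun ij => coeffMap δ ij.1 (coeffMap η ij.2 a)),
      ← Finset.sum_sub_distrib] at h2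
    simp only [hDP, Prod.fst_swap, Prod.snd_swap, map_add, apply_ite (coeffMap η _), map_zero,
      if_neg (Nat.succ_ne_zero n), add_zero] at h2
    rw [h2, ← sum_antidiagonal_snd_zero n fun i => coeffMap η i (M.d a),
      ← sum_antidiagonal_snd_zero n fun i => M.d (coeffMap η i a), ← Finset.sum_sub_distrib,
      ← Finset.sum_add_distrib]
    refine Finset.sum_congr rfl fun ij _ => ?_
    abel
  · have hsum : ∀ a, ∃ m, ∀ n, m ≤ n → ∑ j ∈ Finset.range n, P j a = q.p a := fun a => by
      have h1 := h1 a
      refine ⟨(δ (C a)).natDegree + 1, fun n hn => ?_⟩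
      rw [polyEv_apply, eval₂_eq_sum_range' (n := n) _ (by omega)] at h1
      simp only [map_one, one_pow, mul_one, RingHom.id_apply, ← coeffMap_apply, hDP,
        Finset.sum_add_distrib, Finset.sum_ite_eq', Finset.mem_range] at h1
      rw [if_pos (by omega), LinearMap.add_apply, add_comm] at h1
      exact add_left_cancel h1
    have h1 : q.p - ∑ j ∈ Finset.range N, P j ∈ M.der 1 1 :=
      Submodule.sub_mem _ q.mem (Submodule.sum_mem _ fun j _ => hP1 j)
    refine ⟨h1.1, h1.2.1, fun w a ha => ?_⟩
    obtain ⟨m, hm⟩ := hsum a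
    rw [LinearMap.sub_apply, LinearMap.sum_apply, ← hm (max m N) (le_max_left _ _),
      ← Finset.sum_range_add_sum_Ico _ (le_max_right m N), add_sub_cancel_left]
    refine Submodule.sum_mem _ fun j hj => M.wtLE_mono ?_ ((hPn j).2.2 w a ha)
    have := (Finset.mem_Ico.1 hj).1
    omega

end FilteredModel

/-! ### Exponentials in the tensor coalgebra -/

/-- The graded interchange of a coalgebra with parity operator `σ`. -/
def FiltCoalg.interchange {k : Type u} [Field k] (C : FiltCoalg k) (σ : C.X →ₗ[k] C.X) :
    C.X ⊗[k] C.X →ₗ[k] C.X ⊗[k] C.X :=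
  ((2 : k)⁻¹ • (LinearMap.id + TensorProduct.map σ LinearMap.id + TensorProduct.map LinearMap.id σ -
    TensorProduct.map σ σ)) ∘ₗ (TensorProduct.comm k _ _).toLinearMap

/-- The laws of a graded cocommutative dg coalgebra with parity operator `σ`. -/
structure FiltCoalg.Laws {k : Type u} [Field k] (C : FiltCoalg k) (σ : C.X →ₗ[k] C.X) : Prop where
  coassoc : ∀ c, TensorProduct.assoc k _ _ _ (TensorProduct.map C.comul LinearMap.id (C.comul c)) =
    TensorProduct.map LinearMap.id C.comul (C.comul c)
  counit : ∀ c, TensorProduct.lid k _ (TensorProduct.map C.counit LinearMap.id (C.comul c)) = c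
  cocomm : ∀ c, C.interchange σ (C.comul c) = C.comul c
  comul_par : ∀ c, C.comul (σ c) = TensorProduct.map σ σ (C.comul c)
  counit_par : ∀ c, C.counit (σ c) = C.counit c
  counit_d : ∀ c, C.counit (C.d c) = 0
  comul_d : ∀ c, C.comul (C.d c) = TensorProduct.map C.d LinearMap.id (C.comul c) +
    TensorProduct.map σ C.d (C.comul c)
  comul_gr : ∀ n, ∀ c ∈ C.gr n, C.comul c ∈ Submodule.span k
    {z | ∃ (i j : ℤ) (x y : C.X), i + j = n ∧ x ∈ C.gr i ∧ y ∈ C.gr j ∧ z = x ⊗ₜ[k] y}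
  counit_gr : ∀ n, n ≠ 0 → ∀ c ∈ C.gr n, C.counit c = 0

namespace TensorCoalg

open TensorAlgebra

variable {k : Type u} [Field k] {V : Type u} [AddCommGroup V] [Module k V] {C : FiltCoalg k}

/-- The component of word length `r` of the map to the tensor coalgebra cogenerated by `φ`. -/
def expo (φ : C.X →ₗ[k] V) : ℕ → C.X →ₗ[k] TensorAlgebra k V
  | 0 => Algebra.linearMap k _ ∘ₗ C.counit
  | r + 1 => LinearMap.mul' k _ ∘ₗ TensorProduct.map (ι k ∘ₗ φ) (expo φ r) ∘ₗ C.comul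

variable {φ : C.X →ₗ[k] V} {σ : C.X →ₗ[k] C.X}

theorem expo_zero (c : C.X) : expo φ 0 c = algebraMap k _ (C.counit c) := rfl

theorem expo_succ (r : ℕ) (c : C.X) : expo φ (r + 1) c =
    LinearMap.mul' k _ (TensorProduct.map (ι k ∘ₗ φ) (expo φ r) (C.comul c)) := rfl

/-- Coassociativity, for evaluation of a trilinear map on an iterated coproduct. -/
theorem comul_trilinear (hC : C.Laws σ) {A B A' B' Y : Type u} [AddCommGroup A]
    [Module k A] [AddCommGroup B] [Module k B] [AddCommGroup A'] [Module k A'] [AddCommGroup B']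
    [Module k B'] [AddCommGroup Y] [Module k Y] {f : C.X →ₗ[k] A} {g : C.X →ₗ[k] B'}
    {u : C.X ⊗[k] C.X →ₗ[k] B} {v : C.X ⊗[k] C.X →ₗ[k] A'} {μ : A ⊗[k] B →ₗ[k] Y}
    {ν : A' ⊗[k] B' →ₗ[k] Y}
    (h : ∀ x y z, μ (f x ⊗ₜ[k] u (y ⊗ₜ[k] z)) = ν (v (x ⊗ₜ[k] y) ⊗ₜ[k] g z)) (c : C.X) :
    μ (TensorProduct.map f (u ∘ₗ C.comul) (C.comul c)) =
      ν (TensorProduct.map (v ∘ₗ C.comul) g (C.comul c)) := by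
  have h1 : μ ∘ₗ TensorProduct.map f u ∘ₗ (TensorProduct.assoc k _ _ _).toLinearMap =
      ν ∘ₗ TensorProduct.map v g := TensorProduct.ext_threefold fun x y z => h x y z
  have h2 := DFunLike.congr_fun h1 (TensorProduct.map C.comul LinearMap.id (C.comul c))
  simp only [LinearMap.comp_apply, LinearEquiv.coe_coe, hC.coassoc] at h2
  rw [← LinearMap.comp_apply (TensorProduct.map f u), ← LinearMap.comp_apply (TensorProduct.map v g),
    ← TensorProduct.map_comp, ← TensorProduct.map_comp] at h2
  exact h2

/-- The map `v ⊗ z ↦ (v ⊗ 1) z`. -/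
def consLeft : V ⊗[k] (TensorAlgebra k V ⊗[k] TensorAlgebra k V) →ₗ[k]
    TensorAlgebra k V ⊗[k] TensorAlgebra k V :=
  TensorProduct.lift (LinearMap.mul k (TensorAlgebra k V ⊗[k] TensorAlgebra k V) ∘ₗ
    (TensorProduct.mk k (TensorAlgebra k V) (TensorAlgebra k V)).flip 1 ∘ₗ ι k)

theorem consLeft_tmul (v : V) (z : TensorAlgebra k V ⊗[k] TensorAlgebra k V) :
    consLeft (v ⊗ₜ[k] z) = (ι k v ⊗ₜ[k] 1) * z := rfl

theorem consLeft_expo (hC : C.Laws σ) (a b : ℕ) (c : C.X) :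
    consLeft (TensorProduct.map φ (TensorProduct.map (expo φ a) (expo φ b) ∘ₗ C.comul) (C.comul c)) =
      TensorProduct.map (expo φ (a + 1)) (expo φ b) (C.comul c) := by
  have h : ∀ x y z, consLeft (φ x ⊗ₜ[k] TensorProduct.map (expo φ a) (expo φ b) (y ⊗ₜ[k] z)) =
      LinearMap.id (R := k) ((LinearMap.mul' k _ ∘ₗ TensorProduct.map (ι k ∘ₗ φ) (expo φ a))
        (x ⊗ₜ[k] y) ⊗ₜ[k] expo φ b z) := fun x y z => by
    rw [TensorProduct.map_tmul, consLeft_tmul, Algebra.TensorProduct.tmul_mul_tmul, one_mul]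
    rfl
  exact comul_trilinear hC h c

theorem delta_expo (hC : C.Laws σ) (r : ℕ) (c : C.X) : delta k V (expo φ r c) =
    ∑ ab ∈ Finset.HasAntidiagonal.antidiagonal r,
      TensorProduct.map (expo φ ab.1) (expo φ ab.2) (C.comul c) := by
  have h0 : ∀ (r : ℕ) (c : C.X), TensorProduct.map (expo φ 0) (expo φ r) (C.comul c) =
      1 ⊗ₜ[k] expo φ r c := fun r c => by
    have h : TensorProduct.map (expo φ 0) (expo φ r) = TensorProduct.mk k _ _ 1 ∘ₗ expo φ r ∘ₗ
        (TensorProduct.lid k _).toLinearMap ∘ₗ TensorProduct.map C.counit LinearMap.id := by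
      refine TensorProduct.ext' fun x y => ?_
      simp [expo_zero, Algebra.algebraMap_eq_smul_one, TensorProduct.smul_tmul]
    rw [h]
    simp only [LinearMap.comp_apply, LinearEquiv.coe_coe, hC.counit, TensorProduct.mk_apply]
  induction r generalizing c with
  | zero =>
    rw [Finset.Nat.antidiagonal_zero, Finset.sum_singleton, h0, expo_zero,
      Algebra.algebraMap_eq_smul_one, map_smul, delta_one, TensorProduct.tmul_smul]
  | succ r ih =>
    rw [Finset.Nat.antidiagonal_succ, Finset.sum_cons, h0, Finset.sum_map]
    have hd : delta k V ∘ₗ LinearMap.mul' k _ ∘ₗ TensorProduct.map (ι k ∘ₗ φ) (expo φ r) =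
        TensorProduct.mk k _ _ 1 ∘ₗ LinearMap.mul' k _ ∘ₗ TensorProduct.map (ι k ∘ₗ φ) (expo φ r) +
        ∑ ab ∈ Finset.HasAntidiagonal.antidiagonal r, consLeft ∘ₗ
          TensorProduct.map φ (TensorProduct.map (expo φ ab.1) (expo φ ab.2) ∘ₗ C.comul) := by
      refine TensorProduct.ext' fun x y => ?_
      simp only [LinearMap.comp_apply, TensorProduct.map_tmul, LinearMap.mul'_apply, delta_ι_mul,
        LinearMap.add_apply, LinearMap.sum_apply, ih, TensorProduct.mk_apply, consLeft_tmul,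
        Finset.mul_sum]
    have hd' := DFunLike.congr_fun hd (C.comul c)
    simp only [LinearMap.comp_apply, LinearMap.add_apply, LinearMap.sum_apply] at hd'
    rw [expo_succ, hd']
    congr 1
    exact Finset.sum_congr rfl fun ab _ => consLeft_expo hC ab.1 ab.2 c

theorem par_expo (hC : C.Laws σ) {s : V →ₗ[k] V} (hφ : ∀ c, φ (σ c) = s (φ c)) (r : ℕ) (c : C.X) :
    par s (expo φ r c) = expo φ r (σ c) := by
  induction r generalizing c with
  | zero => rw [expo_zero, expo_zero, hC.counit_par, AlgHom.commutes]
  | succ r ih =>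
    rw [expo_succ, expo_succ, hC.comul_par]
    generalize C.comul c = z
    induction z using TensorProduct.induction_on with
    | zero => simp
    | tmul a b => simp [hφ, ih]
    | add a b ha hb => simp only [map_add, ha, hb]

theorem swap_map_expo (hC : C.Laws σ) {s : V →ₗ[k] V} (hφ : ∀ c, φ (σ c) = s (φ c)) (a b : ℕ)
    (c : C.X) : swap s (TensorProduct.map (expo φ a) (expo φ b) (C.comul c)) =
      TensorProduct.map (expo φ b) (expo φ a) (C.comul c) := by
  conv_rhs => rw [← hC.cocomm]
  generalize C.comul c = z
  induction z using TensorProduct.induction_on with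
  | zero => simp
  | tmul x y =>
    rw [TensorProduct.map_tmul, swap_tmul]
    simp [FiltCoalg.interchange, par_expo hC hφ]
  | add a b ha hb => simp only [map_add, ha, hb]

theorem expo_mem_symm (hC : C.Laws σ) {s : V →ₗ[k] V} (hφ : ∀ c, φ (σ c) = s (φ c)) (r : ℕ)
    (c : C.X) : expo φ r c ∈ symm s := by
  let D : Submodule k (TensorAlgebra k V) := Submodule.span k {x | ∃ r c, x = expo φ r c}
  have hD : ∀ r c, expo φ r c ∈ D := fun r c => Submodule.subset_span ⟨r, c, rfl⟩
  suffices h : IsCocommSub s D from (le_sSup (a := D) h : D ≤ symm s) (hD r c)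
  suffices h : D ≤ (sq D).comap (delta k V) ⊓ LinearMap.ker (swap s ∘ₗ delta k V - delta k V) from
    fun x hx => ⟨(h hx).1, sub_eq_zero.1 (h hx).2⟩
  refine Submodule.span_le.2 ?_
  rintro _ ⟨r, c, rfl⟩
  refine ⟨?_, ?_⟩
  · rw [SetLike.mem_coe, Submodule.mem_comap, delta_expo hC]
    refine Submodule.sum_mem _ fun ab _ => ?_
    generalize C.comul c = z
    induction z using TensorProduct.induction_on with
    | zero => simp
    | tmul x y => exact tmul_mem_sq (hD _ _) (hD _ _)
    | add a b ha hb => rw [map_add]; exact Submodule.add_mem _ ha hb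
  · change swap s (delta k V (expo φ r c)) - delta k V (expo φ r c) = 0
    rw [delta_expo hC, map_sum, sub_eq_zero, ← Finset.Nat.sum_antidiagonal_swap]
    exact Finset.sum_congr rfl fun ab _ => swap_map_expo hC hφ _ _ c

variable {s b₁ : V →ₗ[k] V} {b₂ : V ⊗[k] V →ₗ[k] V}

theorem corest_add (x : TensorAlgebra k V) :
    corest b₁ b₂ x = corest b₁ 0 x + corest 0 b₂ x := by
  simp [corest]

theorem contractHead_add (x : TensorAlgebra k V) :
    contractHead b₁ b₂ x = contractHead b₁ 0 x + contractHead 0 b₂ x := by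
  simp only [contractHead, LinearMap.comp_apply]
  generalize delta k V x = z
  induction z using TensorProduct.induction_on with
  | zero => simp
  | tmul a b =>
    simp only [TensorProduct.map_tmul, LinearMap.comp_apply, LinearMap.mul'_apply]
    rw [corest_add, map_add, add_mul]
  | add a b ha hb => simp only [map_add, ha, hb]; abel

theorem coder_add (x : TensorAlgebra k V) :
    coder s b₁ b₂ x = coder s b₁ 0 x + coder s 0 b₂ x := by
  simp only [coder, LinearMap.comp_apply]
  generalize delta k V x = z
  induction z using TensorProduct.induction_on with
  | zero => simp
  | tmul a b =>
    simp only [TensorProduct.map_tmul, LinearMap.mul'_apply]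
    rw [contractHead_add, mul_add]
  | add a b ha hb => simp only [map_add, ha, hb]; abel

theorem contractHead_linear_ι_mul (v : V) (x : TensorAlgebra k V) :
    contractHead b₁ 0 (ι k v * x) = ι k (b₁ v) * x := by
  suffices h : contractHead b₁ 0 ∘ₗ LinearMap.mulLeft k (ι k v) = LinearMap.mulLeft k (ι k (b₁ v)) from
    DFunLike.congr_fun h x
  refine ext_word fun l => ?_
  rcases l with _ | ⟨w, l⟩
  · simp [contractHead_ι]
  · simp [contractHead_ι_mul_ι_mul]

theorem coder_linear_ι_mul (v : V) (x : TensorAlgebra k V) :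
    coder s b₁ 0 (ι k v * x) = ι k (b₁ v) * x + ι k (s v) * coder s b₁ 0 x := by
  rw [coder_ι_mul, contractHead_linear_ι_mul]

theorem coder_quadratic_ι_mul_ι_mul (v w : V) (x : TensorAlgebra k V) :
    coder s 0 b₂ (ι k v * (ι k w * x)) =
      ι k (b₂ (v ⊗ₜ[k] w)) * x + ι k (s v) * coder s 0 b₂ (ι k w * x) := by
  rw [coder_ι_mul, contractHead_ι_mul_ι_mul]
  simp

theorem coder_quadratic_ι (v : V) : coder s 0 b₂ (ι k v) = 0 := by
  have := coder_ι_mul (s := s) (b₁ := 0) (b₂ := b₂) v 1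
  rw [mul_one, contractHead_ι, coder_one] at this
  rw [this]
  simp

/-- The Maurer-Cartan equation for `φ` makes the exponential of `φ` compatible with
differentials. -/
theorem coder_expo (hC : C.Laws σ) (hφ : ∀ c, φ (σ c) = s (φ c))
    (hmc : ∀ c, b₁ (φ c) + b₂ (TensorProduct.map φ φ (C.comul c)) = φ (C.d c)) (r : ℕ) (c : C.X) :
    coder s b₁ 0 (expo φ r c) + coder s 0 b₂ (expo φ (r + 1) c) = expo φ r (C.d c) := by
  induction r generalizing c with
  | zero =>
    have h1 : ∀ z, coder s 0 b₂ (LinearMap.mul' k _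
        (TensorProduct.map (ι k ∘ₗ φ) (expo φ 0) z)) = 0 := fun z => by
      induction z using TensorProduct.induction_on with
      | zero => simp
      | tmul a b =>
        simp [expo_zero, ← Algebra.commutes, ← Algebra.smul_def, coder_quadratic_ι]
      | add a b ha hb => simp only [map_add, ha, hb, add_zero]
    rw [expo_succ, h1, expo_zero, expo_zero, hC.counit_d, map_zero, add_zero,
      Algebra.algebraMap_eq_smul_one, map_smul, coder_one, smul_zero]
  | succ r ih =>
    have e1 : coder s b₁ 0 (expo φ (r + 1) c) =
        LinearMap.mul' k _ (TensorProduct.map (ι k ∘ₗ b₁ ∘ₗ φ) (expo φ r) (C.comul c)) +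
        LinearMap.mul' k _ (TensorProduct.map (ι k ∘ₗ φ ∘ₗ σ) (coder s b₁ 0 ∘ₗ expo φ r)
          (C.comul c)) := by
      rw [expo_succ]
      generalize C.comul c = z
      induction z using TensorProduct.induction_on with
      | zero => simp
      | tmul a b => simp [coder_linear_ι_mul, hφ]
      | add a b ha hb => simp only [map_add, ha, hb]; abel
    have e2 : coder s 0 b₂ (expo φ (r + 1 + 1) c) =
        LinearMap.mul' k _ (TensorProduct.map (ι k ∘ₗ (b₂ ∘ₗ TensorProduct.map φ φ) ∘ₗ C.comul)
          (expo φ r) (C.comul c)) +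
        LinearMap.mul' k _ (TensorProduct.map (ι k ∘ₗ φ ∘ₗ σ) (coder s 0 b₂ ∘ₗ expo φ (r + 1))
          (C.comul c)) := by
      have h1 : ∀ μ : TensorAlgebra k V ⊗[k] TensorAlgebra k V →ₗ[k] TensorAlgebra k V,
          (∀ x y, μ (ι k x ⊗ₜ[k] y) = coder s 0 b₂ (ι k x * y) - ι k (s x) * coder s 0 b₂ y) →
          μ (TensorProduct.map (ι k ∘ₗ φ) ((LinearMap.mul' k _ ∘ₗ
            TensorProduct.map (ι k ∘ₗ φ) (expo φ r)) ∘ₗ C.comul) (C.comul c)) =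
          LinearMap.mul' k _ (TensorProduct.map ((ι k ∘ₗ (b₂ ∘ₗ TensorProduct.map φ φ)) ∘ₗ C.comul)
            (expo φ r) (C.comul c)) := fun μ hμ =>
        comul_trilinear hC (fun x y z => by simp [hμ, coder_quadratic_ι_mul_ι_mul]) c
      have h2 := h1 (coder s 0 b₂ ∘ₗ LinearMap.mul' k _ -
        LinearMap.mul' k _ ∘ₗ TensorProduct.map (par s).toLinearMap (coder s 0 b₂))
        (fun x y => by simp)
      rw [LinearMap.sub_apply, sub_eq_iff_eq_add] at h2
      refine h2.trans ?_
      congr 1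
      simp only [LinearMap.comp_apply]
      rw [← LinearMap.comp_apply (TensorProduct.map _ _), ← TensorProduct.map_comp]
      congr 2
      refine congrArg₂ TensorProduct.map ?_ rfl
      ext x
      simp [hφ]
    have e3 : expo φ (r + 1) (C.d c) =
        LinearMap.mul' k _ (TensorProduct.map (ι k ∘ₗ φ ∘ₗ C.d) (expo φ r) (C.comul c)) +
        LinearMap.mul' k _ (TensorProduct.map (ι k ∘ₗ φ ∘ₗ σ) (expo φ r ∘ₗ C.d) (C.comul c)) := by
      rw [expo_succ, hC.comul_d, map_add, map_add, ← LinearMap.comp_apply (TensorProduct.map _ _),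
        ← LinearMap.comp_apply (TensorProduct.map _ _), ← TensorProduct.map_comp,
        ← TensorProduct.map_comp]
      rfl
    rw [e1, e2, e3]
    generalize C.comul c = z
    induction z using TensorProduct.induction_on with
    | zero => simp
    | tmul a b =>
      simp only [TensorProduct.map_tmul, LinearMap.comp_apply, LinearMap.mul'_apply, ← ih, ← hmc,
        map_add, add_mul, mul_add]
      abel
    | add a b ha hb =>
      simp only [map_add]
      linear_combination (norm := abel) ha + hb

/-- The exponential preserves filtrations. -/
theorem expo_mem_wordFil {G : Filtration k V} (hφ : ∀ n, C.fil.F n ≤ (G.F n).comap φ) (r n : ℕ) :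
    C.fil.F n ≤ ((wordFil G).F n).comap (expo φ r) := by
  induction r generalizing n with
  | zero =>
    intro c hc
    rw [Submodule.mem_comap, expo_zero]
    rcases n with _ | n
    · rw [Algebra.algebraMap_eq_smul_one]
      exact Submodule.smul_mem _ _ one_mem_wordFil
    · have : C.counit c = 0 := C.counit_fil (C.fil.anti (by omega) hc)
      rw [this, map_zero]
      exact Submodule.zero_mem _
  | succ r ih =>
    intro c hc
    rw [Submodule.mem_comap, expo_succ]
    refine wordFil_mul' n ?_
    exact Filtration.tensor_map_le₀ (F' := wordFil G) (G' := wordFil G) (f := ι k ∘ₗ φ)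
      (fun n c hc => ι_mem (hφ n hc)) ih n (C.comul_fil n hc)

theorem expo_mem_wordFil_length {G : Filtration k V} (hφ : ∀ c, φ c ∈ G.F 1) (r : ℕ) (c : C.X) :
    expo φ r c ∈ (wordFil G).F r := by
  induction r generalizing c with
  | zero =>
    rw [expo_zero, Algebra.algebraMap_eq_smul_one]
    exact Submodule.smul_mem _ _ one_mem_wordFil
  | succ r ih =>
    rw [expo_succ]
    generalize C.comul c = z
    induction z using TensorProduct.induction_on with
    | zero => simp
    | tmul a b =>
      rw [TensorProduct.map_tmul, LinearMap.mul'_apply, add_comm]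
      exact wordFil_mul (ι_mem (hφ a)) (ih b)
    | add a b ha hb => rw [map_add, map_add]; exact Submodule.add_mem _ ha hb

end TensorCoalg

/-! ### Maps of completions -/

namespace Filtration

variable {k X Y : Type u} [Field k] [AddCommGroup X] [Module k X] [AddCommGroup Y] [Module k Y]

/-- The map of completions given by a coherent family of filtration-preserving maps. -/
def lim (F : Filtration k X) (G : Filtration k Y) (Λ : ℕ → X →ₗ[k] Y)
    (h : ∀ n, F.F n ≤ (G.F n).comap (Λ n)) (hc : ∀ m n, m ≤ n → ∀ x, Λ n x - Λ m x ∈ G.F m) :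
    F.Compl →ₗ[k] G.Compl where
  toFun x := ⟨fun n => Submodule.mapQ _ _ (Λ n) (h n) (x.1 n), fun m n hmn => by
    change Submodule.factor (G.anti hmn) (Submodule.mapQ _ _ (Λ n) (h n) (x.1 n)) =
      Submodule.mapQ _ _ (Λ m) (h m) (x.1 m)
    rw [← x.2 m n hmn]
    obtain ⟨y, hy⟩ := Submodule.Quotient.mk_surjective _ (x.1 n)
    rw [← hy]
    exact (Submodule.Quotient.eq _).2 (hc m n hmn y)⟩
  map_add' x y := Subtype.ext (funext fun n => by simp)
  map_smul' c x := Subtype.ext (funext fun n => by simp)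

theorem lim_apply {F : Filtration k X} {G : Filtration k Y} {Λ : ℕ → X →ₗ[k] Y}
    {h : ∀ n, F.F n ≤ (G.F n).comap (Λ n)} {hc : ∀ m n, m ≤ n → ∀ x, Λ n x - Λ m x ∈ G.F m}
    {x : F.Compl} {n : ℕ} {c : X} (hx : x.1 n = Submodule.Quotient.mk c) :
    (lim F G Λ h hc x).1 n = Submodule.Quotient.mk (Λ n c) := by
  change Submodule.mapQ _ _ (Λ n) (h n) (x.1 n) = _
  rw [hx]
  rfl

theorem compl_zero {F : Filtration k X} (h : F.F 0 = ⊤) : F.compl.F 0 = ⊤ := by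
  refine eq_top_iff.2 fun x _ => ?_
  change x.1 0 = 0
  obtain ⟨y, hy⟩ := Submodule.Quotient.mk_surjective _ (x.1 0)
  rw [← hy, Submodule.Quotient.mk_eq_zero, h]
  exact Submodule.mem_top

theorem tensor_map_sub_mem {G : Filtration k Y} (h0 : G.F 0 = ⊤) {n : ℕ} {a b : X →ₗ[k] Y}
    (h : ∀ x, a x - b x ∈ G.F n) (z : X ⊗[k] X) :
    TensorProduct.map a a z - TensorProduct.map b b z ∈ (G.tensor G).F n := by
  have ht : ∀ y, y ∈ G.F 0 := fun y => h0 ▸ Submodule.mem_top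
  induction z using TensorProduct.induction_on with
  | zero => simp
  | tmul x y =>
    have e : a x ⊗ₜ[k] a y - b x ⊗ₜ[k] b y =
        (a x - b x) ⊗ₜ[k] a y + b x ⊗ₜ[k] (a y - b y) := by
      rw [TensorProduct.sub_tmul, TensorProduct.tmul_sub]; abel
    rw [TensorProduct.map_tmul, TensorProduct.map_tmul, e]
    exact Submodule.add_mem _ (tmul_mem (p := n) (q := 0) (by omega) (h x) (ht _))
      (tmul_mem (p := 0) (q := n) (by omega) (ht _) (h y))
  | add z w hz hw =>
    rw [map_add, map_add, add_sub_add_comm]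
    exact Submodule.add_mem _ hz hw

theorem mem_tensor_of_of {F : Filtration k X} (h0 : F.F 0 = ⊤) {n : ℕ} {z : X ⊗[k] X}
    (hz : TensorProduct.map F.of F.of z ∈ (F.compl.tensor F.compl).F n) : z ∈ (F.tensor F).F n := by
  obtain ⟨t, ht⟩ := LinearMap.exists_rightInverse_of_surjective (F.F n).mkQ
    (LinearMap.range_eq_top.2 (Submodule.mkQ_surjective _))
  let s : F.Compl →ₗ[k] X := t ∘ₗ (LinearMap.proj n).comp F.Compl.subtype
  have hs : ∀ x : F.Compl, Submodule.Quotient.mk (s x) = x.1 n := fun x =>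
    DFunLike.congr_fun ht (x.1 n)
  have hsF : ∀ p, ∀ x ∈ F.compl.F p, s x ∈ F.F (min p n) := fun p x hx => by
    have hx0 : x.1 p = 0 := hx
    rcases le_total p n with h | h
    · rw [min_eq_left h]
      have h1 := x.2 p n h
      rw [hx0, ← hs] at h1
      exact (Submodule.Quotient.mk_eq_zero _).1 h1
    · rw [min_eq_right h]
      have h1 := x.2 n p h
      rw [hx0, map_zero, ← hs] at h1
      exact (Submodule.Quotient.mk_eq_zero _).1 h1.symm
  have h1 : TensorProduct.map s s (TensorProduct.map F.of F.of z) ∈ (F.tensor F).F n := by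
    suffices h : (F.compl.tensor F.compl).F n ≤ ((F.tensor F).F n).comap (TensorProduct.map s s) from
      h hz
    refine Submodule.span_le.2 ?_
    rintro _ ⟨p, q, x, y, hpq, hx, hy, rfl⟩
    exact tmul_mem (by omega) (hsF p x hx) (hsF q y hy)
  have h2 := tensor_map_sub_mem h0 (n := n) (a := s ∘ₗ F.of) (b := LinearMap.id)
    (fun x => (Submodule.Quotient.eq _).1 (hs (F.of x))) z
  rw [TensorProduct.map_id, TensorProduct.map_comp] at h2
  have := Submodule.sub_mem _ h1 h2
  simpa using this

end Filtration

namespace TensorCoalg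

open TensorAlgebra

variable {k : Type u} [Field k] {V : Type u} [AddCommGroup V] [Module k V]
  {s b₁ : V →ₗ[k] V} {b₂ : V ⊗[k] V →ₗ[k] V}

theorem algebraMapInv_ι_mul (v : V) (x : TensorAlgebra k V) :
    algebraMapInv (ι k v * x) = (0 : k) := by
  simp [algebraMapInv]

theorem algebraMapInv_coder (x : TensorAlgebra k V) : algebraMapInv (coder s b₁ b₂ x) = (0 : k) := by
  suffices h : algebraMapInv.toLinearMap ∘ₗ coder s b₁ b₂ = 0 from DFunLike.congr_fun h x
  refine ext_word fun l => ?_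
  rcases l with _ | ⟨v, _ | ⟨w, l⟩⟩
  · simp [coder_one]
  · have h := coder_ι_mul (s := s) (b₁ := b₁) (b₂ := b₂) v 1
    have h2 := algebraMapInv_ι_mul (k := k) (b₁ v) 1
    rw [coder_one, mul_zero, add_zero, mul_one, contractHead_ι] at h
    rw [mul_one] at h2
    rw [word_cons, word_nil, mul_one, LinearMap.comp_apply, h]
    exact h2
  · simp [coder_ι_mul v, contractHead_ι_mul_ι_mul, algebraMapInv_ι_mul, -map_mul]

theorem ιInv_contractHead (x : TensorAlgebra k V) :
    ιInv (contractHead b₁ b₂ x) = corest b₁ b₂ x := by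
  suffices h : ιInv ∘ₗ contractHead b₁ b₂ = corest b₁ b₂ from DFunLike.congr_fun h x
  have h1 : ∀ v : V, ιInv (ι k v) = v := fun v => by
    have := ιInv_ι_mul (k := k) v 1
    rwa [mul_one, map_one, one_smul] at this
  refine ext_word fun l => ?_
  rcases l with _ | ⟨v, _ | ⟨w, l⟩⟩
  · simp [contractHead_one, corest_one]
  · have := corest_ι_mul (b₁ := b₁) (b₂ := b₂) v 1
    rw [map_one, one_smul, ιInv_one, TensorProduct.tmul_zero, map_zero, add_zero, mul_one] at this
    simp [contractHead_ι, h1, this]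
  · simp [contractHead_ι_mul_ι_mul, corest_ι_mul, ιInv_ι_mul, algebraMapInv_ι_mul, -map_mul]

theorem ιInv_coder (x : TensorAlgebra k V) : ιInv (coder s b₁ b₂ x) = corest b₁ b₂ x := by
  suffices h : ιInv ∘ₗ coder s b₁ b₂ = corest b₁ b₂ from DFunLike.congr_fun h x
  refine ext_word fun l => ?_
  rcases l with _ | ⟨v, l⟩
  · simp [coder_one, corest_one]
  · rw [LinearMap.comp_apply, word_cons, coder_ι_mul, map_add, ιInv_contractHead, ιInv_ι_mul,
      algebraMapInv_coder, zero_smul, add_zero]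

/-- An element of the tensor algebra is recovered from its first letters. -/
theorem head_tail (x : TensorAlgebra k V) : x = algebraMap k _ (algebraMapInv x) +
    LinearMap.mul' k _ (TensorProduct.map (ι k ∘ₗ ιInv) LinearMap.id (delta k V x)) := by
  suffices h : LinearMap.id = Algebra.linearMap k (TensorAlgebra k V) ∘ₗ
      algebraMapInv.toLinearMap + LinearMap.mul' k _ ∘ₗ
        TensorProduct.map (ι k ∘ₗ ιInv) LinearMap.id ∘ₗ delta k V from DFunLike.congr_fun h x
  refine ext_word fun l => ?_
  rcases l with _ | ⟨v, l⟩
  · simp [ιInv_one]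
  · have h1 : ∀ z : TensorAlgebra k V ⊗[k] TensorAlgebra k V,
        LinearMap.mul' k (TensorAlgebra k V) (TensorProduct.map (ι k ∘ₗ ιInv) LinearMap.id
          ((ι k v ⊗ₜ[k] 1) * z)) = ι k v * TensorProduct.lid k _
            (TensorProduct.map algebraMapInv.toLinearMap LinearMap.id z) := fun z => by
      induction z using TensorProduct.induction_on with
      | zero => simp
      | tmul a b => simp [ιInv_ι_mul]
      | add a b ha hb => simp only [mul_add, map_add, ha, hb]
    simp only [LinearMap.id_apply, LinearMap.add_apply, LinearMap.comp_apply, word_cons,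
      delta_ι_mul, map_add, h1, counit_delta, AlgHom.toLinearMap_apply, algebraMapInv_ι_mul, map_zero,
      TensorProduct.map_tmul, ιInv_one, zero_add, TensorProduct.zero_tmul]

end TensorCoalg

namespace FilteredModel

open TensorAlgebra TensorCoalg

variable {k : Type u} [Field k] {H : GCA k} {M : FilteredModel H}

theorem mem_wtFil_one (v : M.sL) : v ∈ M.wtFil.F 1 := fun n => (M.comp n v).2

theorem wordFil_zero : (wordFil M.wtFil).F 0 = ⊤ := by
  rw [eq_top_iff, ← span_word, Submodule.span_le]
  rintro _ ⟨l, rfl⟩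
  have := word_mem (G := M.wtFil) (l := l.map fun v => (1, v)) (n := 0) (by
    intro a ha
    obtain ⟨v, -, rfl⟩ := List.mem_map.1 ha
    exact mem_wtFil_one v) (by omega)
  simpa [Function.comp_def] using this

theorem mem_wordFil_zero (x : TensorAlgebra k M.sL) : x ∈ (wordFil M.wtFil).F 0 :=
  (wordFil_zero (M := M)).ge Submodule.mem_top

variable (M) in
/-- The elements of degree `j` of the tensor coalgebra. -/
def tensGr (j : ℤ) : Submodule k (TensorAlgebra k M.sL) :=
  Submodule.span k {x | ∃ l : List (Σ n : ℤ, M.der n 1), (l.map fun a => a.1 - 1).sum = j ∧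
    x = word k (l.map fun a => M.susp a.1 a.2)}

theorem one_mem_tensGr : (1 : TensorAlgebra k M.sL) ∈ M.tensGr 0 :=
  Submodule.subset_span ⟨[], by simp, by simp⟩

theorem mul_mem_tensGr {i j : ℤ} {x y : TensorAlgebra k M.sL} (hx : x ∈ M.tensGr i)
    (hy : y ∈ M.tensGr j) : x * y ∈ M.tensGr (i + j) := by
  have := Submodule.mul_mem_mul hx hy
  rw [tensGr, tensGr, Submodule.span_mul_span] at this
  refine Submodule.span_mono ?_ this
  rintro _ ⟨_, ⟨l, rfl, rfl⟩, _, ⟨l', rfl, rfl⟩, rfl⟩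
  exact ⟨l ++ l', by simp, by rw [List.map_append, word_append]⟩

theorem ι_susp_mem_tensGr (n : ℤ) (θ : M.der n 1) : ι k (M.susp n θ) ∈ M.tensGr (n - 1) :=
  Submodule.subset_span ⟨[⟨n, θ⟩], by simp, by simp⟩

/-- The conditions on `φ : C → s L` under which it cogenerates a map of filtered dg coalgebras. -/
structure Twisting {C : FiltCoalg k} (σ : C.X →ₗ[k] C.X) (φ : C.X →ₗ[k] M.sL) : Prop where
  fil : ∀ n, C.fil.F n ≤ (M.wtFil.F n).comap φ
  gr : ∀ n, ∀ c ∈ C.gr n, ι k (φ c) ∈ M.tensGr n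
  par : ∀ c, φ (σ c) = M.par (φ c)
  mc : ∀ c, M.b₁ (φ c) + M.b₂ (TensorProduct.map φ φ (C.comul c)) = φ (C.d c)

/-- The truncated exponential of `φ`. -/
def expSum {C : FiltCoalg k} (φ : C.X →ₗ[k] M.sL) (n : ℕ) : C.X →ₗ[k] TensorAlgebra k M.sL :=
  ∑ r ∈ Finset.range n, expo φ r

variable {C : FiltCoalg k} {σ : C.X →ₗ[k] C.X} {φ : C.X →ₗ[k] M.sL}

theorem expSum_apply (n : ℕ) (c : C.X) : expSum φ n c = ∑ r ∈ Finset.range n, expo φ r c :=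
  LinearMap.sum_apply _ _ _

theorem expo_mem_gr (hC : C.Laws σ) (h : Twisting σ φ) (r : ℕ) {n : ℤ} {c : C.X} (hc : c ∈ C.gr n) :
    expo φ r c ∈ M.tensGr n := by
  induction r generalizing n c with
  | zero =>
    rw [expo_zero]
    by_cases hn : n = 0
    · subst hn
      rw [Algebra.algebraMap_eq_smul_one]
      exact Submodule.smul_mem _ _ one_mem_tensGr
    · rw [hC.counit_gr n hn c hc, map_zero]
      exact Submodule.zero_mem _
  | succ r ih =>
    rw [expo_succ]
    suffices hs : Submodule.span k {z | ∃ (i j : ℤ) (x y : C.X), i + j = n ∧ x ∈ C.gr i ∧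
        y ∈ C.gr j ∧ z = x ⊗ₜ[k] y} ≤ (M.tensGr n).comap (LinearMap.mul' k (TensorAlgebra k M.sL) ∘ₗ
          TensorProduct.map (ι k ∘ₗ φ) (expo φ r)) from hs (hC.comul_gr n c hc)
    refine Submodule.span_le.2 ?_
    rintro _ ⟨i, j, x, y, rfl, hx, hy, rfl⟩
    exact mul_mem_tensGr (h.gr i x hx) (ih hy)

theorem expSum_mem_symm (hC : C.Laws σ) (h : Twisting σ φ) (n : ℕ) (c : C.X) :
    expSum φ n c ∈ M.symm := by
  rw [expSum_apply]
  exact Submodule.sum_mem _ fun r _ => expo_mem_symm hC h.par r c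

theorem expSum_mem_wordFil (h : Twisting σ φ) (m n : ℕ) :
    C.fil.F n ≤ ((wordFil M.wtFil).F n).comap (expSum φ m) := fun c hc => by
  rw [Submodule.mem_comap, expSum_apply]
  exact Submodule.sum_mem _ fun r _ => expo_mem_wordFil h.fil r n hc

theorem expo_mem_length (r : ℕ) (c : C.X) : expo φ r c ∈ (wordFil M.wtFil).F r :=
  expo_mem_wordFil_length (fun _ => mem_wtFil_one _) r c

theorem expSum_sub_mem {m n : ℕ} (hmn : m ≤ n) (c : C.X) :
    expSum φ n c - expSum φ m c ∈ (wordFil M.wtFil).F m := by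
  rw [expSum_apply, expSum_apply, ← Finset.sum_range_add_sum_Ico _ hmn, add_sub_cancel_left]
  exact Submodule.sum_mem _ fun r hr =>
    (wordFil M.wtFil).anti (Finset.mem_Ico.1 hr).1 (expo_mem_length r c)

theorem coder_expSum (hC : C.Laws σ) (h : Twisting σ φ) (n : ℕ) (c : C.X) :
    coder M.par M.b₁ M.b₂ (expSum φ n c) - expSum φ n (C.d c) ∈ (wordFil M.wtFil).F n := by
  have e : coder M.par M.b₁ M.b₂ (expSum φ n c) - expSum φ n (C.d c) =
      -coder M.par 0 M.b₂ (expo φ n c) := by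
    rw [expSum_apply, expSum_apply, map_sum]
    induction n with
    | zero =>
      rw [Finset.sum_range_zero, Finset.sum_range_zero, expo_zero,
        Algebra.algebraMap_eq_smul_one, map_smul, coder_one, smul_zero, sub_zero, neg_zero]
    | succ n ih =>
      rw [Finset.sum_range_succ, Finset.sum_range_succ, add_sub_add_comm, ih,
        coder_add (s := M.par) (b₁ := M.b₁) (b₂ := M.b₂) (expo φ n c), ← coder_expo hC h.par h.mc]
      abel
  rw [e]
  refine Submodule.neg_mem _ ?_
  exact wordFil_coder (b₁ := 0) 0 M.wtFil_par (fun n x _ => by simp) M.wtFil_b₂ n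
    (expo_mem_length n c)

theorem delta_expSum (hC : C.Laws σ) (n : ℕ) (c : C.X) : delta k M.sL (expSum φ n c) -
    TensorProduct.map (expSum φ n) (expSum φ n) (C.comul c) ∈
      ((wordFil M.wtFil).tensor (wordFil M.wtFil)).F n := by
  have h1 : TensorProduct.map (expSum φ n) (expSum φ n) (C.comul c) =
      ∑ ab ∈ Finset.range n ×ˢ Finset.range n,
        TensorProduct.map (expo φ ab.1) (expo φ ab.2) (C.comul c) := by
    generalize C.comul c = z
    induction z using TensorProduct.induction_on with
    | zero => simp
    | tmul x y =>
      simp only [TensorProduct.map_tmul, expSum_apply, TensorProduct.sum_tmul,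
        TensorProduct.tmul_sum, Finset.sum_product]
      try rw [Finset.sum_comm]
    | add a b ha hb => simp only [map_add, ha, hb, Finset.sum_add_distrib]
  have h2 : delta k M.sL (expSum φ n c) =
      ∑ ab ∈ (Finset.range n ×ˢ Finset.range n).filter (fun ab => ab.1 + ab.2 < n),
        TensorProduct.map (expo φ ab.1) (expo φ ab.2) (C.comul c) := by
    rw [expSum_apply, map_sum]
    simp only [delta_expo hC]
    rw [Finset.sum_sigma']
    refine Finset.sum_bij (fun x _ => x.2) ?_ ?_ ?_ ?_
    · rintro ⟨r, ab⟩ h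
      simp only [Finset.mem_sigma, Finset.mem_range, Finset.HasAntidiagonal.mem_antidiagonal] at h
      simp only [Finset.mem_filter, Finset.mem_product, Finset.mem_range]
      omega
    · rintro ⟨r, ab⟩ h ⟨r', ab'⟩ h' e
      simp only [Finset.mem_sigma, Finset.mem_range, Finset.HasAntidiagonal.mem_antidiagonal] at h h'
      simp only at e
      subst e
      obtain rfl : r = r' := h.2.symm.trans h'.2
      rfl
    · intro ab h
      simp only [Finset.mem_filter, Finset.mem_product, Finset.mem_range] at h
      exact ⟨⟨ab.1 + ab.2, ab⟩, by
        simpa [Finset.HasAntidiagonal.mem_antidiagonal] using h.2, rfl⟩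
    · intros; rfl
  rw [h1, h2, ← Finset.sum_filter_add_sum_filter_not (Finset.range n ×ˢ Finset.range n)
    (fun ab => ab.1 + ab.2 < n), sub_add_cancel_left]
  refine Submodule.neg_mem _ (Submodule.sum_mem _ fun ab hab => ?_)
  have hn : n ≤ ab.1 + ab.2 := not_lt.1 (Finset.mem_filter.1 hab).2
  generalize C.comul c = z
  induction z using TensorProduct.induction_on with
  | zero => simp
  | tmul x y => exact Filtration.tmul_mem hn (expo_mem_length _ _) (expo_mem_length _ _)
  | add a b ha hb => rw [map_add]; exact Submodule.add_mem _ ha hb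

end FilteredModel

theorem Filtration.map_apply {k X Y : Type u} [Field k] [AddCommGroup X] [Module k X]
    [AddCommGroup Y] [Module k Y] {F : Filtration k X} {G : Filtration k Y} {f : X →ₗ[k] Y}
    {hf : ∀ n, F.F n ≤ (G.F n).comap f} {x : F.Compl} {n : ℕ} {y : X}
    (hx : x.1 n = Submodule.Quotient.mk y) : (F.map G f hf x).1 n = Submodule.Quotient.mk (f y) := by
  change Submodule.mapQ _ _ f _ (x.1 n) = _
  rw [hx]
  rfl

namespace FiltCoalg

variable {k : Type u} [Field k] {C D : FiltCoalg k}

theorem hatD_apply {x : C.Hat} {n : ℕ} {c : C.X} (hx : x.1 n = Submodule.Quotient.mk c) :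
    (C.hatD x).1 n = Submodule.Quotient.mk (C.d c) := by
  change Submodule.mapQ _ _ C.d _ (x.1 n) = _
  rw [hx]
  rfl

theorem hatCounit_apply {x : C.Hat} {c : C.X} (hx : x.1 1 = Submodule.Quotient.mk c) :
    C.hatCounit x = C.counit c := by
  change (C.fil.F 1).liftQ C.counit C.counit_fil (x.1 1) = _
  rw [hx]
  rfl

theorem hatComul_apply {x : C.Hat} {n : ℕ} {c : C.X} (hx : x.1 n = Submodule.Quotient.mk c) :
    (C.hatComul x).1 n =
      Submodule.Quotient.mk (TensorProduct.map C.fil.of C.fil.of (C.comul c)) := by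
  change Submodule.mapQ _ _ _ _ (x.1 n) = _
  rw [hx]
  rfl

theorem hatTensorMap_hatComul_apply {f : C.Hat →ₗ[k] D.Hat}
    {hf : ∀ n, C.fil.compl.F n ≤ (D.fil.compl.F n).comap f} {x : C.Hat} {n : ℕ} {c : C.X}
    (hx : x.1 n = Submodule.Quotient.mk c) : (hatTensorMap C D f hf (C.hatComul x)).1 n =
      Submodule.Quotient.mk
        (TensorProduct.map f f (TensorProduct.map C.fil.of C.fil.of (C.comul c))) := by
  exact Filtration.map_apply (hatComul_apply hx)

end FiltCoalg

theorem Filtration.tensor_map_sub_map_mem {k X Y A B : Type u} [Field k] [AddCommGroup X]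
    [Module k X] [AddCommGroup Y] [Module k Y] [AddCommGroup A] [Module k A] [AddCommGroup B]
    [Module k B] {W : Filtration k Y} {G : Filtration k B} (h0 : G.F 0 = ⊤) {n : ℕ} {f : A →ₗ[k] B}
    {i : Y →ₗ[k] B} (hi : ∀ n, W.F n ≤ (G.F n).comap i) {g : X →ₗ[k] A} {e : X →ₗ[k] Y}
    (h : ∀ x, f (g x) - i (e x) ∈ G.F n) {z : X ⊗[k] X} {y : Y ⊗[k] Y}
    (hy : y - TensorProduct.map e e z ∈ (W.tensor W).F n) :
    TensorProduct.map i i y - TensorProduct.map f f (TensorProduct.map g g z) ∈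
      (G.tensor G).F n := by
  have e1 := tensor_map_sub_mem h0 (a := f ∘ₗ g) (b := i ∘ₗ e) h z
  have e2 := tensor_map_le₀ hi hi n hy
  rw [TensorProduct.map_comp, TensorProduct.map_comp, LinearMap.comp_apply,
    LinearMap.comp_apply] at e1
  rw [Submodule.mem_comap, map_sub] at e2
  have e3 := Submodule.sub_mem _ e2 e1
  rwa [sub_sub_sub_cancel_right] at e3

namespace FilteredModel

open TensorAlgebra TensorCoalg

variable {k : Type u} [Field k] {H : GCA k} {M : FilteredModel H}
  {C : FiltCoalg k} {σ : C.X →ₗ[k] C.X} {φ : C.X →ₗ[k] M.sL}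

/-- The linear map of completions cogenerated by `φ`. -/
def cogen (h : Twisting σ φ) : C.Hat →ₗ[k] (wordFil M.wtFil).Compl :=
  Filtration.lim C.fil (wordFil M.wtFil) (expSum φ) (fun n => expSum_mem_wordFil h n n)
    fun _ _ hmn c => expSum_sub_mem hmn c

theorem cogen_apply (h : Twisting σ φ) {x : C.Hat} {n : ℕ} {c : C.X}
    (hx : x.1 n = Submodule.Quotient.mk c) :
    (cogen h x).1 n = (Submodule.Quotient.mk (expSum φ n c) :
      TensorAlgebra k M.sL ⧸ (wordFil M.wtFil).F n) := Filtration.lim_apply hx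

theorem cogen_fil (h : Twisting σ φ) (n : ℕ) :
    C.fil.compl.F n ≤ (M.tens.fil.compl.F n).comap (cogen h) := fun x hx => by
  have hx' : x.1 n = Submodule.Quotient.mk 0 := hx
  refine (cogen_apply h hx').trans ?_
  rw [map_zero]
  rfl

theorem cogen_gr (hC : C.Laws σ) (h : Twisting σ φ) (n : ℤ) (x : C.Hat) (hx : x ∈ C.hatGr n) :
    cogen h x ∈ M.tens.hatGr n := fun p => by
  obtain ⟨c, hc, e⟩ := hx p
  refine ⟨expSum φ p c, ?_, (cogen_apply h e.symm).symm⟩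
  rw [expSum_apply]
  exact Submodule.sum_mem (M.tensGr n) fun r _ => expo_mem_gr hC h r hc

theorem cogen_d (hC : C.Laws σ) (h : Twisting σ φ) (x : C.Hat) :
    cogen h (C.hatD x) = M.tens.hatD (cogen h x) := by
  refine Subtype.ext (funext fun n => ?_)
  obtain ⟨c, hc⟩ := Submodule.Quotient.mk_surjective _ (x.1 n)
  have h1 := cogen_apply h (FiltCoalg.hatD_apply hc.symm)
  have h2 := FiltCoalg.hatD_apply (C := M.tens) (cogen_apply h hc.symm)
  refine h1.trans (Eq.trans ?_ h2.symm)
  exact ((Submodule.Quotient.eq _).2 (coder_expSum hC h n c)).symm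

theorem cogen_counit (h : Twisting σ φ) (x : C.Hat) :
    M.tens.hatCounit (cogen h x) = C.hatCounit x := by
  obtain ⟨c, hc⟩ := Submodule.Quotient.mk_surjective _ (x.1 1)
  refine (FiltCoalg.hatCounit_apply (C := M.tens) (cogen_apply h hc.symm)).trans
    (Eq.trans ?_ (FiltCoalg.hatCounit_apply hc.symm).symm)
  change algebraMapInv (expSum φ 1 c) = _
  rw [expSum_apply, Finset.sum_range_one, expo_zero]
  exact TensorAlgebra.algebraMap_leftInverse _ _

theorem cogen_of (h : Twisting σ φ) (n : ℕ) (c : C.X) :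
    cogen h (C.fil.of c) - (wordFil M.wtFil).of (expSum φ n c) ∈
      (wordFil M.wtFil).compl.F n := by
  have h1 : (cogen h (C.fil.of c)).1 n = (Submodule.Quotient.mk (expSum φ n c) :
      TensorAlgebra k M.sL ⧸ (wordFil M.wtFil).F n) := cogen_apply h rfl
  change (cogen h (C.fil.of c)).1 n - ((wordFil M.wtFil).of (expSum φ n c)).1 n = 0
  exact sub_eq_zero.2 h1

theorem cogen_comul (hC : C.Laws σ) (h : Twisting σ φ) (x : C.Hat) : M.tens.hatComul (cogen h x) =
    FiltCoalg.hatTensorMap C M.tens (cogen h) (cogen_fil h) (C.hatComul x) := by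
  refine Subtype.ext (funext fun n => ?_)
  obtain ⟨c, hc⟩ := Submodule.Quotient.mk_surjective _ (x.1 n)
  have h1 := FiltCoalg.hatTensorMap_hatComul_apply (D := M.tens) (f := cogen h) (hf := cogen_fil h)
    hc.symm
  have h2 := FiltCoalg.hatComul_apply (C := M.tens) (cogen_apply h hc.symm)
  refine h2.trans (Eq.trans ?_ h1.symm)
  exact (Submodule.Quotient.eq _).2 (Filtration.tensor_map_sub_map_mem
    (Filtration.compl_zero wordFil_zero) (fun _ _ h => Filtration.of_mem _ h) (cogen_of h n)
    (delta_expSum hC n c))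

/-- The map of filtered dg coalgebras cogenerated by `φ`. -/
theorem Twisting.exists_hom (hC : C.Laws σ) (h : Twisting σ φ) :
    ∃ f : FiltCoalg.Hom C M.tens, (∀ x, f.f x ∈ M.symmHat) ∧
      ∀ (x : C.Hat) (n : ℕ) (c : C.X), x.1 n = Submodule.Quotient.mk c →
        (f.f x).1 n = (Submodule.Quotient.mk (expSum φ n c) :
          TensorAlgebra k M.sL ⧸ (wordFil M.wtFil).F n) := by
  refine ⟨⟨cogen h, cogen_fil h, cogen_gr hC h, cogen_d hC h, cogen_counit h, cogen_comul hC h⟩,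
    fun x p => ?_, fun x n c hx => cogen_apply h hx⟩
  obtain ⟨c, hc⟩ := Submodule.Quotient.mk_surjective _ (x.1 p)
  exact ⟨_, expSum_mem_symm hC h p c, (cogen_apply h hc.symm).symm⟩

end FilteredModel

theorem sum_antidiagonal_assoc {V : Type*} [AddCommMonoid V] (n : ℕ) (F : ℕ → ℕ → ℕ → V) :
    ∑ ij ∈ Finset.HasAntidiagonal.antidiagonal n,
      ∑ ab ∈ Finset.HasAntidiagonal.antidiagonal ij.1, F ab.1 ab.2 ij.2 =
    ∑ ij ∈ Finset.HasAntidiagonal.antidiagonal n,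
      ∑ ab ∈ Finset.HasAntidiagonal.antidiagonal ij.2, F ij.1 ab.1 ab.2 := by
  rw [Finset.sum_sigma', Finset.sum_sigma']
  refine Finset.sum_nbij' (fun x => ⟨(x.2.1, x.2.2 + x.1.2), (x.2.2, x.1.2)⟩)
    (fun x => ⟨(x.1.1 + x.2.1, x.2.2), (x.1.1, x.2.1)⟩) ?_ ?_ ?_ ?_ ?_
  · rintro ⟨⟨i, j⟩, ⟨a, b⟩⟩ h
    simp only [Finset.mem_sigma, Finset.HasAntidiagonal.mem_antidiagonal] at h ⊢
    exact ⟨by omega, trivial⟩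
  · rintro ⟨⟨i, j⟩, ⟨a, b⟩⟩ h
    simp only [Finset.mem_sigma, Finset.HasAntidiagonal.mem_antidiagonal] at h ⊢
    exact ⟨by omega, trivial⟩
  · rintro ⟨⟨i, j⟩, ⟨a, b⟩⟩ h
    simp only [Finset.mem_sigma, Finset.HasAntidiagonal.mem_antidiagonal] at h
    obtain ⟨-, rfl⟩ := h
    rfl
  · rintro ⟨⟨i, j⟩, ⟨a, b⟩⟩ h
    simp only [Finset.mem_sigma, Finset.HasAntidiagonal.mem_antidiagonal] at h
    obtain ⟨-, rfl⟩ := h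
    rfl
  · intros; rfl

namespace FiltCoalg

variable {k : Type u} [Field k]

/-- The graded interchange with parity operator `σ`. -/
def gradedSwap {X : Type u} [AddCommGroup X] [Module k X] (σ : X →ₗ[k] X) :
    X ⊗[k] X →ₗ[k] X ⊗[k] X :=
  ((2 : k)⁻¹ • (LinearMap.id + TensorProduct.map σ LinearMap.id + TensorProduct.map LinearMap.id σ -
    TensorProduct.map σ σ)) ∘ₗ (TensorProduct.comm k _ _).toLinearMap

theorem gradedSwap_tmul {X : Type u} [AddCommGroup X] [Module k X] (σ : X →ₗ[k] X) (x y : X) :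
    gradedSwap σ (x ⊗ₜ[k] y) =
      (2 : k)⁻¹ • (y ⊗ₜ[k] x + σ y ⊗ₜ[k] x + y ⊗ₜ[k] σ x - σ y ⊗ₜ[k] σ x) := rfl

theorem half_smul_add_self [CharZero k] {X : Type u} [AddCommGroup X] [Module k X] (x : X) :
    (2 : k)⁻¹ • (x + x) = x := by
  rw [← two_smul k x, smul_smul, inv_mul_cancel₀ two_ne_zero, one_smul]

theorem gradedSwap_of_even [CharZero k] {X : Type u} [AddCommGroup X] [Module k X] {σ : X →ₗ[k] X}
    {x y : X} (hx : σ x = x) (hy : σ y = y) : gradedSwap σ (x ⊗ₜ[k] y) = y ⊗ₜ[k] x := by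
  rw [gradedSwap_tmul, hx, hy, add_sub_cancel_right, half_smul_add_self]

theorem gradedSwap_of_odd_left [CharZero k] {X : Type u} [AddCommGroup X] [Module k X]
    {σ : X →ₗ[k] X} {x y : X} (hx : σ x = (-1 : k) • x) (hy : σ y = y) :
    gradedSwap σ (x ⊗ₜ[k] y) = y ⊗ₜ[k] x := by
  rw [gradedSwap_tmul, hx, hy, add_sub_cancel_right, half_smul_add_self]

theorem gradedSwap_of_odd_right [CharZero k] {X : Type u} [AddCommGroup X] [Module k X]
    {σ : X →ₗ[k] X} {x y : X} (hx : σ x = x) (hy : σ y = (-1 : k) • y) :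
    gradedSwap σ (x ⊗ₜ[k] y) = y ⊗ₜ[k] x := by
  rw [gradedSwap_tmul, hx, hy, neg_one_smul, TensorProduct.neg_tmul, add_neg_cancel, zero_add,
    sub_neg_eq_add, half_smul_add_self]

theorem pt_cocomm [CharZero k] (c : k) :
    gradedSwap (LinearMap.id : k →ₗ[k] k) ((1 : k) ⊗ₜ[k] c) = (1 : k) ⊗ₜ[k] c := by
  have h : (1 : k) ⊗ₜ[k] c = c ⊗ₜ[k] (1 : k) := by
    have := TensorProduct.smul_tmul (R := k) c (1 : k) (1 : k)
    rwa [smul_eq_mul, mul_one, eq_comm] at this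
  rw [gradedSwap_tmul, LinearMap.id_apply, LinearMap.id_apply, add_sub_cancel_right,
    half_smul_add_self, h]

theorem pt_counit (c : k) : TensorProduct.lid k k (TensorProduct.map (LinearMap.id : k →ₗ[k] k)
    (LinearMap.id : k →ₗ[k] k) ((1 : k) ⊗ₜ[k] c)) = c := by
  rw [TensorProduct.map_tmul, TensorProduct.lid_tmul, LinearMap.id_apply, LinearMap.id_apply,
    one_smul]

theorem pt_comul_d (c : k) :
    (1 : k) ⊗ₜ[k] (0 : k) = (0 : k) ⊗ₜ[k] c + (1 : k) ⊗ₜ[k] (0 : k) := by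
  rw [TensorProduct.zero_tmul, zero_add]

theorem pt_laws [CharZero k] : (pt k).Laws LinearMap.id where
  coassoc _ := rfl
  counit c := pt_counit (k := k) c
  cocomm c := pt_cocomm (k := k) c
  comul_par _ := rfl
  counit_par _ := rfl
  counit_d _ := rfl
  comul_d c := pt_comul_d (k := k) c
  comul_gr n c hc := by
    refine Submodule.subset_span ⟨0, n, (1 : k), c, zero_add n, ?_, hc, rfl⟩
    change (1 : k) ∈ (if (0 : ℤ) = 0 then (⊤ : Submodule k k) else ⊥)
    rw [if_pos rfl]
    exact Submodule.mem_top
  counit_gr n hn c hc := by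
    have h : ∀ c : k, c ∈ (if n = 0 then (⊤ : Submodule k k) else ⊥) → c = 0 := fun c hc => by
      rwa [if_neg hn, Submodule.mem_bot] at hc
    exact h c hc

theorem interval_ext {Y : Type u} [AddCommMonoid Y] [Module k Y] {f g : IntervalSpace k →ₗ[k] Y}
    (ht : ∀ n, f (tt k n) = g (tt k n)) (hu : ∀ n, f (tu k n) = g (tu k n)) : f = g :=
  Finsupp.lhom_ext' fun x => LinearMap.ext_ring (by
    rcases x with n | n
    · exact ht n
    · exact hu n)

variable (k) in
/-- The comultiplication of the interval coalgebra. -/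
def intervalComul : IntervalSpace k →ₗ[k] IntervalSpace k ⊗[k] IntervalSpace k :=
  (interval k).comul

variable (k) in
/-- The differential of the interval coalgebra. -/
def intervalD : IntervalSpace k →ₗ[k] IntervalSpace k := (interval k).d

variable (k) in
/-- The counit of the interval coalgebra. -/
def intervalCounit : IntervalSpace k →ₗ[k] k := (interval k).counit

variable (k) in
/-- The parity operator of the interval coalgebra. -/
def intervalPar : IntervalSpace k →ₗ[k] IntervalSpace k :=
  intervalLift k (tt k) (fun n => (-1 : k) • tu k n)

theorem interval_comul_tt (n : ℕ) : (intervalComul k) (tt k n) =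
    ∑ ij ∈ Finset.HasAntidiagonal.antidiagonal n, tt k ij.1 ⊗ₜ[k] tt k ij.2 :=
  intervalLift_tt _ _ n

theorem interval_comul_tu (n : ℕ) : (intervalComul k) (tu k n) =
    ∑ ij ∈ Finset.HasAntidiagonal.antidiagonal n,
      (tu k ij.1 ⊗ₜ[k] tt k ij.2 + tt k ij.1 ⊗ₜ[k] tu k ij.2) :=
  intervalLift_tu _ _ n

theorem interval_d_tt (n : ℕ) : (intervalD k) (tt k n) = 0 := intervalLift_tt _ _ n

theorem interval_d_tu (n : ℕ) : (intervalD k) (tu k n) = ((n : k) + 1) • tt k (n + 1) :=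
  intervalLift_tu _ _ n

theorem interval_counit_tt (n : ℕ) : (intervalCounit k) (tt k n) = if n = 0 then 1 else 0 :=
  intervalLift_tt _ _ n

theorem interval_counit_tu (n : ℕ) : (intervalCounit k) (tu k n) = 0 := intervalLift_tu _ _ n

theorem intervalPar_tt (n : ℕ) : intervalPar k (tt k n) = tt k n := intervalLift_tt _ _ n

theorem intervalPar_tu (n : ℕ) : intervalPar k (tu k n) = (-1 : k) • tu k n := intervalLift_tu _ _ n

theorem interval_coassoc (c : IntervalSpace k) :
    TensorProduct.assoc k (IntervalSpace k) (IntervalSpace k) (IntervalSpace k)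
      (TensorProduct.map (intervalComul k) LinearMap.id (intervalComul k c)) =
    TensorProduct.map LinearMap.id (intervalComul k) (intervalComul k c) := by
  suffices h : (TensorProduct.assoc k (IntervalSpace k) (IntervalSpace k)
      (IntervalSpace k)).toLinearMap ∘ₗ
      TensorProduct.map (intervalComul k) LinearMap.id ∘ₗ (intervalComul k) =
      TensorProduct.map LinearMap.id (intervalComul k) ∘ₗ (intervalComul k) from
    DFunLike.congr_fun h c
  refine interval_ext (k := k) (fun n => ?_) fun n => ?_
  · rw [LinearMap.comp_apply, LinearMap.comp_apply, LinearMap.comp_apply, interval_comul_tt]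
    simp only [map_sum, TensorProduct.map_tmul, interval_comul_tt, LinearMap.id_apply,
      TensorProduct.sum_tmul, TensorProduct.tmul_sum, LinearEquiv.coe_coe, TensorProduct.assoc_tmul]
    exact sum_antidiagonal_assoc n fun a b c => tt k a ⊗ₜ[k] (tt k b ⊗ₜ[k] tt k c)
  · rw [LinearMap.comp_apply, LinearMap.comp_apply, LinearMap.comp_apply, interval_comul_tu]
    simp only [map_sum, map_add, TensorProduct.map_tmul, interval_comul_tt, interval_comul_tu,
      LinearMap.id_apply, TensorProduct.sum_tmul, TensorProduct.tmul_sum, LinearEquiv.coe_coe,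
      TensorProduct.assoc_tmul, TensorProduct.add_tmul, TensorProduct.tmul_add,
      Finset.sum_add_distrib]
    rw [sum_antidiagonal_assoc n fun a b c => tu k a ⊗ₜ[k] (tt k b ⊗ₜ[k] tt k c),
      sum_antidiagonal_assoc n fun a b c => tt k a ⊗ₜ[k] (tu k b ⊗ₜ[k] tt k c),
      sum_antidiagonal_assoc n fun a b c => tt k a ⊗ₜ[k] (tt k b ⊗ₜ[k] tu k c), add_assoc]

theorem interval_counit (c : IntervalSpace k) : TensorProduct.lid k (IntervalSpace k)
    (TensorProduct.map (intervalCounit k) LinearMap.id (intervalComul k c)) = c := by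
  suffices h : (TensorProduct.lid k (IntervalSpace k)).toLinearMap ∘ₗ
      TensorProduct.map (intervalCounit k) LinearMap.id ∘ₗ (intervalComul k) = LinearMap.id from
    DFunLike.congr_fun h c
  refine interval_ext (k := k) (fun n => ?_) fun n => ?_
  · rw [LinearMap.comp_apply, LinearMap.comp_apply, interval_comul_tt]
    simp only [map_sum, TensorProduct.map_tmul, interval_counit_tt, LinearMap.id_apply,
      LinearEquiv.coe_coe, TensorProduct.lid_tmul, ite_smul, one_smul, zero_smul]
    exact sum_antidiagonal_fst_zero n fun j => tt k j
  · rw [LinearMap.comp_apply, LinearMap.comp_apply, interval_comul_tu]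
    simp only [map_sum, map_add, TensorProduct.map_tmul, interval_counit_tt, interval_counit_tu,
      LinearMap.id_apply, LinearEquiv.coe_coe, TensorProduct.lid_tmul, ite_smul, one_smul,
      zero_smul, zero_add]
    exact sum_antidiagonal_fst_zero n fun j => tu k j

theorem interval_cocomm [CharZero k] (c : IntervalSpace k) :
    gradedSwap (intervalPar k) (intervalComul k c) = (intervalComul k) c := by
  suffices h : gradedSwap (intervalPar k) ∘ₗ (intervalComul k) =
      (intervalComul k) from DFunLike.congr_fun h c
  refine interval_ext (k := k) (fun n => ?_) fun n => ?_
  · rw [LinearMap.comp_apply, interval_comul_tt, map_sum, ← Finset.Nat.sum_antidiagonal_swap]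
    refine Finset.sum_congr rfl fun ij _ => ?_
    exact gradedSwap_of_even (intervalPar_tt _) (intervalPar_tt _)
  · rw [LinearMap.comp_apply, interval_comul_tu, map_sum, ← Finset.Nat.sum_antidiagonal_swap]
    refine Finset.sum_congr rfl fun ij _ => ?_
    rw [map_add, add_comm]
    exact congrArg₂ _ (gradedSwap_of_odd_right (intervalPar_tt _) (intervalPar_tu _))
      (gradedSwap_of_odd_left (intervalPar_tu _) (intervalPar_tt _))

theorem interval_comul_d (c : IntervalSpace k) : (intervalComul k) (intervalD k c) =
    TensorProduct.map (intervalD k) LinearMap.id (intervalComul k c) +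
      TensorProduct.map (intervalPar k) (intervalD k) (intervalComul k c) := by
  suffices h : (intervalComul k) ∘ₗ (intervalD k) =
      TensorProduct.map (intervalD k) LinearMap.id ∘ₗ (intervalComul k) +
        TensorProduct.map (intervalPar k) (intervalD k) ∘ₗ (intervalComul k) from
    DFunLike.congr_fun h c
  refine interval_ext (k := k) (fun n => ?_) fun n => ?_
  · rw [LinearMap.add_apply, LinearMap.comp_apply, LinearMap.comp_apply, LinearMap.comp_apply,
      interval_comul_tt, interval_d_tt]
    simp only [map_sum, map_zero, TensorProduct.map_tmul, interval_d_tt, TensorProduct.zero_tmul,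
      TensorProduct.tmul_zero, Finset.sum_const_zero, add_zero]
  · rw [LinearMap.add_apply, LinearMap.comp_apply, LinearMap.comp_apply, LinearMap.comp_apply,
      interval_comul_tu, interval_d_tu, map_smul, interval_comul_tt]
    simp only [map_sum, map_add, TensorProduct.map_tmul, interval_d_tt, interval_d_tu,
      TensorProduct.zero_tmul, TensorProduct.tmul_zero, add_zero, zero_add, LinearMap.id_apply,
      intervalPar_tt]
    let F : ℕ × ℕ → IntervalSpace k ⊗[k] IntervalSpace k := fun ij =>
      (ij.1 : k) • (tt k ij.1 ⊗ₜ[k] tt k ij.2)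
    let G : ℕ × ℕ → IntervalSpace k ⊗[k] IntervalSpace k := fun ij =>
      (ij.2 : k) • (tt k ij.1 ⊗ₜ[k] tt k ij.2)
    have h1 : ((n : k) + 1) • ∑ ij ∈ Finset.HasAntidiagonal.antidiagonal (n + 1),
        tt k ij.1 ⊗ₜ[k] tt k ij.2 = ∑ ij ∈ Finset.HasAntidiagonal.antidiagonal (n + 1), F ij +
          ∑ ij ∈ Finset.HasAntidiagonal.antidiagonal (n + 1), G ij := by
      rw [Finset.smul_sum, ← Finset.sum_add_distrib]
      refine Finset.sum_congr rfl fun ij hij => ?_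
      rw [← add_smul, ← Nat.cast_add, Finset.HasAntidiagonal.mem_antidiagonal.1 hij]
      push_cast
      rfl
    rw [h1, Finset.Nat.sum_antidiagonal_succ (f := F), Finset.Nat.sum_antidiagonal_succ' (f := G)]
    simp only [F, G, Nat.cast_zero, zero_smul, zero_add, Nat.cast_add, Nat.cast_one,
      ← TensorProduct.smul_tmul', TensorProduct.tmul_smul]

variable (k) in
/-- The grading of the interval coalgebra. -/
def intervalGr (n : ℤ) : Submodule k (IntervalSpace k) :=
  if n = 0 then Submodule.span k (Set.range (tt k))
    else if n = -1 then Submodule.span k (Set.range (tu k)) else ⊥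

theorem intervalGr_zero : intervalGr k 0 = Submodule.span k (Set.range (tt k)) := by
  simp [intervalGr]

theorem intervalGr_neg_one : intervalGr k (-1) = Submodule.span k (Set.range (tu k)) := by
  simp [intervalGr]

theorem intervalGr_eq_bot {n : ℤ} (h0 : n ≠ 0) (h1 : n ≠ -1) : intervalGr k n = ⊥ := by
  simp [intervalGr, h0, h1]

theorem interval_le_of_basis {Y : Type u} [AddCommGroup Y] [Module k Y] {Q : ℤ → Submodule k Y}
    {f : IntervalSpace k →ₗ[k] Y} (h0 : ∀ n, f (tt k n) ∈ Q 0) (h1 : ∀ n, f (tu k n) ∈ Q (-1))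
    (n : ℤ) (c : IntervalSpace k) (hc : c ∈ intervalGr k n) : f c ∈ Q n := by
  by_cases hn : n = 0
  · subst hn
    rw [intervalGr_zero] at hc
    refine (Submodule.span_le (p := (Q 0).comap f)).2 ?_ hc
    rintro _ ⟨i, rfl⟩
    exact h0 i
  · by_cases hn1 : n = -1
    · subst hn1
      rw [intervalGr_neg_one] at hc
      refine (Submodule.span_le (p := (Q (-1)).comap f)).2 ?_ hc
      rintro _ ⟨i, rfl⟩
      exact h1 i
    · rw [intervalGr_eq_bot hn hn1, Submodule.mem_bot] at hc
      rw [hc, map_zero]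
      exact Submodule.zero_mem _

theorem tt_mem_gr (n : ℕ) : tt k n ∈ intervalGr k 0 :=
  intervalGr_zero.ge (Submodule.subset_span ⟨n, rfl⟩)

theorem tu_mem_gr (n : ℕ) : tu k n ∈ intervalGr k (-1) :=
  intervalGr_neg_one.ge (Submodule.subset_span ⟨n, rfl⟩)

theorem interval_comul_par (c : IntervalSpace k) : (intervalComul k) (intervalPar k c) =
    TensorProduct.map (intervalPar k) (intervalPar k) ((intervalComul k) c) := by
  suffices h : (intervalComul k) ∘ₗ intervalPar k =
      TensorProduct.map (intervalPar k) (intervalPar k) ∘ₗ (intervalComul k) from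
    DFunLike.congr_fun h c
  refine interval_ext (k := k) (fun n => ?_) fun n => ?_
  · rw [LinearMap.comp_apply, LinearMap.comp_apply, intervalPar_tt, interval_comul_tt]
    simp only [map_sum, TensorProduct.map_tmul, intervalPar_tt]
  · rw [LinearMap.comp_apply, LinearMap.comp_apply, intervalPar_tu, map_smul, interval_comul_tu]
    simp only [map_sum, map_add, TensorProduct.map_tmul, intervalPar_tt, intervalPar_tu,
      TensorProduct.tmul_smul, smul_add, Finset.smul_sum, ← TensorProduct.smul_tmul']

theorem interval_counit_par (c : IntervalSpace k) :
    (intervalCounit k) (intervalPar k c) = (intervalCounit k) c := by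
  suffices h : (intervalCounit k) ∘ₗ intervalPar k = (intervalCounit k) from DFunLike.congr_fun h c
  refine interval_ext (k := k) (fun n => ?_) fun n => ?_
  · rw [LinearMap.comp_apply, intervalPar_tt]
  · rw [LinearMap.comp_apply, intervalPar_tu, map_smul, interval_counit_tu, smul_zero]

theorem interval_counit_d (c : IntervalSpace k) : (intervalCounit k) ((intervalD k) c) = 0 := by
  suffices h : (intervalCounit k) ∘ₗ (intervalD k) = 0 from DFunLike.congr_fun h c
  refine interval_ext (k := k) (fun n => ?_) fun n => ?_
  · rw [LinearMap.comp_apply, interval_d_tt, map_zero]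
    rfl
  · rw [LinearMap.comp_apply, interval_d_tu, map_smul, interval_counit_tt,
      if_neg (Nat.succ_ne_zero n), smul_zero]
    rfl

theorem interval_comul_gr : ∀ (n : ℤ) (c : IntervalSpace k), c ∈ intervalGr k n →
    (intervalComul k) c ∈ Submodule.span k {z | ∃ (i j : ℤ) (x y : IntervalSpace k),
      i + j = n ∧ x ∈ intervalGr k i ∧ y ∈ intervalGr k j ∧ z = x ⊗ₜ[k] y} := by
  refine interval_le_of_basis (Q := fun n => Submodule.span k {z | ∃ (i j : ℤ)
    (x y : IntervalSpace k), i + j = n ∧ x ∈ intervalGr k i ∧ y ∈ intervalGr k j ∧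
      z = x ⊗ₜ[k] y}) (fun n => ?_) fun n => ?_
  · rw [interval_comul_tt]
    exact Submodule.sum_mem _ fun ij _ => Submodule.subset_span
      ⟨0, 0, _, _, rfl, tt_mem_gr _, tt_mem_gr _, rfl⟩
  · rw [interval_comul_tu]
    exact Submodule.sum_mem _ fun ij _ => Submodule.add_mem _ (Submodule.subset_span
      ⟨-1, 0, _, _, rfl, tu_mem_gr _, tt_mem_gr _, rfl⟩) (Submodule.subset_span
      ⟨0, -1, _, _, rfl, tt_mem_gr _, tu_mem_gr _, rfl⟩)

theorem interval_counit_gr (n : ℤ) (hn : n ≠ 0) (c : IntervalSpace k) (hc : c ∈ intervalGr k n) :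
    (intervalCounit k) c = 0 := by
  have := interval_le_of_basis (Q := fun n => if n = 0 then (⊤ : Submodule k k) else ⊥)
    (f := (intervalCounit k)) (fun n => by simp) (fun n => by simp [interval_counit_tu]) n c hc
  simpa [hn] using this

theorem interval_laws [CharZero k] : (interval k).Laws (intervalPar k) where
  coassoc := interval_coassoc
  counit := interval_counit
  cocomm := interval_cocomm
  comul_par := interval_comul_par
  counit_par := interval_counit_par
  counit_d := interval_counit_d
  comul_d := interval_comul_d
  comul_gr := interval_comul_gr
  counit_gr := interval_counit_gr

end FiltCoalg

namespace FilteredModel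

open TensorAlgebra TensorCoalg

variable {k : Type u} [Field k] {H : GCA k} {M : FilteredModel H}

/-- The operator on `S Z` underlying an element of `s L`. -/
def op : M.sL →ₗ[k] (M.S →ₗ[k] M.S) := M.lift fun n => (M.der n 1).subtype

theorem op_susp (n : ℤ) (θ : M.der n 1) : op (M.susp n θ) = θ.1 := lift_susp _ n θ

theorem comp_susp (n : ℤ) (θ : M.der n 1) : M.comp n (M.susp n θ) = θ := by
  change DirectSum.component k ℤ (fun n => M.der n 1) n
    (DirectSum.lof k ℤ (fun n => M.der n 1) n θ) = θ
  rw [DirectSum.component.lof_self]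

variable (M) in
/-- The suspension of `Lⁿ` in `s L`. -/
def sLgr (n : ℤ) : Submodule k M.sL := LinearMap.range (M.susp n)

theorem susp_mem_sLgr (n : ℤ) (θ : M.der n 1) : M.susp n θ ∈ M.sLgr n := ⟨θ, rfl⟩

theorem op_mem {n : ℤ} {v : M.sL} (hv : v ∈ M.sLgr n) : op v ∈ M.der n 1 := by
  obtain ⟨θ, rfl⟩ := hv
  rw [op_susp]
  exact θ.2

theorem op_injOn {n : ℤ} {v w : M.sL} (hv : v ∈ M.sLgr n) (hw : w ∈ M.sLgr n)
    (h : op v = op w) : v = w := by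
  obtain ⟨θ, rfl⟩ := hv
  obtain ⟨φ, rfl⟩ := hw
  rw [op_susp, op_susp] at h
  rw [Subtype.ext h]

theorem mem_wtFil_iff {n : ℤ} {v : M.sL} (hv : v ∈ M.sLgr n) {p : ℕ} :
    v ∈ M.wtFil.F p ↔ op v ∈ M.der n p := by
  obtain ⟨θ, rfl⟩ := hv
  rw [op_susp]
  refine ⟨fun h => ?_, fun h => susp_mem h⟩
  have := h n
  rwa [comp_susp] at this

theorem eq_zero_of_mem_der {n : ℤ} {θ : M.S →ₗ[k] M.S} (h : ∀ p, θ ∈ M.der n p) : θ = 0 := by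
  refine LinearMap.ext fun a => ?_
  obtain ⟨w, hw⟩ := FreeGCA.exists_mem_wtLE M.wt a
  have h1 := (h (w + 1)).2.2 w a hw
  rw [show M.wtLE _ = ⊥ from FreeGCA.wtLE_neg (wt := M.wt) (by push_cast; omega),
    Submodule.mem_bot] at h1
  exact h1

theorem sL_eq_zero {v : M.sL} (h : ∀ p, v ∈ M.wtFil.F p) : v = 0 := by
  refine DFinsupp.ext fun n => Subtype.ext ?_
  exact eq_zero_of_mem_der fun p => h p n

theorem b₁_mem {n m : ℤ} {v : M.sL} (hv : v ∈ M.sLgr n) (h : 1 + n = m) : M.b₁ v ∈ M.sLgr m := by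
  subst h
  obtain ⟨θ, rfl⟩ := hv
  rw [b₁_susp]
  exact Submodule.neg_mem _ (susp_mem_sLgr _ _)

theorem op_b₁ {n : ℤ} {v : M.sL} (hv : v ∈ M.sLgr n) : op (M.b₁ v) = -M.gcomm 1 n M.d (op v) := by
  obtain ⟨θ, rfl⟩ := hv
  rw [b₁_susp, map_neg, op_susp, op_susp]
  rfl

theorem b₂_mem {n m j : ℤ} {v w : M.sL} (hv : v ∈ M.sLgr n) (hw : w ∈ M.sLgr m) (h : n + m = j) :
    M.b₂ (v ⊗ₜ[k] w) ∈ M.sLgr j := by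
  subst h
  obtain ⟨θ, rfl⟩ := hv
  obtain ⟨φ, rfl⟩ := hw
  rw [b₂_susp]
  exact Submodule.smul_mem _ _ (susp_mem_sLgr _ _)

theorem op_b₂ {n m : ℤ} {v w : M.sL} (hv : v ∈ M.sLgr n) (hw : w ∈ M.sLgr m) :
    op (M.b₂ (v ⊗ₜ[k] w)) = ((2 : k)⁻¹ * sgn k n) • M.gcomm n m (op v) (op w) := by
  obtain ⟨θ, rfl⟩ := hv
  obtain ⟨φ, rfl⟩ := hw
  rw [b₂_susp, map_smul, op_susp, op_susp, op_susp]
  rfl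

/-- The Maurer-Cartan equation of a polynomial family of elements of degree `1`. -/
theorem mc_even_iff [CharZero k] {v : ℕ → M.sL} (hv : ∀ n, v n ∈ M.sLgr 1) (n : ℕ) :
    M.b₁ (v n) + M.b₂ (∑ ij ∈ Finset.HasAntidiagonal.antidiagonal n, v ij.1 ⊗ₜ[k] v ij.2) = 0 ↔
      ∀ a, M.d (op (v n) a) + op (v n) (M.d a) +
        ∑ ij ∈ Finset.HasAntidiagonal.antidiagonal n, op (v ij.1) (op (v ij.2) a) = 0 := by
  have hmem : M.b₁ (v n) + M.b₂ (∑ ij ∈ Finset.HasAntidiagonal.antidiagonal n,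
      v ij.1 ⊗ₜ[k] v ij.2) ∈ M.sLgr 2 := by
    rw [map_sum]
    exact Submodule.add_mem _ (b₁_mem (hv n) (by norm_num))
      (Submodule.sum_mem _ fun ij _ => b₂_mem (hv _) (hv _) (by norm_num))
  have hop : ∀ a, op (M.b₁ (v n) + M.b₂ (∑ ij ∈ Finset.HasAntidiagonal.antidiagonal n,
      v ij.1 ⊗ₜ[k] v ij.2)) a = -(M.d (op (v n) a) + op (v n) (M.d a) +
        ∑ ij ∈ Finset.HasAntidiagonal.antidiagonal n, op (v ij.1) (op (v ij.2) a)) := fun a => by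
    have h2 : ∑ ij ∈ Finset.HasAntidiagonal.antidiagonal n, op (M.b₂ (v ij.1 ⊗ₜ[k] v ij.2)) a =
        -(2 : k)⁻¹ • (∑ ij ∈ Finset.HasAntidiagonal.antidiagonal n, op (v ij.1) (op (v ij.2) a) +
          ∑ ij ∈ Finset.HasAntidiagonal.antidiagonal n, op (v ij.1) (op (v ij.2) a)) := by
      conv_rhs => rw [← Finset.Nat.sum_antidiagonal_swap (M := M.S)]
      conv_rhs =>
        enter [2, 2]
        rw [← Finset.Nat.sum_antidiagonal_swap (M := M.S)]
      rw [← Finset.sum_add_distrib, Finset.smul_sum]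
      refine Finset.sum_congr rfl fun ij _ => ?_
      rw [op_b₂ (hv _) (hv _), gcomm, mul_one, sgn_one]
      simp only [LinearMap.smul_apply, LinearMap.sub_apply, LinearMap.comp_apply, Prod.fst_swap,
        Prod.snd_swap, Prod.swap_swap]
      module
    rw [map_add, map_sum, map_sum, LinearMap.add_apply, LinearMap.sum_apply, h2, op_b₁ (hv n),
      gcomm, mul_one, sgn_one, neg_smul, FiltCoalg.half_smul_add_self]
    simp only [LinearMap.neg_apply, LinearMap.sub_apply, LinearMap.smul_apply, LinearMap.comp_apply]
    module
  refine ⟨fun h a => ?_, fun h => op_injOn hmem (Submodule.zero_mem _) (LinearMap.ext fun a => ?_)⟩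
  · rw [← neg_eq_zero, ← hop, h, map_zero, LinearMap.zero_apply]
  · rw [hop, h, map_zero, neg_zero, LinearMap.zero_apply]

/-- The equation of motion of a polynomial path. -/
theorem mc_odd_iff [CharZero k] {v y : ℕ → M.sL} (hv : ∀ n, v n ∈ M.sLgr 1)
    (hy : ∀ n, y n ∈ M.sLgr 0) (n : ℕ) :
    M.b₁ (y n) + M.b₂ (∑ ij ∈ Finset.HasAntidiagonal.antidiagonal n,
        (y ij.1 ⊗ₜ[k] v ij.2 + v ij.1 ⊗ₜ[k] y ij.2)) = ((n : k) + 1) • v (n + 1) ↔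
      ∀ a, ((n : k) + 1) • op (v (n + 1)) a = op (y n) (M.d a) - M.d (op (y n) a) +
        ∑ ij ∈ Finset.HasAntidiagonal.antidiagonal n,
          (op (y ij.1) (op (v ij.2) a) - op (v ij.2) (op (y ij.1) a)) := by
  have hmem : M.b₁ (y n) + M.b₂ (∑ ij ∈ Finset.HasAntidiagonal.antidiagonal n,
      (y ij.1 ⊗ₜ[k] v ij.2 + v ij.1 ⊗ₜ[k] y ij.2)) ∈ M.sLgr 1 := by
    rw [map_sum]
    refine Submodule.add_mem _ (b₁_mem (hy n) (by norm_num))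
      (Submodule.sum_mem _ fun ij _ => ?_)
    rw [map_add]
    exact Submodule.add_mem _ (b₂_mem (hy _) (hv _) (by norm_num))
      (b₂_mem (hv _) (hy _) (by norm_num))
  have hop : ∀ a, op (M.b₁ (y n) + M.b₂ (∑ ij ∈ Finset.HasAntidiagonal.antidiagonal n,
      (y ij.1 ⊗ₜ[k] v ij.2 + v ij.1 ⊗ₜ[k] y ij.2))) a = op (y n) (M.d a) - M.d (op (y n) a) +
        ∑ ij ∈ Finset.HasAntidiagonal.antidiagonal n,
          (op (y ij.1) (op (v ij.2) a) - op (v ij.2) (op (y ij.1) a)) := fun a => by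
    have h2 : ∑ ij ∈ Finset.HasAntidiagonal.antidiagonal n,
        op (M.b₂ (y ij.1 ⊗ₜ[k] v ij.2 + v ij.1 ⊗ₜ[k] y ij.2)) a =
        ∑ ij ∈ Finset.HasAntidiagonal.antidiagonal n,
          (op (y ij.1) (op (v ij.2) a) - op (v ij.2) (op (y ij.1) a)) := by
      have h3 : ∀ ij : ℕ × ℕ, op (M.b₂ (y ij.1 ⊗ₜ[k] v ij.2 + v ij.1 ⊗ₜ[k] y ij.2)) a =
          (2 : k)⁻¹ • (op (y ij.1) (op (v ij.2) a) - op (v ij.2) (op (y ij.1) a)) +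
          (2 : k)⁻¹ • (op (y ij.2) (op (v ij.1) a) - op (v ij.1) (op (y ij.2) a)) := fun ij => by
        rw [map_add, map_add, op_b₂ (hv _) (hy _), op_b₂ (hy _) (hv _), gcomm, gcomm, zero_mul,
          mul_zero, sgn_one, sgn_zero]
        simp only [LinearMap.smul_apply, LinearMap.sub_apply, LinearMap.comp_apply,
          LinearMap.add_apply]
        module
      simp only [h3]
      rw [Finset.sum_add_distrib]
      conv_lhs =>
        enter [2]
        rw [← Finset.Nat.sum_antidiagonal_swap (M := M.S)]
      rw [← Finset.sum_add_distrib]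
      refine Finset.sum_congr rfl fun ij _ => ?_
      rw [← smul_add]
      exact FiltCoalg.half_smul_add_self _
    rw [map_add, map_sum, map_sum, LinearMap.add_apply, LinearMap.sum_apply, h2, op_b₁ (hy n),
      gcomm, mul_zero, sgn_zero, one_smul]
    simp only [LinearMap.neg_apply, LinearMap.sub_apply, LinearMap.comp_apply]
    abel
  refine ⟨fun h a => ?_, fun h => op_injOn hmem (Submodule.smul_mem _ _ (hv _))
    (LinearMap.ext fun a => ?_)⟩
  · rw [← hop, h, map_smul, LinearMap.smul_apply]
  · rw [hop, map_smul, LinearMap.smul_apply, h]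

theorem ι_mem_tensGr {n m : ℤ} {v : M.sL} (hv : v ∈ M.sLgr n) (h : n - 1 = m) :
    ι k v ∈ M.tensGr m := by
  subst h
  obtain ⟨θ, rfl⟩ := hv
  exact ι_susp_mem_tensGr n θ

theorem par_of_mem {n : ℤ} {v : M.sL} (hv : v ∈ M.sLgr n) : M.par v = sgn k (n - 1) • v := by
  obtain ⟨θ, rfl⟩ := hv
  exact par_susp n θ

theorem sgn_neg_one : sgn k (-1) = -1 := by simp [sgn]

section

open FiltCoalg

theorem intervalLift_par {v y : ℕ → M.sL} (hv : ∀ n, v n ∈ M.sLgr 1) (hy : ∀ n, y n ∈ M.sLgr 0) :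
    intervalLift k v y ∘ₗ intervalPar k = M.par ∘ₗ intervalLift k v y := by
  refine interval_ext (fun n => ?_) fun n => ?_
  · rw [LinearMap.comp_apply, LinearMap.comp_apply, intervalPar_tt, intervalLift_tt,
      par_of_mem (hv n), sub_self, sgn_zero, one_smul]
  · rw [LinearMap.comp_apply, LinearMap.comp_apply, intervalPar_tu, map_smul, intervalLift_tu,
      par_of_mem (hy n), zero_sub, sgn_neg_one]

theorem intervalLift_mc {v y : ℕ → M.sL}
    (hmc : ∀ n, M.b₁ (v n) +
      M.b₂ (∑ ij ∈ Finset.HasAntidiagonal.antidiagonal n, v ij.1 ⊗ₜ[k] v ij.2) = 0)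
    (hev : ∀ n, M.b₁ (y n) + M.b₂ (∑ ij ∈ Finset.HasAntidiagonal.antidiagonal n,
        (y ij.1 ⊗ₜ[k] v ij.2 + v ij.1 ⊗ₜ[k] y ij.2)) = ((n : k) + 1) • v (n + 1)) :
    M.b₁ ∘ₗ intervalLift k v y + M.b₂ ∘ₗ TensorProduct.map (intervalLift k v y)
      (intervalLift k v y) ∘ₗ intervalComul k = intervalLift k v y ∘ₗ intervalD k := by
  refine interval_ext (fun n => ?_) fun n => ?_
  · rw [LinearMap.add_apply, LinearMap.comp_apply, LinearMap.comp_apply, LinearMap.comp_apply,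
      LinearMap.comp_apply, interval_comul_tt, interval_d_tt, intervalLift_tt, map_sum, map_zero]
    simp only [TensorProduct.map_tmul, intervalLift_tt]
    exact hmc n
  · rw [LinearMap.add_apply, LinearMap.comp_apply, LinearMap.comp_apply, LinearMap.comp_apply,
      LinearMap.comp_apply, interval_comul_tu, interval_d_tu, intervalLift_tu, map_sum, map_smul,
      intervalLift_tt]
    simp only [map_add (TensorProduct.map _ _), TensorProduct.map_tmul, intervalLift_tt,
      intervalLift_tu]
    exact hev n

theorem intervalLift_gr {v y : ℕ → M.sL} (hv : ∀ n, v n ∈ M.sLgr 1) (hy : ∀ n, y n ∈ M.sLgr 0)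
    (n : ℤ) (c : IntervalSpace k) (hc : c ∈ intervalGr k n) :
    ι k (intervalLift k v y c) ∈ M.tensGr n :=
  interval_le_of_basis (Q := M.tensGr) (f := ι k ∘ₗ intervalLift k v y)
    (fun n => by
      rw [LinearMap.comp_apply, intervalLift_tt]
      exact ι_mem_tensGr (hv n) (by norm_num))
    (fun n => by
      rw [LinearMap.comp_apply, intervalLift_tu]
      exact ι_mem_tensGr (hy n) (by norm_num)) n c hc

theorem twisting_interval {v y : ℕ → M.sL} (hv : ∀ n, v n ∈ M.sLgr 1) (hy : ∀ n, y n ∈ M.sLgr 0)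
    (hvF : ∀ n, v n ∈ M.wtFil.F n) (hyF : ∀ n, y n ∈ M.wtFil.F n)
    (hmc : ∀ n, M.b₁ (v n) +
      M.b₂ (∑ ij ∈ Finset.HasAntidiagonal.antidiagonal n, v ij.1 ⊗ₜ[k] v ij.2) = 0)
    (hev : ∀ n, M.b₁ (y n) + M.b₂ (∑ ij ∈ Finset.HasAntidiagonal.antidiagonal n,
        (y ij.1 ⊗ₜ[k] v ij.2 + v ij.1 ⊗ₜ[k] y ij.2)) = ((n : k) + 1) • v (n + 1)) :
    Twisting (C := interval k) (M := M) (intervalPar k) (intervalLift k v y) := by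
  have h1 : ∀ n, (intervalFil k).F n ≤ (M.wtFil.F n).comap (intervalLift k v y) := fun n =>
    intervalLift_le fun m hm => ⟨M.wtFil.anti hm (hvF m), M.wtFil.anti hm (hyF m)⟩
  have h3 : ∀ c, intervalLift k v y (intervalPar k c) = M.par (intervalLift k v y c) := fun c =>
    DFunLike.congr_fun (intervalLift_par hv hy) c
  have h4 : ∀ c, M.b₁ (intervalLift k v y c) + M.b₂ (TensorProduct.map (intervalLift k v y)
      (intervalLift k v y) (intervalComul k c)) = intervalLift k v y (intervalD k c) := fun c =>
    DFunLike.congr_fun (intervalLift_mc hmc hev) c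
  exact ⟨h1, intervalLift_gr hv hy, h3, h4⟩

theorem twisting_pt {v : M.sL} (hv : v ∈ M.sLgr 1)
    (hmc : M.b₁ v + M.b₂ (v ⊗ₜ[k] v) = 0) :
    Twisting (C := pt k) (M := M) LinearMap.id (LinearMap.toSpanSingleton k M.sL v) := by
  have h1 : ∀ (n : ℕ) (c : k), c ∈ (if n = 0 then (⊤ : Submodule k k) else ⊥) →
      c • v ∈ M.wtFil.F n := fun n c hc => by
    by_cases hn : n = 0
    · subst hn
      exact (mem_wtFil_iff (Submodule.smul_mem _ _ hv)).2
        (M.der_anti 1 (Nat.zero_le 1) (op_mem (Submodule.smul_mem _ _ hv)))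
    · rw [if_neg hn, Submodule.mem_bot] at hc
      rw [hc, zero_smul]
      exact Submodule.zero_mem _
  have h2 : ∀ (n : ℤ) (c : k), c ∈ (if n = 0 then (⊤ : Submodule k k) else ⊥) →
      ι k (c • v) ∈ M.tensGr n := fun n c hc => by
    by_cases hn : n = 0
    · subst hn
      exact ι_mem_tensGr (Submodule.smul_mem _ _ hv) (by norm_num)
    · rw [if_neg hn, Submodule.mem_bot] at hc
      rw [hc, zero_smul, map_zero]
      exact Submodule.zero_mem _
  have h3 : ∀ c : k, c • v = M.par (c • v) := fun c => by
    rw [map_smul, par_of_mem hv, sub_self, sgn_zero, one_smul]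
  have h4 : ∀ c : k, M.b₁ (c • v) + M.b₂ (((1 : k) • v) ⊗ₜ[k] (c • v)) = (0 : k) • v := fun c => by
    rw [one_smul, TensorProduct.tmul_smul, map_smul, map_smul, ← smul_add, hmc, smul_zero,
      zero_smul]
  exact ⟨h1, h2, h3, h4⟩

end

end FilteredModel

theorem Filtration.sub_map_mem_of_tensor_map {k X Y A : Type u} [Field k] [AddCommGroup X]
    [Module k X] [AddCommGroup Y] [Module k Y] [AddCommGroup A] [Module k A] {W : Filtration k Y}
    {B : Type u} [AddCommGroup B] [Module k B] {G : Filtration k B} (h0 : G.F 0 = ⊤) {n : ℕ}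
    {f : A →ₗ[k] B} {i : Y →ₗ[k] B}
    (hi : ∀ z, TensorProduct.map i i z ∈ (G.tensor G).F n → z ∈ (W.tensor W).F n) {g : X →ₗ[k] A}
    {e : X →ₗ[k] Y} (h : ∀ x, f (g x) - i (e x) ∈ G.F n) {z : X ⊗[k] X} {y : Y ⊗[k] Y}
    (hy : TensorProduct.map i i y - TensorProduct.map f f (TensorProduct.map g g z) ∈
      (G.tensor G).F n) : y - TensorProduct.map e e z ∈ (W.tensor W).F n := by
  have e1 := tensor_map_sub_mem h0 (a := f ∘ₗ g) (b := i ∘ₗ e) h z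
  rw [TensorProduct.map_comp, TensorProduct.map_comp, LinearMap.comp_apply,
    LinearMap.comp_apply] at e1
  refine hi _ ?_
  have e3 := Submodule.add_mem _ hy e1
  rwa [sub_add_sub_cancel, ← map_sub] at e3

namespace FilteredModel

open TensorAlgebra TensorCoalg

variable {k : Type u} [Field k] {H : GCA k} {M : FilteredModel H} {C : FiltCoalg k}

/-! #### Limits in `L` -/

theorem mem_der_of_gen {n : ℤ} {c : ℕ} {θ : M.S →ₗ[k] M.S} (hθ : θ ∈ M.der n c) {p : ℕ}
    (h : ∀ i, θ (M.z i) ∈ M.wtLE (M.wt i - p)) : θ ∈ M.der n p := by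
  obtain ⟨φ, hφ, e⟩ := exists_der (M := M) n p (fun i => θ (M.z i))
    (fun i => hθ.1 _ _ (gen_mem_gr i)) h
  have : θ = φ := LinearMap.ext fun a => by
    obtain ⟨r, hr⟩ := exists_mem_resSub a
    exact eqOn_resSub hθ hφ (fun i _ => (e i).symm) hr
  rwa [this]

theorem exists_der_limit {n : ℤ} {θ : ℕ → M.S →ₗ[k] M.S} (hθ : ∀ p, θ p ∈ M.der n 1)
    (hc : ∀ p q, p ≤ q → θ q - θ p ∈ M.der n p) :
    ∃ φ ∈ M.der n 1, ∀ p, φ - θ p ∈ M.der n p := by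
  obtain ⟨φ, hφ, e⟩ := exists_der (M := M) n 1 (fun i => θ (M.wt i + 1) (M.z i))
    (fun i => (hθ _).1 _ _ (gen_mem_gr i)) (fun i => (hθ _).2.2 _ _ (gen_mem_wtLE i))
  refine ⟨φ, hφ, fun p => mem_der_of_gen (Submodule.sub_mem _ hφ (hθ p)) fun i => ?_⟩
  rw [LinearMap.sub_apply, e]
  rcases le_total p (M.wt i + 1) with h | h
  · exact (hc _ _ h).2.2 _ _ (gen_mem_wtLE i)
  · have h1 := (hc _ _ h).2.2 _ _ (gen_mem_wtLE i)
    rw [show M.wtLE _ = ⊥ from FreeGCA.wtLE_neg (wt := M.wt) (by push_cast; omega),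
      Submodule.mem_bot, LinearMap.sub_apply, sub_eq_zero] at h1
    rw [h1, sub_self]
    exact Submodule.zero_mem _

theorem exists_sL_limit {n : ℤ} (x : M.wtFil.Compl)
    (hx : ∀ p, ∃ v ∈ M.sLgr n, x.1 p = Submodule.Quotient.mk v) :
    ∃ v ∈ M.sLgr n, M.wtFil.of v = x := by
  choose v hv e using hx
  have hc : ∀ p q, p ≤ q → v q - v p ∈ M.wtFil.F p := fun p q hpq => by
    have := x.2 p q hpq
    rw [e, e] at this
    exact (Submodule.Quotient.eq _).1 this
  obtain ⟨φ, hφ, h⟩ := exists_der_limit (fun p => op_mem (hv p)) fun p q hpq => by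
    rw [← map_sub]
    exact (mem_wtFil_iff (Submodule.sub_mem _ (hv q) (hv p))).1 (hc p q hpq)
  refine ⟨M.susp n ⟨φ, hφ⟩, susp_mem_sLgr _ _, Subtype.ext (funext fun p => ?_)⟩
  rw [e]
  refine (Submodule.Quotient.eq _).2 ?_
  rw [mem_wtFil_iff (Submodule.sub_mem _ (susp_mem_sLgr _ _) (hv p)), map_sub, op_susp]
  exact h p

theorem wtFil_of_injective {v w : M.sL} (h : M.wtFil.of v = M.wtFil.of w) : v = w := by
  rw [← sub_eq_zero]
  refine sL_eq_zero fun p => (Submodule.Quotient.eq _).1 ?_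
  exact congrFun (congrArg Subtype.val h) p

theorem wtFil_zero : M.wtFil.F 0 = ⊤ :=
  eq_top_iff.2 fun v _ => M.wtFil.anti (Nat.zero_le 1) (mem_wtFil_one v)

/-! #### The element of `s L` underlying an element of the completed tensor coalgebra -/

variable (M) in
/-- The projection of the completed tensor coalgebra to the completion of `s L`. -/
def hatHead : M.tens.Hat →ₗ[k] M.wtFil.Compl :=
  (wordFil M.wtFil).map M.wtFil ιInv wordFil_ιInv

theorem hatHead_apply {x : M.tens.Hat} {n : ℕ} {c : TensorAlgebra k M.sL}
    (hx : x.1 n = (Submodule.Quotient.mk c : TensorAlgebra k M.sL ⧸ (wordFil M.wtFil).F n)) :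
    (M.hatHead x).1 n = Submodule.Quotient.mk (ιInv c) := Filtration.map_apply hx

theorem ιInv_mem_sLgr {n m : ℤ} (hm : n + 1 = m) {x : TensorAlgebra k M.sL} (hx : x ∈ M.tensGr n) :
    ιInv x ∈ M.sLgr m := by
  suffices h : M.tensGr n ≤ (M.sLgr m).comap ιInv from h hx
  refine Submodule.span_le.2 ?_
  rintro _ ⟨l, hl, rfl⟩
  rcases l with _ | ⟨a, _ | ⟨b, l⟩⟩
  · simp [ιInv_one]
  · have h : algebraMapInv (1 : TensorAlgebra k M.sL) = (1 : k) := map_one _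
    have ha : a.1 = m := by
      simp only [List.map_cons, List.map_nil, List.sum_cons, List.sum_nil] at hl
      omega
    subst ha
    simp only [List.map_cons, List.map_nil, word_cons, word_nil, SetLike.mem_coe,
      Submodule.mem_comap, ιInv_ι_mul, h, one_smul]
    exact susp_mem_sLgr _ _
  · simp [ιInv_ι_mul, algebraMapInv_ι_mul]

theorem exists_head (f : FiltCoalg.Hom C M.tens) {n m : ℤ} (hm : n + 1 = m) {c : C.X}
    (hc : c ∈ C.gr n) : ∃ v ∈ M.sLgr m, M.wtFil.of v = M.hatHead (f.f (C.fil.of c)) := by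
  refine exists_sL_limit _ fun p => ?_
  obtain ⟨x, hx, e⟩ := f.map_gr n (C.fil.of c) (fun p => ⟨c, hc, rfl⟩) p
  exact ⟨_, ιInv_mem_sLgr hm hx, hatHead_apply e.symm⟩

theorem exists_lift (f : FiltCoalg.Hom C M.tens) (n : ℕ) : ∃ Λ : C.X →ₗ[k] TensorAlgebra k M.sL,
    ∀ c, (f.f (C.fil.of c)).1 n =
      (Submodule.Quotient.mk (Λ c) : TensorAlgebra k M.sL ⧸ (wordFil M.wtFil).F n) := by
  obtain ⟨t, ht⟩ := LinearMap.exists_rightInverse_of_surjective ((wordFil M.wtFil).F n).mkQ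
    (LinearMap.range_eq_top.2 (Submodule.mkQ_surjective _))
  let π : (wordFil M.wtFil).Compl →ₗ[k] TensorAlgebra k M.sL ⧸ (wordFil M.wtFil).F n :=
    (LinearMap.proj n).comp (wordFil M.wtFil).Compl.subtype
  let g : C.Hat →ₗ[k] (wordFil M.wtFil).Compl := f.f
  exact ⟨t ∘ₗ π ∘ₗ g ∘ₗ C.fil.of, fun c => (DFunLike.congr_fun ht (π (g (C.fil.of c)))).symm⟩

theorem lift_sub_mem (f : FiltCoalg.Hom C M.tens) {n : ℕ} {Λ : C.X →ₗ[k] TensorAlgebra k M.sL}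
    (hΛ : ∀ c, (f.f (C.fil.of c)).1 n =
      (Submodule.Quotient.mk (Λ c) : TensorAlgebra k M.sL ⧸ (wordFil M.wtFil).F n)) (c : C.X) :
    f.f (C.fil.of c) - M.tens.fil.of (Λ c) ∈ M.tens.fil.compl.F n :=
  (sub_eq_zero.2 (hΛ c) :)

theorem delta_lift (f : FiltCoalg.Hom C M.tens) {n : ℕ} {Λ : C.X →ₗ[k] TensorAlgebra k M.sL}
    (hΛ : ∀ c, (f.f (C.fil.of c)).1 n =
      (Submodule.Quotient.mk (Λ c) : TensorAlgebra k M.sL ⧸ (wordFil M.wtFil).F n)) (c : C.X) :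
    delta k M.sL (Λ c) - TensorProduct.map Λ Λ (C.comul c) ∈
      ((wordFil M.wtFil).tensor (wordFil M.wtFil)).F n := by
  have h1 := FiltCoalg.hatComul_apply (C := M.tens) (hΛ c)
  have h2 := FiltCoalg.hatTensorMap_hatComul_apply (D := M.tens) (f := f.f) (hf := f.map_fil)
    (x := C.fil.of c) (n := n) (c := c) rfl
  have h3 := (h1.symm.trans (congrFun (congrArg Subtype.val (f.map_comul (C.fil.of c))) n)).trans h2
  have h4 := (Submodule.Quotient.eq _).1 h3
  exact Filtration.sub_map_mem_of_tensor_map (Filtration.compl_zero wordFil_zero)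
    (fun z hz => Filtration.mem_tensor_of_of wordFil_zero hz) (lift_sub_mem f hΛ) h4

theorem coder_lift (f : FiltCoalg.Hom C M.tens) {n : ℕ} {Λ : C.X →ₗ[k] TensorAlgebra k M.sL}
    (hΛ : ∀ c, (f.f (C.fil.of c)).1 n =
      (Submodule.Quotient.mk (Λ c) : TensorAlgebra k M.sL ⧸ (wordFil M.wtFil).F n)) (c : C.X) :
    Λ (C.d c) - coder M.par M.b₁ M.b₂ (Λ c) ∈ (wordFil M.wtFil).F n := by
  have h1 := FiltCoalg.hatD_apply (C := M.tens) (hΛ c)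
  have h2 : (f.f (C.hatD (C.fil.of c))).1 n = _ := hΛ (C.d c)
  have h3 := (h2.symm.trans (congrFun (congrArg Subtype.val (f.map_d (C.fil.of c))) n)).trans h1
  exact (Submodule.Quotient.eq _).1 h3

section

variable {f : FiltCoalg.Hom C M.tens} {φ : C.X →ₗ[k] M.sL}

theorem head_mem_wtFil (hφ : ∀ c, M.wtFil.of (φ c) = M.hatHead (f.f (C.fil.of c))) {n : ℕ} {c : C.X}
    (hc : c ∈ C.fil.F n) : φ c ∈ M.wtFil.F n := by
  have h1 : (f.f (C.fil.of c)).1 n = (Submodule.Quotient.mk 0 :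
      TensorAlgebra k M.sL ⧸ (wordFil M.wtFil).F n) := f.map_fil n (C.fil.of_mem hc)
  have h2 := congrFun (congrArg Subtype.val (hφ c)) n
  rw [hatHead_apply h1, map_zero] at h2
  exact (Submodule.Quotient.mk_eq_zero _).1 h2

theorem head_sub_mem (hφ : ∀ c, M.wtFil.of (φ c) = M.hatHead (f.f (C.fil.of c))) {n : ℕ}
    {Λ : C.X →ₗ[k] TensorAlgebra k M.sL} (hΛ : ∀ c, (f.f (C.fil.of c)).1 n =
      (Submodule.Quotient.mk (Λ c) : TensorAlgebra k M.sL ⧸ (wordFil M.wtFil).F n)) (c : C.X) :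
    ιInv (Λ c) - φ c ∈ M.wtFil.F n := by
  have h2 := congrFun (congrArg Subtype.val (hφ c)) n
  rw [hatHead_apply (hΛ c)] at h2
  exact (Submodule.Quotient.eq _).1 h2.symm

theorem corest_lift (f : FiltCoalg.Hom C M.tens) {n : ℕ} {Λ : C.X →ₗ[k] TensorAlgebra k M.sL}
    (hΛ : ∀ c, (f.f (C.fil.of c)).1 n =
      (Submodule.Quotient.mk (Λ c) : TensorAlgebra k M.sL ⧸ (wordFil M.wtFil).F n)) (c : C.X) :
    (M.b₁ (ιInv (Λ c)) + M.b₂ (TensorProduct.map (ιInv ∘ₗ Λ) (ιInv ∘ₗ Λ) (C.comul c))) -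
      ιInv (Λ (C.d c)) ∈ M.wtFil.F n := by
  have h2 : ιInv (Λ (C.d c) - coder M.par M.b₁ M.b₂ (Λ c)) ∈ M.wtFil.F n :=
    wordFil_ιInv n (coder_lift f hΛ c)
  have h3 : M.b₂ (TensorProduct.map ιInv ιInv
      (delta k M.sL (Λ c) - TensorProduct.map Λ Λ (C.comul c))) ∈ M.wtFil.F n :=
    M.wtFil_b₂ n (Filtration.tensor_map_le₀ (F' := M.wtFil) (G' := M.wtFil) wordFil_ιInv
      wordFil_ιInv n (delta_lift f hΛ c))
  rw [map_sub, ιInv_coder, corest, LinearMap.add_apply, LinearMap.comp_apply, LinearMap.comp_apply,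
    LinearMap.comp_apply] at h2
  rw [map_sub, map_sub] at h3
  rw [TensorProduct.map_comp, LinearMap.comp_apply]
  have h7 := Submodule.neg_mem _ (Submodule.add_mem _ h2 h3)
  refine (congrArg (· ∈ M.wtFil.F n) ?_).mp h7
  abel

theorem head_mc (hφ : ∀ c, M.wtFil.of (φ c) = M.hatHead (f.f (C.fil.of c))) (c : C.X) :
    M.b₁ (φ c) + M.b₂ (TensorProduct.map φ φ (C.comul c)) = φ (C.d c) := by
  rw [← sub_eq_zero]
  refine sL_eq_zero fun n => ?_
  obtain ⟨Λ, hΛ⟩ := exists_lift f n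
  have h1 := head_sub_mem hφ hΛ
  have h2 := corest_lift f hΛ c
  have h4 : M.b₂ (TensorProduct.map (ιInv ∘ₗ Λ) (ιInv ∘ₗ Λ) (C.comul c) -
      TensorProduct.map φ φ (C.comul c)) ∈ M.wtFil.F n :=
    M.wtFil_b₂ n (Filtration.tensor_map_sub_mem (a := ιInv ∘ₗ Λ) wtFil_zero h1 _)
  have h5 : M.b₁ (ιInv (Λ c) - φ c) ∈ M.wtFil.F n := M.wtFil_b₁ n (h1 c)
  have h6 := h1 (C.d c)
  rw [map_sub] at h4
  rw [map_sub] at h5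
  have h7 := Submodule.sub_mem _ (Submodule.add_mem _ h2 h6) (Submodule.add_mem _ h4 h5)
  refine (congrArg (· ∈ M.wtFil.F n) ?_).mp h7
  abel

end

/-! #### Group-like elements -/

theorem sub_head_mul_mem {n : ℕ} {x : TensorAlgebra k M.sL} {v : M.sL}
    (hx : delta k M.sL x - x ⊗ₜ[k] x ∈ ((wordFil M.wtFil).tensor (wordFil M.wtFil)).F n)
    (h1 : algebraMapInv x = (1 : k)) (hv : ιInv x - v ∈ M.wtFil.F n) :
    x - (1 + ι k v * x) ∈ (wordFil M.wtFil).F n := by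
  have h2 : LinearMap.mul' k _ (TensorProduct.map (ι k ∘ₗ ιInv) LinearMap.id
      (delta k M.sL x - x ⊗ₜ[k] x)) ∈ (wordFil M.wtFil).F n :=
    wordFil_mul' n (Filtration.tensor_map_le₀ (F' := wordFil M.wtFil) (G' := wordFil M.wtFil)
      (f := ι k ∘ₗ ιInv) (fun n y hy => ι_mem (wordFil_ιInv (G := M.wtFil) n hy)) (fun _ _ h => h) n hx)
  have h3 : ι k (ιInv x - v) * x ∈ (wordFil M.wtFil).F n :=
    wordFil_mul (m := n) (n := 0) (ι_mem hv) (mem_wordFil_zero x)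
  have h4 := head_tail x
  rw [h1, map_one] at h4
  rw [map_sub, map_sub, TensorProduct.map_tmul, LinearMap.mul'_apply, LinearMap.comp_apply,
    LinearMap.id_apply] at h2
  rw [map_sub, sub_mul] at h3
  have h5 := Submodule.add_mem _ h2 h3
  refine (congrArg (· ∈ (wordFil M.wtFil).F n) ?_).mp h5
  conv_rhs =>
    enter [1]
    rw [h4]
  abel

theorem ι_pow_mem (v : M.sL) (j : ℕ) : ι k v ^ j ∈ (wordFil M.wtFil).F j := by
  induction j with
  | zero => exact mem_wordFil_zero _
  | succ j ih => rw [pow_succ]; exact wordFil_mul ih (ι_mem (mem_wtFil_one v))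

/-- A group-like element is the geometric series of its first component. -/
theorem sub_geom_sum_mem {n : ℕ} {x : TensorAlgebra k M.sL} {v : M.sL}
    (hx : delta k M.sL x - x ⊗ₜ[k] x ∈ ((wordFil M.wtFil).tensor (wordFil M.wtFil)).F n)
    (h1 : 0 < n → algebraMapInv x = (1 : k)) (hv : ιInv x - v ∈ M.wtFil.F n) :
    x - ∑ j ∈ Finset.range n, ι k v ^ j ∈ (wordFil M.wtFil).F n := by
  rcases Nat.eq_zero_or_pos n with rfl | hn
  · exact mem_wordFil_zero _
  have h := sub_head_mul_mem hx (h1 hn) hv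
  have hj : ∀ j, x - ∑ i ∈ Finset.range j, ι k v ^ i - ι k v ^ j * x ∈ (wordFil M.wtFil).F n := by
    intro j
    induction j with
    | zero =>
      rw [Finset.sum_range_zero, pow_zero, one_mul, sub_zero, sub_self]
      exact Submodule.zero_mem _
    | succ j ih =>
      have h2 : ι k v ^ j * (x - (1 + ι k v * x)) ∈ (wordFil M.wtFil).F n := by
        have := wordFil_mul (m := 0) (n := n) (mem_wordFil_zero (ι k v ^ j)) h
        rwa [zero_add] at this
      have h3 := Submodule.add_mem _ ih h2
      refine (congrArg (· ∈ (wordFil M.wtFil).F n) ?_).mp h3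
      rw [Finset.sum_range_succ, pow_succ, mul_sub, mul_add, mul_one, mul_assoc]
      abel
  have h2 : ι k v ^ n * x ∈ (wordFil M.wtFil).F n :=
    wordFil_mul (m := n) (n := 0) (ι_pow_mem v n) (mem_wordFil_zero x)
  have h3 := Submodule.add_mem _ (hj n) h2
  rwa [sub_add_cancel] at h3

theorem ιInv_ι_pow (v : M.sL) (j : ℕ) : ιInv (ι k v ^ j) = if j = 1 then v else 0 := by
  rcases j with _ | _ | j
  · rw [pow_zero, ιInv_one, if_neg (by omega)]
  · rw [zero_add, pow_one, if_pos rfl]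
    have := ιInv_ι_mul v (1 : TensorAlgebra k M.sL)
    rwa [mul_one, map_one, one_smul] at this
  · rw [pow_succ', pow_succ', ιInv_ι_mul, algebraMapInv_ι_mul, zero_smul, if_neg (by omega)]

theorem hatHead_chiElt (p : M.Perturbation) : M.hatHead p.chiElt = M.wtFil.of p.sp := by
  refine Subtype.ext (funext fun n => ?_)
  have h : (p.chiElt).1 n = (Submodule.Quotient.mk (∑ j ∈ Finset.range n, ι k p.sp ^ j) :
      TensorAlgebra k M.sL ⧸ (wordFil M.wtFil).F n) := rfl
  rw [hatHead_apply h]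
  refine (Submodule.Quotient.eq _).2 ?_
  rw [map_sum]
  simp only [ιInv_ι_pow, Finset.sum_ite_eq', Finset.mem_range]
  split_ifs with h1
  · rw [sub_self]
    exact Submodule.zero_mem _
  · exact M.wtFil.anti (show n ≤ 1 by omega) (mem_wtFil_one _)

end FilteredModel

theorem exists_quot_equiv {A B : Type*} {r : A → A → Prop} {s : B → B → Prop} (R : A → B → Prop)
    (hA : ∀ a, ∃ b, R a b) (hB : ∀ b, ∃ a, R a b) (hr : ∀ a, r a a) (hs : ∀ b, s b b)
    (h : ∀ a a' b b', R a b → R a' b' → (r a a' ↔ s b b')) :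
    ∃ Φ : Quot r ≃ Quot s, ∀ a b, R a b → Φ (Quot.mk r a) = Quot.mk s b := by
  choose F hF using hA
  choose G hG using hB
  refine ⟨⟨Quot.map F fun a a' haa => (h _ _ _ _ (hF a) (hF a')).1 haa,
    Quot.map G fun b b' hbb => (h _ _ _ _ (hG b) (hG b')).2 hbb, ?_, ?_⟩, fun a b hab => ?_⟩
  · rintro ⟨a⟩
    exact Quot.sound ((h _ _ _ _ (hG _) (hF a)).2 (hs _))
  · rintro ⟨b⟩
    exact Quot.sound ((h _ _ _ _ (hF _) (hG b)).1 (hr _))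
  · exact Quot.sound ((h _ _ _ _ (hF a) hab).1 (hr a))

theorem sum_antidiagonal_sub_mem {R V : Type*} [Ring R] [AddCommGroup V] [Module R V]
    (Q : Submodule R V) (n : ℕ) (F : ℕ → ℕ → V) (hF : ∀ i j, n ≤ i + j → F i j ∈ Q) :
    ∑ m ∈ Finset.range n, ∑ ij ∈ Finset.HasAntidiagonal.antidiagonal m, F ij.1 ij.2 -
      ∑ i ∈ Finset.range n, ∑ j ∈ Finset.range n, F i j ∈ Q := by
  have h2 : ∑ m ∈ Finset.range n, ∑ ij ∈ Finset.HasAntidiagonal.antidiagonal m, F ij.1 ij.2 =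
      ∑ ab ∈ (Finset.range n ×ˢ Finset.range n).filter (fun ab => ab.1 + ab.2 < n),
        F ab.1 ab.2 := by
    rw [Finset.sum_sigma']
    refine Finset.sum_bij (fun x _ => x.2) ?_ ?_ ?_ ?_
    · rintro ⟨r, ab⟩ h
      simp only [Finset.mem_sigma, Finset.mem_range, Finset.HasAntidiagonal.mem_antidiagonal] at h
      simp only [Finset.mem_filter, Finset.mem_product, Finset.mem_range]
      omega
    · rintro ⟨r, ab⟩ h ⟨r', ab'⟩ h' e
      simp only [Finset.mem_sigma, Finset.mem_range, Finset.HasAntidiagonal.mem_antidiagonal] at h h'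
      simp only at e
      subst e
      obtain rfl : r = r' := h.2.symm.trans h'.2
      rfl
    · intro ab h
      simp only [Finset.mem_filter, Finset.mem_product, Finset.mem_range] at h
      exact ⟨⟨ab.1 + ab.2, ab⟩, by
        simpa [Finset.HasAntidiagonal.mem_antidiagonal] using h.2, rfl⟩
    · intros; rfl
  have h3 : ∑ i ∈ Finset.range n, ∑ j ∈ Finset.range n, F i j =
      ∑ ab ∈ Finset.range n ×ˢ Finset.range n, F ab.1 ab.2 := (Finset.sum_product _ _ fun ab : ℕ × ℕ => F ab.1 ab.2).symm
  rw [h2, h3, ← Finset.sum_filter_add_sum_filter_not (Finset.range n ×ˢ Finset.range n)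
    (fun ab => ab.1 + ab.2 < n), sub_add_cancel_left]
  have h4 : ∑ ab ∈ (Finset.range n ×ˢ Finset.range n).filter (fun ab => ¬ ab.1 + ab.2 < n),
      F ab.1 ab.2 ∈ Q := by
    refine Submodule.sum_mem Q fun ab hab => ?_
    exact hF _ _ (not_lt.1 (Finset.mem_filter.1 hab).2)
  exact Q.neg_mem h4

theorem FiltCoalg.Hom.ext_f {k : Type u} [Field k] {C D : FiltCoalg k} {f g : FiltCoalg.Hom C D}
    (h : f.f = g.f) : f = g := by
  cases f
  cases g
  cases h
  rfl

theorem FiltCoalg.exists_eq_smul_ptOne {k : Type u} [Field k] (x : (FiltCoalg.pt k).Hat) :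
    ∃ c : k, x = c • FiltCoalg.ptOne := by
  have hF : ∀ n (c : k), c ∈ (pt k).fil.F 1 → c ∈ (pt k).fil.F n := fun n c hc => by
    have h : c = 0 := by
      change c ∈ (if 1 = 0 then (⊤ : Submodule k k) else ⊥) at hc
      simpa using hc
    rw [h]
    exact Submodule.zero_mem _
  have key : ∃ c : k, (Submodule.Quotient.mk (p := (pt k).fil.F 1) c) = x.1 1 :=
    Submodule.Quotient.mk_surjective _ (x.1 1)
  obtain ⟨c, hc⟩ := key
  refine ⟨c, Subtype.ext (funext fun n => ?_)⟩
  have h1 : (c • (ptOne : (pt k).Hat)).1 n = Submodule.Quotient.mk c :=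
    congrArg (Submodule.Quotient.mk (p := (pt k).fil.F n)) (mul_one (c : k))
  rw [h1]
  obtain ⟨c', hc'⟩ := Submodule.Quotient.mk_surjective _ (x.1 n)
  rw [← hc']
  refine (Submodule.Quotient.eq _).2 ?_
  rcases Nat.eq_zero_or_pos n with rfl | hn
  · exact Submodule.mem_top (R := k) (M := k)
  · have h2 := x.2 1 n hn
    rw [← hc, ← hc'] at h2
    exact hF n _ ((Submodule.Quotient.eq _).1 h2)

namespace FilteredModel

open TensorAlgebra TensorCoalg FiltCoalg

variable {k : Type u} [Field k] {H : GCA k} {M : FilteredModel H} {C : FiltCoalg k}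

theorem expo_of_grouplike {φ : C.X →ₗ[k] M.sL} {c : C.X} (hc : C.comul c = c ⊗ₜ[k] c)
    (h1 : C.counit c = 1) (r : ℕ) : expo φ r c = ι k (φ c) ^ r := by
  induction r with
  | zero => rw [expo_zero, h1, map_one, pow_zero]
  | succ r ih => rw [expo_succ, hc, TensorProduct.map_tmul, LinearMap.mul'_apply, ih, pow_succ']; rfl

theorem Perturbation.sp_mem (p : M.Perturbation) : p.sp ∈ M.sLgr 1 := susp_mem_sLgr _ _

theorem Perturbation.op_sp (p : M.Perturbation) : op p.sp = p.p := op_susp _ _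

theorem mc_iff [CharZero k] {v : M.sL} (hv : v ∈ M.sLgr 1) : M.b₁ v + M.b₂ (v ⊗ₜ[k] v) = 0 ↔
    ∀ a, (M.d + op v) ((M.d + op v) a) = 0 := by
  have h := mc_even_iff (v := fun _ => v) (fun _ => hv) 0
  simp only [Finset.Nat.antidiagonal_zero, Finset.sum_singleton] at h
  rw [h]
  refine forall_congr' fun a => ?_
  rw [LinearMap.add_apply, LinearMap.add_apply, map_add, map_add, M.d_d, zero_add, ← add_assoc]

theorem Perturbation.sp_mc [CharZero k] (p : M.Perturbation) :
    M.b₁ p.sp + M.b₂ (p.sp ⊗ₜ[k] p.sp) = 0 :=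
  (mc_iff p.sp_mem).2 (by rw [p.op_sp]; exact p.sq)

theorem exists_perturbation_of_mc [CharZero k] {v : M.sL} (hv : v ∈ M.sLgr 1)
    (h : M.b₁ v + M.b₂ (v ⊗ₜ[k] v) = 0) : ∃ p : M.Perturbation, p.sp = v := by
  refine ⟨⟨op v, op_mem hv, (mc_iff hv).1 h⟩, ?_⟩
  exact op_injOn (Perturbation.sp_mem _) hv (Perturbation.op_sp _)

theorem Perturbation.exists_point [CharZero k] (p : M.Perturbation) :
    ∃ χ : M.Point, p.IsClassifying χ := by
  obtain ⟨f, hs, hf⟩ := Twisting.exists_hom pt_laws (twisting_pt p.sp_mem p.sp_mc)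
  refine ⟨⟨f, hs⟩, Subtype.ext (funext fun n => (hf ptOne n (1 : k) rfl).trans ?_)⟩
  refine congrArg Submodule.Quotient.mk ?_
  refine (expSum_apply (C := pt k) n (1 : k)).trans (Finset.sum_congr rfl fun r _ => ?_)
  refine (expo_of_grouplike (C := pt k) (c := (1 : k)) rfl rfl r).trans ?_
  exact congrArg (fun v => ι k v ^ r) (one_smul k p.sp)

theorem point_ext {χ ψ : M.Point} (h : χ.1.f ptOne = ψ.1.f ptOne) : χ = ψ := by
  refine Subtype.ext (Hom.ext_f (LinearMap.ext fun x => ?_))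
  obtain ⟨c, rfl⟩ := exists_eq_smul_ptOne x
  rw [map_smul, map_smul, h]

theorem Perturbation.existsUnique_point [CharZero k] (p : M.Perturbation) :
    ∃! χ : M.Point, p.IsClassifying χ := by
  obtain ⟨χ, hχ⟩ := p.exists_point
  exact ⟨χ, hχ, fun ψ hψ => point_ext (Eq.trans hψ (Eq.symm hχ))⟩

theorem one_mem_pt_gr : (1 : k) ∈ (pt k).gr 0 := by
  change (1 : k) ∈ (if (0 : ℤ) = 0 then (⊤ : Submodule k k) else ⊥)
  rw [if_pos rfl]
  exact Submodule.mem_top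

theorem pt_of_eq (c : k) : (pt k).fil.of c = c • (ptOne : (pt k).Hat) :=
  (congrArg (pt k).fil.of (mul_one (c : k)).symm).trans (map_smul (pt k).fil.of (c : k) (1 : k))

theorem Point.head_eq {χ : M.Point} {v : M.sL}
    (e : M.wtFil.of v = M.hatHead (χ.1.f ptOne)) (c : k) :
    M.wtFil.of (LinearMap.toSpanSingleton k M.sL v c) = M.hatHead (χ.1.f ((pt k).fil.of c)) := by
  rw [pt_of_eq, map_smul, map_smul, ← e, LinearMap.toSpanSingleton_apply, map_smul]

theorem Point.head_mc [CharZero k] {χ : M.Point} {v : M.sL}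
    (e : M.wtFil.of v = M.hatHead (χ.1.f ptOne)) : M.b₁ v + M.b₂ (v ⊗ₜ[k] v) = 0 := by
  have h := FilteredModel.head_mc (C := pt k) (f := χ.1)
    (φ := LinearMap.toSpanSingleton k M.sL v) (Point.head_eq (k := k) e) (1 : k)
  have h1 : (LinearMap.toSpanSingleton k M.sL v) (1 : k) = v := one_smul k v
  have h2 : M.b₁ ((LinearMap.toSpanSingleton k M.sL v) (1 : k)) +
      M.b₂ ((LinearMap.toSpanSingleton k M.sL v) (1 : k) ⊗ₜ[k]
        (LinearMap.toSpanSingleton k M.sL v) (1 : k)) =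
      (LinearMap.toSpanSingleton k M.sL v) (0 : k) := h
  rwa [h1, map_zero] at h2

theorem Point.exists_perturbation [CharZero k] (χ : M.Point) :
    ∃ p : M.Perturbation, p.IsClassifying χ := by
  obtain ⟨v, hv, e⟩ := exists_head χ.1 (zero_add 1) (one_mem_pt_gr (k := k))
  obtain ⟨p, rfl⟩ := exists_perturbation_of_mc hv (Point.head_mc e)
  refine ⟨p, Subtype.ext (funext fun n => ?_)⟩
  obtain ⟨Λ, hΛ⟩ := exists_lift χ.1 n
  refine (hΛ (1 : k)).trans ((Submodule.Quotient.eq _).2 ?_)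
  refine sub_geom_sum_mem (delta_lift χ.1 hΛ (1 : k)) (fun hn => ?_) ?_
  · have h1 := (χ.1.f ptOne).2 1 n hn
    have h2 : (χ.1.f ptOne).1 1 = (Submodule.Quotient.mk (Λ (1 : k)) :
        TensorAlgebra k M.sL ⧸ (wordFil M.wtFil).F 1) :=
      h1.symm.trans (congrArg (Submodule.factor ((wordFil M.wtFil).anti hn)) (hΛ (1 : k)))
    exact (hatCounit_apply (C := M.tens) h2).symm.trans (χ.1.map_counit ptOne)
  · have h := head_sub_mem (C := pt k) (f := χ.1)
      (φ := LinearMap.toSpanSingleton k M.sL p.sp) (Point.head_eq (k := k) e) hΛ (1 : k)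
    have h1 : (LinearMap.toSpanSingleton k M.sL p.sp) (1 : k) = p.sp := one_smul k _
    exact h1 ▸ h

end FilteredModel

namespace TensorCoalg

open TensorAlgebra

variable {k : Type u} [Field k] {C : FiltCoalg k} {V : Type u} [AddCommGroup V] [Module k V]
  {φ : C.X →ₗ[k] V}

theorem algebraMapInv_expo (r : ℕ) (c : C.X) :
    algebraMapInv (expo φ r c) = if r = 0 then C.counit c else 0 := by
  rcases r with _ | r
  · rw [if_pos rfl, expo_zero]
    exact TensorAlgebra.algebraMap_leftInverse _ _
  · rw [expo_succ, if_neg (Nat.succ_ne_zero r)]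
    generalize C.comul c = z
    induction z using TensorProduct.induction_on with
    | zero => simp
    | tmul x y =>
      rw [TensorProduct.map_tmul, LinearMap.mul'_apply]
      exact algebraMapInv_ι_mul _ _
    | add a b ha hb => rw [map_add, map_add, map_add, ha, hb, add_zero]

theorem ιInv_expo (r : ℕ) (c : C.X) : ιInv (expo φ (r + 1) c) =
    if r = 0 then TensorProduct.rid k V (TensorProduct.map φ C.counit (C.comul c)) else 0 := by
  rw [expo_succ]
  generalize C.comul c = z
  induction z using TensorProduct.induction_on with
  | zero => simp
  | tmul x y =>
    rw [TensorProduct.map_tmul, LinearMap.mul'_apply, TensorProduct.map_tmul,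
      TensorProduct.rid_tmul]
    refine (ιInv_ι_mul _ _).trans ?_
    rw [algebraMapInv_expo, ite_smul, zero_smul]
  | add a b ha hb =>
    simp only [map_add, ha, hb]
    split_ifs
    · rfl
    · rw [add_zero]

end TensorCoalg

namespace FiltCoalg

variable {k : Type u} [Field k]

theorem interval_rid {V : Type u} [AddCommGroup V] [Module k V] (φ : IntervalSpace k →ₗ[k] V)
    (n : ℕ) : TensorProduct.rid k V (TensorProduct.map φ (intervalCounit k)
      (intervalComul k (tt k n))) = φ (tt k n) := by
  rw [interval_comul_tt, map_sum, map_sum]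
  simp only [TensorProduct.map_tmul, TensorProduct.rid_tmul, interval_counit_tt, ite_smul, one_smul,
    zero_smul]
  exact sum_antidiagonal_snd_zero n fun i => φ (tt k i)

end FiltCoalg

namespace FilteredModel

open TensorAlgebra TensorCoalg FiltCoalg

variable {k : Type u} [Field k] {H : GCA k} {M : FilteredModel H}

theorem map_sum_tt_sub_mem {E : IntervalSpace k →ₗ[k] TensorAlgebra k M.sL}
    (hE : ∀ i, E (tt k i) ∈ (wordFil M.wtFil).F i) (n : ℕ) :
    TensorProduct.map E E (intervalComul k (∑ i ∈ Finset.range n, tt k i)) -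
      E (∑ i ∈ Finset.range n, tt k i) ⊗ₜ[k] E (∑ i ∈ Finset.range n, tt k i) ∈
        ((wordFil M.wtFil).tensor (wordFil M.wtFil)).F n := by
  have h := sum_antidiagonal_sub_mem (((wordFil M.wtFil).tensor (wordFil M.wtFil)).F n) n
    (fun i j => E (tt k i) ⊗ₜ[k] E (tt k j)) fun i j hij =>
      Filtration.tmul_mem hij (hE i) (hE j)
  refine (congrArg (· ∈ ((wordFil M.wtFil).tensor (wordFil M.wtFil)).F n) ?_).mp h
  rw [map_sum, map_sum, map_sum, TensorProduct.sum_tmul]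
  simp only [TensorProduct.tmul_sum, interval_comul_tt, map_sum, TensorProduct.map_tmul]

theorem expSum_sum_tt_mem [CharZero k] {v y : ℕ → M.sL}
    (hT : Twisting (C := interval k) (M := M) (intervalPar k) (intervalLift k v y)) {w : M.sL} {n : ℕ}
    (hw : w - ∑ i ∈ Finset.range n, v i ∈ M.wtFil.F n) :
    expSum (C := interval k) (intervalLift k v y) n (∑ i ∈ Finset.range n, tt k i) -
      ∑ j ∈ Finset.range n, ι k w ^ j ∈ (wordFil M.wtFil).F n := by
  let E : IntervalSpace k →ₗ[k] TensorAlgebra k M.sL :=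
    expSum (C := interval k) (intervalLift k v y) n
  let c : IntervalSpace k := ∑ i ∈ Finset.range n, tt k i
  have hE : ∀ c, E c = ∑ r ∈ Finset.range n, expo (C := interval k) (intervalLift k v y) r c :=
    fun c => expSum_apply (C := interval k) n c
  change E c - _ ∈ _
  refine sub_geom_sum_mem ?_ (fun hn => ?_) ?_
  · have h1 : delta k M.sL (E c) - TensorProduct.map E E (intervalComul k c) ∈
        ((wordFil M.wtFil).tensor (wordFil M.wtFil)).F n := delta_expSum interval_laws n c
    have h2 := map_sum_tt_sub_mem (E := E)
      (fun i => expSum_mem_wordFil (C := interval k) hT n i (tt_mem i)) n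
    exact (congrArg (· ∈ ((wordFil M.wtFil).tensor (wordFil M.wtFil)).F n)
      (sub_add_sub_cancel _ _ _)).mp (Submodule.add_mem _ h1 h2)
  · rw [hE, map_sum, Finset.sum_eq_single 0]
    · have h1 : intervalCounit k c = 1 := by
        simp only [c, map_sum, interval_counit_tt]
        rw [Finset.sum_ite_eq', if_pos (Finset.mem_range.2 hn)]
      exact (algebraMapInv_expo (C := interval k) 0 c).trans ((if_pos rfl).trans h1)
    · exact fun r _ hr => (algebraMapInv_expo (C := interval k) r c).trans (if_neg hr)
    · exact fun h => absurd (Finset.mem_range.2 hn) h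
  · rcases Nat.lt_or_ge n 2 with hn | hn
    · exact M.wtFil.anti (show n ≤ 1 by omega) (mem_wtFil_one _)
    · have h1 : ιInv (E c) = ∑ i ∈ Finset.range n, v i := by
        rw [hE, map_sum, Finset.sum_eq_single 1]
        · have h2 : TensorProduct.rid k M.sL (TensorProduct.map (intervalLift k v y)
              (intervalCounit k) (intervalComul k c)) = ∑ i ∈ Finset.range n, v i := by
            simp only [c, map_sum, interval_rid, intervalLift_tt]
          exact (ιInv_expo (C := interval k) 0 c).trans ((if_pos rfl).trans h2)
        · intro r _ hr
          rcases r with _ | r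
          · exact (congrArg ιInv (expo_zero (C := interval k) c)).trans
              (by rw [Algebra.algebraMap_eq_smul_one, map_smul, ιInv_one, smul_zero])
          · exact (ιInv_expo (C := interval k) r c).trans (if_neg (by omega))
        · exact fun h => absurd (Finset.mem_range.2 (by omega)) h
      rw [h1]
      refine (congrArg (· ∈ M.wtFil.F n) ?_).mp (Submodule.neg_mem _ hw)
      abel

theorem expSum_tt_zero [CharZero k] (v y : ℕ → M.sL) (n : ℕ) :
    expSum (C := interval k) (intervalLift k v y) n (tt k 0) =
      ∑ j ∈ Finset.range n, ι k (v 0) ^ j := by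
  refine (expSum_apply (C := interval k) n (tt k 0)).trans (Finset.sum_congr rfl fun r _ => ?_)
  have h1 : intervalComul k (tt k 0) = tt k 0 ⊗ₜ[k] tt k 0 := by
    rw [interval_comul_tt, Finset.Nat.antidiagonal_zero, Finset.sum_singleton]
  have h2 : intervalCounit k (tt k 0) = 1 := by rw [interval_counit_tt, if_pos rfl]
  refine (expo_of_grouplike (C := interval k) (c := tt k 0) h1 h2 r).trans ?_
  exact congrArg (fun w => ι k w ^ r) (intervalLift_tt v y 0)

theorem Gauge.exists_twisting [CharZero k] {p q : M.Perturbation} (h : Gauge p q) :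
    ∃ v y : ℕ → M.sL, Twisting (C := interval k) (M := M) (intervalPar k) (intervalLift k v y) ∧
      v 0 = p.sp ∧ ∀ n, q.sp - ∑ i ∈ Finset.range n, v i ∈ M.wtFil.F n := by
  obtain ⟨c, hP, hY, h0, h1⟩ := h.exists_path
  let v : ℕ → M.sL := fun n => M.susp 1 ⟨c.P n, c.P_mem n⟩
  let y : ℕ → M.sL := fun n => M.susp 0 ⟨c.Y n, c.Y_mem n⟩
  have hv : ∀ n, v n ∈ M.sLgr 1 := fun n => susp_mem_sLgr _ _
  have hy : ∀ n, y n ∈ M.sLgr 0 := fun n => susp_mem_sLgr _ _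
  have hov : ∀ n, op (v n) = c.P n := fun n => op_susp _ _
  have hoy : ∀ n, op (y n) = c.Y n := fun n => op_susp _ _
  refine ⟨v, y, twisting_interval hv hy
    (fun n => (mem_wtFil_iff (hv n)).2 (by rw [hov]; exact hP n))
    (fun n => (mem_wtFil_iff (hy n)).2 (by rw [hoy]; exact hY n))
    (fun n => (mc_even_iff hv n).2 (by simp only [hov]; exact c.mc n))
    (fun n => (mc_odd_iff hv hy n).2 (by simp only [hov, hoy]; exact c.ev n)),
    op_injOn (hv 0) p.sp_mem (by rw [hov, h0, p.op_sp]), fun n => ?_⟩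
  rw [mem_wtFil_iff (Submodule.sub_mem _ q.sp_mem (Submodule.sum_mem _ fun i _ => hv i)), map_sub,
    map_sum, q.op_sp]
  simp only [hov]
  exact h1 n

theorem Gauge.filtHomotopic [CharZero k] {p q : M.Perturbation} (h : Gauge p q) {χ ψ : M.Point}
    (hp : p.IsClassifying χ) (hq : q.IsClassifying ψ) : FiltHomotopic χ ψ := by
  obtain ⟨v, y, hT, hv0, hqs⟩ := h.exists_twisting
  obtain ⟨f, hs, hf⟩ := Twisting.exists_hom interval_laws hT
  refine ⟨⟨f, hs⟩, Eq.trans (Subtype.ext (funext fun n => ?_)) (Eq.symm hp),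
    Eq.trans (Subtype.ext (funext fun n => ?_)) (Eq.symm hq)⟩
  · refine (hf (tZero k) n (tt k 0) rfl).trans (congrArg Submodule.Quotient.mk ?_)
    rw [← hv0]
    exact expSum_tt_zero v y n
  · refine (hf (tSum k) n (∑ i ∈ Finset.range n, tt k i) rfl).trans ?_
    exact (Submodule.Quotient.eq _).2 (expSum_sum_tt_mem hT (hqs n))

end FilteredModel

theorem Filtration.map_apply_eq {k X Y : Type u} [Field k] [AddCommGroup X] [Module k X]
    [AddCommGroup Y] [Module k Y] {F : Filtration k X} {G : Filtration k Y}
    {f : F.Compl →ₗ[k] G.Compl} {n : ℕ} (hf : F.compl.F n ≤ (G.compl.F n).comap f)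
    {x y : F.Compl} (h : x.1 n = y.1 n) : (f x).1 n = (f y).1 n := by
  have h1 : x - y ∈ F.compl.F n := sub_eq_zero.2 h
  have h2 := hf h1
  rw [Submodule.mem_comap, map_sub] at h2
  exact sub_eq_zero.1 h2

namespace FilteredModel

open TensorAlgebra TensorCoalg FiltCoalg

variable {k : Type u} [Field k] {H : GCA k} {M : FilteredModel H}

theorem exists_der_eq_zero (a : M.S) : ∃ N : ℕ, ∀ n, N ≤ n → ∀ (m : ℤ) (θ : M.S →ₗ[k] M.S),
    θ ∈ M.der m n → θ a = 0 := by
  obtain ⟨w, hw⟩ := FreeGCA.exists_mem_wtLE M.wt a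
  refine ⟨w + 1, fun n hn m θ hθ => ?_⟩
  have h1 := hθ.2.2 w a hw
  rw [show M.wtLE _ = ⊥ from FreeGCA.wtLE_neg (wt := M.wt) (by omega), Submodule.mem_bot] at h1
  exact h1

theorem intervalLift_head {f : Hom (interval k) M.tens} {v y : ℕ → M.sL}
    (hv : ∀ n, M.wtFil.of (v n) = M.hatHead (f.f ((intervalFil k).of (tt k n))))
    (hy : ∀ n, M.wtFil.of (y n) = M.hatHead (f.f ((intervalFil k).of (tu k n))))
    (x : IntervalSpace k) : M.wtFil.of (intervalLift k v y x) =
      M.hatHead (f.f ((intervalFil k).of x)) := by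
  let g : IntervalSpace k →ₗ[k] M.tens.Hat := f.f ∘ₗ (interval k).fil.of
  suffices h : M.wtFil.of ∘ₗ intervalLift k v y = M.hatHead ∘ₗ g from DFunLike.congr_fun h x
  refine interval_ext (fun n => ?_) fun n => ?_
  · exact (congrArg M.wtFil.of (intervalLift_tt v y n)).trans (hv n)
  · exact (congrArg M.wtFil.of (intervalLift_tu v y n)).trans (hy n)

theorem intervalLift_comul_tt (v y : ℕ → M.sL) (n : ℕ) :
    TensorProduct.map (intervalLift k v y) (intervalLift k v y) (intervalComul k (tt k n)) =
      ∑ ij ∈ Finset.HasAntidiagonal.antidiagonal n, v ij.1 ⊗ₜ[k] v ij.2 := by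
  rw [interval_comul_tt, map_sum]
  simp only [TensorProduct.map_tmul, intervalLift_tt]

theorem intervalLift_comul_tu (v y : ℕ → M.sL) (n : ℕ) :
    TensorProduct.map (intervalLift k v y) (intervalLift k v y) (intervalComul k (tu k n)) =
      ∑ ij ∈ Finset.HasAntidiagonal.antidiagonal n,
        (y ij.1 ⊗ₜ[k] v ij.2 + v ij.1 ⊗ₜ[k] y ij.2) := by
  rw [interval_comul_tu, map_sum]
  simp only [map_add (TensorProduct.map _ _), TensorProduct.map_tmul, intervalLift_tt,
    intervalLift_tu]

theorem sp_eq_of_isClassifying {p : M.Perturbation} {χ : M.Point} (hp : p.IsClassifying χ)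
    {v : M.sL} (h : M.wtFil.of v = M.hatHead (χ.1.f ptOne)) : v = p.sp :=
  wtFil_of_injective (h.trans ((congrArg M.hatHead hp).trans (hatHead_chiElt p)))

theorem hatHead_tSum (f : Hom (interval k) M.tens) {v y : ℕ → M.sL}
    (h : ∀ x : IntervalSpace k, M.wtFil.of (intervalLift k v y x) =
      M.hatHead (f.f ((intervalFil k).of x))) (n : ℕ) :
    (M.hatHead (f.f (tSum k))).1 n = Submodule.Quotient.mk (∑ i ∈ Finset.range n, v i) := by
  have h3 : (f.f (tSum k)).1 n = (f.f ((intervalFil k).of (∑ i ∈ Finset.range n, tt k i))).1 n :=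
    Filtration.map_apply_eq (F := (interval k).fil) (G := M.tens.fil) (f.map_fil n) rfl
  obtain ⟨z, hz⟩ := Submodule.Quotient.mk_surjective _ ((f.f (tSum k)).1 n)
  have h4 := congrFun (congrArg Subtype.val (h (∑ i ∈ Finset.range n, tt k i))) n
  rw [hatHead_apply (h3.symm.trans hz.symm), map_sum] at h4
  simp only [intervalLift_tt] at h4
  exact (hatHead_apply hz.symm).trans h4.symm

theorem exists_polyPath [CharZero k] (f : Hom (interval k) M.tens) {v y : ℕ → M.sL}
    (hv : ∀ n, v n ∈ M.sLgr 1) (hy : ∀ n, y n ∈ M.sLgr 0)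
    (h : ∀ x : IntervalSpace k, M.wtFil.of (intervalLift k v y x) =
      M.hatHead (f.f ((intervalFil k).of x))) :
    ∃ c : PolyPath M, ∀ n, c.P n = op (v n) := by
  have hmc : ∀ n, M.b₁ (v n) +
      M.b₂ (∑ ij ∈ Finset.HasAntidiagonal.antidiagonal n, v ij.1 ⊗ₜ[k] v ij.2) = 0 := fun n => by
    have h1 : M.b₁ (intervalLift k v y (tt k n)) + M.b₂ (TensorProduct.map (intervalLift k v y)
        (intervalLift k v y) (intervalComul k (tt k n))) = intervalLift k v y (intervalD k (tt k n)) :=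
      head_mc (C := interval k) (f := f) (φ := intervalLift k v y) h (tt k n)
    rwa [intervalLift_comul_tt, intervalLift_tt, interval_d_tt, map_zero] at h1
  have hev : ∀ n, M.b₁ (y n) + M.b₂ (∑ ij ∈ Finset.HasAntidiagonal.antidiagonal n,
      (y ij.1 ⊗ₜ[k] v ij.2 + v ij.1 ⊗ₜ[k] y ij.2)) = ((n : k) + 1) • v (n + 1) := fun n => by
    have h1 : M.b₁ (intervalLift k v y (tu k n)) + M.b₂ (TensorProduct.map (intervalLift k v y)
        (intervalLift k v y) (intervalComul k (tu k n))) = intervalLift k v y (intervalD k (tu k n)) :=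
      head_mc (C := interval k) (f := f) (φ := intervalLift k v y) h (tu k n)
    rwa [intervalLift_comul_tu, intervalLift_tu, interval_d_tu, map_smul, intervalLift_tt] at h1
  have hP : ∀ n, op (v n) ∈ M.der 1 n := fun n => (mem_wtFil_iff (hv n)).1 (by
    have h1 : intervalLift k v y (tt k n) ∈ M.wtFil.F n :=
      head_mem_wtFil (C := interval k) (f := f) (φ := intervalLift k v y) h (tt_mem n)
    rwa [intervalLift_tt] at h1)
  have hY : ∀ n, op (y n) ∈ M.der 0 n := fun n => (mem_wtFil_iff (hy n)).1 (by
    have h1 : intervalLift k v y (tu k n) ∈ M.wtFil.F n :=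
      head_mem_wtFil (C := interval k) (f := f) (φ := intervalLift k v y) h (tu_mem n)
    rwa [intervalLift_tu] at h1)
  refine ⟨⟨fun n => op (v n), fun n => op (y n), fun n => op_mem (hv n), fun n => op_mem (hy n),
    fun a => ?_, fun n => (mc_even_iff hv n).1 (hmc n), fun n => (mc_odd_iff hv hy n).1 (hev n)⟩,
    fun n => rfl⟩
  obtain ⟨N, hN⟩ := exists_der_eq_zero a
  exact ⟨N, fun n hn => ⟨hN n hn _ _ (hP n), hN n hn _ _ (hY n)⟩⟩

theorem FiltHomotopic.gauge [CharZero k] {p q : M.Perturbation} {χ ψ : M.Point}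
    (hp : p.IsClassifying χ) (hq : q.IsClassifying ψ) (h : FiltHomotopic χ ψ) : Gauge p q := by
  obtain ⟨⟨f, hs⟩, h0, h1⟩ := h
  choose v hv hv' using fun n => exists_head f (zero_add 1)
    (show tt k n ∈ (interval k).gr 0 from tt_mem_gr n)
  choose y hy hy' using fun n => exists_head f (show (-1 : ℤ) + 1 = 0 by norm_num)
    (show tu k n ∈ (interval k).gr (-1) from tu_mem_gr n)
  have hφ := intervalLift_head hv' hy'
  obtain ⟨c, hc⟩ := exists_polyPath f hv hy hφ
  have hv0 : v 0 = p.sp := sp_eq_of_isClassifying hp ((hv' 0).trans (congrArg M.hatHead h0))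
  have hq1 : ∀ n, q.p - ∑ i ∈ Finset.range n, op (v i) ∈ M.der 1 n := fun n => by
    have h2 : (M.hatHead (f.f (tSum k))).1 n = (M.wtFil.of q.sp).1 n :=
      congrFun (congrArg Subtype.val ((congrArg M.hatHead (h1.trans hq)).trans (hatHead_chiElt q))) n
    have h3 := (Submodule.Quotient.eq _).1 (h2.symm.trans (hatHead_tSum f hφ n))
    rw [mem_wtFil_iff (Submodule.sub_mem _ q.sp_mem (Submodule.sum_mem _ fun i _ => hv i)), map_sub,
      map_sum, q.op_sp] at h3
    exact h3
  refine c.gauge (by rw [hc, hv0, p.op_sp]) fun a => ?_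
  obtain ⟨N, hN⟩ := exists_der_eq_zero a
  refine ⟨N, fun n hn => ?_⟩
  have h4 := hN n hn _ _ (hq1 n)
  rw [LinearMap.sub_apply, LinearMap.sum_apply, sub_eq_zero] at h4
  simp only [hc]
  exact h4.symm

theorem filtHomotopic_iff_gauge [CharZero k] {p q : M.Perturbation} {χ ψ : M.Point}
    (hp : p.IsClassifying χ) (hq : q.IsClassifying ψ) : FiltHomotopic χ ψ ↔ Gauge p q :=
  ⟨FiltHomotopic.gauge hp hq, fun h => h.filtHomotopic hp hq⟩

theorem Gauge.refl (p : M.Perturbation) : Gauge p p :=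
  ⟨AlgHom.id k M.S, fun i => FreeGCA.gen_mem_gr i, fun i => by
    rw [AlgHom.id_apply, sub_self]; exact Submodule.zero_mem _, fun _ => rfl⟩

theorem exists_gauge_equiv_pathComponent [CharZero k] :
    ∃ Φ : Quot (Gauge (M := M)) ≃ M.PathComponent, ∀ (p : M.Perturbation) (χ : M.Point),
      p.IsClassifying χ → Φ (Quot.mk _ p) = Quot.mk _ χ :=
  exists_quot_equiv (fun p χ => p.IsClassifying χ) (fun p => p.exists_point)
    (fun χ => χ.exists_perturbation) Gauge.refl (fun χ => by
      obtain ⟨p, hp⟩ := χ.exists_perturbation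
      exact (filtHomotopic_iff_gauge hp hp).2 (Gauge.refl p))
    fun _ _ _ _ hp hq => (filtHomotopic_iff_gauge hp hq).symm

end FilteredModel

namespace FilteredModel

open TensorAlgebra TensorCoalg FiltCoalg

variable {k : Type u} [Field k] {H : GCA k} {M : FilteredModel H}

theorem mem_contFil_of_mem_wtFil {w : ℤ} {a : ℕ} (h : w < a) {v : M.sL} (hv : v ∈ M.wtFil.F a)
    (p : ℕ) : v ∈ (M.contFil w).F p := fun n => by
  by_cases hp : p ≤ 1
  · simp [hp]
  · simp only [hp, if_false]
    intro b hb
    have h1 := Submodule.mem_comap.1 (hv n)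
    have h2 := h1.2.2 w b hb
    rw [show M.wtLE _ = ⊥ from FreeGCA.wtLE_neg (wt := M.wt) (by omega), Submodule.mem_bot] at h2
    exact h2

theorem exists_le_ker_of_mem_contDual {α : Module.Dual k (TensorAlgebra k M.sL)}
    (hα : α ∈ M.contDual) : ∃ m, ∀ n, m ≤ n → (wordFil M.wtFil).F n ≤ LinearMap.ker α := by
  obtain ⟨w, N, h⟩ := hα
  let W := w.toNat + 1
  refine ⟨N * W, fun n hn => le_trans (Submodule.span_le.2 ?_) h⟩
  rintro _ ⟨l, hl, hs, rfl⟩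
  let f : ℕ × M.sL → ℕ × M.sL := fun a => (if W ≤ a.1 then N else 1, a.2)
  have hf : (l.map f).map Prod.snd = l.map Prod.snd := by
    rw [List.map_map]
    rfl
  rw [← hf]
  refine word_mem (G := M.contFil w) ?_ ?_
  · intro b hb
    obtain ⟨a, ha, rfl⟩ := List.mem_map.1 hb
    by_cases hW : W ≤ a.1
    · exact mem_contFil_of_mem_wtFil (by omega) (hl a ha) _
    · simp only [f, hW, if_false]
      exact fun n => by simp
  · rw [List.map_map]
    by_cases hW : ∃ a ∈ l, W ≤ a.1
    · obtain ⟨a, ha, hW⟩ := hW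
      refine le_trans ?_ (List.single_le_sum (fun _ _ => Nat.zero_le _) _
        (List.mem_map.2 ⟨a, ha, rfl⟩))
      simp [f, hW]
    · push Not at hW
      have h1 : (l.map Prod.fst).sum ≤ (l.map Prod.fst).length • W :=
        List.sum_le_card_nsmul _ _ fun x hx => by
          obtain ⟨a, ha, rfl⟩ := List.mem_map.1 hx
          exact (hW a ha).le
      have h2 : l.map (Prod.fst ∘ f) = List.replicate l.length 1 :=
        List.eq_replicate_iff.2 ⟨by simp, fun x hx => by
          obtain ⟨a, ha, rfl⟩ := List.mem_map.1 hx
          simp [f, hW a ha]⟩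
      rw [h2, List.sum_replicate, smul_eq_mul, mul_one]
      rw [List.length_map, smul_eq_mul] at h1
      exact Nat.le_of_mul_le_mul_right (hn.trans (hs.trans h1)) (Nat.succ_pos _)

variable {C : FiltCoalg k} {σ : C.X →ₗ[k] C.X} {φ : C.X →ₗ[k] M.sL}

/-- The homogeneous components of the map of coalgebras cogenerated by `φ`, with values in
`C(L)`. -/
def symmExpo (hC : C.Laws σ) (h : Twisting σ φ) (r : ℕ) : C.X →ₗ[k] M.symm :=
  (expo φ r).codRestrict M.symm (expo_mem_symm hC h.par r)

theorem exists_pairing (hC : C.Laws σ) (h : Twisting σ φ)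
    {α : Module.Dual k (TensorAlgebra k M.sL)} (hα : α ∈ M.contDual) : ∃ m, ∀ n, m ≤ n →
      (∀ x ∈ (wordFil M.wtFil).F n, α x = 0) ∧ (∀ c ∈ C.fil.F n, α (expSum φ n c) = 0) ∧
      ∀ c, ∑ᶠ r, M.restrict α (symmExpo hC h r c) = α (expSum φ n c) := by
  obtain ⟨m, hm⟩ := exists_le_ker_of_mem_contDual hα
  refine ⟨m, fun n hn => ⟨fun x hx => hm n hn hx, fun c hc => hm n hn (expSum_mem_wordFil h n n hc),
    fun c => ?_⟩⟩
  rw [expSum_apply, map_sum]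
  refine finsum_eq_sum_of_support_subset _ fun r hr => ?_
  by_contra hr'
  simp only [Finset.coe_range, Set.mem_Iio, not_lt] at hr'
  exact hr (hm r (hn.trans hr') (expo_mem_length r c))

theorem support_symmExpo_finite (hC : C.Laws σ) (h : Twisting σ φ) (α : M.A) (c : C.X) :
    (Function.support fun r => α.1 (symmExpo hC h r c)).Finite := by
  obtain ⟨α₁, α', hα, e⟩ := α
  obtain ⟨m, hm⟩ := exists_le_ker_of_mem_contDual hα
  refine (Finset.range m).finite_toSet.subset fun r hr => ?_
  by_contra hr'
  simp only [Finset.coe_range, Set.mem_Iio, not_lt] at hr'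
  refine hr ?_
  subst e
  exact hm r hr' (expo_mem_length r c)

/-- The pairing of `A(L)` with a coalgebra, through the map of coalgebras cogenerated by `φ`. -/
def pairing (hC : C.Laws σ) (h : Twisting σ φ) : M.A →ₗ[k] Module.Dual k C.X where
  toFun α :=
    { toFun := fun c => ∑ᶠ r, α.1 (symmExpo hC h r c)
      map_add' := fun c c' => by
        rw [← finsum_add_distrib (support_symmExpo_finite hC h α c)
          (support_symmExpo_finite hC h α c')]
        exact finsum_congr fun r => by rw [map_add, map_add]
      map_smul' := fun a c => by
        rw [RingHom.id_apply, smul_finsum]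
        exact finsum_congr fun r => by rw [map_smul, map_smul] }
  map_add' := fun α β => LinearMap.ext fun c =>
    finsum_add_distrib (support_symmExpo_finite hC h α c) (support_symmExpo_finite hC h β c)
  map_smul' := fun a α => LinearMap.ext fun c => (smul_finsum a _).symm

variable {hC : C.Laws σ} {h : Twisting σ φ}

theorem pairing_one (c : C.X) : pairing hC h (A.one M) c = C.counit c := by
  change ∑ᶠ r, algebraMapInv (expo φ r c) = _
  rw [finsum_eq_single _ 0 fun r hr => by rw [algebraMapInv_expo, if_neg hr], algebraMapInv_expo,
    if_pos rfl]

theorem exists_pairing_eq (α : M.A) : ∃ α' : Module.Dual k (TensorAlgebra k M.sL),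
    M.restrict α' = α.1 ∧ ∃ m, ∀ n, m ≤ n → (∀ x ∈ (wordFil M.wtFil).F n, α' x = 0) ∧
      (∀ c ∈ C.fil.F n, pairing hC h α c = 0) ∧ pairing hC h α = α' ∘ₗ expSum φ n := by
  obtain ⟨_, ⟨α, hα, rfl⟩⟩ := α
  obtain ⟨m, hm⟩ := exists_pairing hC h hα
  exact ⟨α, rfl, m, fun n hn => ⟨(hm n hn).1, fun c hc => ((hm n hn).2.2 c).trans ((hm n hn).2.1 c hc),
    LinearMap.ext (hm n hn).2.2⟩⟩

theorem pairing_eq_of_restrict {α : M.A} {α' : Module.Dual k (TensorAlgebra k M.sL)}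
    (e : ∀ x : M.symm, α.1 x = α' x) (c : C.X) : ∃ m, ∀ n, m ≤ n →
      pairing hC h α c = α' (expSum φ n c) := by
  obtain ⟨α₁, e₁, m, hm⟩ := exists_pairing_eq (hC := hC) (h := h) α
  refine ⟨m, fun n hn => ?_⟩
  rw [(hm n hn).2.2]
  exact (DFunLike.congr_fun e₁ ⟨expSum φ n c, expSum_mem_symm hC h n c⟩).trans (e _)

theorem A_mul_apply {α β : M.A} {α' β' : Module.Dual k (TensorAlgebra k M.sL)}
    (eα : M.restrict α' = α.1) (eβ : M.restrict β' = β.1) (x : M.symm) :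
    (A.mul M α β).1 x = LinearMap.mul' k k (TensorProduct.map α' β' (delta k M.sL x)) := by
  change LinearMap.mul' k k (TensorProduct.map α.1 β.1 (comulSymm M.par x)) = _
  rw [← comulSymm_eq, ← eα, ← eβ]
  generalize comulSymm M.par x = z
  induction z using TensorProduct.induction_on with
  | zero => simp
  | tmul x y => rfl
  | add a b ha hb => simp only [map_add, ha, hb]

theorem pairing_mul (α β : M.A) (c : C.X) : pairing hC h (A.mul M α β) c =
    LinearMap.mul' k k (TensorProduct.map (pairing hC h α) (pairing hC h β) (C.comul c)) := by
  obtain ⟨α', eα, m, hm⟩ := exists_pairing_eq (hC := hC) (h := h) α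
  obtain ⟨β', eβ, m', hm'⟩ := exists_pairing_eq (hC := hC) (h := h) β
  let γ : Module.Dual k (TensorAlgebra k M.sL) :=
    LinearMap.mul' k k ∘ₗ TensorProduct.map α' β' ∘ₗ delta k M.sL
  have hγ : ∀ x : M.symm, (A.mul M α β).1 x = γ x := A_mul_apply eα eβ
  obtain ⟨m'', hm''⟩ := pairing_eq_of_restrict (hC := hC) (h := h) hγ c
  let n := max (m + m') m''
  have hker : ((wordFil M.wtFil).tensor (wordFil M.wtFil)).F n ≤
      LinearMap.ker (LinearMap.mul' k k ∘ₗ TensorProduct.map α' β') := by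
    refine Submodule.span_le.2 ?_
    rintro _ ⟨p, q, x, y, hpq, hx, hy, rfl⟩
    have hn : m + m' ≤ p + q := (le_max_left _ _).trans hpq
    rw [SetLike.mem_coe, LinearMap.mem_ker, LinearMap.comp_apply, TensorProduct.map_tmul,
      LinearMap.mul'_apply]
    rcases le_or_gt m p with hp | hp
    · rw [(hm p hp).1 x hx, zero_mul]
    · rw [(hm' q (by omega)).1 y hy, mul_zero]
  have h1 := hker (delta_expSum hC (φ := φ) n c)
  rw [LinearMap.mem_ker, map_sub, sub_eq_zero] at h1
  rw [hm'' n (le_max_right _ _), (hm n (by omega)).2.2, (hm' n (by omega)).2.2,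
    TensorProduct.map_comp]
  exact h1

theorem pairing_d (α : M.A) (c : C.X) : pairing hC h (A.d M α) c = pairing hC h α (C.d c) := by
  obtain ⟨α', eα, m, hm⟩ := exists_pairing_eq (hC := hC) (h := h) α
  obtain ⟨m', hm'⟩ := pairing_eq_of_restrict (hC := hC) (h := h) (α := A.d M α)
    (α' := α' ∘ₗ coder M.par M.b₁ M.b₂) (fun x => by
      change α.1 (M.dC x) = α' (coder M.par M.b₁ M.b₂ x)
      rw [← eα]
      rfl) c
  let n := max m m'
  have h1 := (hm n (le_max_left _ _)).1 _ (coder_expSum hC h n c)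
  rw [map_sub, sub_eq_zero] at h1
  rw [hm' n (le_max_right _ _), (hm n (le_max_left _ _)).2.2]
  exact h1

theorem pairing_gr {α : M.A} {m n : ℤ} (hα : A.HasDegree α m) {c : C.X} (hc : c ∈ C.gr n)
    (hn : n ≠ -m) : pairing hC h α c = 0 := by
  change ∑ᶠ r, α.1 (symmExpo hC h r c) = 0
  exact (finsum_congr fun r =>
    hα n (symmExpo hC h r c) hn (expo_mem_gr hC h r hc)).trans finsum_zero

end FilteredModel

section

open Polynomial

variable {k : Type u} [Field k]

/-- The polynomial with given coefficients, almost all of which are zero. -/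
def ofCoeffs (u : ℕ → k) : k[X] := ∑ᶠ j, monomial j (u j)

theorem coeff_ofCoeffs {u : ℕ → k} {N : ℕ} (h : ∀ n, N ≤ n → u n = 0) (n : ℕ) :
    (ofCoeffs u).coeff n = u n := by
  have h1 : ofCoeffs u = ∑ j ∈ Finset.range N, monomial j (u j) :=
    finsum_eq_sum_of_support_subset _ fun j hj => by
      by_contra hj'
      simp only [Finset.coe_range, Set.mem_Iio, not_lt] at hj'
      exact hj ((congrArg (monomial j) (h j hj')).trans (map_zero _))
  rw [h1, finsetSum_coeff]
  simp only [coeff_monomial]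
  rw [Finset.sum_ite_eq']
  split_ifs with hn
  · rfl
  · exact (h n (by simpa using hn)).symm

theorem eval_one_ofCoeffs {u : ℕ → k} {N : ℕ} (h : ∀ n, N ≤ n → u n = 0) :
    (ofCoeffs u).eval 1 = ∑ n ∈ Finset.range N, u n := by
  have h1 : (ofCoeffs u).natDegree < N ∨ ofCoeffs u = 0 := by
    by_contra hc
    push Not at hc
    have := h _ hc.1
    rw [← coeff_ofCoeffs h] at this
    exact hc.2 (leadingCoeff_eq_zero.1 this)
  rcases h1 with h1 | h1
  · rw [eval_eq_sum_range' h1]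
    exact Finset.sum_congr rfl fun n _ => by rw [coeff_ofCoeffs h, one_pow, mul_one]
  · rw [h1, eval_zero]
    exact (Finset.sum_eq_zero fun n _ => by rw [← coeff_ofCoeffs h, h1, coeff_zero]).symm

end

namespace FilteredModel

open TensorAlgebra TensorCoalg FiltCoalg

variable {k : Type u} [Field k] {H : GCA k} {M : FilteredModel H}

/-! #### The map `A(L) → k` of a point -/

theorem Perturbation.exists_isEval [CharZero k] (p : M.Perturbation) :
    ∃ f : M.AMap (DGCA.unit k), p.IsEval f := by
  let F : M.A →ₗ[k] (k →ₗ[k] k) := pairing pt_laws (twisting_pt p.sp_mem p.sp_mc)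
  have h1 : F (A.one M) 1 = 1 := pairing_one (C := pt k) (1 : k)
  have h2 : ∀ α β, F (A.mul M α β) 1 = F α 1 * F β 1 := fun α β =>
    pairing_mul (C := pt k) α β (1 : k)
  have h3 : ∀ α, F (A.d M α) 1 = 0 := fun α =>
    (pairing_d (C := pt k) α (1 : k)).trans (map_zero (F α))
  have h4 : ∀ (m : ℤ) (α : M.A), A.HasDegree α m →
      F α 1 ∈ (if m = 0 then (⊤ : Submodule k k) else ⊥) := fun m α hα => by
    by_cases hm : m = 0
    · rw [if_pos hm]
      exact Submodule.mem_top
    · rw [if_neg hm, Submodule.mem_bot]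
      exact pairing_gr (C := pt k) hα (one_mem_pt_gr (k := k)) (by omega)
  refine ⟨⟨(LinearMap.applyₗ (1 : k)) ∘ₗ F, h1, h2, h4, h3⟩, fun α hα => ?_⟩
  refine finsum_congr fun r => congrArg α ?_
  refine (expo_of_grouplike (C := pt k) (c := (1 : k)) rfl rfl r).trans ?_
  exact congrArg (fun v => ι k v ^ r) (one_smul k p.sp)

theorem AMap.ext {B : DGCA k} {f g : M.AMap B} (h : ∀ α (hα : α ∈ M.contDual),
    f.f ⟨M.restrict α, Submodule.mem_map_of_mem hα⟩ =
      g.f ⟨M.restrict α, Submodule.mem_map_of_mem hα⟩) : f = g := by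
  have e : f.f = g.f := LinearMap.ext fun ⟨_, α, hα, e⟩ => by
    subst e
    exact h α hα
  cases f
  cases g
  cases e
  rfl

theorem Perturbation.IsEval.unique {p : M.Perturbation} {f g : M.AMap (DGCA.unit k)}
    (hf : p.IsEval f) (hg : p.IsEval g) : f = g :=
  AMap.ext fun α hα => (hf α hα).trans (hg α hα).symm

theorem Perturbation.existsUnique_isEval [CharZero k] (p : M.Perturbation) :
    ∃! f : M.AMap (DGCA.unit k), p.IsEval f := by
  obtain ⟨f, hf⟩ := p.exists_isEval
  exact ⟨f, hf, fun g hg => hg.unique hf⟩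

theorem Perturbation.IsEval.eq_geom_sum {p : M.Perturbation} {f : M.AMap (DGCA.unit k)}
    (hf : p.IsEval f) {α : Module.Dual k (TensorAlgebra k M.sL)} (hα : α ∈ M.contDual) :
    ∃ m, ∀ n, m ≤ n → f.f ⟨M.restrict α, Submodule.mem_map_of_mem hα⟩ =
      α (∑ r ∈ Finset.range n, ι k p.sp ^ r) := by
  obtain ⟨m, hm⟩ := exists_le_ker_of_mem_contDual hα
  refine ⟨m, fun n hn => ?_⟩
  rw [map_sum]
  refine (hf α hα).trans (finsum_eq_sum_of_support_subset _ fun r hr => ?_)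
  by_contra hr'
  simp only [Finset.coe_range, Set.mem_Iio, not_lt] at hr'
  exact hr (hm r (hn.trans hr') (ι_pow_mem p.sp r))

/-! #### The map `A(L) → k[t, dt]` of a path -/

section

open Polynomial

/-- The element of `k[t, dt]` given by a linear form on the interval coalgebra. -/
def formOf (ξ : IntervalSpace k →ₗ[k] k) : TrivSqZeroExt k[X] k[X] :=
  TrivSqZeroExt.inl (ofCoeffs fun n => ξ (tt k n)) + TrivSqZeroExt.inr (ofCoeffs fun n => ξ (tu k n))

/-- Linear forms on the interval coalgebra which are continuous for the index filtration. -/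
def ContForm (ξ : IntervalSpace k →ₗ[k] k) : Prop :=
  ∃ N, ∀ n, N ≤ n → ξ (tt k n) = 0 ∧ ξ (tu k n) = 0

theorem fst_formOf {ξ : IntervalSpace k →ₗ[k] k} (h : ContForm ξ) (n : ℕ) :
    (formOf ξ).fst.coeff n = ξ (tt k n) := by
  obtain ⟨N, hN⟩ := h
  rw [formOf, TrivSqZeroExt.fst_add, TrivSqZeroExt.fst_inl, TrivSqZeroExt.fst_inr, add_zero]
  exact coeff_ofCoeffs (u := fun n => ξ (tt k n)) (fun n hn => (hN n hn).1) n

theorem snd_formOf {ξ : IntervalSpace k →ₗ[k] k} (h : ContForm ξ) (n : ℕ) :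
    (formOf ξ).snd.coeff n = ξ (tu k n) := by
  obtain ⟨N, hN⟩ := h
  rw [formOf, TrivSqZeroExt.snd_add, TrivSqZeroExt.snd_inl, TrivSqZeroExt.snd_inr, zero_add]
  exact coeff_ofCoeffs (u := fun n => ξ (tu k n)) (fun n hn => (hN n hn).2) n

theorem formOf_eq {ξ : IntervalSpace k →ₗ[k] k} (h : ContForm ξ) {x : TrivSqZeroExt k[X] k[X]}
    (h1 : ∀ n, ξ (tt k n) = x.fst.coeff n) (h2 : ∀ n, ξ (tu k n) = x.snd.coeff n) :
    formOf ξ = x :=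
  TrivSqZeroExt.ext (Polynomial.ext fun n => (fst_formOf h n).trans (h1 n))
    (Polynomial.ext fun n => (snd_formOf h n).trans (h2 n))

theorem formOf_mul {ξ η ζ : IntervalSpace k →ₗ[k] k} (hξ : ContForm ξ) (hη : ContForm η)
    (hζ : ContForm ζ) (h : ∀ c, ζ c =
      LinearMap.mul' k k (TensorProduct.map ξ η (intervalComul k c))) :
    formOf ζ = formOf ξ * formOf η := by
  refine formOf_eq hζ (fun n => ?_) fun n => ?_
  · rw [h, interval_comul_tt, TrivSqZeroExt.fst_mul, coeff_mul, map_sum, map_sum]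
    simp only [TensorProduct.map_tmul, LinearMap.mul'_apply, fst_formOf hξ, fst_formOf hη]
  · rw [h, interval_comul_tu, TrivSqZeroExt.snd_mul, map_sum, map_sum, op_smul_eq_smul, smul_eq_mul,
      smul_eq_mul, mul_comm (formOf η).fst, coeff_add, coeff_mul, coeff_mul,
      ← Finset.sum_add_distrib]
    simp only [map_add, TensorProduct.map_tmul, LinearMap.mul'_apply, fst_formOf hξ, fst_formOf hη,
      snd_formOf hξ, snd_formOf hη]
    exact Finset.sum_congr rfl fun _ _ => add_comm _ _

theorem formOf_d {ξ ζ : IntervalSpace k →ₗ[k] k} (hξ : ContForm ξ)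
    (hζ : ContForm ζ) (h : ∀ c, ζ c = ξ (intervalD k c)) :
    formOf ζ = TrivSqZeroExt.inr (derivative (formOf ξ).fst) := by
  refine formOf_eq hζ (fun n => ?_) fun n => ?_
  · rw [h, interval_d_tt, map_zero, TrivSqZeroExt.fst_inr, coeff_zero]
  · rw [h, interval_d_tu, map_smul, TrivSqZeroExt.snd_inr, coeff_derivative, fst_formOf hξ,
      smul_eq_mul, mul_comm]

theorem formOf_gr {ξ : IntervalSpace k →ₗ[k] k} (hξ : ContForm ξ) (m : ℤ)
    (h0 : m ≠ 0 → ∀ n, ξ (tt k n) = 0) (h1 : m ≠ 1 → ∀ n, ξ (tu k n) = 0) :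
    formOf ξ ∈ (DGCA.polyForms k).gr m := by
  change formOf ξ ∈ (if m = 0 then
    LinearMap.ker (TrivSqZeroExt.sndHom k[X] k[X] |>.restrictScalars k)
    else if m = 1 then LinearMap.ker (TrivSqZeroExt.fstHom k k[X] k[X]).toLinearMap else ⊥)
  have e0 : m ≠ 0 → (formOf ξ).fst = 0 := fun hm =>
    Polynomial.ext fun n => by rw [fst_formOf hξ, h0 hm, coeff_zero]
  have e1 : m ≠ 1 → (formOf ξ).snd = 0 := fun hm =>
    Polynomial.ext fun n => by rw [snd_formOf hξ, h1 hm, coeff_zero]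
  split_ifs with hm hm1
  · exact e1 (by omega)
  · exact e0 hm
  · exact TrivSqZeroExt.ext (e0 hm) (e1 hm1)

end

theorem Gauge.aHomotopic [CharZero k] {p q : M.Perturbation} (h : Gauge p q)
    {f g : M.AMap (DGCA.unit k)} (hf : p.IsEval f) (hg : q.IsEval g) : AHomotopic f g := by
  obtain ⟨v, y, hT, hv0, hqs⟩ := h.exists_twisting
  let F : M.A →ₗ[k] (IntervalSpace k →ₗ[k] k) := pairing interval_laws hT
  have hc : ∀ α, ContForm (F α) := fun α => by
    obtain ⟨α', -, m, hm⟩ := exists_pairing_eq (C := interval k) (hC := interval_laws) (h := hT) α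
    exact ⟨m, fun n hn => ⟨(hm n hn).2.1 _ (tt_mem n), (hm n hn).2.1 _ (tu_mem n)⟩⟩
  let G : M.A →ₗ[k] TrivSqZeroExt (Polynomial k) (Polynomial k) :=
    { toFun := fun α => formOf (F α)
      map_add' := fun α β => formOf_eq (hc _)
        (fun n => by
          rw [map_add, LinearMap.add_apply, TrivSqZeroExt.fst_add, Polynomial.coeff_add,
            fst_formOf (hc α), fst_formOf (hc β)])
        (fun n => by
          rw [map_add, LinearMap.add_apply, TrivSqZeroExt.snd_add, Polynomial.coeff_add,
            snd_formOf (hc α), snd_formOf (hc β)])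
      map_smul' := fun a α => formOf_eq (hc _)
        (fun n => by
          rw [map_smul, LinearMap.smul_apply, RingHom.id_apply, TrivSqZeroExt.fst_smul,
            Polynomial.coeff_smul, fst_formOf (hc α)])
        (fun n => by
          rw [map_smul, LinearMap.smul_apply, RingHom.id_apply, TrivSqZeroExt.snd_smul,
            Polynomial.coeff_smul, snd_formOf (hc α)]) }
  have h1 : G (A.one M) = 1 := formOf_eq (hc _)
    (fun n => (pairing_one (C := interval k) (tt k n)).trans (by
      refine (interval_counit_tt n).trans ?_
      rw [TrivSqZeroExt.fst_one, Polynomial.coeff_one]))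
    (fun n => (pairing_one (C := interval k) (tu k n)).trans (by
      refine (interval_counit_tu n).trans ?_
      rw [TrivSqZeroExt.snd_one, Polynomial.coeff_zero]))
  have h2 : ∀ α β, G (A.mul M α β) = G α * G β := fun α β =>
    formOf_mul (hc α) (hc β) (hc _) (pairing_mul (C := interval k) α β)
  have h3 : ∀ α, G (A.d M α) = TrivSqZeroExt.inr (Polynomial.derivative (G α).fst) := fun α =>
    formOf_d (hc α) (hc _) (pairing_d (C := interval k) α)
  have h4 : ∀ (m : ℤ) (α : M.A), A.HasDegree α m → G α ∈ (DGCA.polyForms k).gr m := fun m α hα =>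
    formOf_gr (hc α) m
      (fun hm n => pairing_gr (C := interval k) hα (n := 0) (tt_mem_gr n) (by omega))
      (fun hm n => pairing_gr (C := interval k) hα (n := -1) (tu_mem_gr n) (by omega))
  refine ⟨⟨G, h1, h2, h4, h3⟩, ?_⟩
  rintro ⟨_, α, hα, rfl⟩
  have e : ∀ n, (G ⟨M.restrict α, Submodule.mem_map_of_mem hα⟩).fst.coeff n =
      F ⟨M.restrict α, Submodule.mem_map_of_mem hα⟩ (tt k n) := fun n => fst_formOf (hc _) n
  obtain ⟨m, hm⟩ := exists_pairing (C := interval k) interval_laws hT hα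
  have hF : ∀ n, m ≤ n → ∀ c, F ⟨M.restrict α, Submodule.mem_map_of_mem hα⟩ c =
      α (expSum (C := interval k) (intervalLift k v y) n c) := fun n hn c => (hm n hn).2.2 c
  constructor
  · obtain ⟨m', hm'⟩ := hf.eq_geom_sum hα
    refine (hm' (max m m') (le_max_right _ _)).trans ?_
    change _ = Polynomial.eval 0 (G ⟨M.restrict α, Submodule.mem_map_of_mem hα⟩).fst
    rw [← Polynomial.coeff_zero_eq_eval_zero, e, hF (max m m') (le_max_left _ _), expSum_tt_zero, hv0]
  · obtain ⟨m', hm'⟩ := hg.eq_geom_sum hα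
    let n := max m m'
    refine (hm' n (le_max_right _ _)).trans ?_
    change _ = Polynomial.eval 1 (G ⟨M.restrict α, Submodule.mem_map_of_mem hα⟩).fst
    have h0 : ∀ i, n ≤ i → F ⟨M.restrict α, Submodule.mem_map_of_mem hα⟩ (tt k i) = 0 := fun i hi =>
      (hF i ((le_max_left _ _).trans hi) _).trans
        ((hm i ((le_max_left _ _).trans hi)).2.1 _ (tt_mem i))
    have h5 : (G ⟨M.restrict α, Submodule.mem_map_of_mem hα⟩).fst = ofCoeffs fun i =>
        F ⟨M.restrict α, Submodule.mem_map_of_mem hα⟩ (tt k i) :=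
      Polynomial.ext fun i => (e i).trans (coeff_ofCoeffs h0 i).symm
    rw [h5, eval_one_ofCoeffs h0, ← map_sum, hF n (le_max_left _ _)]
    have h6 := (hm n (le_max_left _ _)).1 _ (expSum_sum_tt_mem hT (hqs n))
    rw [map_sub, sub_eq_zero] at h6
    exact h6.symm

end FilteredModel

theorem finite_lists {I : Type*} {F : Set I} (hF : F.Finite) (n : ℕ) :
    {l : List I | (∀ i ∈ l, i ∈ F) ∧ l.length ≤ n}.Finite := by
  have : Finite F := hF
  refine ((List.finite_length_le F n).image (List.map Subtype.val)).subset ?_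
  rintro l ⟨h1, h2⟩
  lift l to List F using h1
  exact ⟨l, by simpa using h2, rfl⟩

namespace FreeGCA

variable {k : Type u} [Field k] {I : Type u} {deg : I → ℕ}

variable (k deg) in
/-- The augmentation modulo decomposable elements. -/
def augLin : FreeGCA k deg →ₐ[k] TrivSqZeroExt k (I →₀ k) :=
  lift (fun i => TrivSqZeroExt.inr (Finsupp.single i 1)) fun i j => by
    rw [TrivSqZeroExt.inr_mul_inr, TrivSqZeroExt.inr_mul_inr, smul_zero]

variable (k deg) in
/-- The projection to the space of generators, modulo constants and decomposable elements. -/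
def lin : FreeGCA k deg →ₗ[k] I →₀ k :=
  TrivSqZeroExt.sndHom k (I →₀ k) ∘ₗ (augLin k deg).toLinearMap

theorem augLin_gen (i : I) : augLin k deg (gen k deg i) = TrivSqZeroExt.inr (Finsupp.single i 1) :=
  lift_gen _ _ i

theorem lin_gen (i : I) : lin k deg (gen k deg i) = Finsupp.single i 1 :=
  congrArg TrivSqZeroExt.snd (augLin_gen i)

theorem lin_one : lin k deg 1 = 0 := by
  change (augLin k deg 1).snd = 0
  rw [map_one, TrivSqZeroExt.snd_one]

theorem lin_mul (a b : FreeGCA k deg) : lin k deg (a * b) =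
    (augLin k deg a).fst • lin k deg b + (augLin k deg b).fst • lin k deg a := by
  change (augLin k deg (a * b)).snd = _
  rw [map_mul, TrivSqZeroExt.snd_mul, op_smul_eq_smul]
  rfl

theorem fst_augLin_of_mem_gr {n : ℤ} (hn : 0 < n) {a : FreeGCA k deg} (ha : a ∈ gr k deg n) :
    (augLin k deg a).fst = 0 := by
  suffices h : gr k deg n ≤ LinearMap.ker ((TrivSqZeroExt.fstHom k k (I →₀ k)).toLinearMap ∘ₗ
      (augLin k deg).toLinearMap) from h ha
  refine Submodule.span_le.2 ?_
  rintro _ ⟨l, hl, rfl⟩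
  change (augLin k deg (mono k deg l)).fst = 0
  rcases l with _ | ⟨i, l⟩
  · simp only [List.map_nil, List.sum_nil] at hl
    omega
  · rw [mono_cons, map_mul, augLin_gen, TrivSqZeroExt.fst_mul, TrivSqZeroExt.fst_inr, zero_mul]

theorem finiteDimensional_wtLE {wt : I → ℕ} (hpos : ∀ i, 0 < wt i) {w : ℕ}
    (hF : {i | wt i ≤ w}.Finite) : FiniteDimensional k (wtLE k deg wt w) := by
  have h1 : wtLE k deg wt w ≤ Submodule.span k
      (mono k deg '' {l : List I | (∀ i ∈ l, i ∈ {i | wt i ≤ w}) ∧ l.length ≤ w}) := by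
    refine Submodule.span_mono ?_
    rintro _ ⟨l, hl, rfl⟩
    have hl' : (l.map wt).sum ≤ w := by exact_mod_cast hl
    refine ⟨l, ⟨fun i hi => (List.single_le_sum (by simp) _ (List.mem_map_of_mem hi)).trans hl', ?_⟩,
      rfl⟩
    have h2 : (l.map wt).length ≤ (l.map wt).sum := List.length_le_sum_of_one_le _ fun n hn => by
      obtain ⟨i, -, rfl⟩ := List.mem_map.1 hn
      exact hpos i
    rw [List.length_map] at h2
    exact h2.trans hl'
  have := FiniteDimensional.span_of_finite k ((finite_lists hF w).image (mono k deg))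
  exact Submodule.finiteDimensional_of_le h1

end FreeGCA

namespace FilteredModel

variable {k : Type u} [Field k] {H : GCA k} {M : FilteredModel H}

theorem wt_pos (i : M.I) : 0 < M.wt i := Nat.add_pos_left (M.deg_pos i) _

theorem deg_le_wt (i : M.I) : M.deg i ≤ M.wt i := Nat.le_add_right _ _

theorem fst_augLin_d (a : M.S) : (FreeGCA.augLin k M.deg (M.d a)).fst = 0 := by
  have ha : a ∈ Submodule.span k (Set.range (FreeGCA.mono k M.deg)) := by
    rw [FreeGCA.span_mono]
    exact Submodule.mem_top
  induction ha using Submodule.span_induction with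
  | mem a h =>
    obtain ⟨l, rfl⟩ := h
    exact FreeGCA.fst_augLin_of_mem_gr (by omega) (M.d_mem (FreeGCA.mono_mem_gr l))
  | zero => rw [map_zero, map_zero, TrivSqZeroExt.fst_zero]
  | add a b _ _ ha hb => rw [map_add, map_add, TrivSqZeroExt.fst_add, ha, hb, add_zero]
  | smul c a _ ha => rw [map_smul, map_smul, TrivSqZeroExt.fst_smul, ha, smul_zero]

theorem Minimal.lin_d_gen (hM : M.Minimal) (i : M.I) :
    FreeGCA.lin k M.deg (M.d (M.z i)) = 0 := by
  refine (Submodule.span_le (p := LinearMap.ker (FreeGCA.lin k M.deg))).2 ?_ (hM i)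
  rintro _ ⟨m, n, a, b, hm, hn, ha, hb, rfl⟩
  rw [SetLike.mem_coe, LinearMap.mem_ker, FreeGCA.lin_mul, FreeGCA.fst_augLin_of_mem_gr hm ha,
    FreeGCA.fst_augLin_of_mem_gr hn hb, zero_smul, zero_smul, add_zero]

theorem d_one : M.d (1 : M.S) = 0 := by
  have h := M.leibniz FreeGCA.one_mem_gr (1 : M.S)
  rw [sgn_zero, one_smul, mul_one, mul_one, one_mul] at h
  simpa using h

theorem Minimal.lin_d (hM : M.Minimal) (a : M.S) : FreeGCA.lin k M.deg (M.d a) = 0 := by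
  have ha : a ∈ Submodule.span k (Set.range (FreeGCA.mono k M.deg)) := by
    rw [FreeGCA.span_mono]
    exact Submodule.mem_top
  induction ha using Submodule.span_induction with
  | mem a h =>
    obtain ⟨l, rfl⟩ := h
    rcases l with _ | ⟨i, l⟩
    · rw [FreeGCA.mono_nil, d_one, map_zero]
    · rw [FreeGCA.mono_cons, M.leibniz (gen_mem_gr i), map_add, map_smul, FreeGCA.lin_mul,
        FreeGCA.lin_mul, fst_augLin_d, fst_augLin_d, hM.lin_d_gen, FreeGCA.augLin_gen,
        TrivSqZeroExt.fst_inr]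
      simp
  | zero => rw [map_zero, map_zero]
  | add a b _ _ ha hb => rw [map_add, map_add, ha, hb, add_zero]
  | smul c a _ ha => rw [map_smul, map_smul, ha, smul_zero]

variable (M) in
/-- The part of weight `w` of the projection to the space of generators. -/
def linPart (w : ℕ) : M.S →ₗ[k] M.S :=
  Finsupp.linearCombination k (fun i => if M.wt i = w then M.z i else 0) ∘ₗ FreeGCA.lin k M.deg

theorem sub_linPart_mem {w : ℕ} {a : M.S} (ha : a ∈ M.wtLE (w + 1 : ℕ)) :
    a - M.linPart (w + 1) a ∈ Submodule.span k (FreeGCA.mono k M.deg ''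
      {l : List M.I | (∀ i ∈ l, i ∈ {i | M.wt i ≤ w}) ∧ l.length ≤ w + 1}) := by
  suffices h : M.wtLE (w + 1 : ℕ) ≤ (Submodule.span k (FreeGCA.mono k M.deg ''
      {l : List M.I | (∀ i ∈ l, i ∈ {i | M.wt i ≤ w}) ∧ l.length ≤ w + 1})).comap
        (LinearMap.id - M.linPart (w + 1)) from h ha
  refine Submodule.span_le.2 ?_
  rintro _ ⟨l, hl, rfl⟩
  have hl' : (l.map M.wt).sum ≤ w + 1 := by exact_mod_cast hl
  have h2 : (l.map M.wt).length ≤ (l.map M.wt).sum := List.length_le_sum_of_one_le _ fun n hn => by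
    obtain ⟨i, -, rfl⟩ := List.mem_map.1 hn
    exact wt_pos i
  rw [List.length_map] at h2
  rw [SetLike.mem_coe, Submodule.mem_comap, LinearMap.sub_apply, LinearMap.id_apply, linPart,
    LinearMap.comp_apply]
  rcases l with _ | ⟨i, _ | ⟨j, l⟩⟩
  · rw [FreeGCA.mono_nil, FreeGCA.lin_one, map_zero, sub_zero]
    exact Submodule.subset_span ⟨[], by simp, FreeGCA.mono_nil⟩
  · have e : FreeGCA.mono k M.deg [i] = M.z i := by rw [FreeGCA.mono_cons, FreeGCA.mono_nil, mul_one]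
    rw [e, FreeGCA.lin_gen, Finsupp.linearCombination_single, one_smul]
    split_ifs with hi
    · rw [sub_self]
      exact Submodule.zero_mem _
    · rw [sub_zero]
      refine Submodule.subset_span ⟨[i], ⟨fun j hj => ?_, by simp⟩, e⟩
      obtain rfl := List.mem_singleton.1 hj
      simp only [List.map_cons, List.map_nil, List.sum_cons, List.sum_nil] at hl'
      change M.wt j ≤ w
      change M.wt j ≠ w + 1 at hi
      omega
  · have e : FreeGCA.lin k M.deg (FreeGCA.mono k M.deg (i :: j :: l)) = 0 := by
      rw [FreeGCA.mono_cons, FreeGCA.lin_mul, FreeGCA.augLin_gen, TrivSqZeroExt.fst_inr,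
        FreeGCA.mono_cons, map_mul (FreeGCA.augLin k M.deg), FreeGCA.augLin_gen, TrivSqZeroExt.fst_mul,
        TrivSqZeroExt.fst_inr, zero_mul, zero_smul, zero_smul, add_zero]
    rw [e, map_zero, sub_zero]
    refine Submodule.subset_span ⟨_, ⟨fun x hx => ?_, h2.trans hl'⟩, rfl⟩
    have h3 : ∀ x ∈ l, M.wt x ≤ (l.map M.wt).sum := fun x hx =>
      List.single_le_sum (by simp) _ (List.mem_map_of_mem hx)
    have hi := wt_pos i
    have hj := wt_pos j
    simp only [List.map_cons, List.sum_cons] at hl'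
    change M.wt x ≤ w
    rcases List.mem_cons.1 hx with rfl | hx
    · omega
    · rcases List.mem_cons.1 hx with rfl | hx
      · omega
      · have := h3 x hx
        omega

theorem Minimal.finite_wt (hM : M.Minimal) (hH : H.FiniteType) (w : ℕ) :
    {i | M.wt i ≤ w}.Finite := by
  induction w with
  | zero =>
    refine Set.finite_empty.subset fun i hi => ?_
    have h1 := wt_pos i
    have h2 : M.wt i ≤ 0 := hi
    omega
  | succ w ih =>
    let J := {i | M.wt i = w + 1}
    let W : Submodule k M.S := Submodule.span k (FreeGCA.mono k M.deg ''
      {l : List M.I | (∀ i ∈ l, i ∈ {i | M.wt i ≤ w}) ∧ l.length ≤ w + 1})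
    let K : Submodule k H.carrier := ⨆ n : Fin (w + 2), H.gr (n : ℕ)
    have hW : FiniteDimensional k W :=
      FiniteDimensional.span_of_finite k ((finite_lists ih (w + 1)).image _)
    have hK : FiniteDimensional k K := by
      have : ∀ n : Fin (w + 2), FiniteDimensional k (H.gr (n : ℕ)) := fun n => hH n
      exact Submodule.finiteDimensional_iSup _
    let Φ : (J →₀ k) →ₗ[k] M.S × H.carrier :=
      Finsupp.linearCombination k fun j : J => (M.d (M.z j), M.ρ (M.z j))
    let Z : (J →₀ k) →ₗ[k] M.S := Finsupp.linearCombination k fun j : J => M.z j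
    have hΦ : ∀ c, Φ c = (M.d (Z c), M.ρ (Z c)) := fun c => by
      induction c using Finsupp.induction_linear with
      | zero => simp only [map_zero]; rfl
      | add a b ha hb => simp only [map_add, ha, hb]; rfl
      | single j r =>
        simp only [Φ, Z, Finsupp.linearCombination_single, map_smul]
        rfl
    have hZ : ∀ c, FreeGCA.lin k M.deg (Z c) = c.mapDomain Subtype.val := fun c => by
      induction c using Finsupp.induction_linear with
      | zero => simp
      | add a b ha hb => simp only [map_add, Finsupp.mapDomain_add, ha, hb]
      | single j r =>
        simp only [Z, Finsupp.linearCombination_single, map_smul, FreeGCA.lin_gen,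
          Finsupp.mapDomain_single, Finsupp.smul_single, smul_eq_mul, mul_one]
    have hinj : Function.Injective Φ := by
      rw [← LinearMap.ker_eq_bot, eq_bot_iff]
      intro c hc
      rw [LinearMap.mem_ker, hΦ, Prod.mk_eq_zero] at hc
      obtain ⟨y, hy⟩ := M.ρ_inj _ hc.1 hc.2
      have h1 := hZ c
      rw [← hy, hM.lin_d] at h1
      exact Finsupp.mapDomain_injective Subtype.val_injective (h1.symm.trans Finsupp.mapDomain_zero.symm)
    have hle : LinearMap.range Φ ≤ W.prod K := by
      rw [Finsupp.range_linearCombination, Submodule.span_le]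
      rintro _ ⟨⟨j, hj⟩, rfl⟩
      have hj' : M.wt j = w + 1 := hj
      refine ⟨?_, ?_⟩
      · have h1 := sub_linPart_mem (w := w) (a := M.d (M.z j)) (M.d_wt (hj' ▸ gen_mem_wtLE j))
        have h2 : M.linPart (w + 1) (M.d (M.z j)) = 0 := by
          rw [linPart, LinearMap.comp_apply, hM.lin_d_gen, map_zero]
        rwa [h2, sub_zero] at h1
      · have h1 : M.deg j < w + 2 := by
          have := deg_le_wt j
          omega
        exact le_iSup (fun n : Fin (w + 2) => H.gr (n : ℕ)) ⟨M.deg j, h1⟩ (M.ρ_mem (gen_mem_gr j))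
    have h1 : FiniteDimensional k (W.prod K) :=
      Module.Finite.iff_fg.2 ((Module.Finite.iff_fg.1 hW).prod (Module.Finite.iff_fg.1 hK))
    have h2 : FiniteDimensional k (LinearMap.range Φ) := Submodule.finiteDimensional_of_le hle
    have h3 : Module.Finite k (J →₀ k) := Module.Finite.equiv (LinearEquiv.ofInjective Φ hinj).symm
    have h4 : Finite J := Module.Finite.finite_basis (Finsupp.basisSingleOne (R := k) (ι := J))
    refine (ih.union (Set.toFinite J)).subset fun i hi => ?_
    have hi' : M.wt i ≤ w + 1 := hi
    rcases Nat.lt_or_ge (M.wt i) (w + 1) with h | h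
    · exact Or.inl (Nat.lt_succ_iff.1 h)
    · exact Or.inr (le_antisymm hi' h)

theorem FiniteType.finite_wt (hM : M.FiniteType) (w : ℕ) : {i | M.wt i ≤ w}.Finite := by
  refine ((Finset.range (w + 1)).finite_toSet.biUnion fun n _ => hM n).subset fun i hi => ?_
  have hi' : M.wt i ≤ w := hi
  have h1 : M.deg i < w + 1 := by
    have := deg_le_wt i
    omega
  exact Set.mem_biUnion (x := M.deg i) (Finset.mem_coe.2 (Finset.mem_range.2 h1)) rfl

theorem finiteDimensional_wtLE (hM : M.Minimal ∨ M.FiniteType) (hH : H.FiniteType) (w : ℕ) :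
    FiniteDimensional k (M.wtLE w) :=
  FreeGCA.finiteDimensional_wtLE wt_pos
    (hM.elim (fun h => h.finite_wt hH w) fun h => h.finite_wt w)

end FilteredModel

namespace FilteredModel

open TensorAlgebra TensorCoalg

variable {k : Type u} [Field k] {H : GCA k} {M : FilteredModel H}

theorem op_b₁_apply (v : M.sL) (a : M.S) :
    op (M.b₁ v) a = -M.d (op v a) - op (M.par v) (M.d a) := by
  suffices h : op ∘ₗ M.b₁ = -((LinearMap.llcomp k _ _ _ M.d) ∘ₗ op) -
      ((LinearMap.llcomp k _ _ _).flip M.d) ∘ₗ op ∘ₗ M.par from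
    DFunLike.congr_fun (DFunLike.congr_fun h v) a
  refine susp_ext fun n θ => LinearMap.ext fun a => ?_
  simp only [LinearMap.comp_apply, LinearMap.sub_apply, LinearMap.neg_apply, LinearMap.flip_apply,
    LinearMap.llcomp_apply]
  rw [op_b₁ (susp_mem_sLgr n θ), par_susp, map_smul, op_susp, gcomm, one_mul,
    show sgn k (n - 1) = -sgn k n by rw [← neg_neg (sgn k (n - 1)), ← sgn_succ]; congr 2; ring]
  simp only [LinearMap.neg_apply, LinearMap.sub_apply, LinearMap.smul_apply, LinearMap.comp_apply,
    neg_smul]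
  abel

theorem sgn_of_even {n : ℤ} (h : Even n) : sgn k n = 1 :=
  (sgn_congr (by rwa [sub_zero])).trans sgn_zero

theorem sgn_of_odd {n : ℤ} (h : Odd n) : sgn k n = -1 :=
  (sgn_congr (h.sub_odd odd_one)).trans sgn_one

theorem sgn_sub_one (n : ℤ) : sgn k (n - 1) = -sgn k n := by
  rw [← neg_neg (sgn k (n - 1)), ← sgn_succ, add_sub_cancel]

theorem sL_induction {P : M.sL → Prop} (h0 : P 0) (hadd : ∀ v w, P v → P w → P (v + w))
    (hs : ∀ n θ, P (M.susp n θ)) (v : M.sL) : P v := by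
  classical
  have hv : v = ∑ n ∈ DFinsupp.support (β := fun n => M.der n 1) v, M.susp n (M.comp n v) :=
    (DirectSum.sum_support_of (β := fun n => M.der n 1) v).symm
  rw [hv]
  exact Finset.sum_induction _ P hadd h0 fun n _ => hs n _

theorem op_b₂_tmul [CharZero k] (v w : M.sL) : op (M.b₂ (v ⊗ₜ[k] w)) =
    -((2 : k)⁻¹ • (op (M.par v) ∘ₗ op w + (2 : k)⁻¹ • (op (M.par w) ∘ₗ op v + op w ∘ₗ op v +
      op (M.par w) ∘ₗ op (M.par v) - op w ∘ₗ op (M.par v)))) := by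
  induction v using sL_induction with
  | h0 => simp
  | hadd v v' hv hv' =>
    simp only [TensorProduct.add_tmul, map_add, LinearMap.add_comp, LinearMap.comp_add, hv, hv']
    module
  | hs n θ =>
    induction w using sL_induction with
    | h0 => simp
    | hadd w w' hw hw' =>
      simp only [TensorProduct.tmul_add, map_add, LinearMap.add_comp, LinearMap.comp_add, hw, hw']
      module
    | hs m φ =>
      rw [op_b₂ (susp_mem_sLgr n θ) (susp_mem_sLgr m φ), par_susp, par_susp, map_smul, map_smul,
        op_susp, op_susp, gcomm, sgn_sub_one, sgn_sub_one]
      simp only [LinearMap.smul_comp, LinearMap.comp_smul]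
      rcases Int.even_or_odd n with hn | hn <;> rcases Int.even_or_odd m with hm | hm
      · rw [sgn_of_even hn, sgn_of_even hm, sgn_of_even (hn.mul_right m)]
        module
      · rw [sgn_of_even hn, sgn_of_odd hm, sgn_of_even (hn.mul_right m)]
        module
      · rw [sgn_of_odd hn, sgn_of_even hm, sgn_of_even (hm.mul_left n)]
        module
      · rw [sgn_of_odd hn, sgn_of_odd hm, sgn_of_odd (hn.mul hm)]
        module

variable (M) in
/-- The operator `x ⊗ y ↦ ± x₁ y₁` on `S Z`, where `x₁`, `y₁` are the operators underlying the
components in `s L` of `x` and `y`. -/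
def opMul : TensorAlgebra k M.sL ⊗[k] TensorAlgebra k M.sL →ₗ[k] (M.S →ₗ[k] M.S) :=
  TensorProduct.lift ((LinearMap.llcomp k M.S M.S M.S).compl₁₂ (op ∘ₗ M.par ∘ₗ ιInv) (op ∘ₗ ιInv))

theorem opMul_tmul (x y : TensorAlgebra k M.sL) :
    M.opMul (x ⊗ₜ[k] y) = op (M.par (ιInv x)) ∘ₗ op (ιInv y) := rfl

theorem ιInv_par (x : TensorAlgebra k M.sL) : ιInv (TensorCoalg.par M.par x) = M.par (ιInv x) := by
  suffices h : ιInv ∘ₗ (TensorCoalg.par M.par).toLinearMap = M.par ∘ₗ ιInv from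
    DFunLike.congr_fun h x
  refine ext_word fun l => ?_
  rcases l with _ | ⟨v, l⟩
  · simp [ιInv_one]
  · have h : ∀ l : List M.sL, algebraMapInv (TensorCoalg.par M.par (word k l)) =
        (algebraMapInv (word k l) : k) := fun l => by
      rcases l with _ | ⟨w, l⟩
      · simp
      · rw [word_cons, map_mul, par_ι, algebraMapInv_ι_mul, algebraMapInv_ι_mul]
    rw [LinearMap.comp_apply, LinearMap.comp_apply, AlgHom.toLinearMap_apply, word_cons, map_mul,
      par_ι, ιInv_ι_mul, ιInv_ι_mul, h, map_smul]

theorem op_b₂_eq_opMul [CharZero k] (z : TensorAlgebra k M.sL ⊗[k] TensorAlgebra k M.sL) :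
    op (M.b₂ (TensorProduct.map ιInv ιInv z)) =
      -((2 : k)⁻¹ • (M.opMul z + M.opMul (swap M.par z))) := by
  induction z using TensorProduct.induction_on with
  | zero => simp
  | tmul x y =>
    rw [TensorProduct.map_tmul, op_b₂_tmul, swap_tmul, map_smul, map_sub, map_add, map_add]
    simp only [opMul_tmul, ιInv_par, par_invol]
  | add a b ha hb =>
    simp only [map_add, ha, hb]
    module

theorem op_ιInv_coder [CharZero k] (x : M.symm) (a : M.S) :
    op (ιInv (coder M.par M.b₁ M.b₂ (x : TensorAlgebra k M.sL))) a =
      -M.d (op (ιInv (x : TensorAlgebra k M.sL)) a) -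
        op (M.par (ιInv (x : TensorAlgebra k M.sL))) (M.d a) -
        M.opMul (delta k M.sL x) a := by
  have h := op_b₂_eq_opMul (delta k M.sL x)
  rw [(isCocommSub_symm x.1 x.2).2, ← two_smul k, smul_smul, inv_mul_cancel₀ two_ne_zero,
    one_smul] at h
  rw [ιInv_coder, corest, LinearMap.add_apply, LinearMap.comp_apply, LinearMap.comp_apply,
    LinearMap.comp_apply, map_add, LinearMap.add_apply, h, op_b₁_apply, LinearMap.neg_apply]
  abel

end FilteredModel

namespace FilteredModel

open TensorAlgebra TensorCoalg

variable {k : Type u} [Field k] {H : GCA k} {M : FilteredModel H}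

theorem op_mem_wtLE (v : M.sL) {w : ℤ} {a : M.S} (ha : a ∈ M.wtLE w) : op v a ∈ M.wtLE w := by
  induction v using sL_induction with
  | h0 => rw [map_zero]; exact Submodule.zero_mem _
  | hadd v v' hv hv' => rw [map_add]; exact Submodule.add_mem _ hv hv'
  | hs n θ =>
    rw [op_susp]
    exact M.wtLE_mono (by omega) (θ.2.2.2 w a ha)

theorem op_apply_eq_zero {w : ℤ} {v : M.sL} (hv : v ∈ (M.contFil w).F 2) {a : M.S}
    (ha : a ∈ M.wtLE w) : op v a = 0 := by
  have h : (M.contFil w).F 2 ≤ (⊥ : Submodule k M.S).comap ((LinearMap.applyₗ a) ∘ₗ op) :=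
    filOf_le fun n θ hθ => by
      change op (M.susp n θ) a = 0
      rw [op_susp]
      simp only [show ¬ 2 ≤ 1 by omega, if_false] at hθ
      exact hθ a ha
  exact h hv

theorem gproj_op {m : ℤ} {a : M.S} (ha : a ∈ M.gr m) (n : ℤ) (v : M.sL) :
    gproj FreeGCA.isInternal_gr (m + n) (op v a) = (M.comp n v).1 a := by
  induction v using sL_induction with
  | h0 => simp
  | hadd v v' hv hv' => simp only [map_add, LinearMap.add_apply, hv, hv', Submodule.coe_add]
  | hs j θ =>
    rw [op_susp, gproj_of_mem _ (θ.2.1 m a ha)]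
    by_cases h : j = n
    · subst h
      rw [if_pos rfl, comp_susp]
    · rw [if_neg (by omega)]
      have : M.comp n (M.susp j θ) = 0 := DirectSum.of_eq_of_ne _ _ _ (Ne.symm h)
      rw [this]
      rfl

theorem mem_contFil_of_op {w : ℤ} {v : M.sL} (h : ∀ a ∈ M.wtLE w, op v a = 0) (p : ℕ) :
    v ∈ (M.contFil w).F p := fun n => by
  by_cases hp : p ≤ 1
  · simp [hp]
  · simp only [hp, if_false]
    have h1 : ∀ (l : List M.I), ((l.map M.wt).sum : ℤ) ≤ w →
        (M.comp n v).1 (FreeGCA.mono k M.deg l) = 0 := fun l hl => by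
      rw [← gproj_op (FreeGCA.mono_mem_gr l), h _ (Submodule.subset_span ⟨l, hl, rfl⟩), map_zero]
    refine fun b hb => (Submodule.span_le (p := LinearMap.ker (M.comp n v).1)).2 ?_ hb
    rintro _ ⟨l, hl, rfl⟩
    exact h1 l hl

/-- Endomorphisms of `s L` which preserve the subspaces of derivations vanishing on the elements of
given weight. -/
def Stable (T : M.sL →ₗ[k] M.sL) : Prop :=
  ∀ w, (M.contFil w).F 2 ≤ ((M.contFil w).F 2).comap T

variable (M) in
/-- The projection of `s L` to the suspension of `Lⁿ`. -/
def sLproj (n : ℤ) : M.sL →ₗ[k] M.sL := M.susp n ∘ₗ M.comp n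

theorem stable_id : Stable (M := M) LinearMap.id := fun _ _ h => h

theorem stable_par : Stable M.par := fun _ => par_le 2

theorem stable_sLproj (n : ℤ) : Stable (M.sLproj n) := fun w v hv => by
  change M.susp n (M.comp n v) ∈ (M.contFil w).F 2
  unfold contFil
  exact susp_mem (hv n)

theorem sLproj_susp (n m : ℤ) (θ : M.der m 1) :
    M.sLproj n (M.susp m θ) = if m = n then M.susp m θ else 0 := by
  rw [sLproj, LinearMap.comp_apply]
  split_ifs with h
  · subst h
    rw [comp_susp]
  · have : M.comp n (M.susp m θ) = 0 := DirectSum.of_eq_of_ne _ _ _ (Ne.symm h)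
    rw [this, map_zero]

theorem sLproj_par (n : ℤ) (v : M.sL) : M.sLproj n (M.par v) = sgn k (n - 1) • M.sLproj n v := by
  induction v using sL_induction with
  | h0 => simp
  | hadd v v' hv hv' => rw [map_add, map_add, hv, hv', map_add, smul_add]
  | hs m θ =>
    rw [par_susp, map_smul, sLproj_susp]
    split_ifs with h
    · subst h
      rfl
    · rw [smul_zero, smul_zero]

theorem comp_ιInv_mem_contDual {l : Module.Dual k M.sL} {w : ℤ}
    (h : (M.contFil w).F 2 ≤ LinearMap.ker l) : l ∘ₗ ιInv ∈ M.contDual :=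
  ⟨w, 2, fun _ hx => h (wordFil_ιInv 2 hx)⟩

/-- The form `v ↦ ξ ((T v) a)` on `s L`, as an element of `A(L)`. -/
def gForm {T : M.sL →ₗ[k] M.sL} (hT : Stable T) : Module.Dual k M.S →ₗ[k] M.S →ₗ[k] M.A :=
  LinearMap.mk₂ k (fun ξ a => ⟨M.restrict ((ξ ∘ₗ LinearMap.applyₗ a ∘ₗ op ∘ₗ T) ∘ₗ ιInv), by
    obtain ⟨w, hw⟩ := FreeGCA.exists_mem_wtLE M.wt a
    refine Submodule.mem_map_of_mem (comp_ιInv_mem_contDual (w := w) fun v hv => ?_)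
    change ξ (op (T v) a) = 0
    rw [op_apply_eq_zero (hT w hv) hw, map_zero]⟩)
    (fun ξ η a => rfl) (fun c ξ a => rfl)
    (fun ξ a b => Subtype.ext (LinearMap.ext fun x => by
      change ξ (op (T (ιInv x.1)) (a + b)) = ξ (op (T (ιInv x.1)) a) + ξ (op (T (ιInv x.1)) b)
      rw [map_add, map_add]))
    (fun c ξ a => Subtype.ext (LinearMap.ext fun x => by
      change ξ (op (T (ιInv x.1)) (c • a)) = c • ξ (op (T (ιInv x.1)) a)
      rw [map_smul, map_smul]))

theorem gForm_apply {T : M.sL →ₗ[k] M.sL} (hT : Stable T) (ξ : Module.Dual k M.S) (a : M.S)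
    (x : M.symm) : (gForm hT ξ a).1 x = ξ (op (T (ιInv x.1)) a) := rfl

/-- A finite family of elements and linear forms which represents the elements of weight at most
`w`. -/
structure IsFrame (w : ℤ) {n : ℕ} (e : Fin n → M.S) (ε : Fin n → Module.Dual k M.S) : Prop where
  mem : ∀ j, e j ∈ M.wtLE w
  sum_eq : ∀ b ∈ M.wtLE w, ∑ j, ε j b • e j = b

theorem exists_isFrame {w : ℤ} (h : FiniteDimensional k (M.wtLE w)) :
    ∃ (n : ℕ) (e : Fin n → M.S) (ε : Fin n → Module.Dual k M.S), IsFrame w e ε := by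
  let b := Module.finBasis k (M.wtLE w)
  choose ε hε using fun j => LinearMap.exists_extend (b.coord j)
  refine ⟨_, fun j => (b j : M.S), ε, ⟨fun j => (b j).2, fun a ha => ?_⟩⟩
  have h1 := congrArg Subtype.val (b.sum_repr ⟨a, ha⟩)
  rw [Submodule.coe_sum] at h1
  refine (Finset.sum_congr rfl fun j _ => ?_).trans h1
  have h2 : ε j a = b.repr ⟨a, ha⟩ j := DFunLike.congr_fun (hε j) ⟨a, ha⟩
  rw [h2]
  rfl

theorem IsFrame.apply {w : ℤ} {n : ℕ} {e : Fin n → M.S} {ε : Fin n → Module.Dual k M.S}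
    (h : IsFrame w e ε) {b : M.S} (hb : b ∈ M.wtLE w) {Y : Type u} [AddCommGroup Y] [Module k Y]
    (f : M.S →ₗ[k] Y) : f b = ∑ j, ε j b • f (e j) := by
  conv_lhs => rw [← h.sum_eq b hb]
  rw [map_sum]
  simp only [map_smul]

theorem d_gForm [CharZero k] {w : ℤ} {n : ℕ} {e : Fin n → M.S} {ε : Fin n → Module.Dual k M.S}
    (h : IsFrame w e ε) (ξ : Module.Dual k M.S) {a : M.S} (ha : a ∈ M.wtLE w) :
    A.d M (gForm stable_id ξ a) + (gForm stable_id (ξ ∘ₗ M.d) a + gForm stable_par ξ (M.d a) +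
      ∑ j, A.mul M (gForm stable_par ξ (e j)) (gForm stable_id (ε j) a)) = 0 := by
  refine Subtype.ext (LinearMap.ext fun x => ?_)
  have h1 : ∀ z, ξ (M.opMul z a) = ∑ j, LinearMap.mul' k k (TensorProduct.map
      ((ξ ∘ₗ LinearMap.applyₗ (e j) ∘ₗ op ∘ₗ M.par) ∘ₗ ιInv)
      ((ε j ∘ₗ LinearMap.applyₗ a ∘ₗ op ∘ₗ LinearMap.id) ∘ₗ ιInv) z) := fun z => by
    induction z using TensorProduct.induction_on with
    | zero => simp
    | tmul x y =>
      rw [opMul_tmul, LinearMap.comp_apply]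
      refine (h.apply (op_mem_wtLE (ιInv y) ha) (ξ ∘ₗ op (M.par (ιInv x)))).trans ?_
      refine Finset.sum_congr rfl fun j _ => ?_
      rw [TensorProduct.map_tmul, LinearMap.mul'_apply, mul_comm]
      rfl
    | add z z' hz hz' =>
      rw [map_add, LinearMap.add_apply, map_add, hz, hz', ← Finset.sum_add_distrib]
      simp only [map_add]
  have h2 : (∑ j, A.mul M (gForm stable_par ξ (e j)) (gForm stable_id (ε j) a)).1 x =
      ξ (M.opMul (delta k M.sL x) a) := by
    rw [h1, Submodule.coe_sum, LinearMap.sum_apply]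
    exact Finset.sum_congr rfl fun j _ => A_mul_apply rfl rfl x
  change ξ (op (ιInv (coder M.par M.b₁ M.b₂ (x : TensorAlgebra k M.sL))) a) +
    (ξ (M.d (op (ιInv x.1) a)) + ξ (op (M.par (ιInv x.1)) (M.d a)) +
      (∑ j, A.mul M (gForm stable_par ξ (e j)) (gForm stable_id (ε j) a)).1 x) = 0
  rw [op_ιInv_coder, h2, map_sub, map_sub, map_neg]
  ring

theorem eq_zero_of_mem_gr_neg {n : ℤ} (hn : n < 0) {a : M.S} (ha : a ∈ M.gr n) : a = 0 := by
  suffices h : M.gr n ≤ ⊥ from h ha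
  refine Submodule.span_le.2 ?_
  rintro _ ⟨l, hl, rfl⟩
  omega

theorem exists_der_degree_eq_zero (a : M.S) : ∃ N : ℕ, ∀ n : ℤ, N < n.natAbs → ∀ θ ∈ M.der n 1,
    θ a = 0 := by
  have ha : a ∈ Submodule.span k (Set.range (FreeGCA.mono k M.deg)) := by
    rw [FreeGCA.span_mono]
    exact Submodule.mem_top
  induction ha using Submodule.span_induction with
  | mem a h =>
    obtain ⟨l, rfl⟩ := h
    refine ⟨(l.map M.deg).sum + (l.map M.wt).sum, fun n hn θ hθ => ?_⟩
    have h1 := hθ.1 _ _ (FreeGCA.mono_mem_gr l)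
    rcases lt_or_ge (((l.map M.deg).sum : ℤ) + n) 0 with h | h
    · exact eq_zero_of_mem_gr_neg h h1
    · exact eq_zero_of_mem h1 (hθ.2.2 _ _ (FreeGCA.mono_mem_wtLE M.wt l)) (by omega)
  | zero => exact ⟨0, fun _ _ _ _ => map_zero _⟩
  | add a b _ _ ha hb =>
    obtain ⟨N, hN⟩ := ha
    obtain ⟨N', hN'⟩ := hb
    refine ⟨max N N', fun n hn θ hθ => ?_⟩
    rw [map_add, hN n (by omega) θ hθ, hN' n (by omega) θ hθ, add_zero]
  | smul c a _ ha =>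
    obtain ⟨N, hN⟩ := ha
    exact ⟨N, fun n hn θ hθ => by rw [map_smul, hN n hn θ hθ, smul_zero]⟩

theorem exists_op_eq_sum (a : M.S) : ∃ s : Finset ℤ, 0 ∈ s ∧ 1 ∈ s ∧ ∀ v,
    op v a = ∑ n ∈ s, op (M.sLproj n v) a := by
  obtain ⟨N, hN⟩ := exists_der_degree_eq_zero a
  refine ⟨Finset.Icc (-(N + 1) : ℤ) (N + 1), by simp; omega, by simp; omega, fun v => ?_⟩
  induction v using sL_induction with
  | h0 => simp
  | hadd v v' hv hv' => simp only [map_add, LinearMap.add_apply, hv, hv', Finset.sum_add_distrib]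
  | hs n θ =>
    simp only [sLproj_susp]
    by_cases hn : n ∈ Finset.Icc (-(N + 1) : ℤ) (N + 1)
    · rw [Finset.sum_eq_single n, if_pos rfl]
      · intro m _ hm
        rw [if_neg (Ne.symm hm), map_zero, LinearMap.zero_apply]
      · exact fun h => absurd hn h
    · rw [op_susp, hN n (by rw [Finset.mem_Icc] at hn; omega) θ.1 θ.2]
      refine (Finset.sum_eq_zero fun m hm => ?_).symm
      have hne : n ≠ m := fun h => hn (h ▸ hm)
      rw [if_neg hne, map_zero, LinearMap.zero_apply]

end FilteredModel

namespace FilteredModel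

open TensorAlgebra TensorCoalg

variable {k : Type u} [Field k] {H : GCA k} {M : FilteredModel H}

theorem sLproj_of_mem {n m : ℤ} {v : M.sL} (hv : v ∈ M.sLgr m) (h : m ≠ n) : M.sLproj n v = 0 := by
  obtain ⟨θ, rfl⟩ := hv
  rw [sLproj_susp, if_neg h]

theorem sLproj_mem (n : ℤ) (v : M.sL) : M.sLproj n v ∈ M.sLgr n := susp_mem_sLgr _ _

theorem gForm_eq_zero {T : M.sL →ₗ[k] M.sL} (hT : Stable T) {ξ : Module.Dual k M.S} {a : M.S}
    (h : ∀ v, ξ (op (T v) a) = 0) : gForm hT ξ a = 0 :=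
  Subtype.ext (LinearMap.ext fun x => h (ιInv x.1))

theorem hasDegree_gForm {n m : ℤ} (h : m = 1 - n) (ξ : Module.Dual k M.S) (a : M.S) :
    A.HasDegree (gForm (stable_sLproj n) ξ a) m := fun j x hj hx => by
  have h1 : ιInv x.1 ∈ M.sLgr (j + 1) := ιInv_mem_sLgr rfl hx
  rw [gForm_apply, sLproj_of_mem h1 (by omega), map_zero, LinearMap.zero_apply, map_zero]

theorem IsFrame.gForm_eq {w : ℤ} {n : ℕ} {e : Fin n → M.S} {ε : Fin n → Module.Dual k M.S}
    (h : IsFrame w e ε) {T : M.sL →ₗ[k] M.sL} (hT : Stable T) (ξ : Module.Dual k M.S) {a : M.S}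
    (ha : a ∈ M.wtLE w) : gForm hT ξ a = ∑ j, ξ (e j) • gForm hT (ε j) a := by
  refine Subtype.ext (LinearMap.ext fun x => ?_)
  rw [Submodule.coe_sum, LinearMap.sum_apply]
  refine (h.apply (op_mem_wtLE (T (ιInv x.1)) ha) ξ).trans (Finset.sum_congr rfl fun j _ => ?_)
  exact mul_comm _ _

theorem exists_endomorphism {V : Type u} [AddCommGroup V] [Module k V]
    {B : Module.Dual k V →ₗ[k] V →ₗ[k] k} (h : ∀ a, ∃ b, ∀ ξ, ξ b = B ξ a) :
    ∃ θ : V →ₗ[k] V, ∀ ξ a, ξ (θ a) = B ξ a := by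
  choose θ hθ using h
  refine ⟨⟨⟨θ, fun a b => ?_⟩, fun c a => ?_⟩, fun ξ a => hθ a ξ⟩
  · refine sub_eq_zero.1 ((Module.forall_dual_apply_eq_zero_iff k _).1 fun ξ => ?_)
    rw [map_sub, map_add, hθ, hθ, hθ, map_add, sub_self]
  · refine sub_eq_zero.1 ((Module.forall_dual_apply_eq_zero_iff k _).1 fun ξ => ?_)
    rw [map_sub, RingHom.id_apply, map_smul, hθ, hθ, map_smul, sub_self]

theorem mem_of_forall_dual {V : Type u} [AddCommGroup V] [Module k V] {Q : Submodule k V} {b : V}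
    (h : ∀ ξ : Module.Dual k V, (∀ q ∈ Q, ξ q = 0) → ξ b = 0) : b ∈ Q := by
  by_contra hb
  obtain ⟨ξ, hξ, hQ⟩ := Submodule.exists_le_ker_of_notMem hb
  exact hξ (h ξ fun q hq => hQ hq)

/-- Linear forms on `A(L)` give derivations. -/
theorem exists_der_of_form (hM : ∀ w : ℕ, FiniteDimensional k (M.wtLE w)) (Λ : M.A →ₗ[k] k) (n : ℤ) :
    ∃ θ ∈ M.der n 1, ∀ ξ a, ξ (θ a) = Λ (gForm (stable_sLproj n) ξ a) := by
  have h1 : ∀ a, ∃ b, ∀ ξ, ξ b = Λ (gForm (stable_sLproj n) ξ a) := fun a => by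
    obtain ⟨w, hw⟩ := FreeGCA.exists_mem_wtLE M.wt a
    obtain ⟨m, e, ε, h⟩ := exists_isFrame (hM w)
    refine ⟨∑ j, Λ (gForm (stable_sLproj n) (ε j) a) • e j, fun ξ => ?_⟩
    rw [h.gForm_eq _ ξ hw, map_sum, map_sum]
    simp only [map_smul, smul_eq_mul, mul_comm]
  obtain ⟨θ, hθ⟩ := exists_endomorphism (B := (gForm (stable_sLproj n)).compr₂ Λ) h1
  have hθ' : ∀ ξ a, ξ (θ a) = Λ (gForm (stable_sLproj n) ξ a) := hθ
  have hmem : ∀ {a : M.S} {Q : Submodule k M.S}, (∀ v ∈ M.sLgr n, op v a ∈ Q) → θ a ∈ Q :=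
    fun {a Q} h => mem_of_forall_dual fun ξ hξ => by
      rw [hθ', gForm_eq_zero _ fun v => hξ _ (h _ (sLproj_mem n v)), map_zero]
  refine ⟨θ, ⟨fun m a ha => hmem fun v hv => (op_mem hv).1 m a ha, fun m a ha b => ?_,
    fun w a ha => hmem fun v hv => (op_mem hv).2.2 w a ha⟩, hθ'⟩
  refine sub_eq_zero.1 ((Module.forall_dual_apply_eq_zero_iff k _).1 fun ξ => ?_)
  have h2 : gForm (stable_sLproj n) ξ (a * b) =
      gForm (stable_sLproj n) (ξ ∘ₗ LinearMap.mulRight k b) a +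
        sgn k (n * m) • gForm (stable_sLproj n) (ξ ∘ₗ LinearMap.mulLeft k a) b :=
    Subtype.ext (LinearMap.ext fun x => by
      have h3 := congrArg ξ ((op_mem (sLproj_mem n (ιInv x.1))).2.1 m a ha b)
      rw [map_add, map_smul] at h3
      exact h3)
  have h4 : ξ (θ a * b) = Λ (gForm (stable_sLproj n) (ξ ∘ₗ LinearMap.mulRight k b) a) :=
    hθ' (ξ ∘ₗ LinearMap.mulRight k b) a
  have h5 : ξ (a * θ b) = Λ (gForm (stable_sLproj n) (ξ ∘ₗ LinearMap.mulLeft k a) b) :=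
    hθ' (ξ ∘ₗ LinearMap.mulLeft k a) b
  rw [map_sub, map_add, map_smul, hθ', h2, h4, h5, map_add, map_smul, sub_self]

section

open Polynomial

/-- A linear map `A(L) → k[t, dt]`, with values in the underlying square zero extension. -/
def AMap.toForms (f : M.AMap (DGCA.polyForms k)) : M.A →ₗ[k] TrivSqZeroExt k[X] k[X] := f.f

variable (f : M.AMap (DGCA.polyForms k))

theorem AMap.fst_gForm_sLproj {n : ℤ} (hn : n ≠ 1) (ξ : Module.Dual k M.S) (a : M.S) :
    (f.toForms (gForm (stable_sLproj n) ξ a)).fst = 0 := by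
  have h := f.map_gr (1 - n) _ (hasDegree_gForm rfl ξ a)
  by_cases h0 : n = 0
  · subst h0
    exact h
  · have h1 : (DGCA.polyForms k).gr (1 - n) = ⊥ :=
      (if_neg (by omega)).trans (if_neg (by omega))
    rw [h1] at h
    have h2 : f.toForms (gForm (stable_sLproj n) ξ a) = 0 := h
    rw [h2, TrivSqZeroExt.fst_zero]

theorem AMap.snd_gForm_sLproj {n : ℤ} (hn : n ≠ 0) (ξ : Module.Dual k M.S) (a : M.S) :
    (f.toForms (gForm (stable_sLproj n) ξ a)).snd = 0 := by
  have h := f.map_gr (1 - n) _ (hasDegree_gForm rfl ξ a)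
  by_cases h0 : n = 1
  · subst h0
    exact h
  · have h1 : (DGCA.polyForms k).gr (1 - n) = ⊥ :=
      (if_neg (by omega)).trans (if_neg (by omega))
    rw [h1] at h
    have h2 : f.toForms (gForm (stable_sLproj n) ξ a) = 0 := h
    rw [h2, TrivSqZeroExt.snd_zero]

theorem exists_gForm_eq_sum (a : M.S) : ∃ s : Finset ℤ, 0 ∈ s ∧ 1 ∈ s ∧ ∀ ξ,
    gForm stable_id ξ a = ∑ n ∈ s, gForm (stable_sLproj n) ξ a ∧
      gForm stable_par ξ a = ∑ n ∈ s, sgn k (n - 1) • gForm (stable_sLproj n) ξ a := by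
  obtain ⟨s, h0, h1, h⟩ := exists_op_eq_sum (M := M) a
  refine ⟨s, h0, h1, fun ξ => ⟨Subtype.ext (LinearMap.ext fun x => ?_),
    Subtype.ext (LinearMap.ext fun x => ?_)⟩⟩
  · rw [Submodule.coe_sum, LinearMap.sum_apply]
    exact (congrArg ξ (h (ιInv x.1))).trans (map_sum ξ _ _)
  · rw [Submodule.coe_sum, LinearMap.sum_apply]
    refine (congrArg ξ (h (M.par (ιInv x.1)))).trans ((map_sum ξ _ _).trans ?_)
    refine Finset.sum_congr rfl fun n _ => ?_
    rw [sLproj_par, map_smul, LinearMap.smul_apply, map_smul]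
    rfl

theorem AMap.fst_gForm (ξ : Module.Dual k M.S) (a : M.S) :
    (f.toForms (gForm stable_id ξ a)).fst = (f.toForms (gForm (stable_sLproj 1) ξ a)).fst ∧
    (f.toForms (gForm stable_par ξ a)).fst = (f.toForms (gForm (stable_sLproj 1) ξ a)).fst := by
  obtain ⟨s, h0, h1, h⟩ := exists_gForm_eq_sum (M := M) a
  rw [(h ξ).1, (h ξ).2, map_sum, map_sum, TrivSqZeroExt.fst_sum, TrivSqZeroExt.fst_sum]
  refine ⟨Finset.sum_eq_single 1 (fun n _ hn => f.fst_gForm_sLproj hn ξ a) fun h => absurd h1 h,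
    (Finset.sum_eq_single 1 (fun n _ hn => ?_) fun h => absurd h1 h).trans ?_⟩
  · rw [map_smul, TrivSqZeroExt.fst_smul, f.fst_gForm_sLproj hn, smul_zero]
  · rw [sub_self, sgn_zero, one_smul]

theorem AMap.snd_gForm (ξ : Module.Dual k M.S) (a : M.S) :
    (f.toForms (gForm stable_id ξ a)).snd = (f.toForms (gForm (stable_sLproj 0) ξ a)).snd ∧
    (f.toForms (gForm stable_par ξ a)).snd = -(f.toForms (gForm (stable_sLproj 0) ξ a)).snd := by
  obtain ⟨s, h0, h1, h⟩ := exists_gForm_eq_sum (M := M) a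
  rw [(h ξ).1, (h ξ).2, map_sum, map_sum, TrivSqZeroExt.snd_sum, TrivSqZeroExt.snd_sum]
  refine ⟨Finset.sum_eq_single 0 (fun n _ hn => f.snd_gForm_sLproj hn ξ a) fun h => absurd h0 h,
    (Finset.sum_eq_single 0 (fun n _ hn => ?_) fun h => absurd h0 h).trans ?_⟩
  · rw [map_smul, TrivSqZeroExt.snd_smul, f.snd_gForm_sLproj hn, smul_zero]
  · rw [sgn_sub_one, sgn_zero, map_smul, TrivSqZeroExt.snd_smul, neg_smul, one_smul]

theorem AMap.toForms_d_gForm [CharZero k] {w : ℤ} {n : ℕ} {e : Fin n → M.S}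
    {ε : Fin n → Module.Dual k M.S} (h : IsFrame w e ε) (ξ : Module.Dual k M.S) {a : M.S}
    (ha : a ∈ M.wtLE w) :
    TrivSqZeroExt.inr (derivative (f.toForms (gForm stable_id ξ a)).fst) +
      (f.toForms (gForm stable_id (ξ ∘ₗ M.d) a) + f.toForms (gForm stable_par ξ (M.d a)) +
        ∑ j, f.toForms (gForm stable_par ξ (e j)) * f.toForms (gForm stable_id (ε j) a)) = 0 := by
  have h1 : f.toForms (A.d M (gForm stable_id ξ a)) =
    TrivSqZeroExt.inr (derivative (f.toForms (gForm stable_id ξ a)).fst) := f.map_d _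
  have h2 : ∀ j, f.toForms (A.mul M (gForm stable_par ξ (e j)) (gForm stable_id (ε j) a)) =
    f.toForms (gForm stable_par ξ (e j)) * f.toForms (gForm stable_id (ε j) a) := fun j =>
      f.map_mul _ _
  have h3 := congrArg f.toForms (d_gForm h ξ ha)
  rw [map_add, map_add, map_add, map_sum, map_zero, h1] at h3
  simpa only [h2] using h3

theorem AMap.exists_polyPath [CharZero k] (hM : ∀ w : ℕ, FiniteDimensional k (M.wtLE w)) :
    ∃ c : PolyPath M, ∀ n ξ a,
      ξ (c.P n a) = (f.toForms (gForm stable_id ξ a)).fst.coeff n := by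
  let Λ₀ : ℕ → M.A →ₗ[k] k := fun n =>
    lcoeff k n ∘ₗ (TrivSqZeroExt.fstHom k k[X] k[X]).toLinearMap ∘ₗ f.toForms
  let Λ₁ : ℕ → M.A →ₗ[k] k := fun n =>
    lcoeff k n ∘ₗ (TrivSqZeroExt.sndHom k[X] k[X]).restrictScalars k ∘ₗ f.toForms
  choose P hP hP' using fun n => exists_der_of_form hM (Λ₀ n) 1
  choose Y hY hY' using fun n => exists_der_of_form hM (Λ₁ n) 0
  let p : Module.Dual k M.S → M.S → k[X] := fun ξ a => (f.toForms (gForm stable_id ξ a)).fst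
  let y : Module.Dual k M.S → M.S → k[X] := fun ξ a => (f.toForms (gForm stable_id ξ a)).snd
  have ep : ∀ n ξ a, ξ (P n a) = (p ξ a).coeff n := fun n ξ a =>
    (hP' n ξ a).trans (congrArg (fun q => q.coeff n) (f.fst_gForm ξ a).1.symm)
  have ey : ∀ n ξ a, ξ (Y n a) = (y ξ a).coeff n := fun n ξ a =>
    (hY' n ξ a).trans (congrArg (fun q => q.coeff n) (f.snd_gForm ξ a).1.symm)
  have epar : ∀ ξ a, (f.toForms (gForm stable_par ξ a)).fst = p ξ a := fun ξ a =>
    (f.fst_gForm ξ a).2.trans (f.fst_gForm ξ a).1.symm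
  have eypar : ∀ ξ a, (f.toForms (gForm stable_par ξ a)).snd = -y ξ a := fun ξ a =>
    (f.snd_gForm ξ a).2.trans (congrArg _ (f.snd_gForm ξ a).1.symm)
  have hframe : ∀ a : M.S, ∃ (w : ℤ) (m : ℕ) (e : Fin m → M.S) (ε : Fin m → Module.Dual k M.S),
      a ∈ M.wtLE w ∧ IsFrame w e ε := fun a => by
    obtain ⟨w, hw⟩ := FreeGCA.exists_mem_wtLE M.wt a
    obtain ⟨m, e, ε, h⟩ := exists_isFrame (hM w)
    exact ⟨w, m, e, ε, hw, h⟩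
  have hext : ∀ {b b' : M.S}, (∀ ξ : Module.Dual k M.S, ξ b = ξ b') → b = b' := fun {b b'} h =>
    sub_eq_zero.1 ((Module.forall_dual_apply_eq_zero_iff k _).1 fun ξ => by
      rw [map_sub, h, sub_self])
  have hwt : ∀ {n : ℤ} {θ : M.S →ₗ[k] M.S}, θ ∈ M.der n 1 → ∀ {w : ℤ} {a : M.S}, a ∈ M.wtLE w →
      θ a ∈ M.wtLE w := fun hθ w a ha => M.wtLE_mono (by omega) (hθ.2.2 w a ha)
  have hconv : ∀ {w : ℤ} {m : ℕ} {e : Fin m → M.S} {ε : Fin m → Module.Dual k M.S} {a : M.S}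
      (h : IsFrame w e ε) (ha : a ∈ M.wtLE w) {u v : Module.Dual k M.S → M.S → k[X]}
      {U V : ℕ → M.S →ₗ[k] M.S} {i : ℤ} (hV : ∀ n, V n ∈ M.der i 1)
      (eu : ∀ n ξ a, ξ (U n a) = (u ξ a).coeff n) (ev : ∀ n ξ a, ξ (V n a) = (v ξ a).coeff n)
      (ξ : Module.Dual k M.S) (n : ℕ), (∑ l, u ξ (e l) * v (ε l) a).coeff n =
        ∑ ij ∈ Finset.HasAntidiagonal.antidiagonal n, ξ (U ij.1 (V ij.2 a)) := by
    intro w m e ε a h ha u v U V i hV eu ev ξ n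
    rw [finsetSum_coeff]
    simp only [coeff_mul]
    rw [Finset.sum_comm]
    refine Finset.sum_congr rfl fun ij _ => ?_
    refine Eq.trans ?_ (h.apply (hwt (hV ij.2) ha) (ξ ∘ₗ U ij.1)).symm
    refine Finset.sum_congr rfl fun l _ => ?_
    rw [← eu, ← ev, mul_comm]
    rfl
  refine ⟨⟨P, Y, hP, hY, fun a => ?_, fun n a => ?_, fun n a => ?_⟩, ep⟩
  · obtain ⟨w, m, e, ε, ha, h⟩ := hframe a
    have hvan : ∀ {q : Module.Dual k M.S → M.S → k[X]} {Q : ℕ → M.S →ₗ[k] M.S} {i : ℤ},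
        (∀ n, Q n ∈ M.der i 1) → (∀ n ξ a, ξ (Q n a) = (q ξ a).coeff n) →
        ∀ n, (∀ j, (q (ε j) a).natDegree < n) → Q n a = 0 := fun {q Q i} hQ e n hn => by
      rw [← h.sum_eq _ (hwt (hQ n) ha)]
      refine Finset.sum_eq_zero fun j _ => ?_
      rw [e, coeff_eq_zero_of_natDegree_lt (hn j), zero_smul]
    refine ⟨Finset.univ.sup (fun j => (p (ε j) a).natDegree) +
      Finset.univ.sup (fun j => (y (ε j) a).natDegree) + 1, fun n hn =>
        ⟨hvan hP ep n fun j => ?_, hvan hY ey n fun j => ?_⟩⟩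
    · have := Finset.le_sup (f := fun j => (p (ε j) a).natDegree) (Finset.mem_univ j)
      omega
    · have := Finset.le_sup (f := fun j => (y (ε j) a).natDegree) (Finset.mem_univ j)
      omega
  · obtain ⟨w, m, e, ε, ha, h⟩ := hframe a
    refine hext fun ξ => ?_
    have h1 := congrArg TrivSqZeroExt.fst (f.toForms_d_gForm h ξ ha)
    simp only [TrivSqZeroExt.fst_add, TrivSqZeroExt.fst_sum, TrivSqZeroExt.fst_mul,
      TrivSqZeroExt.fst_inr, epar, zero_add, TrivSqZeroExt.fst_zero] at h1
    have h2 := congrArg (fun q => q.coeff n) h1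
    simp only [coeff_add, coeff_zero] at h2
    have h3 := hconv h ha hP ep ep ξ n
    rw [map_zero, map_add, map_add, map_sum, ← h3, ep n ξ (M.d a)]
    exact (congrArg (· + _ + _) (ep n (ξ ∘ₗ M.d) a)).trans h2
  · obtain ⟨w, m, e, ε, ha, h⟩ := hframe a
    refine hext fun ξ => ?_
    have h1 := congrArg TrivSqZeroExt.snd (f.toForms_d_gForm h ξ ha)
    simp only [TrivSqZeroExt.snd_add, TrivSqZeroExt.snd_sum, TrivSqZeroExt.snd_mul,
      TrivSqZeroExt.snd_inr, epar, eypar, TrivSqZeroExt.snd_zero, op_smul_eq_smul, smul_eq_mul,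
      Finset.sum_add_distrib] at h1
    have h2 := congrArg (fun q => q.coeff n) h1
    simp only [coeff_add, coeff_zero, coeff_neg, coeff_derivative] at h2
    have h3 := hconv h ha hY ep ey ξ n
    have h4 := hconv h ha hP ey ep ξ n
    rw [map_smul, map_add, map_sub, map_sum, smul_eq_mul, ep, ey]
    simp only [map_sub, Finset.sum_sub_distrib]
    rw [Finset.Nat.sum_antidiagonal_swap (f := fun ij => ξ (P ij.2 (Y ij.1 a))) |>.symm]
    have h5 : ∑ x, p (ε x) a * -y ξ (e x) = -∑ x, y ξ (e x) * p (ε x) a := by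
      rw [← Finset.sum_neg_distrib]
      exact Finset.sum_congr rfl fun x _ => by ring
    have h6 : (p ξ a).coeff (n + 1) * ((n : k) + 1) + ((y (ξ ∘ₗ M.d) a).coeff n +
        -(y ξ (M.d a)).coeff n + ((∑ x, p ξ (e x) * y (ε x) a).coeff n +
          (∑ x, p (ε x) a * -y ξ (e x)).coeff n)) = 0 := h2
    have h7 : ξ (M.d (Y n a)) = (y (ξ ∘ₗ M.d) a).coeff n := ey n (ξ ∘ₗ M.d) a
    rw [h5, coeff_neg, h3, h4, ← h7] at h6
    simp only [Prod.fst_swap, Prod.snd_swap]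
    linear_combination h6

end

end FilteredModel

namespace FilteredModel

open TensorAlgebra TensorCoalg

variable {k : Type u} [Field k] {H : GCA k} {M : FilteredModel H}

theorem exists_quasiInverse {V : Type*} {W : Type*} [AddCommGroup V] [Module k V] [AddCommGroup W]
    [Module k W] (g : V →ₗ[k] W) : ∃ s : W →ₗ[k] V, ∀ v, g (s (g v)) = g v := by
  obtain ⟨s, hs⟩ := LinearMap.exists_rightInverse_of_surjective g.rangeRestrict
    (LinearMap.range_rangeRestrict g)
  obtain ⟨s', hs'⟩ := LinearMap.exists_extend s
  refine ⟨s', fun v => ?_⟩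
  have h1 : s' (g v) = s (g.rangeRestrict v) := DFunLike.congr_fun hs' (g.rangeRestrict v)
  rw [h1]
  exact congrArg Subtype.val (DFunLike.congr_fun hs (g.rangeRestrict v))

theorem IsFrame.exists_dual {w : ℤ} {n : ℕ} {e : Fin n → M.S} {ε : Fin n → Module.Dual k M.S}
    (h : IsFrame w e ε) : ∃ u : Fin n → Fin n → M.sL, ∀ (v : M.sL) (p : ℕ),
      v - ∑ i, ∑ j, ε i (op v (e j)) • u i j ∈ (M.contFil w).F p := by
  let g : M.sL →ₗ[k] (Fin n × Fin n → k) :=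
    LinearMap.pi fun ij => ε ij.1 ∘ₗ LinearMap.applyₗ (e ij.2) ∘ₗ op
  have hg : ∀ v ij, g v ij = ε ij.1 (op v (e ij.2)) := fun _ _ => rfl
  obtain ⟨t, ht⟩ := exists_quasiInverse g
  refine ⟨fun i j => t (fun l => if (i, j) = l then 1 else 0), fun v p => ?_⟩
  have h1 : ∑ i, ∑ j, ε i (op v (e j)) • t (fun l => if (i, j) = l then 1 else 0) = t (g v) := by
    rw [LinearMap.pi_apply_eq_sum_univ t (g v), Fintype.sum_prod_type]
    rfl
  rw [h1]
  refine mem_contFil_of_op (fun a ha => ?_) p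
  have h2 : ∀ i j, ε i (op (v - t (g v)) (e j)) = 0 := fun i j => by
    have h3 := congrFun (ht v) (i, j)
    have h4 : ε i (op (t (g v)) (e j)) = ε i (op v (e j)) := h3
    rw [map_sub, LinearMap.sub_apply, map_sub, h4, sub_self]
  have h5 : ∀ j, op (v - t (g v)) (e j) = 0 := fun j => by
    rw [← h.sum_eq _ (op_mem_wtLE _ (h.mem j))]
    exact Finset.sum_eq_zero fun i _ => by rw [h2, zero_smul]
  rw [h.apply ha (op (v - t (g v)))]
  exact Finset.sum_eq_zero fun j _ => by rw [h5, smul_zero]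

theorem mem_contFil_one (w : ℤ) (v : M.sL) : v ∈ (M.contFil w).F 1 := fun n => by
  simp

theorem mem_wordFil_contFil_zero (w : ℤ) (x : TensorAlgebra k M.sL) :
    x ∈ (wordFil (M.contFil w)).F 0 := by
  suffices h : ⊤ ≤ (wordFil (M.contFil w)).F 0 from h Submodule.mem_top
  rw [← span_word, Submodule.span_le]
  rintro _ ⟨l, rfl⟩
  induction l with
  | nil => rw [word_nil]; exact one_mem_wordFil
  | cons v l ih =>
    have h := wordFil_mul (ι_mem (mem_contFil_one w v)) ih
    rw [← word_cons] at h
    exact (wordFil (M.contFil w)).anti (Nat.zero_le (1 + 0)) h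

theorem AMap.eq_of_le_ker {B : DGCA k} {f g : M.AMap B}
    (hfg : ∀ ξ a, f.f (gForm stable_id ξ a) = g.f (gForm stable_id ξ a)) {w : ℤ} {n : ℕ}
    {e : Fin n → M.S} {ε : Fin n → Module.Dual k M.S} (h : IsFrame w e ε) (N : ℕ) :
    ∀ α (hα : α ∈ M.contDual), (wordFil (M.contFil w)).F N ≤ LinearMap.ker α →
      f.f ⟨M.restrict α, Submodule.mem_map_of_mem hα⟩ =
        g.f ⟨M.restrict α, Submodule.mem_map_of_mem hα⟩ := by
  induction N with
  | zero =>
    intro α hα hker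
    have h1 : (⟨M.restrict α, Submodule.mem_map_of_mem hα⟩ : M.A) = 0 :=
      Subtype.ext (LinearMap.ext fun x => hker (mem_wordFil_contFil_zero w x.1))
    rw [h1, map_zero, map_zero]
  | succ N ih =>
    intro α hα hker
    obtain ⟨u, hu⟩ := h.exists_dual
    let β : Fin n → Fin n → Module.Dual k (TensorAlgebra k M.sL) := fun i j =>
      α ∘ₗ LinearMap.mulLeft k (ι k (u i j))
    have hker' : ∀ i j, (wordFil (M.contFil w)).F N ≤ LinearMap.ker (β i j) := fun i j x hx => by
      have h1 := wordFil_mul (ι_mem (mem_contFil_one w (u i j))) hx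
      rw [add_comm] at h1
      exact hker h1
    have hβ : ∀ i j, β i j ∈ M.contDual := fun i j => ⟨w, N, hker' i j⟩
    have hα' : ∀ v y, α (ι k v * y) = ∑ i, ∑ j, ε i (op v (e j)) * β i j y := fun v y => by
      have h1 : α (ι k (v - ∑ i, ∑ j, ε i (op v (e j)) • u i j) * y) = 0 :=
        hker (wordFil_mul (n := 0) (ι_mem (hu v (N + 1))) (mem_wordFil_contFil_zero w y))
      rw [map_sub, sub_mul, map_sub, sub_eq_zero] at h1
      rw [h1]
      simp only [map_sum, map_smul, Finset.sum_mul, smul_mul_assoc, smul_eq_mul]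
      rfl
    have key : (⟨M.restrict α, Submodule.mem_map_of_mem hα⟩ : M.A) = α 1 • A.one M +
        ∑ i, ∑ j, A.mul M (gForm stable_id (ε i) (e j))
          ⟨M.restrict (β i j), Submodule.mem_map_of_mem (hβ i j)⟩ := by
      refine Subtype.ext (LinearMap.ext fun x => ?_)
      have h1 : ∀ z : TensorAlgebra k M.sL ⊗[k] TensorAlgebra k M.sL,
          α (LinearMap.mul' k _ (TensorProduct.map (ι k ∘ₗ ιInv) LinearMap.id z)) =
            ∑ i, ∑ j, LinearMap.mul' k k (TensorProduct.map
              ((ε i ∘ₗ LinearMap.applyₗ (e j) ∘ₗ op ∘ₗ LinearMap.id) ∘ₗ ιInv) (β i j) z) := fun z => by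
        induction z using TensorProduct.induction_on with
        | zero => simp
        | tmul x y => exact hα' (ιInv x) y
        | add z z' hz hz' => simp only [map_add, hz, hz', Finset.sum_add_distrib]
      have h2 : α x.1 = algebraMapInv x.1 * α 1 + ∑ i, ∑ j, LinearMap.mul' k k (TensorProduct.map
          ((ε i ∘ₗ LinearMap.applyₗ (e j) ∘ₗ op ∘ₗ LinearMap.id) ∘ₗ ιInv) (β i j)
            (delta k M.sL x)) := by
        conv_lhs => rw [head_tail x.1]
        rw [map_add, h1, Algebra.algebraMap_eq_smul_one, map_smul, smul_eq_mul]
      refine h2.trans ?_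
      rw [Submodule.coe_add, LinearMap.add_apply, Submodule.coe_sum, LinearMap.sum_apply]
      refine congrArg₂ (· + ·) (mul_comm _ _) (Finset.sum_congr rfl fun i _ => ?_)
      rw [Submodule.coe_sum, LinearMap.sum_apply]
      exact Finset.sum_congr rfl fun j _ => (A_mul_apply rfl rfl x).symm
    rw [key, map_add, map_add, map_smul, map_smul, f.map_one, g.map_one]
    simp only [map_sum, f.map_mul, g.map_mul, hfg, ih _ (hβ _ _) (hker' _ _)]

/-- Maps from `A(L)` are determined by their values on the matrix coefficients of elements of
`s L`. -/
theorem AMap.eq_of_gForm (hM : ∀ w : ℕ, FiniteDimensional k (M.wtLE w)) {B : DGCA k} {f g : M.AMap B}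
    (hfg : ∀ ξ a, f.f (gForm stable_id ξ a) = g.f (gForm stable_id ξ a)) : f = g :=
  AMap.ext fun α hα => by
    obtain ⟨w, N, hN⟩ := id hα
    have h1 : (wordFil (M.contFil w.toNat)).F N ≤ LinearMap.ker α :=
      (contFil_mono (Int.self_le_toNat w) N).trans hN
    obtain ⟨n, e, ε, h⟩ := exists_isFrame (hM w.toNat)
    exact AMap.eq_of_le_ker hfg h N α hα h1

theorem Perturbation.IsEval.gForm {p : M.Perturbation} {f : M.AMap (DGCA.unit k)} (hf : p.IsEval f)
    (ξ : Module.Dual k M.S) (a : M.S) : f.f (gForm stable_id ξ a) = ξ (p.p a) := by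
  let α : Module.Dual k (TensorAlgebra k M.sL) :=
    (ξ ∘ₗ LinearMap.applyₗ a ∘ₗ op ∘ₗ LinearMap.id) ∘ₗ ιInv
  have hα : α ∈ M.contDual := by
    obtain ⟨w, hw⟩ := FreeGCA.exists_mem_wtLE M.wt a
    refine comp_ιInv_mem_contDual (w := w) fun v hv => ?_
    change ξ (op v a) = 0
    rw [op_apply_eq_zero hv hw, map_zero]
  refine (hf α hα).trans ?_
  have h1 : ∀ n, α (ι k p.sp ^ n) = if n = 1 then ξ (p.p a) else 0 := fun n => by
    change ξ (op (ιInv (ι k p.sp ^ n)) a) = _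
    rw [ιInv_ι_pow]
    split_ifs with hn
    · rw [p.op_sp]
    · rw [map_zero, LinearMap.zero_apply, map_zero]
  rw [finsum_congr h1]
  exact (finsum_eq_single _ 1 fun n hn => if_neg hn).trans (if_pos rfl)

section

open Polynomial

variable (k) in
/-- The inclusion of the constants in `k[t, dt]`. -/
def constForms : k →ₐ[k] TrivSqZeroExt k[X] k[X] :=
  (TrivSqZeroExt.inlAlgHom k k[X] k[X]).comp (Algebra.ofId k k[X])

/-- The constant path of maps. -/
def AMap.const (f : M.AMap (DGCA.unit k)) : M.AMap (DGCA.polyForms k) where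
  f := (constForms k).toLinearMap ∘ₗ f.f
  map_one := (congrArg (constForms k) f.map_one).trans (_root_.map_one (constForms k))
  map_mul α β := (congrArg (constForms k) (f.map_mul α β)).trans (_root_.map_mul (constForms k) _ _)
  map_gr m α hα := by
    have h := f.map_gr m α hα
    by_cases hm : m = 0
    · subst hm
      exact TrivSqZeroExt.snd_inl k[X] (C (f.f α : k))
    · have h1 : (DGCA.unit k).gr m = ⊥ := if_neg hm
      rw [h1] at h
      have h2 : @Eq k (f.f α) 0 := h
      have h3 : constForms k (f.f α) = 0 := (congrArg (constForms k) h2).trans (map_zero _)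
      exact (congrArg (· ∈ (DGCA.polyForms k).gr m) h3).mpr (Submodule.zero_mem _)
  map_d α := by
    have h1 : constForms k (f.f (A.d M α)) = 0 :=
      (congrArg (constForms k) (f.map_d α)).trans (map_zero (constForms k))
    have h2 : (TrivSqZeroExt.inr (derivative (C (f.f α : k))) : TrivSqZeroExt k[X] k[X]) = 0 :=
      (congrArg TrivSqZeroExt.inr derivative_C).trans (TrivSqZeroExt.inr_zero k[X])
    exact h1.trans h2.symm

theorem AMap.exists_isEval [CharZero k] (hM : ∀ w : ℕ, FiniteDimensional k (M.wtLE w))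
    (f : M.AMap (DGCA.unit k)) : ∃ p : M.Perturbation, p.IsEval f := by
  obtain ⟨c, hc⟩ := f.const.exists_polyPath hM
  have h0 : ∀ ξ a, ξ (c.P 0 a) = f.f (gForm stable_id ξ a) := fun ξ a =>
    (hc 0 ξ a).trans (coeff_C_zero (a := (f.f (gForm stable_id ξ a) : k)))
  let p : M.Perturbation := ⟨c.P 0, c.P_mem 0, fun a => by
    have h1 := c.mc 0 a
    rw [Finset.Nat.antidiagonal_zero, Finset.sum_singleton] at h1
    simp only [LinearMap.add_apply, map_add, M.d_d, zero_add]
    rw [← add_assoc, add_comm (c.P 0 (M.d a))]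
    exact h1⟩
  obtain ⟨g, hg⟩ := p.exists_isEval
  have h1 : f = g := AMap.eq_of_gForm hM fun ξ a => (h0 ξ a).symm.trans (hg.gForm ξ a).symm
  exact ⟨p, h1 ▸ hg⟩

theorem AHomotopic.gauge [CharZero k] (hM : ∀ w : ℕ, FiniteDimensional k (M.wtLE w))
    {p q : M.Perturbation} {f g : M.AMap (DGCA.unit k)} (hf : p.IsEval f) (hg : q.IsEval g)
    (h : AHomotopic f g) : Gauge p q := by
  obtain ⟨c, hc⟩ := h
  obtain ⟨γ, hγ⟩ := c.exists_polyPath hM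
  have hext : ∀ {b b' : M.S}, (∀ ξ : Module.Dual k M.S, ξ b = ξ b') → b = b' := fun {b b'} h =>
    sub_eq_zero.1 ((Module.forall_dual_apply_eq_zero_iff k _).1 fun ξ => by
      rw [map_sub, h, sub_self])
  refine γ.gauge (LinearMap.ext fun a => hext fun ξ => ?_) fun a => ?_
  · rw [hγ, ← hf.gForm, coeff_zero_eq_eval_zero]
    exact (hc _).1.symm
  · obtain ⟨w, hw⟩ := FreeGCA.exists_mem_wtLE M.wt a
    obtain ⟨N, hN⟩ := γ.fin a
    refine ⟨N, fun n hn => hext fun ξ => ?_⟩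
    rw [map_sum, ← hg.gForm]
    refine Eq.trans ?_ (hc _).2.symm
    let F : k[X] := (c.toForms (FilteredModel.gForm stable_id ξ a)).fst
    change _ = F.eval 1
    have h1 : ∀ j, N ≤ j → F.coeff j = 0 := fun j hj => by
      rw [← hγ, (hN j hj).1, map_zero]
    have h2 : ∀ m, n ≤ m → ∑ j ∈ Finset.range m, F.coeff j = ∑ j ∈ Finset.range n, F.coeff j :=
      fun m hm => (Finset.sum_subset (Finset.range_mono hm) fun j _ hj =>
        h1 j (by rw [Finset.mem_range] at hj; omega)).symm
    rw [eval_eq_sum_range' (n := n + F.natDegree + 1) (by omega)]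
    simp only [one_pow, mul_one]
    rw [h2 _ (by omega)]
    exact Finset.sum_congr rfl fun j _ => hγ j ξ a

end

theorem aHomotopic_iff_gauge [CharZero k] (hM : ∀ w : ℕ, FiniteDimensional k (M.wtLE w))
    {p q : M.Perturbation} {f g : M.AMap (DGCA.unit k)} (hf : p.IsEval f) (hg : q.IsEval g) :
    AHomotopic f g ↔ Gauge p q :=
  ⟨AHomotopic.gauge hM hf hg, fun h => h.aHomotopic hf hg⟩

theorem exists_gauge_equiv_aHomotopyClass [CharZero k]
    (hM : ∀ w : ℕ, FiniteDimensional k (M.wtLE w)) :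
    ∃ Φ : Quot (Gauge (M := M)) ≃ M.AHomotopyClass, ∀ (p : M.Perturbation)
      (f : M.AMap (DGCA.unit k)), p.IsEval f → Φ (Quot.mk _ p) = Quot.mk _ f :=
  exists_quot_equiv (s := AHomotopic)
    (fun (p : M.Perturbation) (f : M.AMap (DGCA.unit k)) => p.IsEval f) (fun p => p.exists_isEval)
    (fun f => f.exists_isEval hM) Gauge.refl (fun f => by
      obtain ⟨p, hp⟩ := f.exists_isEval hM
      exact (Gauge.refl p).aHomotopic hp hp)
    fun _ _ _ _ hp hq => (aHomotopic_iff_gauge hM hp hq).symm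

end FilteredModel

end

theorem mainTheorem2 {k : Type u} [Field k] [CharZero k] (H : GCA k) (hsc : H.SimplyConnected)
    (hft : H.FiniteType) (M : FilteredModel H) :
    -- each perturbation `p` has a canonical augmentation `H ≅ H(S Z, d + p)` ...
    (∀ p : M.Perturbation, ∃! i : CohIso H p.dgca, p.IsAugmentation i) ∧
    -- ... and a classifying map `χ(p) : k → Ĉ(L)`
    (∀ p : M.Perturbation, ∃! χ : M.Point, p.IsClassifying χ) ∧
    -- two perturbations represent the same augmented homotopy type iff their classifying maps are
    -- homotopic as filtered maps of coalgebras
    (∀ (p q : M.Perturbation) (i : CohIso H p.dgca) (j : CohIso H q.dgca) (χ ψ : M.Point),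
      p.IsAugmentation i → q.IsAugmentation j → p.IsClassifying χ → q.IsClassifying ψ →
        (SameAugType ⟨p.dgca, i⟩ ⟨q.dgca, j⟩ ↔ FilteredModel.FiltHomotopic χ ψ)) ∧
    -- augmented homotopy types correspond bijectively to path components of `Ĉ(L)`
    (∃ Φ : AugHomotopyType H ≃ M.PathComponent,
      ∀ (p : M.Perturbation) (i : CohIso H p.dgca) (χ : M.Point),
        p.IsAugmentation i → p.IsClassifying χ →
          Φ (Quot.mk SameAugType ⟨p.dgca, i⟩) = Quot.mk FilteredModel.FiltHomotopic χ) ∧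
    -- under the finiteness restriction needed for dual algebras: the same with dga maps `A(L) → k`
    (M.Minimal ∨ M.FiniteType →
      (∀ p : M.Perturbation, ∃! f : M.AMap (DGCA.unit k), p.IsEval f) ∧
      (∀ (p q : M.Perturbation) (i : CohIso H p.dgca) (j : CohIso H q.dgca)
        (f g : M.AMap (DGCA.unit k)),
        p.IsAugmentation i → q.IsAugmentation j → p.IsEval f → q.IsEval g →
          (SameAugType ⟨p.dgca, i⟩ ⟨q.dgca, j⟩ ↔ FilteredModel.AHomotopic f g)) ∧
      ∃ Ψ : AugHomotopyType H ≃ M.AHomotopyClass,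
        ∀ (p : M.Perturbation) (i : CohIso H p.dgca) (f : M.AMap (DGCA.unit k)),
          p.IsAugmentation i → p.IsEval f →
            Ψ (Quot.mk SameAugType ⟨p.dgca, i⟩) = Quot.mk FilteredModel.AHomotopic f) := by
  refine ⟨fun p => p.existsUnique_augmentation, fun p => p.existsUnique_point,
    fun p q i j χ ψ hi hj hp hq => (FilteredModel.sameAugType_iff_gauge hi hj).trans
      (FilteredModel.filtHomotopic_iff_gauge hp hq).symm, ?_, fun hM => ?_⟩
  · obtain ⟨Φ, hΦ⟩ := FilteredModel.exists_augHomotopyType_equiv (M := M)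
    obtain ⟨Ψ, hΨ⟩ := FilteredModel.exists_gauge_equiv_pathComponent (M := M)
    exact ⟨Φ.trans Ψ, fun p i χ hi hp => (congrArg Ψ (hΦ p i hi)).trans (hΨ p χ hp)⟩
  · have hfin := FilteredModel.finiteDimensional_wtLE hM hft
    obtain ⟨Φ, hΦ⟩ := FilteredModel.exists_augHomotopyType_equiv (M := M)
    obtain ⟨Ψ, hΨ⟩ := FilteredModel.exists_gauge_equiv_aHomotopyClass hfin
    exact ⟨fun p => p.existsUnique_isEval,
      fun p q i j f g hi hj hf hg => (FilteredModel.sameAugType_iff_gauge hi hj).trans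
        (FilteredModel.aHomotopic_iff_gauge hfin hf hg).symm,
      Φ.trans Ψ, fun p i f hi hf => (congrArg Ψ (hΦ p i hi)).trans (hΨ p f hf)⟩
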